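/- Let $X$ be a two-dimensional complex orbifold (Hausdorff, second countable) whose singular points are exactly the finitely many distinct points $p_1,\dots,p_k$, each with isotropy group $\mathbb{Z}_2$ (acting by $-1$ in an orbifold chart). Let $q\colon\hat X\to X$ be the blow-up of $X$ at $p_1,\dots,p_k$: $\hat X$ is a complex surface, $q$ is biholomorphic over $X\setminus\{p_1,\dots,p_k\}$, and over a disk in an orbifold chart centred at $p_i$ the map $q$ is the blow-up of $\mathbb{C}^2/\{\pm1\}$ at $[0]$, that is, the map $$(\mathbb{C}^2\setminus 0)\times_{\mathbb{C}^\times}\mathbb{C}\to\mathbb{C}^2/\{\pm1\},\quad [z;u]\mapsto[\sqrt u\,z],\qquad\text{where } t\cdot(z;u)=(tz;t^{-2}u)\text{ for }t\in\mathbb{C}^\times .$$ Let $E_i=q^{-1}(p_i)\cong\mathbb{CP}^1$, and let $\mathcal{E}_i\in H^{1,1}(\hat X;\mathbb{R})$ be the Poincaré dual of $E_i$. For a holomorphic $\mathbb{C}^\times$ bundle $\mathcal{L}$ over a complex orbifold, the Euler class is $e(\mathcal{L})=-[\zeta]$ in real second cohomology. Here $\zeta$ is the closed real orbifold $(1,1)$-form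 with $\zeta=\frac{\sqrt{-1}}{2\pi}\partial\bar\partial\,\ln|s|^2$ for every local holomorphic section $s$ of $\mathcal{L}$, where $|\cdot|$ is any hermitian metric on the associated line bundle; the class does not depend on the metric. Let $\hat{\mathcal{L}}$ be a holomorphic $\mathbb{C}^\times$ bundle over $\hat X$. Then every $\int_{E_i}e(\hat{\mathcal{L}})$ is an integer, and there exists a holomorphic (orbifold) $\mathbb{C}^\times$ bundle $\mathcal{L}$ over $X$ such that $e(\mathcal{L})\in H^{1,1}(X)$ is the unique class in $H^2(X;\mathbb{R})$ with $$q^*(e(\mathcal{L}))=e(\hat{\mathcal{L}})+\sum_{i=1}^k\tfrac12\Big(\int_{E_i}e(\hat{\mathcal{L}})\Big)\mathcal{E}_i ,$$ and such that the total space of $\mathcal{L}$, which is a complex orbifold, is a manifold if and only if $\int_{E_i}e(\hat{\mathcal{L}})$ is odd for all $i$. -/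

import Mathlib

open Set Filter Topology MeasureTheory
open scoped Manifold ContDiff

universe u

/-! ## Complex orbifolds of dimension two -/

/-- The model space `ℂ²`. -/
abbrev C2 : Type := EuclideanSpace ℂ (Fin 2)

/-- An orbifold chart of complex dimension two on `X`: an open `dom ⊆ ℂ²`, invariant under the
linear action of a finite group `Γ`, and a map `map` which induces a homeomorphism from
`dom / Γ` onto an open subset of `X`. -/
structure OrbiChart (X : Type u) [TopologicalSpace X] where
  dom : Set C2
  Γ : Subgroup (C2 ≃L[ℂ] C2)
  map : C2 → X
  isOpen_dom : IsOpen dom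
  finite : Finite Γ
  apply_mem : ∀ g ∈ Γ, ∀ x ∈ dom, g x ∈ dom
  continuousOn : ContinuousOn map dom
  isOpen_image : ∀ U ⊆ dom, IsOpen U → IsOpen (map '' U)
  map_eq_iff : ∀ x ∈ dom, ∀ y ∈ dom, map x = map y ↔ ∃ g ∈ Γ, g x = y

/-- `h` is (the germ at `x` of) a holomorphic lift of `f : X → Y` to the charts `c` and `c'`. -/
def IsLiftAt {X Y : Type u} [TopologicalSpace X] [TopologicalSpace Y] (f : X → Y)
    (c : OrbiChart X) (c' : OrbiChart Y) (h : C2 → C2) (x : C2) : Prop :=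
  x ∈ c.dom ∧ h x ∈ c'.dom ∧ AnalyticAt ℂ h x ∧ ∀ᶠ z in 𝓝 x, c'.map (h z) = f (c.map z)

/-- `f` lifts, between the charts `c` and `c'`, to a biholomorphic map from a neighbourhood of `x`
onto a neighbourhood of `y`, taking `x` to `y`. -/
def LiftsBihol {X Y : Type u} [TopologicalSpace X] [TopologicalSpace Y] (f : X → Y)
    (c : OrbiChart X) (c' : OrbiChart Y) (x y : C2) : Prop :=
  ∃ h k : C2 → C2, IsLiftAt f c c' h x ∧ h x = y ∧ AnalyticAt ℂ k y ∧
    (∀ᶠ z in 𝓝 x, k (h z) = z) ∧ ∀ᶠ w in 𝓝 y, h (k w) = w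

/-- Two orbifold charts on `X` are compatible if the identity of `X` lifts to a local
biholomorphism between any two points which lie over the same point of `X`. -/
def OrbiChart.Compatible {X : Type u} [TopologicalSpace X] (c c' : OrbiChart X) : Prop :=
  ∀ x ∈ c.dom, ∀ y ∈ c'.dom, c.map x = c'.map y → LiftsBihol id c c' x y

/-- A two-dimensional complex orbifold structure on `X`: a cover by compatible orbifold charts. -/
structure ComplexOrbifold (X : Type u) [TopologicalSpace X] where
  charts : Set (OrbiChart X)
  cover : ∀ p : X, ∃ c ∈ charts, p ∈ c.map '' c.dom
  compatible : ∀ c ∈ charts, ∀ c' ∈ charts, c.Compatible c'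

/-- The singular points of the orbifold are exactly the (distinct) points `p 0, …, p (k - 1)`, and
each of them has isotropy group of order two.  (As the singular points are isolated, the nontrivial
element of the isotropy group then acts on the chart as `-1`.) -/
def ComplexOrbifold.HasIsolatedZ2Singularities {X : Type u} [TopologicalSpace X]
    (O : ComplexOrbifold X) {k : ℕ} (p : Fin k → X) : Prop :=
  Function.Injective p ∧ ∀ c ∈ O.charts, ∀ x ∈ c.dom,
    (c.map x ∈ range p → Nat.card {g : C2 ≃L[ℂ] C2 // g ∈ c.Γ ∧ g x = x} = 2) ∧
    (c.map x ∉ range p → ∀ g ∈ c.Γ, g x = x → g = 1)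

/-- A manifold chart, regarded as an orbifold chart with trivial group. -/
noncomputable def manifoldChart {M : Type u} [TopologicalSpace M] (e : OpenPartialHomeomorph M C2) :
    OrbiChart M where
  dom := e.target
  Γ := ⊥
  map := e.symm
  isOpen_dom := e.open_target
  finite := inferInstance
  apply_mem := by
    intro g hg x hx
    rw [Subgroup.mem_bot] at hg
    subst hg
    exact hx
  continuousOn := e.continuousOn_symm
  isOpen_image := fun U hU hUo => e.symm.isOpen_image_of_subset_source hUo hU
  map_eq_iff := by
    intro x hx y hy
    constructor
    · intro h
      exact ⟨1, Subgroup.one_mem _, e.symm.injOn hx hy h⟩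
    · rintro ⟨g, hg, rfl⟩
      rw [Subgroup.mem_bot] at hg
      subst hg
      rfl

theorem manifoldChart_compatible {M : Type u} [TopologicalSpace M] [ChartedSpace C2 M]
    [IsManifold 𝓘(ℂ, C2) ω M] {e e' : OpenPartialHomeomorph M C2}
    (he : e ∈ atlas C2 M) (he' : e' ∈ atlas C2 M) :
    (manifoldChart e).Compatible (manifoldChart e') := by
  have key : ∀ {a b : OpenPartialHomeomorph M C2}, a ∈ atlas C2 M → b ∈ atlas C2 M →
      ∀ z ∈ a.target, a.symm z ∈ b.source → AnalyticAt ℂ (fun w => b (a.symm w)) z := by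
    intro a b ha hb z hz hz'
    have h1 : ContMDiffAt 𝓘(ℂ, C2) 𝓘(ℂ, C2) ω b (a.symm z) := contMDiffAt_of_mem_maximalAtlas
      (IsManifold.subset_maximalAtlas hb) hz'
    have h2 : ContMDiffAt 𝓘(ℂ, C2) 𝓘(ℂ, C2) ω a.symm z := contMDiffAt_symm_of_mem_maximalAtlas
      (IsManifold.subset_maximalAtlas ha) hz
    exact (contMDiffAt_iff_contDiffAt.1 (h1.comp z h2)).analyticAt
  intro x hx y hy hxy
  change x ∈ e.target at hx
  change y ∈ e'.target at hy
  change e.symm x = e'.symm y at hxy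
  have hx' : e.symm x ∈ e'.source := hxy ▸ e'.map_target hy
  have hy' : e'.symm y ∈ e.source := hxy ▸ e.map_target hx
  have near : ∀ᶠ z in 𝓝 x, z ∈ e.target ∧ e.symm z ∈ e'.source :=
    Filter.Eventually.and (e.open_target.mem_nhds hx)
      ((e.continuousAt_symm hx).preimage_mem_nhds (e'.open_source.mem_nhds hx'))
  have near' : ∀ᶠ z in 𝓝 y, z ∈ e'.target ∧ e'.symm z ∈ e.source :=
    Filter.Eventually.and (e'.open_target.mem_nhds hy)
      ((e'.continuousAt_symm hy).preimage_mem_nhds (e.open_source.mem_nhds hy'))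
  refine ⟨fun z => e' (e.symm z), fun z => e (e'.symm z),
    ⟨hx, e'.map_source hx', key he he' x hx hx', near.mono fun z hz => e'.left_inv hz.2⟩,
    ?_, key he' he y hy hy', near.mono fun z hz => ?_, near'.mono fun z hz => ?_⟩
  · change e' (e.symm x) = y
    rw [hxy, e'.right_inv hy]
  · change e (e'.symm (e' (e.symm z))) = z
    rw [e'.left_inv hz.2, e.right_inv hz.1]
  · change e' (e.symm (e (e'.symm z))) = z
    rw [e.left_inv hz.2, e'.right_inv hz.1]

/-- A complex surface, regarded as a complex orbifold. -/
noncomputable def ComplexOrbifold.ofManifold (M : Type u) [TopologicalSpace M] [ChartedSpace C2 M]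
    [IsManifold 𝓘(ℂ, C2) ω M] : ComplexOrbifold M where
  charts := manifoldChart '' atlas C2 M
  cover := fun p => ⟨_, mem_image_of_mem _ (chart_mem_atlas C2 p),
    chartAt C2 p p, (chartAt C2 p).map_source (mem_chart_source C2 p),
    (chartAt C2 p).left_inv (mem_chart_source C2 p)⟩
  compatible := by
    rintro _ ⟨e, he, rfl⟩ _ ⟨e', he', rfl⟩
    exact manifoldChart_compatible he he'

/-! ## Orbifold forms and de Rham cohomology -/

/-- The pullback of a differential form on (an open subset of) `ℂ²`. -/
noncomputable def pullForm {k : ℕ} (h : C2 → C2) (η : C2 → C2 [⋀^Fin k]→L[ℝ] ℝ) (x : C2) :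
    C2 [⋀^Fin k]→L[ℝ] ℝ :=
  (η (h x)).compContinuousLinearMap (fderiv ℝ h x)

/-- The space `Ω^k(X)`, as a subspace of the space of families of (arbitrary) forms on the charts: a
family is a smooth real orbifold form if its members are smooth on the domains of the charts and are
compatible with all local lifts of the identity; in particular each member is invariant under the
group of its chart.  (The form is set to be `0` outside the domain of the chart,
so that equality of forms is equality of families.) -/
def ComplexOrbifold.formSubmodule {X : Type u} [TopologicalSpace X] (O : ComplexOrbifold X) (k : ℕ) :
    Submodule ℝ (O.charts → C2 → C2 [⋀^Fin k]→L[ℝ] ℝ) where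
  carrier := {η | (∀ c, ∀ x ∉ c.1.dom, η c x = 0) ∧ (∀ c, ContDiffOn ℝ ∞ (η c) c.1.dom) ∧
    ∀ c c' h x, IsLiftAt id c.1 c'.1 h x → η c x = pullForm h (η c') x}
  zero_mem' := ⟨fun _ _ _ => rfl, fun _ => contDiffOn_const, fun _ _ _ _ _ => rfl⟩
  add_mem' := by
    rintro a b ⟨ha, ha', ha''⟩ ⟨hb, hb', hb''⟩
    refine ⟨fun c x hx => ?_, fun c => (ha' c).add (hb' c), fun c c' h x hl => ?_⟩
    · simp [ha c x hx, hb c x hx]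
    · have h1 := ha'' c c' h x hl
      have h2 := hb'' c c' h x hl
      simp only [Pi.add_apply, h1, h2]
      rfl
  smul_mem' := by
    rintro r a ⟨ha, ha', ha''⟩
    refine ⟨fun c x hx => ?_, fun c => (ha' c).const_smul r, fun c c' h x hl => ?_⟩
    · simp [ha c x hx]
    · have h1 := ha'' c c' h x hl
      simp only [Pi.smul_apply, h1]
      rfl

/-- The real vector space `Ω^k(X)` of smooth real orbifold forms. -/
def ComplexOrbifold.Form {X : Type u} [TopologicalSpace X] (O : ComplexOrbifold X) (k : ℕ) :
    Type u :=
  O.formSubmodule k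

noncomputable instance {X : Type u} [TopologicalSpace X] (O : ComplexOrbifold X) (k : ℕ) :
    AddCommGroup (O.Form k) :=
  inferInstanceAs (AddCommGroup (O.formSubmodule k))

noncomputable instance {X : Type u} [TopologicalSpace X] (O : ComplexOrbifold X) (k : ℕ) :
    Module ℝ (O.Form k) :=
  inferInstanceAs (Module ℝ (O.formSubmodule k))

theorem ComplexOrbifold.Form.differentiableAt {X : Type u} [TopologicalSpace X]
    {O : ComplexOrbifold X} {k : ℕ} (η : O.Form k) (c : O.charts) {x : C2} (hx : x ∈ c.1.dom) :
    DifferentiableAt ℝ (η.1 c) x :=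
  ((η.2.2.1 c).differentiableOn (by simp)).differentiableAt (c.1.isOpen_dom.mem_nhds hx)

/-- The closed orbifold forms. -/
noncomputable def ComplexOrbifold.Closed {X : Type u} [TopologicalSpace X] (O : ComplexOrbifold X)
    (k : ℕ) : Submodule ℝ (O.Form k) where
  carrier := {η | ∀ c, ∀ x ∈ c.1.dom, extDeriv (η.1 c) x = 0}
  zero_mem' := by
    intro c x _
    have := extDeriv_smul (x := x) (0 : ℝ) ((0 : O.Form k).1 c)
    rw [zero_smul, zero_smul] at this
    exact this
  add_mem' := by
    intro a b ha hb c x hx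
    have := extDeriv_add (Form.differentiableAt a c hx) (Form.differentiableAt b c hx)
    rw [ha c x hx, hb c x hx, add_zero] at this
    exact this
  smul_mem' := by
    intro r a ha c x hx
    have := extDeriv_smul (x := x) r (a.1 c)
    rw [ha c x hx, smul_zero] at this
    exact this

/-- The exact orbifold 2-forms (inside the closed ones). -/
noncomputable def ComplexOrbifold.Exact2 {X : Type u} [TopologicalSpace X] (O : ComplexOrbifold X) :
    Submodule ℝ (O.Closed 2) where
  carrier := {η | ∃ α : O.Form 1, ∀ c, ∀ x ∈ c.1.dom, η.1.1 c x = extDeriv (α.1 c) x}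
  zero_mem' := by
    refine ⟨0, fun c x _ => ?_⟩
    have := extDeriv_smul (x := x) (0 : ℝ) ((0 : O.Form 1).1 c)
    rw [zero_smul, zero_smul] at this
    exact this.symm
  add_mem' := by
    rintro a b ⟨α, hα⟩ ⟨β, hβ⟩
    refine ⟨α + β, fun c x hx => ?_⟩
    have := extDeriv_add (Form.differentiableAt α c hx) (Form.differentiableAt β c hx)
    rw [← hα c x hx, ← hβ c x hx] at this
    exact this.symm
  smul_mem' := by
    rintro r a ⟨α, hα⟩
    refine ⟨r • α, fun c x hx => ?_⟩
    have := extDeriv_smul (x := x) r (α.1 c)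
    rw [← hα c x hx] at this
    exact this.symm

/-- The second real cohomology `H²(X; ℝ)`, as de Rham cohomology. -/
abbrev ComplexOrbifold.H2 {X : Type u} [TopologicalSpace X] (O : ComplexOrbifold X) : Type u :=
  O.Closed 2 ⧸ O.Exact2

/-- The cohomology class of a closed 2-form. -/
noncomputable def ComplexOrbifold.cls {X : Type u} [TopologicalSpace X] (O : ComplexOrbifold X)
    (η : O.Closed 2) : O.H2 :=
  Submodule.Quotient.mk η

/-- The class lies in `H^{1,1}(X)`: it is represented by a closed real form of type `(1,1)`, that is,
by a closed real 2-form which is invariant under multiplication by `√-1`. -/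
def ComplexOrbifold.IsType11 {X : Type u} [TopologicalSpace X] (O : ComplexOrbifold X)
    (a : O.H2) : Prop :=
  ∃ η : O.Closed 2, O.cls η = a ∧ ∀ c x v w,
    η.1.1 c x ![Complex.I • v, Complex.I • w] = η.1.1 c x ![v, w]

/-- The form `η` vanishes on the subset `W` of the orbifold. -/
def VanishesOn {X : Type u} [TopologicalSpace X] {O : ComplexOrbifold X}
    {k : ℕ} (η : O.Form k) (W : Set X) : Prop :=
  ∀ c, ∀ x ∈ c.1.dom, c.1.map x ∈ W → η.1 c x = 0

/-- `f^* a = b` in `H²( ; ℝ)`, for a continuous map `f : X' → X` which is a local biholomorphism over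
the complement of the finite set `range p`.  The map `f` need not be smooth over `p i`; but every
class `a` has representatives `η` which vanish near all `p i`; the pullback of such a form,
extended by zero, is a smooth closed form on `X'`, and its class is `f^* a`. -/
def IsPullbackClass {X' X : Type u} [TopologicalSpace X'] [TopologicalSpace X]
    (O' : ComplexOrbifold X') (O : ComplexOrbifold X) (f : X' → X) {k : ℕ} (p : Fin k → X)
    (a : O.H2) (b : O'.H2) : Prop :=
  ∃ (η : O.Closed 2) (η' : O'.Closed 2) (W : Set X),
    O.cls η = a ∧ O'.cls η' = b ∧ IsOpen W ∧ range p ⊆ W ∧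
    VanishesOn η.1 W ∧ VanishesOn η'.1 (f ⁻¹' W) ∧
    ∀ c' c h x, IsLiftAt f c'.1 c.1 h x → η'.1.1 c' x = pullForm h (η.1.1 c) x

/-! ## Holomorphic `ℂ^×` bundles -/

/-- A local trivialization of a `ℂ^×` bundle `proj : L → X` over (a restriction of) an orbifold
chart `base`: the group `Γ` of the chart acts on `dom × ℂ^×` by
`g · (x, w) = (g x, mult g x * w)`, with `mult g` holomorphic, and `triv` induces an equivariant
homeomorphism from `(dom × ℂ^×) / Γ` onto the restriction of `L` to the image of the chart. -/
structure BundleChart {X : Type u} [TopologicalSpace X] (O : ComplexOrbifold X) {L : Type u}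
    [TopologicalSpace L] [MulAction ℂˣ L] (proj : L → X) where
  base : OrbiChart X
  base_compatible : ∀ c ∈ O.charts, base.Compatible c
  mult : (C2 ≃L[ℂ] C2) → C2 → ℂˣ
  analytic_mult : ∀ g ∈ base.Γ, AnalyticOnNhd ℂ (fun x => (mult g x : ℂ)) base.dom
  mult_mul : ∀ g ∈ base.Γ, ∀ h ∈ base.Γ, ∀ x ∈ base.dom,
    mult (g * h) x = mult g (h x) * mult h x
  triv : C2 × ℂˣ → L
  proj_triv : ∀ x ∈ base.dom, ∀ w, proj (triv (x, w)) = base.map x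
  smul_triv : ∀ x ∈ base.dom, ∀ t w, triv (x, t * w) = t • triv (x, w)
  surjOn : SurjOn triv (base.dom ×ˢ univ) (proj ⁻¹' (base.map '' base.dom))
  continuousOn : ContinuousOn triv (base.dom ×ˢ univ)
  isOpen_image : ∀ U ⊆ base.dom ×ˢ univ, IsOpen U → IsOpen (triv '' U)
  triv_eq_iff : ∀ x ∈ base.dom, ∀ y ∈ base.dom, ∀ v w,
    triv (x, v) = triv (y, w) ↔ ∃ g ∈ base.Γ, g x = y ∧ mult g x * v = w

/-- A holomorphic `ℂ^×` bundle over a two-dimensional complex orbifold. -/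
structure CStarBundle {X : Type u} [TopologicalSpace X] (O : ComplexOrbifold X) where
  Total : Type u
  [topology : TopologicalSpace Total]
  [action : MulAction ℂˣ Total]
  proj : Total → X
  charts : Set (BundleChart O proj)
  cover : ∀ x : X, ∃ b ∈ charts, x ∈ b.base.map '' b.base.dom
  /-- Coordinate changes are holomorphic: each local lift `h` of the identity of `X` is covered by
  multiplication by a nonvanishing holomorphic function. -/
  compatible : ∀ b ∈ charts, ∀ b' ∈ charts, ∀ h x, IsLiftAt id b.base b'.base h x →
    ∃ κ : C2 → ℂˣ, AnalyticAt ℂ (fun z => (κ z : ℂ)) x ∧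
      ∀ᶠ z in 𝓝 x, ∀ w, b'.triv (h z, κ z * w) = b.triv (z, w)

attribute [instance] CStarBundle.topology CStarBundle.action

/-- The total space of the bundle, which is a complex orbifold with orbifold charts
`dom × ℂ^× → (dom × ℂ^×) / Γ ⊆ L`, is a manifold: it has the structure of a complex 3-manifold for
which these orbifold charts are local biholomorphisms.  (Equivalently, all isotropy groups of the
orbifold `L` are trivial.) -/
def CStarBundle.IsComplexManifold {X : Type u} [TopologicalSpace X] {O : ComplexOrbifold X}
    (L : CStarBundle O) : Prop :=
  ∃ _ : ChartedSpace (C2 × ℂ) L.Total, IsManifold 𝓘(ℂ, C2 × ℂ) ω L.Total ∧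
    ∀ b ∈ L.charts, IsLocalDiffeomorphOn (𝓘(ℂ, C2).prod 𝓘(ℂ, ℂ)) 𝓘(ℂ, C2 × ℂ) ω b.triv
      (b.base.dom ×ˢ univ)

/-- A hermitian metric on the line bundle associated to `L`, given by the length `|m|` of the
elements `m` of `L`. -/
structure CStarBundle.HermitianMetric {X : Type u} [TopologicalSpace X] {O : ComplexOrbifold X}
    (L : CStarBundle O) where
  len : L.Total → ℝ
  len_pos : ∀ m, 0 < len m
  len_smul : ∀ (t : ℂˣ) m, len (t • m) = ‖(t : ℂ)‖ * len m
  smooth : ∀ b ∈ L.charts, ContDiffOn ℝ ∞ (fun x => len (b.triv (x, 1))) b.base.dom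

/-- The real 2-form `(√-1 / 2π) ∂∂̄ f` on `ℂ²`, which is `-(1 / 4π) d (df ∘ √-1)`. -/
noncomputable def iddbar (f : C2 → ℝ) (x : C2) : C2 [⋀^Fin 2]→L[ℝ] ℝ :=
  extDeriv (fun z => ContinuousAlternatingMap.ofSubsingleton ℝ C2 ℝ (0 : Fin 1)
    ((-(1 / (4 * Real.pi))) •
      (fderiv ℝ f z).comp ((Complex.I • ContinuousLinearMap.id ℂ C2).restrictScalars ℝ))) x

/-- `ζ` is the form `(√-1 / 2π) ∂∂̄ s^*(ln |m|²)` for every local holomorphic section `s` of `L`;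
that is, `2π√-1 ζ` is the Chern curvature of the metric.  In the orbifold chart `c`, the local
holomorphic sections are the germs `z ↦ triv (h z, g z)`, with `h` a local lift of the identity
and `g` holomorphic and nonvanishing. -/
def CStarBundle.HermitianMetric.IsChernForm {X : Type u} [TopologicalSpace X]
    {O : ComplexOrbifold X} {L : CStarBundle O} (H : L.HermitianMetric) (ζ : O.Form 2) : Prop :=
  ∀ c, ∀ b ∈ L.charts, ∀ h x, IsLiftAt id c.1 b.base h x →
    ∀ g : C2 → ℂˣ, AnalyticAt ℂ (fun z => (g z : ℂ)) x →
      ζ.1 c x = iddbar (fun z => Real.log (H.len (b.triv (h z, g z)) ^ 2)) x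

/-- `e` is the Euler class `e(L) = -[ζ]` of `L`, where `2π√-1 ζ` is the Chern curvature of a
hermitian metric; hermitian metrics exist and all of them give the class `e`. -/
def CStarBundle.IsEulerClass {X : Type u} [TopologicalSpace X] {O : ComplexOrbifold X}
    (L : CStarBundle O) (e : O.H2) : Prop :=
  Nonempty L.HermitianMetric ∧ ∀ H : L.HermitianMetric,
    ∃ ζ : O.Closed 2, H.IsChernForm ζ.1 ∧ e = -O.cls ζ

/-! ## Blow-ups, exceptional divisors, Poincaré duals -/

/-- The part of `(ℂ² ∖ 0) × ℂ` which lies over the disk of radius `r` in `ℂ² / ±1`, under the map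
`(z, u) ↦ [√u z]`. -/
def tube (r : ℝ) : Set (C2 × ℂ) := {y | y.1 ≠ 0 ∧ ‖y.2‖ * ‖y.1‖ ^ 2 < r ^ 2}

/-- The blow-up `q : X̂ → X` of the orbifold at the isolated `ℤ/2` singularities `p i`: the map `q` is
biholomorphic over `X ∖ {p i}`, and over a disk in an orbifold chart centred at `p i` it is the
blow-up of `ℂ² / ±1` at `[0]`, that is, the map `[z; u] ↦ [√u z]` from
`(ℂ² ∖ 0) ×_{ℂ^×} ℂ`, where `t · (z; u) = (t z; t⁻² u)`.  The local identification is given by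
`Φ i (z, u) = [z; u]`, a holomorphic submersion whose fibres are the orbits of `ℂ^×`. -/
structure Blowup {X : Type u} [TopologicalSpace X] (O : ComplexOrbifold X) {k : ℕ}
    (p : Fin k → X) (Xhat : Type u) [TopologicalSpace Xhat] [ChartedSpace C2 Xhat]
    [IsManifold 𝓘(ℂ, C2) ω Xhat] where
  q : Xhat → X
  continuous_q : Continuous q
  bijOn : BijOn q (q ⁻¹' (range p)ᶜ) (range p)ᶜ
  bihol : ∀ c' ∈ (ComplexOrbifold.ofManifold Xhat).charts, ∀ c ∈ O.charts,
    ∀ x ∈ c'.dom, ∀ y ∈ c.dom, q (c'.map x) = c.map y → c.map y ∉ range p → LiftsBihol q c' c x y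
  chart : Fin k → OrbiChart X
  chart_mem : ∀ i, chart i ∈ O.charts
  map_zero : ∀ i, (chart i).map 0 = p i
  r : Fin k → ℝ
  r_pos : ∀ i, 0 < r i
  ball_subset : ∀ i, Metric.ball 0 (r i) ⊆ (chart i).dom
  Φ : Fin k → C2 × ℂ → Xhat
  holomorphic_Φ : ∀ i, ContMDiffOn 𝓘(ℂ, C2 × ℂ) 𝓘(ℂ, C2) ω (Φ i) (tube (r i))
  submersion_Φ : ∀ i, ∀ y ∈ tube (r i),
    Function.Surjective (mfderiv 𝓘(ℂ, C2 × ℂ) 𝓘(ℂ, C2) (Φ i) y)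
  Φ_eq_iff : ∀ i, ∀ y ∈ tube (r i), ∀ y' ∈ tube (r i),
    Φ i y = Φ i y' ↔ ∃ t : ℂˣ, y'.1 = (t : ℂ) • y.1 ∧ y'.2 = (t : ℂ)⁻¹ ^ 2 * y.2
  image_Φ : ∀ i, Φ i '' tube (r i) = q ⁻¹' ((chart i).map '' Metric.ball 0 (r i))
  q_Φ : ∀ i z s, (z, s ^ 2) ∈ tube (r i) → q (Φ i (z, s ^ 2)) = (chart i).map (s • z)

namespace Blowup

variable {X : Type u} [TopologicalSpace X] {O : ComplexOrbifold X} {k : ℕ} {p : Fin k → X}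
  {Xhat : Type u} [TopologicalSpace Xhat] [ChartedSpace C2 Xhat] [IsManifold 𝓘(ℂ, C2) ω Xhat]

/-- The holomorphic parametrization `t ↦ [1, t; 0]` of the exceptional divisor
`E i = q ⁻¹ (p i) ≅ ℂP¹` without the point `[0, 1; 0]`. -/
noncomputable def curve (B : Blowup O p Xhat) (i : Fin k) (t : ℂ) : Xhat :=
  B.Φ i (!₂[1, t], 0)

/-- The chart of the complex surface at the point `m`. -/
noncomputable def chartAtPt (m : Xhat) : (ComplexOrbifold.ofManifold Xhat).charts :=
  ⟨manifoldChart (chartAt C2 m), mem_image_of_mem _ (chart_mem_atlas C2 m)⟩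

/-- The coefficient of `dx ∧ dy` in the pullback of the 2-form `η` to `E i`, in the coordinate
`t = x + √-1 y`. -/
noncomputable def density (B : Blowup O p Xhat) (i : Fin k)
    (η : (ComplexOrbifold.ofManifold Xhat).Form 2) (t : ℂ) : ℝ :=
  let e := chartAt C2 (B.curve i t)
  let D := fderiv ℝ (fun s => e (B.curve i s)) t
  η.1 (chartAtPt (B.curve i t)) (e (B.curve i t)) ![D 1, D Complex.I]

/-- `∫_{E i} η`, for the complex orientation of `E i`. -/
noncomputable def integralE (B : Blowup O p Xhat) (i : Fin k)
    (η : (ComplexOrbifold.ofManifold Xhat).Form 2) : ℝ :=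
  ∫ t : ℂ, B.density i η t

/-- `∫_{E i} a = r`, for a cohomology class `a`. -/
def HasIntegralE (B : Blowup O p Xhat) (i : Fin k) (a : (ComplexOrbifold.ofManifold Xhat).H2)
    (r : ℝ) : Prop :=
  ∀ η, (ComplexOrbifold.ofManifold Xhat).cls η = a →
    Integrable (B.density i η.1) ∧ B.integralE i η.1 = r

end Blowup

/-- The coefficient of the orientation form `dx₁ ∧ dy₁ ∧ dx₂ ∧ dy₂` in `α ∧ β`, for alternating
2-forms `α`, `β` on `ℂ²`, where `z₁ = x₁ + √-1 y₁` and `z₂ = x₂ + √-1 y₂`. -/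
noncomputable def wedgeCoeff (α β : C2 [⋀^Fin 2]→L[ℝ] ℝ) : ℝ :=
  let v : Fin 4 → C2 := ![!₂[1, 0], !₂[Complex.I, 0], !₂[0, 1], !₂[0, Complex.I]]
  α ![v 0, v 1] * β ![v 2, v 3] - α ![v 0, v 2] * β ![v 1, v 3] + α ![v 0, v 3] * β ![v 1, v 2]
    + α ![v 1, v 2] * β ![v 0, v 3] - α ![v 1, v 3] * β ![v 0, v 2] + α ![v 2, v 3] * β ![v 0, v 1]

/-- The support of the form `ψ` is contained in a compact subset of `S`. -/
def CompactSupportIn {X : Type u} [TopologicalSpace X] {O : ComplexOrbifold X}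
    {k : ℕ} (ψ : O.Form k) (S : Set X) : Prop :=
  ∃ K ⊆ S, IsCompact K ∧ VanishesOn ψ Kᶜ

/-- `∫_M ε ∧ ψ = r` for 2-forms `ε`, `ψ` on the complex surface `M`, with `ψ` compactly supported:
`ψ` is a finite sum of forms `ψ j` with compact support in the source of a chart `e j`, and `r` is the
sum of the integrals of `ε ∧ ψ j` in these charts. -/
def IntegralWedge (M : Type u) [TopologicalSpace M] [ChartedSpace C2 M]
    [IsManifold 𝓘(ℂ, C2) ω M] (ε ψ : (ComplexOrbifold.ofManifold M).Form 2) (r : ℝ) : Prop :=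
  ∃ (n : ℕ) (e : Fin n → atlas C2 M) (φ : Fin n → (ComplexOrbifold.ofManifold M).Form 2),
    (∀ j, CompactSupportIn (φ j) (e j).1.source) ∧ ψ = ∑ j, φ j ∧
    r = ∑ j, ∫ y : ℂ × ℂ,
      wedgeCoeff (ε.1 ⟨_, mem_image_of_mem manifoldChart (e j).2⟩ !₂[y.1, y.2])
        ((φ j).1 ⟨_, mem_image_of_mem manifoldChart (e j).2⟩ !₂[y.1, y.2])

/-- `a` is the Poincaré dual of the exceptional divisor `E i`: it is represented by a closed form `ε`
such that `∫_X̂ ε ∧ ψ = ∫_{E i} ψ` for all closed compactly supported 2-forms `ψ` on `X̂`. -/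
def Blowup.IsPoincareDualE {X : Type u} [TopologicalSpace X] {O : ComplexOrbifold X} {k : ℕ}
    {p : Fin k → X} {Xhat : Type u} [TopologicalSpace Xhat] [ChartedSpace C2 Xhat]
    [IsManifold 𝓘(ℂ, C2) ω Xhat] (B : Blowup O p Xhat) (i : Fin k)
    (a : (ComplexOrbifold.ofManifold Xhat).H2) : Prop :=
  ∃ ε, (ComplexOrbifold.ofManifold Xhat).cls ε = a ∧
    ∀ ψ : (ComplexOrbifold.ofManifold Xhat).Closed 2, CompactSupportIn ψ.1 univ →
      IntegralWedge Xhat ε.1 ψ.1 (B.integralE i ψ.1)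

/-!
Near `E_i`, the blow-up is the quotient of a tube of points `(z, u)` by `t • (z, u) = (t z, t⁻² u)`.
The pullback of `L̂` to the tube is trivial, by an equivariant section `S_i` of some weight `m_i`
(`exists_equivariant_section`): over each of the two affine charts `L̂` is trivial, by Cauchy
integrals splitting transition functions over overlapping rectangles and annuli, and a splitting of
the transition function between the two charts into an inner part, a power and an outer part leaves
only the power. The integer `m_i` is the integral of `e(L̂)` over `E_i`: the length of `S_i` may be
taken to be `‖z‖^(-m_i)` (`Good.exists_normalised_metric`), and the integral is then that of a
multiple of the Fubini–Study form (`Good.hasIntegralE`).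

Since `z ↦ [z; 1]` parametrises the complement of `E_i` and `(-1)` acts on `S_i` by `(-1)^(m_i)`,
the restriction of `L̂` to the complement of the `E_i` extends over the singular points, with fibre
`ℂ^× / ⟨(-1)^(m_i)⟩` over `p_i` (`Good.descent`). The isotropy group acts freely on the total space
of the local cover if and only if `m_i` is odd, which decides when the total space is a manifold
(`Good.isComplexManifold_iff`).

Multiplying the normalised metric by `‖z‖^(m_i)`, suitably cut off, gives a metric on the new
bundle, for which `S_i` has length one near `p_i`. So the Chern forms differ, away from the `E_i`,
by multiples of the operator `(√-1 / 2π) ∂∂̄` applied to the cut off function `log ‖z‖²`, and these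
terms extend to the blow-up as half of `m_i` times a closed form with support near `E_i` (`dualPot`,
`Good.isPullbackClass`). That this form represents the Poincaré dual of `E_i` follows from Stokes'
theorem: after adding an exact form, a closed form vanishes near one point of `E_i`, so that a
single affine chart suffices (`Good.integral_wedge_dual`, `Good.isPoincareDualE`).

The class on the orbifold is unique because a closed 1-form near `E_i` has a primitive outside
`E_i`, as `E_i` is simply connected (`Good.exists_primitive`): a primitive of a pulled back form can
therefore be made to vanish near `E_i` and then descends (`exact_of_pullback_exact`).
-/

set_option linter.unusedSectionVars false

noncomputable section BlowupEuler

open Complex (I I_ne_zero)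
open Metric (ball closedBall sphere ball_subset_ball ball_mem_nhds mem_ball_self isOpen_ball)
open Real (log)

variable {X : Type u} [TopologicalSpace X] {O : ComplexOrbifold X} {k : ℕ} {p : Fin k → X}
  {Xhat : Type u} [TopologicalSpace Xhat] [ChartedSpace C2 Xhat] [IsManifold 𝓘(ℂ, C2) ω Xhat]
  {B : Blowup O p Xhat} {ε : ℝ} {V : Type*} [NormedAddCommGroup V] [NormedSpace ℂ V]
  {x : V} {z : C2} {f : V → X} {c : OrbiChart X}

local notation "OM" => ComplexOrbifold.ofManifold Xhat
/-! ### Lifts of maps to orbifold charts -/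

/-- `h` is a holomorphic lift of `f : V → X` to the orbifold chart `c`, near the point `x`. -/
def LiftAt (f : V → X) (c : OrbiChart X) (h : V → C2) (x : V) : Prop :=
  h x ∈ c.dom ∧ AnalyticAt ℂ h x ∧ ∀ᶠ z in 𝓝 x, c.map (h z) = f z

/-- If an open set is covered by finitely many conditions which are closed on open sets, one of
these holds on a nonempty open subset. -/
lemma exists_open_of_finite_cover {α ι : Type*} [TopologicalSpace α] (P : ι → α → Prop)
    (T : Finset ι) : ∀ U : Set α, IsOpen U → U.Nonempty →
      (∀ g ∈ T, ∀ W ⊆ U, IsOpen W → IsOpen {z | z ∈ W ∧ ¬ P g z}) → (∀ z ∈ U, ∃ g ∈ T, P g z) →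
      ∃ g ∈ T, ∃ W ⊆ U, IsOpen W ∧ W.Nonempty ∧ ∀ z ∈ W, P g z := by
  classical
  induction T using Finset.induction_on with
  | empty =>
    rintro U - ⟨z, hz⟩ - h
    obtain ⟨g, hg, -⟩ := h z hz
    simp at hg
  | insert g T _ ih =>
    intro U hU hne hcl hcov
    by_cases h : ∀ z ∈ U, P g z
    · exact ⟨g, Finset.mem_insert_self _ _, U, subset_rfl, hU, hne, h⟩
    · push Not at h
      obtain ⟨z, hz, hgz⟩ := h
      obtain ⟨g', hg', W, hW, hWo, hWn, hP⟩ := ih {z | z ∈ U ∧ ¬ P g z}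
        (hcl g (Finset.mem_insert_self _ _) U subset_rfl hU) ⟨z, hz, hgz⟩
        (fun g' hg' W hW hWo => hcl g' (Finset.mem_insert_of_mem hg') W (hW.trans fun _ h => h.1) hWo)
        (by
          rintro w ⟨hw, hw'⟩
          obtain ⟨g', hg', hp⟩ := hcov w hw
          rcases Finset.mem_insert.1 hg' with rfl | hg''
          · exact absurd hp hw'
          · exact ⟨g', hg'', hp⟩)
      exact ⟨g', Finset.mem_insert_of_mem hg', W, hW.trans fun _ h => h.1, hWo, hWn, hP⟩

section
variable {Y : Type u} [TopologicalSpace Y]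
  {V' : Type*} [NormedAddCommGroup V'] [NormedSpace ℂ V']

lemma LiftAt.eventually {h : V → C2} (hl : LiftAt f c h x) : ∀ᶠ z in 𝓝 x, LiftAt f c h z := by
  filter_upwards [hl.2.1.continuousAt.preimage_mem_nhds (c.isOpen_dom.mem_nhds hl.1),
    hl.2.1.eventually_analyticAt, hl.2.2.eventually_nhds] with z h1 h2 h3
  exact ⟨h1, h2, h3⟩

lemma LiftAt.map_eq {h : V → C2} (hl : LiftAt f c h x) : c.map (h x) = f x := hl.2.2.self_of_nhds

lemma LiftAt.comp {h : V → C2} {g : V' → V} {y : V'}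
    (hl : LiftAt f c h (g y)) (hg : AnalyticAt ℂ g y) : LiftAt (f ∘ g) c (h ∘ g) y :=
  ⟨hl.1, hl.2.1.comp hg, hg.continuousAt.eventually hl.2.2⟩

lemma LiftAt.congr {f f' : V → X} {h h' : V → C2}
    (hl : LiftAt f c h x) (hf : f =ᶠ[𝓝 x] f') (hh : h =ᶠ[𝓝 x] h') : LiftAt f' c h' x := by
  refine ⟨hh.self_of_nhds ▸ hl.1, hl.2.1.congr hh, ?_⟩
  filter_upwards [hl.2.2, hf, hh] with z h1 h2 h3
  rw [← h2, ← h3, h1]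

lemma isLiftAt_iff {f : X → Y} {c' : OrbiChart Y} {h : C2 → C2} {x : C2} :
    IsLiftAt f c c' h x ↔ x ∈ c.dom ∧ LiftAt (fun z => f (c.map z)) c' h x := Iff.rfl

lemma LiftAt.post {F : X → Y} {c' : OrbiChart Y} {h : V → C2}
    {j : C2 → C2} (hl : LiftAt f c h x) (hj : IsLiftAt F c c' j (h x)) :
    LiftAt (fun z => F (f z)) c' (fun z => j (h z)) x := by
  refine ⟨hj.2.1, hj.2.2.1.comp hl.2.1, ?_⟩
  filter_upwards [hl.2.2, hl.2.1.continuousAt.eventually hj.2.2.2] with z h1 h2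
  rw [h2, h1]

lemma LiftAt.postId {c c' : OrbiChart X} {h : V → C2}
    {j : C2 → C2} (hl : LiftAt f c h x) (hj : IsLiftAt id c c' j (h x)) :
    LiftAt f c' (fun z => j (h z)) x := hl.post hj

/-- Two lifts of the same map to the same chart differ by an element of the group of the chart:
the closed sets on which a given element works cover a neighbourhood, so one of them has interior
points, and the identity theorem applies. -/
lemma LiftAt.unique {h h' : V → C2}
    (hl : LiftAt f c h x) (hl' : LiftAt f c h' x) : ∃ g ∈ c.Γ, ∀ᶠ z in 𝓝 x, h' z = g (h z) := by
  classical
  have := c.finite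
  have := Fintype.ofFinite c.Γ
  have := hl.eventually.and hl'.eventually
  obtain ⟨ρ, hρ, hB⟩ := Metric.eventually_nhds_iff_ball.1 this
  have han : ∀ g : C2 ≃L[ℂ] C2, AnalyticOnNhd ℂ (fun z => g (h z)) (ball x ρ) :=
    fun g z hz => (g : C2 →L[ℂ] C2).analyticAt _ |>.comp (hB z hz).1.2.1
  have han' : AnalyticOnNhd ℂ h' (ball x ρ) := fun z hz => (hB z hz).2.2.1
  obtain ⟨g, -, W, hWB, hWo, ⟨w, hw⟩, hW⟩ := exists_open_of_finite_cover
    (fun (g : c.Γ) z => h' z = (g : C2 ≃L[ℂ] C2) (h z)) Finset.univ (ball x ρ)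
    isOpen_ball ⟨x, mem_ball_self hρ⟩ (by
      intro g _ W hW hWo
      rw [isOpen_iff_mem_nhds]
      rintro z ⟨hz, hne⟩
      have h1 := (han' z (hW hz)).continuousAt
      have h2 := (han g z (hW hz)).continuousAt
      exact Filter.inter_mem (hWo.mem_nhds hz) (h1.ne_iff_eventually_ne h2 |>.1 hne)) (by
      intro z hz
      have h1 := (hB z hz).1
      have h2 := (hB z hz).2
      obtain ⟨g, hg, he⟩ := (c.map_eq_iff _ h1.1 _ h2.1).1 (h1.map_eq.trans h2.map_eq.symm)
      exact ⟨⟨g, hg⟩, Finset.mem_univ _, he.symm⟩)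
  refine ⟨g, g.2, ?_⟩
  have key := han'.eqOn_of_preconnected_of_eventuallyEq (han g)
    (convex_ball x ρ).isPreconnected (hWB hw)
    (Filter.eventually_of_mem (hWo.mem_nhds hw) fun z hz => hW z hz)
  exact Filter.eventually_of_mem (ball_mem_nhds x hρ) fun z hz => key hz

lemma LiftsBihol.exists_isLiftAt {f : X → Y} {c' : OrbiChart Y} {x y : C2}
    (h : LiftsBihol f c c' x y) : ∃ j, IsLiftAt f c c' j x ∧ j x = y := by
  obtain ⟨j, k, h1, h2, -⟩ := h
  exact ⟨j, h1, h2⟩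

lemma LiftAt.group_smul {h : V → C2}
    (hl : LiftAt f c h x) {g : C2 ≃L[ℂ] C2} (hg : g ∈ c.Γ) : LiftAt f c (fun z => g (h z)) x := by
  refine ⟨c.apply_mem g hg _ hl.1, (g : C2 →L[ℂ] C2).analyticAt _ |>.comp hl.2.1, ?_⟩
  filter_upwards [hl.eventually] with z hz
  rw [← hz.map_eq, eq_comm, c.map_eq_iff _ hz.1 _ (c.apply_mem g hg _ hz.1)]
  exact ⟨g, hg, rfl⟩

/-- Lifts of the same map to compatible charts differ by a local lift of the identity. -/
lemma LiftAt.exists_transition {c c' : OrbiChart X} (hc : c.Compatible c')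
    {h h' : V → C2} (hl : LiftAt f c h x) (hl' : LiftAt f c' h' x) :
    ∃ j, IsLiftAt id c c' j (h x) ∧ ∀ᶠ z in 𝓝 x, h' z = j (h z) := by
  obtain ⟨j, hj, hjx⟩ := (hc _ hl.1 _ hl'.1 (hl.map_eq.trans hl'.map_eq.symm)).exists_isLiftAt
  obtain ⟨g, hg, he⟩ := (hl.postId hj).unique hl'
  refine ⟨fun z => g (j z), ⟨hj.1, (LiftAt.group_smul hj.2 hg)⟩, he⟩

lemma LiftAt.transfer {c c' : OrbiChart X} (hc : c.Compatible c')
    {h : V → C2} (hl : LiftAt f c h x) (hx : f x ∈ c'.map '' c'.dom) : ∃ h', LiftAt f c' h' x := by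
  obtain ⟨y, hy, hyx⟩ := hx
  obtain ⟨j, hj, -⟩ := (hc _ hl.1 _ hy (hl.map_eq.trans hyx.symm)).exists_isLiftAt
  exact ⟨_, hl.postId hj⟩

/-- Every local lift of the identity between compatible charts is locally biholomorphic. -/
lemma IsLiftAt.exists_inverse {c c' : OrbiChart X} (hc : c.Compatible c') {j : C2 → C2} {x : C2}
    (hj : IsLiftAt id c c' j x) : ∃ k, IsLiftAt id c' c k (j x) ∧ k (j x) = x ∧
      (∀ᶠ z in 𝓝 x, k (j z) = z) ∧ ∀ᶠ w in 𝓝 (j x), j (k w) = w := by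
  obtain ⟨j0, k0, hj0, hx0, hk0, hkj, hjk⟩ := hc x hj.1 (j x) hj.2.1
    (LiftAt.map_eq hj.2).symm
  obtain ⟨g, hg, he⟩ := LiftAt.unique hj0.2 hj.2
  have hgx : g (j x) = j x := by have := he.self_of_nhds; rw [hx0] at this; exact this.symm
  have hgs : g.symm (j x) = j x := by rw [ContinuousLinearEquiv.symm_apply_eq, hgx]
  have hkx : k0 (j x) = x := by have := hkj.self_of_nhds; rwa [hx0] at this
  have hsym : ContinuousAt g.symm (j x) := g.symm.continuous.continuousAt
  have hk0c : ContinuousAt (fun w => k0 (g.symm w)) (j x) :=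
    ContinuousAt.comp (by rw [hgs]; exact hk0.continuousAt) hsym
  have hinv : ∀ᶠ w in 𝓝 (j x), j (k0 (g.symm w)) = w := by
    have h1 : ∀ᶠ w in 𝓝 (j x), j0 (k0 (g.symm w)) = g.symm w := by
      have : Tendsto g.symm (𝓝 (j x)) (𝓝 (j x)) := by have := hsym.tendsto; rwa [hgs] at this
      exact this.eventually hjk
    have h2 : ∀ᶠ w in 𝓝 (j x), j (k0 (g.symm w)) = g (j0 (k0 (g.symm w))) := by
      have : Tendsto (fun w => k0 (g.symm w)) (𝓝 (j x)) (𝓝 x) := by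
        have := hk0c.tendsto; simpa only [hgs, hkx] using this
      exact this.eventually he
    filter_upwards [h1, h2] with w h1 h2
    rw [h2, h1, g.apply_symm_apply]
  refine ⟨fun w => k0 (g.symm w), ⟨hj.2.1, ?_, ?_, ?_⟩, ?_, ?_, hinv⟩
  · simpa only [hgs, hkx] using hj.1
  · refine AnalyticAt.comp (by rw [hgs]; exact hk0) ((g.symm : C2 →L[ℂ] C2).analyticAt _)
  · have h3 : ∀ᶠ w in 𝓝 (j x), c'.map (j (k0 (g.symm w))) = id (c.map (k0 (g.symm w))) := by
      have : Tendsto (fun w => k0 (g.symm w)) (𝓝 (j x)) (𝓝 x) := by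
        have := hk0c.tendsto; simpa only [hgs, hkx] using this
      exact this.eventually hj.2.2.2
    filter_upwards [hinv, h3] with w h1 h2
    rw [← h1, h2, h1]; rfl
  · simp only [hgs, hkx]
  · filter_upwards [he, hkj] with z h1 h2
    rw [h1, g.symm_apply_apply, h2]

lemma LiftAt.self {x : C2} (hx : x ∈ c.dom) : LiftAt c.map c (fun z => z) x :=
  ⟨hx, analyticAt_id, Eventually.of_forall fun _ => rfl⟩

lemma OrbiChart.Compatible.symm {c c' : OrbiChart X} (h : c.Compatible c') : c'.Compatible c := by
  intro y hy x hx hxy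
  obtain ⟨j, hj, hjx⟩ := (h x hx y hy hxy.symm).exists_isLiftAt
  obtain ⟨k, hk, hkx, h1, h2⟩ := hj.exists_inverse h
  subst hjx
  exact ⟨k, j, hk, hkx, hj.2.2.1, h2, h1⟩

end

/-- The map `f : V → X` is holomorphic at `x`, in the sense of having a holomorphic local lift. -/
def ComplexOrbifold.Hol {X : Type u} [TopologicalSpace X] (O : ComplexOrbifold X)
    (f : V → X) (x : V) : Prop :=
  ∃ c ∈ O.charts, ∃ h, LiftAt f c h x

section
variable {V' : Type*} [NormedAddCommGroup V'] [NormedSpace ℂ V']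

lemma ComplexOrbifold.Hol.eventually (h : O.Hol f x) : ∀ᶠ z in 𝓝 x, O.Hol f z := by
  obtain ⟨c, hc, h, hl⟩ := h
  exact hl.eventually.mono fun z hz => ⟨c, hc, h, hz⟩

lemma ComplexOrbifold.Hol.comp {g : V' → V} {y : V'} (h : O.Hol f (g y))
    (hg : AnalyticAt ℂ g y) : O.Hol (f ∘ g) y := by
  obtain ⟨c, hc, h, hl⟩ := h
  exact ⟨c, hc, _, hl.comp hg⟩

lemma ComplexOrbifold.Hol.congr {f f' : V → X} (h : O.Hol f x) (hf : f =ᶠ[𝓝 x] f') :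
    O.Hol f' x := by
  obtain ⟨c, hc, h, hl⟩ := h
  exact ⟨c, hc, h, hl.congr hf EventuallyEq.rfl⟩

lemma ComplexOrbifold.hol_chart (hc : c ∈ O.charts) {x : C2} (hx : x ∈ c.dom) :
    O.Hol c.map x := ⟨c, hc, _, LiftAt.self hx⟩

lemma ComplexOrbifold.Hol.exists_lift (h : O.Hol f x)
    (hc : ∀ c' ∈ O.charts, c.Compatible c') (hx : f x ∈ c.map '' c.dom) : ∃ h, LiftAt f c h x := by
  obtain ⟨c', hc', h, hl⟩ := h
  exact hl.transfer (hc c' hc').symm hx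

lemma ComplexOrbifold.Hol.continuousAt (h : O.Hol f x) : ContinuousAt f x := by
  obtain ⟨c, -, h, hl⟩ := h
  have h1 : ContinuousAt (fun z => c.map (h z)) x :=
    ContinuousAt.comp (c.continuousOn.continuousAt (c.isOpen_dom.mem_nhds hl.1)) hl.2.1.continuousAt
  exact h1.congr hl.2.2

end

/-! ### Pullback of orbifold forms -/

section
variable {k : ℕ}
  [NormedSpace ℝ V] [IsScalarTower ℝ ℂ V]
  {V' : Type*} [NormedAddCommGroup V'] [NormedSpace ℂ V'] [NormedSpace ℝ V']
  [IsScalarTower ℝ ℂ V']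

open Classical in
/-- The pullback of the orbifold form `η` under a holomorphic map `f : V → X`, computed by means of
any local lift (see `pull_eq`). -/
def pull (η : O.Form k) (f : V → X) (x : V) : V [⋀^Fin k]→L[ℝ] ℝ :=
  if H : ∃ c : O.charts, ∃ h, LiftAt f c.1 h x then
    (η.1 H.choose (H.choose_spec.choose x)).compContinuousLinearMap
      (fderiv ℝ H.choose_spec.choose x)
  else 0

lemma pull_eq (η : O.Form k) (c : O.charts) {h : V → C2} (hl : LiftAt f c.1 h x) :
    pull η f x = (η.1 c (h x)).compContinuousLinearMap (fderiv ℝ h x) := by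
  have H : ∃ c : O.charts, ∃ h, LiftAt f c.1 h x := ⟨c, h, hl⟩
  rw [pull, dif_pos H]
  obtain ⟨j, hj, he⟩ := hl.exists_transition (O.compatible _ c.2 _ H.choose.2)
    H.choose_spec.choose_spec
  have he' : H.choose_spec.choose =ᶠ[𝓝 x] fun z => j (h z) := he
  rw [he'.fderiv_eq, he'.self_of_nhds, η.2.2.2 _ _ _ _ hj,
    show fderiv ℝ (fun z => j (h z)) x = (fderiv ℝ j (h x)).comp (fderiv ℝ h x) from
      fderiv_comp x (hj.2.2.1.differentiableAt.restrictScalars ℝ)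
        (hl.2.1.differentiableAt.restrictScalars ℝ)]
  rfl

lemma pull_chart (η : O.Form k) (c : O.charts) {x : C2} (hx : x ∈ c.1.dom) :
    pull η c.1.map x = η.1 c x := by
  rw [pull_eq η c (LiftAt.self hx)]
  ext v
  simp [ContinuousAlternatingMap.compContinuousLinearMap_apply]

lemma pull_comp (η : O.Form k) {g : V' → V} {y : V'} (hf : O.Hol f (g y)) (hg : AnalyticAt ℂ g y) :
    pull η (f ∘ g) y = (pull η f (g y)).compContinuousLinearMap (fderiv ℝ g y) := by
  obtain ⟨c, hc, h, hl⟩ := hf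
  rw [pull_eq η ⟨c, hc⟩ hl, pull_eq η ⟨c, hc⟩ (hl.comp hg),
    fderiv_comp y (hl.2.1.differentiableAt.restrictScalars ℝ)
      (hg.differentiableAt.restrictScalars ℝ)]
  rfl

lemma pull_congr (η : O.Form k) {f f' : V → X} (h : f =ᶠ[𝓝 x] f') : pull η f x = pull η f' x := by
  by_cases H : ∃ c : O.charts, ∃ h, LiftAt f c.1 h x
  · obtain ⟨c, j, hl⟩ := H
    rw [pull_eq η c hl, pull_eq η c (hl.congr h EventuallyEq.rfl)]
  · rw [pull, dif_neg H, pull, dif_neg]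
    rintro ⟨c, j, hl⟩
    exact H ⟨c, j, hl.congr h.symm EventuallyEq.rfl⟩

lemma pull_add (η η' : O.Form k) (f : V → X) (x : V) :
    pull (η + η') f x = pull η f x + pull η' f x := by
  by_cases H : ∃ c : O.charts, ∃ h, LiftAt f c.1 h x
  · obtain ⟨c, j, hl⟩ := H
    rw [pull_eq _ c hl, pull_eq _ c hl, pull_eq _ c hl]; rfl
  · rw [pull, dif_neg H, pull, dif_neg H, pull, dif_neg H, add_zero]

/-- A form is zero if its pullbacks to all charts are. -/
lemma form_ext {η η' : O.Form k} (h : ∀ c : O.charts, ∀ x ∈ c.1.dom, η.1 c x = η'.1 c x) :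
    η = η' := by
  apply Subtype.ext
  funext c x
  by_cases hx : x ∈ c.1.dom
  · exact h c x hx
  · rw [η.2.1 c x hx, η'.2.1 c x hx]

omit [NormedSpace ℂ V] [IsScalarTower ℝ ℂ V] in
lemma contDiffAt_comp_apply {η : C2 → C2 [⋀^Fin k]→L[ℝ] ℝ} {h : V → C2}
    (hη : ContDiffAt ℝ ∞ η (h x)) (hh : ContDiffAt ℝ ∞ h x) (v : Fin k → V) :
    ContDiffAt ℝ ∞ (fun z => (η (h z)).compContinuousLinearMap (fderiv ℝ h z) v) x := by
  have h1 : ContDiffAt ℝ ∞ (fun z => (ContinuousAlternatingMap.toContinuousMultilinearMapCLM ℝ)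
      (η (h z))) x :=
    (ContinuousLinearMap.contDiff _).contDiffAt.comp x (hη.comp x hh)
  have h2 : ContDiffAt ℝ ∞ (fun z => fun _ : Fin k => fderiv ℝ h z) x :=
    contDiffAt_pi.2 fun _ => hh.fderiv_right (m := ∞) (by simp)
  have h3 : ContDiffAt ℝ ∞ (fun z =>
      ContinuousMultilinearMap.compContinuousLinearMapContinuousMultilinear ℝ (fun _ : Fin k => V)
        (fun _ : Fin k => C2) ℝ (fun _ : Fin k => fderiv ℝ h z)) x :=
    (ContinuousMultilinearMap.contDiff _).contDiffAt.comp x h2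
  have h4 := h3.clm_apply h1
  exact (ContinuousMultilinearMap.apply ℝ (fun _ : Fin k => V) ℝ v).contDiff.contDiffAt.comp x h4

lemma ComplexOrbifold.Form.contDiffAt (η : O.Form k) (c : O.charts) {x : C2} (hx : x ∈ c.1.dom) :
    ContDiffAt ℝ ∞ (η.1 c) x := (η.2.2.1 c).contDiffAt (c.1.isOpen_dom.mem_nhds hx)

lemma AnalyticAt.contDiffAt_real {E F : Type*} [NormedAddCommGroup E] [NormedSpace ℂ E]
    [NormedSpace ℝ E] [IsScalarTower ℝ ℂ E] [NormedAddCommGroup F] [NormedSpace ℂ F]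
    [NormedSpace ℝ F] [IsScalarTower ℝ ℂ F] [CompleteSpace F] {f : E → F} {x : E}
    (h : AnalyticAt ℂ f x) {n : WithTop ℕ∞} : ContDiffAt ℝ n f x :=
  (h.restrictScalars (𝕜 := ℝ)).contDiffAt

lemma contDiffAt_pull_apply (η : O.Form k) (hf : O.Hol f x)
    (v : Fin k → V) : ContDiffAt ℝ ∞ (fun z => pull η f z v) x := by
  obtain ⟨c, hc, h, hl⟩ := hf
  refine (contDiffAt_comp_apply (η.contDiffAt ⟨c, hc⟩ hl.1) hl.2.1.contDiffAt_real v).congr_of_eventuallyEq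
    ?_
  filter_upwards [hl.eventually] with z hz
  rw [pull_eq η ⟨c, hc⟩ hz]

lemma extDeriv_pull {η : O.Form k} {c : O.charts} {h : V → C2} (hl : LiftAt f c.1 h x) :
    extDeriv (pull η f) x = (extDeriv (η.1 c) (h x)).compContinuousLinearMap (fderiv ℝ h x) := by
  have : pull η f =ᶠ[𝓝 x] fun z => (η.1 c (h z)).compContinuousLinearMap (fderiv ℝ h z) := by
    filter_upwards [hl.eventually] with z hz
    rw [pull_eq η c hz]
  rw [this.extDeriv_eq]
  exact extDeriv_pullback (η.differentiableAt c hl.1)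
    (hl.2.1.contDiffAt_real (n := 2)) (by simp)

lemma extDeriv_pull_eq_zero (η : O.Closed k) (hf : O.Hol f x) : extDeriv (pull η.1 f) x = 0 := by
  obtain ⟨c, hc, h, hl⟩ := hf
  rw [extDeriv_pull (c := ⟨c, hc⟩) hl, η.2 ⟨c, hc⟩ _ hl.1]
  rfl

lemma differentiableAt_pull (η : O.Form k) (hf : O.Hol f x) : DifferentiableAt ℝ (pull η f) x := by
  obtain ⟨c, hc, h, hl⟩ := hf
  have : pull η f =ᶠ[𝓝 x] fun z => (η.1 ⟨c, hc⟩ (h z)).compContinuousLinearMap (fderiv ℝ h z) := by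
    filter_upwards [hl.eventually] with z hz
    rw [pull_eq η ⟨c, hc⟩ hz]
  refine DifferentiableAt.congr_of_eventuallyEq ?_ this
  have h1 : DifferentiableAt ℝ (fun z => η.1 ⟨c, hc⟩ (h z)) x :=
    (η.differentiableAt ⟨c, hc⟩ hl.1).comp x (hl.2.1.differentiableAt.restrictScalars ℝ)
  have h2 : DifferentiableAt ℝ (fderiv ℝ h) x :=
    (hl.2.1.contDiffAt_real (n := 2)).fderiv_right (m := 1) (by norm_num)
      |>.differentiableAt (by simp)
  exact h1.continuousAlternatingMapCompContinuousLinearMap h2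

end
lemma two_le_infty : (2 : WithTop ℕ∞) ≤ ∞ := WithTop.coe_le_coe.2 le_top

lemma one_le_infty : (1 : WithTop ℕ∞) ≤ ∞ := WithTop.coe_le_coe.2 le_top

/-! ### The operator `(√-1 / 2π) ∂∂̄` -/

section
variable [NormedSpace ℝ V]
  [IsScalarTower ℝ ℂ V]
  {V' : Type*} [NormedAddCommGroup V'] [NormedSpace ℂ V'] [NormedSpace ℝ V']
  [IsScalarTower ℝ ℂ V']

/-- The linear form `-(1 / 4π) df ∘ √-1`. -/
def dcLin (f : V → ℝ) (z : V) : V →L[ℝ] ℝ :=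
  (-(1 / (4 * Real.pi))) •
    (fderiv ℝ f z).comp ((I • ContinuousLinearMap.id ℂ V).restrictScalars ℝ)

/-- The 1-form `-(1 / 4π) df ∘ √-1`. -/
def dc (f : V → ℝ) (z : V) : V [⋀^Fin 1]→L[ℝ] ℝ :=
  ContinuousAlternatingMap.ofSubsingleton ℝ V ℝ (0 : Fin 1) (dcLin f z)

/-- The 2-form `(√-1 / 2π) ∂∂̄ f` on a complex vector space. -/
def ddc (f : V → ℝ) (x : V) : V [⋀^Fin 2]→L[ℝ] ℝ := extDeriv (dc f) x

lemma iddbar_eq_ddc (f : C2 → ℝ) : iddbar f = ddc f := rfl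

lemma dcLin_apply (f : V → ℝ) (z v : V) :
    dcLin f z v = -(1 / (4 * Real.pi)) * fderiv ℝ f z (I • v) := rfl

lemma dc_apply (f : V → ℝ) (z : V) (v : Fin 1 → V) : dc f z v = dcLin f z (v 0) := rfl

lemma Filter.EventuallyEq.dc {f g : V → ℝ} (h : f =ᶠ[𝓝 x] g) : dc f =ᶠ[𝓝 x] dc g := by
  filter_upwards [h.eventuallyEq_nhds] with z hz
  simp only [_root_.dc, dcLin, hz.fderiv_eq]

lemma Filter.EventuallyEq.ddc_eq {f g : V → ℝ} (h : f =ᶠ[𝓝 x] g) : ddc f x = ddc g x :=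
  h.dc.extDeriv_eq

lemma ContDiffAt.dcLin {f : V → ℝ} (h : ContDiffAt ℝ ∞ f x) : ContDiffAt ℝ ∞ (dcLin f) x := by
  have h1 : ContDiffAt ℝ ∞ (fderiv ℝ f) x := h.fderiv_right (by simp)
  exact (h1.clm_comp contDiffAt_const).const_smul _

lemma ContDiffAt.dc {f : V → ℝ} (h : ContDiffAt ℝ ∞ f x) : ContDiffAt ℝ ∞ (dc f) x :=
  (ContinuousAlternatingMap.ofSubsingletonLIE (𝕜 := ℝ) (E := V) (F := ℝ)
    (0 : Fin 1)).contDiff.contDiffAt.comp x h.dcLin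

lemma contDiffAt_extDeriv {k : ℕ} {β : V → V [⋀^Fin k]→L[ℝ] ℝ}
    (h : ContDiffAt ℝ ∞ β x) : ContDiffAt ℝ ∞ (extDeriv β) x :=
  have h1 : ContDiffAt ℝ ∞ (fderiv ℝ β) x := h.fderiv_right (by simp)
  have h2 : ContDiff ℝ ∞ (ContinuousAlternatingMap.alternatizeUncurryFinCLM ℝ V ℝ (n := k)) :=
    ContinuousLinearMap.contDiff _
  h2.contDiffAt.comp x h1

lemma ContDiffAt.ddc {f : V → ℝ} (h : ContDiffAt ℝ ∞ f x) : ContDiffAt ℝ ∞ (ddc f) x :=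
  contDiffAt_extDeriv h.dc

lemma extDeriv_ddc {f : V → ℝ} (h : ContDiffAt ℝ ∞ f x) : extDeriv (ddc f) x = 0 :=
  extDeriv_extDeriv_apply h.dc (by simpa using two_le_infty)

lemma dc_add {f g : V → ℝ} (hf : DifferentiableAt ℝ f x) (hg : DifferentiableAt ℝ g x) :
    dc (fun z => f z + g z) x = dc f x + dc g x := by
  ext v
  simp only [dc_apply, dcLin_apply, ContinuousAlternatingMap.add_apply, fderiv_fun_add hf hg,
    add_apply]
  ring

lemma dc_smul (r : ℝ) {f : V → ℝ} (hf : DifferentiableAt ℝ f x) :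
    dc (fun z => r * f z) x = r • dc f x := by
  ext v
  simp only [dc_apply, dcLin_apply, ContinuousAlternatingMap.smul_apply, fderiv_const_mul hf,
    smul_apply, smul_eq_mul]
  ring

lemma ContDiffAt.eventually_differentiableAt {f : V → ℝ} (hf : ContDiffAt ℝ ∞ f x) :
    ∀ᶠ z in 𝓝 x, DifferentiableAt ℝ f z :=
  ((hf.of_le one_le_infty).eventually (by simp)).mono
    fun _ h => h.differentiableAt (by simp)

lemma ddc_add {f g : V → ℝ} (hf : ContDiffAt ℝ ∞ f x) (hg : ContDiffAt ℝ ∞ g x) :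
    ddc (fun z => f z + g z) x = ddc f x + ddc g x := by
  have : dc (fun z => f z + g z) =ᶠ[𝓝 x] fun z => dc f z + dc g z := by
    filter_upwards [hf.eventually_differentiableAt, hg.eventually_differentiableAt] with z h1 h2
    exact dc_add h1 h2
  rw [ddc, this.extDeriv_eq, extDeriv_fun_add (hf.dc.differentiableAt (by simp))
    (hg.dc.differentiableAt (by simp))]
  rfl

lemma ddc_const_mul (r : ℝ) {f : V → ℝ} (hf : ContDiffAt ℝ ∞ f x) :
    ddc (fun z => r * f z) x = r • ddc f x := by
  have : dc (fun z => r * f z) =ᶠ[𝓝 x] fun z => r • dc f z := by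
    filter_upwards [hf.eventually_differentiableAt] with z h1
    exact dc_smul r h1
  rw [ddc, this.extDeriv_eq]
  exact extDeriv_fun_smul r (dc f)

lemma fderiv_I_smul {h : V → V'} (hh : DifferentiableAt ℂ h x) (v : V) :
    fderiv ℝ h x (I • v) = I • fderiv ℝ h x v := by
  rw [hh.fderiv_restrictScalars ℝ]
  simp

/-- The form `-(1 / 4π) df ∘ √-1` is natural for holomorphic maps. -/
lemma dc_comp {f : V' → ℝ} {h : V → V'} (hf : DifferentiableAt ℝ f (h x))
    (hh : DifferentiableAt ℂ h x) :
    dc (fun z => f (h z)) x = (dc f (h x)).compContinuousLinearMap (fderiv ℝ h x) := by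
  ext v
  simp only [dc_apply, dcLin_apply, ContinuousAlternatingMap.compContinuousLinearMap_apply,
    Function.comp_apply]
  rw [show (fun z => f (h z)) = f ∘ h from rfl, fderiv_comp x hf (hh.restrictScalars ℝ),
    ContinuousLinearMap.comp_apply, fderiv_I_smul hh]

lemma ddc_comp [CompleteSpace V'] {f : V' → ℝ} {h : V → V'} (hf : ContDiffAt ℝ ∞ f (h x))
    (hh : AnalyticAt ℂ h x) :
    ddc (fun z => f (h z)) x = (ddc f (h x)).compContinuousLinearMap (fderiv ℝ h x) := by
  have : dc (fun z => f (h z)) =ᶠ[𝓝 x]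
      fun z => (dc f (h z)).compContinuousLinearMap (fderiv ℝ h z) := by
    filter_upwards [hh.continuousAt.eventually hf.eventually_differentiableAt,
      hh.eventually_analyticAt] with z h1 h2
    exact dc_comp h1 h2.differentiableAt
  rw [ddc, this.extDeriv_eq]
  exact extDeriv_pullback (hf.dc.differentiableAt (by simp)) (hh.contDiffAt_real (n := 2)) (by simp)

lemma fderiv_dcLin_apply {f : V → ℝ} (hf : ContDiffAt ℝ ∞ f x) (v w : V) :
    fderiv ℝ (dcLin f) x v w = -(1 / (4 * Real.pi)) * fderiv ℝ (fderiv ℝ f) x v (I • w) := by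
  have hd : DifferentiableAt ℝ (fderiv ℝ f) x :=
    (hf.fderiv_right (m := ∞) (by simp)).differentiableAt (by simp)
  have h1 : DifferentiableAt ℝ (dcLin f) x := hf.dcLin.differentiableAt (by simp)
  have h2 : fderiv ℝ (fun z => dcLin f z w) x v = fderiv ℝ (dcLin f) x v w := by
    rw [fderiv_clm_apply h1 (differentiableAt_const _)]
    simp
  rw [← h2]
  simp only [dcLin_apply]
  rw [fderiv_const_mul (hd.clm_apply (differentiableAt_const _)),
    fderiv_clm_apply hd (differentiableAt_const _)]
  simp

lemma fderiv_apply_const_alternating {k : ℕ} {β : V → V [⋀^Fin k]→L[ℝ] ℝ}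
    (h : DifferentiableAt ℝ β x) (u : Fin k → V) (v : V) :
    fderiv ℝ (fun z => β z u) x v = fderiv ℝ β x v u := by
  rw [fderiv_continuousAlternatingMap_apply_const_apply h]

lemma extDeriv_one_apply {β : V → V [⋀^Fin 1]→L[ℝ] ℝ} (h : DifferentiableAt ℝ β x)
    (v w : V) : extDeriv β x ![v, w] =
      fderiv ℝ (fun z => β z ![w]) x v - fderiv ℝ (fun z => β z ![v]) x w := by
  rw [extDeriv_apply h, Fin.sum_univ_two]
  have e1 : (0 : Fin 2).removeNth ![v, w] = ![w] := by ext i; fin_cases i; rfl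
  have e2 : (1 : Fin 2).removeNth ![v, w] = ![v] := by ext i; fin_cases i; rfl
  rw [e1, e2]
  simp [sub_eq_add_neg]

lemma ddc_apply {f : V → ℝ} (hf : ContDiffAt ℝ ∞ f x) (v w : V) :
    ddc f x ![v, w] = -(1 / (4 * Real.pi)) *
      (fderiv ℝ (fderiv ℝ f) x v (I • w) - fderiv ℝ (fderiv ℝ f) x w (I • v)) := by
  have h1 : DifferentiableAt ℝ (dcLin f) x := hf.dcLin.differentiableAt (by simp)
  have key : ∀ a b : V, fderiv ℝ (fun z => dc f z ![b]) x a = fderiv ℝ (dcLin f) x a b := by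
    intro a b
    have : (fun z => dc f z ![b]) = fun z => dcLin f z b := by funext z; simp [dc_apply]
    rw [this, fderiv_clm_apply h1 (differentiableAt_const _)]
    simp
  rw [ddc, extDeriv_one_apply (hf.dc.differentiableAt (by simp)), key, key,
    fderiv_dcLin_apply hf, fderiv_dcLin_apply hf]
  ring

lemma ddc_I_smul {f : V → ℝ} (hf : ContDiffAt ℝ ∞ f x) (v w : V) :
    ddc f x ![I • v, I • w] = ddc f x ![v, w] := by
  have hs : ∀ a b, fderiv ℝ (fderiv ℝ f) x a b = fderiv ℝ (fderiv ℝ f) x b a := fun a b =>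
    (hf.isSymmSndFDerivAt (by simpa using two_le_infty)).eq a b
  rw [ddc_apply hf, ddc_apply hf]
  simp only [smul_smul, Complex.I_mul_I, neg_smul, one_smul, map_neg]
  rw [hs (I • v) w, hs (I • w) v]
  ring

/-- Near a point, a nonvanishing holomorphic function is the exponential of a holomorphic one. -/
lemma AnalyticAt.exists_eventually_exp {κ : V → ℂ} (h : AnalyticAt ℂ κ x)
    (h0 : κ x ≠ 0) : ∃ g : V → ℂ, AnalyticAt ℂ g x ∧ ∀ᶠ z in 𝓝 x, κ z = Complex.exp (g z) := by
  have h1 : AnalyticAt ℂ (fun z => κ z / κ x) x := h.div analyticAt_const h0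
  refine ⟨fun z => Complex.log (κ x) + Complex.log (κ z / κ x), analyticAt_const.add
    (h1.clog (by simp [h0])), ?_⟩
  filter_upwards [h.continuousAt.eventually_ne h0] with z hz
  rw [Complex.exp_add, Complex.exp_log h0, Complex.exp_log (div_ne_zero hz h0)]
  field_simp

/-- The real part of a holomorphic function is pluriharmonic. -/
lemma ddc_re {g : V → ℂ} (hg : AnalyticAt ℂ g x) : ddc (fun z => (g z).re) x = 0 := by
  have hre : ContDiffAt ℝ ∞ (fun z => (g z).im) x :=
    Complex.imCLM.contDiff.contDiffAt.comp x hg.contDiffAt_real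
  have : dc (fun z => (g z).re) =ᶠ[𝓝 x] extDeriv
      (fun z => ContinuousAlternatingMap.constOfIsEmpty ℝ V (Fin 0)
        ((1 / (4 * Real.pi)) * (g z).im)) := by
    filter_upwards [hg.eventually_analyticAt] with z hz
    have hd := hz.differentiableAt.restrictScalars ℝ
    have e1 : fderiv ℝ (fun z => (g z).re) z = Complex.reCLM.comp (fderiv ℝ g z) :=
      (Complex.reCLM.hasFDerivAt.comp z hd.hasFDerivAt).fderiv
    have e2 : fderiv ℝ (fun z => (g z).im) z = Complex.imCLM.comp (fderiv ℝ g z) :=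
      (Complex.imCLM.hasFDerivAt.comp z hd.hasFDerivAt).fderiv
    have hd2 : DifferentiableAt ℝ (fun z => (g z).im) z := Complex.imCLM.differentiableAt.comp z hd
    rw [extDeriv_constOfIsEmpty, fderiv_const_mul hd2, e2]
    ext v
    simp only [dc_apply, dcLin_apply, e1, ContinuousLinearMap.comp_apply,
      fderiv_I_smul hz.differentiableAt]
    simp
  rw [ddc, this.extDeriv_eq]
  refine extDeriv_extDeriv_apply (r := 2) ?_ (by simp)
  refine (ContinuousAlternatingMap.constOfIsEmptyLIE ℝ V ℝ (Fin 0)).contDiff.contDiffAt.comp x ?_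
  exact contDiffAt_const.mul (hre.of_le two_le_infty)

lemma ddc_log_norm_sq {κ : V → ℂ} (h : AnalyticAt ℂ κ x) (h0 : κ x ≠ 0) :
    ddc (fun z => log (‖κ z‖ ^ 2)) x = 0 := by
  obtain ⟨g, hg, he⟩ := h.exists_eventually_exp h0
  have : (fun z => log (‖κ z‖ ^ 2)) =ᶠ[𝓝 x] fun z => ((2 * g z : ℂ)).re := by
    filter_upwards [he] with z hz
    rw [hz, Complex.norm_exp, Real.log_pow, Real.log_exp]
    simp
  rw [this.ddc_eq]
  exact ddc_re (analyticAt_const.mul hg)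

lemma contDiffAt_log_norm_sq {κ : V → ℂ} (h : AnalyticAt ℂ κ x) (h0 : κ x ≠ 0) :
    ContDiffAt ℝ ∞ (fun z => log (‖κ z‖ ^ 2)) x :=
  ((contDiff_norm_sq ℝ).contDiffAt.comp x h.contDiffAt_real).log (by simpa using h0)

lemma ddc_const (r : ℝ) (x : V) : ddc (fun _ : V => r) x = 0 := by
  simpa using ddc_re (V := V) (g := fun _ => (r : ℂ)) (x := x) analyticAt_const

end
/-! ### Holomorphic sections of `ℂ^×` bundles -/

section
variable (L : CStarBundle O)
  {V' : Type*} [NormedAddCommGroup V'] [NormedSpace ℂ V']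

/-- The map `s : V → L` is holomorphic at `x`: in some bundle chart it is given by holomorphic
functions. -/
def CStarBundle.HolAt (s : V → L.Total) (x : V) : Prop :=
  ∃ b ∈ L.charts, ∃ (h : V → C2) (κ : V → ℂˣ), h x ∈ b.base.dom ∧ AnalyticAt ℂ h x ∧
    AnalyticAt ℂ (fun z => (κ z : ℂ)) x ∧ ∀ᶠ z in 𝓝 x, s z = b.triv (h z, κ z)

variable {L}

lemma BundleChart.triv_mul {Lt : Type u} [TopologicalSpace Lt] [MulAction ℂˣ Lt] {pr : Lt → X}
    (b : BundleChart O pr) {x : C2} (hx : x ∈ b.base.dom) (w : ℂˣ) :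
    b.triv (x, w) = w • b.triv (x, 1) := by
  rw [← b.smul_triv x hx, mul_one]

lemma CStarBundle.proj_smul (t : ℂˣ) (m : L.Total) : L.proj (t • m) = L.proj m := by
  obtain ⟨b, -, hb⟩ := L.cover (L.proj m)
  obtain ⟨⟨x, w⟩, ⟨hx, -⟩, rfl⟩ := b.surjOn hb
  rw [← b.smul_triv x hx, b.proj_triv x hx, b.proj_triv x hx]

lemma CStarBundle.exists_smul_eq {m m' : L.Total} (h : L.proj m = L.proj m') :
    ∃ t : ℂˣ, t • m = m' := by
  obtain ⟨b, -, hb⟩ := L.cover (L.proj m)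
  obtain ⟨⟨x, w⟩, ⟨hx, -⟩, rfl⟩ := b.surjOn hb
  rw [h] at hb
  obtain ⟨⟨y, v⟩, ⟨hy, -⟩, rfl⟩ := b.surjOn hb
  change x ∈ b.base.dom at hx
  change y ∈ b.base.dom at hy
  rw [b.proj_triv x hx, b.proj_triv y hy] at h
  obtain ⟨g, hg, hgx⟩ := (b.base.map_eq_iff x hx y hy).1 h
  refine ⟨v * (b.mult g x * w)⁻¹, ?_⟩
  rw [(b.triv_eq_iff x hx y hy w (b.mult g x * w)).2 ⟨g, hg, hgx, rfl⟩, ← b.smul_triv y hy,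
    inv_mul_cancel_right]

lemma CStarBundle.HolAt.eventually {s : V → L.Total} (hs : L.HolAt s x) :
    ∀ᶠ z in 𝓝 x, L.HolAt s z := by
  obtain ⟨b, hb, h, κ, h1, h2, h3, h4⟩ := hs
  filter_upwards [h2.continuousAt.preimage_mem_nhds (b.base.isOpen_dom.mem_nhds h1),
    h2.eventually_analyticAt, h3.eventually_analyticAt, h4.eventually_nhds] with z g1 g2 g3 g4
  exact ⟨b, hb, h, κ, g1, g2, g3, g4⟩

lemma CStarBundle.HolAt.congr {s s' : V → L.Total} (hs : L.HolAt s x)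
    (h : s =ᶠ[𝓝 x] s') : L.HolAt s' x := by
  obtain ⟨b, hb, f, κ, h1, h2, h3, h4⟩ := hs
  refine ⟨b, hb, f, κ, h1, h2, h3, ?_⟩
  filter_upwards [h, h4] with z g1 g2
  rw [← g1, g2]

lemma CStarBundle.HolAt.comp {s : V → L.Total} {g : V' → V} {y : V'} (hs : L.HolAt s (g y))
    (hg : AnalyticAt ℂ g y) : L.HolAt (fun z => s (g z)) y := by
  obtain ⟨b, hb, h, κ, h1, h2, h3, h4⟩ := hs
  exact ⟨b, hb, fun z => h (g z), fun z => κ (g z), h1, h2.comp hg, h3.comp hg,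
    hg.continuousAt.eventually h4⟩

lemma CStarBundle.HolAt.smul {s : V → L.Total} (hs : L.HolAt s x) {κ : V → ℂˣ}
    (hκ : AnalyticAt ℂ (fun z => (κ z : ℂ)) x) : L.HolAt (fun z => κ z • s z) x := by
  obtain ⟨b, hb, h, κ', h1, h2, h3, h4⟩ := hs
  refine ⟨b, hb, h, fun z => κ z * κ' z, h1, h2, ?_, ?_⟩
  · simp only [Units.val_mul]
    exact hκ.mul h3
  · filter_upwards [h4, h2.continuousAt.preimage_mem_nhds (b.base.isOpen_dom.mem_nhds h1)]
      with z g1 g2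
    rw [g1, b.smul_triv _ g2]

lemma BundleChart.hol_of_lift {b : BundleChart O L.proj} (hb : b ∈ L.charts) {h : V → C2}
    (hx : h x ∈ b.base.dom) (hh : AnalyticAt ℂ h x) : L.HolAt (fun z => b.triv (h z, 1)) x :=
  ⟨b, hb, h, fun _ => 1, hx, hh, analyticAt_const, Eventually.of_forall fun _ => rfl⟩

/-- A holomorphic section in a bundle chart, over the lift `h` of its projection. -/
lemma CStarBundle.HolAt.exists_lift {s : V → L.Total} (hs : L.HolAt s x) :
    ∃ b ∈ L.charts, ∃ (h : V → C2) (κ : V → ℂˣ), LiftAt (fun z => L.proj (s z)) b.base h x ∧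
      AnalyticAt ℂ (fun z => (κ z : ℂ)) x ∧ ∀ᶠ z in 𝓝 x, s z = κ z • b.triv (h z, 1) := by
  obtain ⟨b, hb, h, κ, h1, h2, h3, h4⟩ := hs
  have h5 := h2.continuousAt.preimage_mem_nhds (b.base.isOpen_dom.mem_nhds h1)
  refine ⟨b, hb, h, κ, ⟨h1, h2, ?_⟩, h3, ?_⟩
  · filter_upwards [h4, h5] with z g1 g2
    rw [g1, b.proj_triv _ g2]
  · filter_upwards [h4, h5] with z g1 g2
    rw [g1, b.triv_mul g2]

lemma BundleChart.analyticAt_mult (b : BundleChart O L.proj) {g : C2 ≃L[ℂ] C2} (hg : g ∈ b.base.Γ)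
    {h : V → C2} (hx : h x ∈ b.base.dom) (hh : AnalyticAt ℂ h x) :
    AnalyticAt ℂ (fun z => (b.mult g (h z) : ℂ)) x :=
  (b.analytic_mult g hg _ hx).comp hh

lemma analyticAt_units_inv {κ : V → ℂˣ} (h : AnalyticAt ℂ (fun z => (κ z : ℂ)) x) :
    AnalyticAt ℂ (fun z => (((κ z)⁻¹ : ℂˣ) : ℂ)) x := by
  simp only [Units.val_inv_eq_inv_val]
  exact h.inv (κ x).ne_zero

lemma analyticAt_units_mul {κ κ' : V → ℂˣ} (h : AnalyticAt ℂ (fun z => (κ z : ℂ)) x)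
    (h' : AnalyticAt ℂ (fun z => (κ' z : ℂ)) x) :
    AnalyticAt ℂ (fun z => ((κ z * κ' z : ℂˣ) : ℂ)) x := by
  simp only [Units.val_mul]
  exact h.mul h'

lemma BundleChart.base_compat (b b' : BundleChart O L.proj) : b.base.Compatible b'.base := by
  intro x hx y hy hxy
  obtain ⟨c, hc, z, hz, hzx⟩ := O.cover (b.base.map x)
  obtain ⟨j, hj, hjx⟩ := (b.base_compatible c hc x hx z hz hzx.symm).exists_isLiftAt
  obtain ⟨i, hi, hix⟩ := ((b'.base_compatible c hc).symm z hz y hy (hzx.trans hxy)).exists_isLiftAt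
  subst hjx
  obtain ⟨k, hk, hk1, hk2, hk3⟩ := hj.exists_inverse (b.base_compatible c hc)
  obtain ⟨l, hl, hl1, hl2, hl3⟩ := hi.exists_inverse (b'.base_compatible c hc).symm
  subst hix
  have hlk : AnalyticAt ℂ k (l (i (j x))) := by rw [hl1]; exact hk.2.2.1
  refine ⟨fun w => i (j w), fun w => k (l w), ⟨hx, LiftAt.postId hj.2 hi⟩, rfl,
    hlk.comp hl.2.2.1, ?_, ?_⟩
  · filter_upwards [hj.2.2.1.continuousAt.eventually hl2, hk2] with w h1 h2
    rw [h1, h2]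
  · have : Tendsto l (𝓝 (i (j x))) (𝓝 (j x)) := by
      have := hl.2.2.1.continuousAt.tendsto; rwa [hl1] at this
    filter_upwards [this.eventually hk3, hl3] with w h1 h2
    rw [h1, h2]

/-- Two holomorphic sections over the same map differ by a nonvanishing holomorphic function. -/
lemma CStarBundle.HolAt.exists_ratio {s s' : V → L.Total} (hs : L.HolAt s x)
    (hs' : L.HolAt s' x) (hp : ∀ᶠ z in 𝓝 x, L.proj (s z) = L.proj (s' z)) :
    ∃ κ : V → ℂˣ, AnalyticAt ℂ (fun z => (κ z : ℂ)) x ∧ ∀ᶠ z in 𝓝 x, s' z = κ z • s z := by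
  obtain ⟨b, hb, h, κ, hl, hκ, he⟩ := hs.exists_lift
  obtain ⟨b', hb', h', κ', hl', hκ', he'⟩ := hs'.exists_lift
  obtain ⟨j, hj, hjh⟩ := LiftAt.exists_transition (b.base_compat b')
    (hl.congr hp EventuallyEq.rfl) hl'
  obtain ⟨τ, hτ, hτe⟩ := L.compatible b hb b' hb' j (h x) hj
  have hτ' : AnalyticAt ℂ (fun z => (τ (h z) : ℂ)) x := hτ.comp hl.2.1
  refine ⟨fun z => κ' z * (κ z * τ (h z))⁻¹, analyticAt_units_mul hκ'
    (analyticAt_units_inv (analyticAt_units_mul hκ hτ')), ?_⟩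
  filter_upwards [he, he', hl.2.1.continuousAt.eventually hτe, hjh, hl'.eventually]
    with z e1 e2 e3 e4 e5
  have e6 : b.triv (h z, 1) = τ (h z) • b'.triv (h' z, 1) := by
    rw [← e3 1, ← e4, mul_one, b'.triv_mul e5.1]
  rw [e2, e1, e6, smul_smul, smul_smul]
  congr 1
  group

lemma CStarBundle.exists_holAt (hf : O.Hol f x) :
    ∃ s : V → L.Total, L.HolAt s x ∧ ∀ᶠ z in 𝓝 x, L.proj (s z) = f z := by
  obtain ⟨b, hb, hx⟩ := L.cover (f x)
  obtain ⟨h, hl⟩ := hf.exists_lift b.base_compatible hx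
  refine ⟨_, BundleChart.hol_of_lift hb hl.1 hl.2.1, ?_⟩
  filter_upwards [hl.eventually] with z hz
  rw [b.proj_triv _ hz.1, hz.map_eq]

lemma CStarBundle.HolAt.hol {s : V → L.Total} (hs : L.HolAt s x) :
    O.Hol (fun z => L.proj (s z)) x := by
  obtain ⟨b, hb, h, κ, hl, -⟩ := hs.exists_lift
  obtain ⟨c, hc, hx⟩ := O.cover (L.proj (s x))
  obtain ⟨h', hl'⟩ := hl.transfer (b.base_compatible c hc) hx
  exact ⟨c, hc, h', hl'⟩

end

/-! ### Forms given by local potentials -/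

section
/-- A coherent system of smooth local potentials `φ` on the orbifold charts: any two potentials at
the same point have the same `ddc`. -/
structure Potentials (O : ComplexOrbifold X) where
  /-- `φ` is a potential at the point `x` of the chart `c`. -/
  IsPot : O.charts → C2 → (C2 → ℝ) → Prop
  exists_pot : ∀ c, ∀ x ∈ c.1.dom, ∃ φ, IsPot c x φ
  smooth : ∀ c, ∀ x ∈ c.1.dom, ∀ φ, IsPot c x φ → ContDiffAt ℝ ∞ φ x
  eventually : ∀ c, ∀ x ∈ c.1.dom, ∀ φ, IsPot c x φ → ∀ᶠ z in 𝓝 x, IsPot c z φ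
  ddc_eq : ∀ c, ∀ x ∈ c.1.dom, ∀ φ φ', IsPot c x φ → IsPot c x φ' → ddc φ x = ddc φ' x
  comp : ∀ c c' h x φ, IsLiftAt id c.1 c'.1 h x → IsPot c' (h x) φ → IsPot c x (fun z => φ (h z))

open Classical in
/-- The `ddc` of a coherent system of potentials, as a family of forms on the charts. -/
def Potentials.fam (P : Potentials O) (c : O.charts) (x : C2) : C2 [⋀^Fin 2]→L[ℝ] ℝ :=
  if hx : x ∈ c.1.dom then ddc (P.exists_pot c x hx).choose x else 0

lemma Potentials.fam_eq (P : Potentials O) {c : O.charts} {x : C2} (hx : x ∈ c.1.dom) {φ : C2 → ℝ}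
    (h : P.IsPot c x φ) : P.fam c x = ddc φ x := by
  rw [Potentials.fam, dif_pos hx]
  exact P.ddc_eq c x hx _ _ (P.exists_pot c x hx).choose_spec h

lemma Potentials.fam_eventuallyEq (P : Potentials O) {c : O.charts} {x : C2} (hx : x ∈ c.1.dom)
    {φ : C2 → ℝ} (h : P.IsPot c x φ) : P.fam c =ᶠ[𝓝 x] ddc φ := by
  filter_upwards [P.eventually c x hx φ h, c.1.isOpen_dom.mem_nhds hx] with z h1 h2
  exact P.fam_eq h2 h1

/-- The closed 2-form with the given local potentials. -/
def Potentials.form (P : Potentials O) : O.Closed 2 :=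
  ⟨⟨P.fam, by
    refine ⟨fun c x hx => dif_neg hx, fun c x hx => ?_, fun c c' h x hl => ?_⟩
    · obtain ⟨φ, hφ⟩ := P.exists_pot c x hx
      exact ((P.smooth c x hx φ hφ).ddc.congr_of_eventuallyEq
        (P.fam_eventuallyEq hx hφ)).contDiffWithinAt
    · obtain ⟨φ, hφ⟩ := P.exists_pot c' (h x) hl.2.1
      rw [P.fam_eq hl.1 (P.comp c c' h x φ hl hφ), pullForm, P.fam_eq hl.2.1 hφ]
      exact ddc_comp (P.smooth c' _ hl.2.1 φ hφ) hl.2.2.1⟩, by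
    intro c x hx
    obtain ⟨φ, hφ⟩ := P.exists_pot c x hx
    exact (P.fam_eventuallyEq hx hφ).extDeriv_eq.trans (extDeriv_ddc (P.smooth c x hx φ hφ))⟩

lemma Potentials.form_apply (P : Potentials O) {c : O.charts} {x : C2} (hx : x ∈ c.1.dom)
    {φ : C2 → ℝ} (h : P.IsPot c x φ) : P.form.1.1 c x = ddc φ x := P.fam_eq hx h

lemma Potentials.form_I (P : Potentials O) (c : O.charts) (x v w : C2) :
    P.form.1.1 c x ![I • v, I • w] = P.form.1.1 c x ![v, w] := by
  by_cases hx : x ∈ c.1.dom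
  · obtain ⟨φ, hφ⟩ := P.exists_pot c x hx
    rw [P.form_apply hx hφ, ddc_I_smul (P.smooth c x hx φ hφ)]
  · rw [P.form.1.2.1 c x hx]; rfl

/-- A real function on an orbifold is smooth at a point of a chart. -/
def ComplexOrbifold.Smooth (O : ComplexOrbifold X) (F : X → ℝ) : Prop :=
  ∀ c ∈ O.charts, ∀ x ∈ c.dom, ContDiffAt ℝ ∞ (fun z => F (c.map z)) x

lemma ComplexOrbifold.Smooth.comp {F : X → ℝ} (hF : O.Smooth F) [NormedSpace ℝ V] [IsScalarTower ℝ ℂ V]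
    (hf : O.Hol f x) : ContDiffAt ℝ ∞ (fun z => F (f z)) x := by
  obtain ⟨c, hc, h, hl⟩ := hf
  have := (hF c hc _ hl.1).comp x hl.2.1.contDiffAt_real
  refine this.congr_of_eventuallyEq ?_
  filter_upwards [hl.2.2] with z hz
  simp [hz]

open Classical in
/-- The 1-form `-(1 / 4π) dF ∘ √-1`. -/
def dcForm {F : X → ℝ} (hF : O.Smooth F) : O.Form 1 :=
  ⟨fun c x => if x ∈ c.1.dom then dc (fun z => F (c.1.map z)) x else 0, by
    refine ⟨fun c x hx => if_neg hx, fun c x hx => ?_, fun c c' h x hl => ?_⟩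
    · refine ((hF c.1 c.2 x hx).dc.congr_of_eventuallyEq ?_).contDiffWithinAt
      filter_upwards [c.1.isOpen_dom.mem_nhds hx] with z hz
      rw [if_pos hz]
    · dsimp only
      rw [if_pos hl.1, pullForm, if_pos hl.2.1, ← dc_comp (f := fun z => F (c'.1.map z))
        ((hF c'.1 c'.2 _ hl.2.1).differentiableAt (by simp)) hl.2.2.1.differentiableAt]
      refine EventuallyEq.eq_of_nhds (EventuallyEq.dc ?_)
      filter_upwards [hl.2.2.2] with z hz
      rw [hz]; rfl⟩

lemma extDeriv_dcForm {F : X → ℝ} (hF : O.Smooth F) (c : O.charts) {x : C2} (hx : x ∈ c.1.dom) :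
    extDeriv ((dcForm hF).1 c) x = ddc (fun z => F (c.1.map z)) x := by
  refine EventuallyEq.extDeriv_eq ?_
  filter_upwards [c.1.isOpen_dom.mem_nhds hx] with z hz
  exact if_pos hz

lemma Potentials.cls_eq (P P' : Potentials O) {F : X → ℝ} (hF : O.Smooth F)
    (h : ∀ c, ∀ x ∈ c.1.dom, ∃ φ φ', P.IsPot c x φ ∧ P'.IsPot c x φ' ∧
      φ' =ᶠ[𝓝 x] fun z => φ z + F (c.1.map z)) : O.cls P.form = O.cls P'.form := by
  refine (Submodule.Quotient.eq _).2 ?_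
  rw [← neg_mem_iff, neg_sub]
  refine ⟨dcForm hF, fun c x hx => ?_⟩
  obtain ⟨φ, φ', h1, h2, h3⟩ := h c x hx
  rw [extDeriv_dcForm hF c hx]
  change P'.form.1.1 c x - P.form.1.1 c x = _
  rw [P.form_apply hx h1, P'.form_apply hx h2, h3.ddc_eq,
    ddc_add (P.smooth c x hx φ h1) (hF c.1 c.2 x hx), add_sub_cancel_left]

end

/-! ### Chern forms of hermitian metrics -/

section
variable {L : CStarBundle O}
  [NormedSpace ℝ V] [IsScalarTower ℝ ℂ V]

lemma CStarBundle.HermitianMetric.contDiffAt_log (H : L.HermitianMetric) {s : V → L.Total}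
    (hs : L.HolAt s x) : ContDiffAt ℝ ∞ (fun z => log (H.len (s z) ^ 2)) x := by
  obtain ⟨b, hb, h, κ, hl, hκ, he⟩ := hs.exists_lift
  have h1 : ContDiffAt ℝ ∞ (fun z => H.len (b.triv (h z, 1))) x :=
    ((H.smooth b hb).contDiffAt (b.base.isOpen_dom.mem_nhds hl.1)).comp x hl.2.1.contDiffAt_real
  have h2 : ContDiffAt ℝ ∞ (fun z => log (‖(κ z : ℂ)‖ ^ 2)) x :=
    contDiffAt_log_norm_sq hκ (κ x).ne_zero
  have h3 : ContDiffAt ℝ ∞ (fun z => log (H.len (b.triv (h z, 1)) ^ 2)) x :=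
    (h1.pow 2).log (pow_ne_zero _ (H.len_pos _).ne')
  refine (h2.add h3).congr_of_eventuallyEq ?_
  filter_upwards [he] with z hz
  rw [hz, H.len_smul, mul_pow, Real.log_mul (pow_ne_zero _ (norm_ne_zero_iff.2 (κ z).ne_zero))
    (pow_ne_zero _ (H.len_pos _).ne')]

lemma CStarBundle.HermitianMetric.log_smul (H : L.HermitianMetric) (t : ℂˣ) (m : L.Total) :
    log (H.len (t • m) ^ 2) = log (‖(t : ℂ)‖ ^ 2) + log (H.len m ^ 2) := by
  rw [H.len_smul, mul_pow, Real.log_mul (pow_ne_zero _ (norm_ne_zero_iff.2 t.ne_zero))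
    (pow_ne_zero _ (H.len_pos _).ne')]

/-- The potentials `log |s|²` of the Chern form of a hermitian metric, for local holomorphic
sections `s`. -/
def CStarBundle.HermitianMetric.pot (H : L.HermitianMetric) : Potentials O where
  IsPot c x φ := ∃ s : C2 → L.Total, L.HolAt s x ∧ (∀ᶠ z in 𝓝 x, L.proj (s z) = c.1.map z) ∧
    φ =ᶠ[𝓝 x] fun z => log (H.len (s z) ^ 2)
  exists_pot c x hx := by
    obtain ⟨s, h1, h2⟩ := CStarBundle.exists_holAt (L := L) (O.hol_chart c.2 hx)
    exact ⟨_, s, h1, h2, EventuallyEq.rfl⟩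
  smooth := by
    rintro c x hx φ ⟨s, h1, h2, h3⟩
    exact (H.contDiffAt_log h1).congr_of_eventuallyEq h3
  eventually := by
    rintro c x hx φ ⟨s, h1, h2, h3⟩
    filter_upwards [h1.eventually, h2.eventually_nhds, h3.eventuallyEq_nhds] with z g1 g2 g3
    exact ⟨s, g1, g2, g3⟩
  ddc_eq := by
    rintro c x hx φ φ' ⟨s, h1, h2, h3⟩ ⟨s', h1', h2', h3'⟩
    obtain ⟨κ, hκ, he⟩ := h1.exists_ratio h1' (by
      filter_upwards [h2, h2'] with z g1 g2
      rw [g1, g2])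
    have : φ' =ᶠ[𝓝 x] fun z => log (‖(κ z : ℂ)‖ ^ 2) + log (H.len (s z) ^ 2) := by
      filter_upwards [h3', he] with z g1 g2
      rw [g1, g2, H.log_smul]
    rw [this.ddc_eq, ddc_add (contDiffAt_log_norm_sq hκ (κ x).ne_zero) (H.contDiffAt_log h1),
      ddc_log_norm_sq hκ (κ x).ne_zero, zero_add, h3.ddc_eq]
  comp := by
    rintro c c' h x φ hl ⟨s, h1, h2, h3⟩
    have hc := hl.2.2.1.continuousAt
    refine ⟨fun z => s (h z), h1.comp hl.2.2.1, ?_, hc.eventually h3⟩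
    filter_upwards [hc.eventually h2, hl.2.2.2] with z g1 g2
    rw [g1, g2]; rfl

lemma CStarBundle.HermitianMetric.isChernForm (H : L.HermitianMetric) :
    H.IsChernForm H.pot.form.1 := by
  intro c b hb h x hl g hg
  rw [iddbar_eq_ddc]
  refine H.pot.form_apply hl.1 ⟨fun z => b.triv (h z, g z), ⟨b, hb, h, g, hl.2.1, hl.2.2.1, hg,
    Eventually.of_forall fun _ => rfl⟩, ?_, EventuallyEq.rfl⟩
  filter_upwards [LiftAt.eventually hl.2] with z hz
  rw [b.proj_triv _ hz.1, hz.map_eq]; rfl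

open Classical in
/-- The logarithm of the squared ratio of two hermitian metrics, as a function on the base. -/
def CStarBundle.HermitianMetric.logRatio (H H' : L.HermitianMetric) (x : X) : ℝ :=
  if h : ∃ m, L.proj m = x then
    log (H'.len h.choose ^ 2) - log (H.len h.choose ^ 2) else 0

lemma CStarBundle.HermitianMetric.logRatio_proj (H H' : L.HermitianMetric) (m : L.Total) :
    H.logRatio H' (L.proj m) = log (H'.len m ^ 2) - log (H.len m ^ 2) := by
  have h : ∃ m', L.proj m' = L.proj m := ⟨m, rfl⟩
  rw [logRatio, dif_pos h]
  have key : ∀ m', L.proj m' = L.proj m → log (H'.len m' ^ 2) - log (H.len m' ^ 2) =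
      log (H'.len m ^ 2) - log (H.len m ^ 2) := by
    intro m' hm
    obtain ⟨t, rfl⟩ := CStarBundle.exists_smul_eq hm
    rw [H.log_smul, H'.log_smul]
    ring
  exact key _ h.choose_spec

lemma CStarBundle.HermitianMetric.smooth_logRatio (H H' : L.HermitianMetric) :
    O.Smooth (H.logRatio H') := by
  intro c hc x hx
  obtain ⟨s, h1, h2⟩ := CStarBundle.exists_holAt (L := L) (O.hol_chart hc hx)
  refine ((H'.contDiffAt_log h1).sub (H.contDiffAt_log h1)).congr_of_eventuallyEq ?_
  filter_upwards [h2] with z hz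
  rw [← hz, logRatio_proj]

/-- The class of the Chern form does not depend on the metric. -/
lemma CStarBundle.HermitianMetric.isEulerClass (H : L.HermitianMetric) :
    L.IsEulerClass (-O.cls H.pot.form) := by
  refine ⟨⟨H⟩, fun H' => ⟨H'.pot.form, H'.isChernForm, ?_⟩⟩
  congr 1
  refine Potentials.cls_eq _ _ (H.smooth_logRatio H') fun c x hx => ?_
  obtain ⟨s, h1, h2⟩ := CStarBundle.exists_holAt (L := L) (O.hol_chart c.2 hx)
  refine ⟨_, _, ⟨s, h1, h2, EventuallyEq.rfl⟩, ⟨s, h1, h2, EventuallyEq.rfl⟩, ?_⟩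
  filter_upwards [h2] with z hz
  rw [← hz, logRatio_proj]
  ring

end
/-! ### Bundles over complex surfaces -/

section

lemma isManifold_real : IsManifold 𝓘(ℝ, C2) ∞ Xhat := by
  refine isManifold_of_contDiffOn _ _ _ fun e e' he he' => ?_
  have h := (contDiffGroupoid ω 𝓘(ℂ, C2)).compatible he he'
  rw [contDiffGroupoid, mem_groupoid_of_pregroupoid] at h
  exact (h.1.restrict_scalars ℝ).of_le le_top

end

section
lemma smooth_of_contMDiff {F : Xhat → ℝ} (hF : ContMDiff 𝓘(ℝ, C2) 𝓘(ℝ, ℝ) ∞ F) : (OM).Smooth F := by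
  have := isManifold_real (Xhat := Xhat)
  rintro _ ⟨e, he, rfl⟩ x hx
  have h1 : ContMDiffAt 𝓘(ℝ, C2) 𝓘(ℝ, C2) ∞ e.symm x := contMDiffAt_symm_of_mem_maximalAtlas
    (IsManifold.subset_maximalAtlas he) hx
  exact contMDiffAt_iff_contDiffAt.1 (hF.contMDiffAt.comp x h1)

lemma ofManifold_injOn {c : OrbiChart Xhat} (hc : ∀ c' ∈ (OM).charts,
    c.Compatible c') {y : C2} (hy : y ∈ c.dom) : ∃ N ∈ 𝓝 y, InjOn c.map N := by
  obtain ⟨_, ⟨e, he, rfl⟩, z, hz, hzy⟩ := (OM).cover (c.map y)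
  obtain ⟨h, k, hl, -, -, hk, -⟩ := hc _ ⟨e, he, rfl⟩ y hy z hz hzy.symm
  refine ⟨_, hl.2.2.2.and (hk.and (LiftAt.eventually hl.2)), ?_⟩
  rintro a ⟨ha1, ha2, ha3⟩ b ⟨hb1, hb2, hb3⟩ hab
  have h1 : e.symm (h a) = e.symm (h b) := by
    have h2 : (manifoldChart e).map (h a) = (manifoldChart e).map (h b) := by
      rw [ha1, hb1, id, id, hab]
    exact h2
  have := e.symm.injOn ha3.1 hb3.1 h1
  rw [← ha2, ← hb2, this]

lemma ofManifold_free {c : OrbiChart Xhat} (hc : ∀ c' ∈ (OM).charts,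
    c.Compatible c') {y : C2} (hy : y ∈ c.dom) {g : C2 ≃L[ℂ] C2} (hg : g ∈ c.Γ) (hgy : g y = y) :
    g = 1 := by
  obtain ⟨N, hN, hinj⟩ := ofManifold_injOn hc hy
  have hgc : Tendsto g (𝓝 y) (𝓝 y) := by
    have := g.continuous.continuousAt (x := y); rwa [ContinuousAt, hgy] at this
  have h1 : ∀ᶠ z in 𝓝 y, g z = z := by
    filter_upwards [hN, hgc hN, c.isOpen_dom.mem_nhds hy] with z h1 h2 h3
    refine (hinj h1 h2 ?_).symm
    exact (c.map_eq_iff z h3 _ (c.apply_mem g hg z h3)).2 ⟨g, hg, rfl⟩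
  refine ContinuousLinearEquiv.ext (funext fun v => ?_)
  have h2 : Tendsto (fun t : ℂ => y + t • v) (𝓝[≠] 0) (𝓝 y) := by
    have : Tendsto (fun t : ℂ => y + t • v) (𝓝 0) (𝓝 (y + (0 : ℂ) • v)) :=
      (by fun_prop : Continuous fun t : ℂ => y + t • v).tendsto 0
    simpa using this.mono_left nhdsWithin_le_nhds
  obtain ⟨t, ht, ht0⟩ := ((h2.eventually h1).and self_mem_nhdsWithin).exists
  rw [map_add, map_smul, hgy, add_right_inj] at ht
  exact smul_right_injective _ ht0 ht

variable {L : CStarBundle (ComplexOrbifold.ofManifold Xhat)}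

lemma smul_free {t : ℂˣ} {m : L.Total} (h : t • m = m) : t = 1 := by
  obtain ⟨b, -, hb⟩ := L.cover (L.proj m)
  obtain ⟨⟨x, w⟩, ⟨hx, -⟩, rfl⟩ := b.surjOn hb
  change x ∈ b.base.dom at hx
  rw [← b.smul_triv x hx, b.triv_eq_iff x hx x hx] at h
  obtain ⟨g, hg, hgx, hw⟩ := h
  have h1 := ofManifold_free b.base_compatible hx hg hgx
  subst h1
  have h2 := b.mult_mul 1 b.base.Γ.one_mem 1 b.base.Γ.one_mem x hx
  rw [mul_one, show (1 : C2 ≃L[ℂ] C2) x = x from rfl] at h2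
  have h3 : b.mult 1 x = 1 := by simpa using h2
  rw [h3, one_mul] at hw
  simpa using hw

lemma smul_left_cancel' {t t' : ℂˣ} {m : L.Total} (h : t • m = t' • m) : t = t' := by
  have : (t'⁻¹ * t) • m = m := by rw [mul_smul, h, inv_smul_smul]
  have := smul_free this
  rw [inv_mul_eq_one] at this
  exact this.symm

open Classical in
/-- The quotient of two elements of the same fibre. -/
def fibreRatio (m m' : L.Total) : ℂˣ := if h : ∃ t : ℂˣ, t • m = m' then h.choose else 1

lemma fibreRatio_smul {m m' : L.Total} (h : L.proj m = L.proj m') : fibreRatio m m' • m = m' := by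
  have h' := CStarBundle.exists_smul_eq h
  rw [fibreRatio, dif_pos h']
  exact h'.choose_spec

lemma fibreRatio_eq {m m' : L.Total} {t : ℂˣ} (h : t • m = m') : fibreRatio m m' = t :=
  smul_left_cancel' ((fibreRatio_smul (by rw [← h, CStarBundle.proj_smul])).trans h.symm)

lemma analyticAt_fibreRatio {s s' : V → L.Total} (hs : L.HolAt s x) (hs' : L.HolAt s' x)
    (hp : ∀ᶠ z in 𝓝 x, L.proj (s z) = L.proj (s' z)) :
    AnalyticAt ℂ (fun z => (fibreRatio (s z) (s' z) : ℂ)) x := by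
  obtain ⟨κ, hκ, he⟩ := hs.exists_ratio hs' hp
  refine hκ.congr ?_
  filter_upwards [he] with z hz
  rw [fibreRatio_eq hz.symm]

/-- A local holomorphic section near a given point, defined on an open subset of the surface. -/
lemma exists_local_section (L : CStarBundle OM) (m : Xhat) :
    ∃ (U : Set Xhat) (s : Xhat → L.Total), IsOpen U ∧ m ∈ U ∧ (∀ m' ∈ U, L.proj (s m') = m') ∧
      ∀ (V : Type) [NormedAddCommGroup V] [NormedSpace ℂ V] (f : V → Xhat) (x : V), f x ∈ U →
        (OM).Hol f x → L.HolAt (fun z => s (f z)) x := by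
  set e := chartAt C2 m
  have he : e ∈ atlas C2 Xhat := chart_mem_atlas C2 m
  have hm : m ∈ e.source := mem_chart_source C2 m
  set c : OrbiChart Xhat := manifoldChart e
  have hc : c ∈ (OM).charts := ⟨e, he, rfl⟩
  obtain ⟨s, hs, hp⟩ := CStarBundle.exists_holAt (L := L)
    (ComplexOrbifold.hol_chart hc (x := e m) (e.map_source hm))
  obtain ⟨W, hW, hWo, hmW⟩ := eventually_nhds_iff.1 (hs.eventually.and hp)
  refine ⟨e.source ∩ e ⁻¹' W, fun m' => s (e m'), e.isOpen_inter_preimage hWo, ⟨hm, hmW⟩, ?_, ?_⟩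
  · rintro m' ⟨h1, h2⟩
    rw [(hW _ h2).2]
    exact e.left_inv h1
  · intro V _ _ f x hx hf
    obtain ⟨h, hl⟩ := hf.exists_lift (c := c)
      (fun c' hc' => (OM).compatible c hc c' hc')
      ⟨e (f x), e.map_source hx.1, e.left_inv hx.1⟩
    have h1 : ∀ᶠ z in 𝓝 x, e (f z) = h z := by
      filter_upwards [hl.eventually] with z hz
      rw [← hz.map_eq]
      exact e.right_inv hz.1
    have h2 : L.HolAt s (h x) := by rw [← h1.self_of_nhds]; exact (hW _ hx.2).1
    refine (h2.comp hl.2.1).congr ?_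
    filter_upwards [h1] with z hz
    rw [hz]

variable [T2Space Xhat] [SecondCountableTopology Xhat]

lemma exists_partition {ι : Type*} (U : ι → Set Xhat) (ho : ∀ i, IsOpen (U i))
    (hU : ∀ x, ∃ i, x ∈ U i) : ∃ f : SmoothPartitionOfUnity ι 𝓘(ℝ, C2) Xhat univ, f.IsSubordinate U := by
  have := isManifold_real (Xhat := Xhat)
  have : LocallyCompactSpace Xhat := ChartedSpace.locallyCompactSpace C2 Xhat
  exact SmoothPartitionOfUnity.exists_isSubordinate 𝓘(ℝ, C2) isClosed_univ U ho
    fun x _ => mem_iUnion.2 (hU x)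

lemma smooth_partition {ι : Type*} (f : SmoothPartitionOfUnity ι 𝓘(ℝ, C2) Xhat univ) (i : ι) :
    (OM).Smooth (f i) := smooth_of_contMDiff (f i).contMDiff

/-- Hermitian metrics exist: local holomorphic sections give local metrics, and a weighted geometric
mean of these, with the weights of a partition of unity, is a global one. -/
lemma nonempty_hermitianMetric (L : CStarBundle OM) : Nonempty L.HermitianMetric := by
  choose U s hUo hmU hps hhol using exists_local_section L
  obtain ⟨ρ, hρ⟩ := exists_partition U hUo fun x => ⟨x, hmU x⟩
  set ℓ : Xhat → L.Total → ℝ := fun i v => log ‖(fibreRatio (s i (L.proj v)) v : ℂ)‖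
  have hℓ : ∀ i v (t : ℂˣ), L.proj v ∈ U i → ℓ i (t • v) = log ‖(t : ℂ)‖ + ℓ i v := by
    intro i v t hv
    simp only [ℓ, CStarBundle.proj_smul]
    have h1 := fibreRatio_smul (m := s i (L.proj v)) (m' := v) (by rw [hps i _ hv])
    rw [fibreRatio_eq (t := t * fibreRatio (s i (L.proj v)) v) (by rw [mul_smul, h1]),
      Units.val_mul, norm_mul, Real.log_mul (norm_ne_zero_iff.2 t.ne_zero)
      (norm_ne_zero_iff.2 (Units.ne_zero _))]
  have hsum : ∀ x : Xhat, ∃ I : Finset Xhat, ∀ᶠ y in 𝓝 x, ∑ i ∈ I, ρ i y = 1 ∧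
      ∀ g : Xhat → ℝ, ∑ᶠ i, ρ i y * g i = ∑ i ∈ I, ρ i y * g i := by
    intro x
    obtain ⟨I, hI⟩ := ρ.toPartitionOfUnity.exists_finset_nhds x
    refine ⟨I, ?_⟩
    filter_upwards [hI] with y hy
    refine ⟨hy.1, fun g => finsum_eq_sum_of_support_subset _ ?_⟩
    intro i hi
    refine hy.2 fun h0 => hi ?_
    have h1 : ρ i y = 0 := h0
    simp only [h1, zero_mul]
  have hmem : ∀ i y, ρ i y ≠ 0 → y ∈ U i := fun i y h => hρ i (subset_tsupport _ h)
  refine ⟨⟨fun v => Real.exp (∑ᶠ i, ρ i (L.proj v) * ℓ i v), fun v => Real.exp_pos _, ?_, ?_⟩⟩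
  · intro t v
    obtain ⟨I, hI⟩ := hsum (L.proj v)
    have hI' := hI.self_of_nhds
    rw [CStarBundle.proj_smul, hI'.2, hI'.2]
    have : ∑ i ∈ I, ρ i (L.proj v) * ℓ i (t • v) =
        log ‖(t : ℂ)‖ + ∑ i ∈ I, ρ i (L.proj v) * ℓ i v := by
      rw [← one_mul (log _), ← hI'.1, Finset.sum_mul, ← Finset.sum_add_distrib]
      refine Finset.sum_congr rfl fun i _ => ?_
      by_cases h0 : ρ i (L.proj v) = 0
      · simp [h0]
      · rw [hℓ i v t (hmem i _ h0)]; ring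
    rw [this, Real.exp_add, Real.exp_log (norm_pos_iff.2 t.ne_zero)]
  · intro b hb x hx
    refine ContDiffAt.contDiffWithinAt ?_
    have hf : (OM).Hol b.base.map x := by
      obtain ⟨c, hc, hx'⟩ := (OM).cover (b.base.map x)
      obtain ⟨h, hl⟩ := (LiftAt.self hx).transfer (b.base_compatible c hc) hx'
      exact ⟨c, hc, h, hl⟩
    have hbh : L.HolAt (fun z => b.triv (z, 1)) x :=
      BundleChart.hol_of_lift hb (h := fun z => z) hx analyticAt_id
    obtain ⟨I, hI⟩ := hsum (b.base.map x)
    have hdom := b.base.isOpen_dom.mem_nhds hx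
    refine ContDiffAt.exp ?_
    have hev : (fun z => ∑ᶠ i, ρ i (L.proj (b.triv (z, 1))) * ℓ i (b.triv (z, 1))) =ᶠ[𝓝 x]
        fun z => ∑ i ∈ I, ρ i (b.base.map z) * ℓ i (b.triv (z, 1)) := by
      filter_upwards [hdom, hf.continuousAt.eventually hI] with z h1 h2
      rw [b.proj_triv z h1, h2.2]
    refine ContDiffAt.congr_of_eventuallyEq (ContDiffAt.sum fun i _ => ?_) hev
    by_cases hxU : b.base.map x ∈ tsupport (ρ i)
    · have hxU' := hρ i hxU
      refine ((smooth_partition ρ i).comp hf).mul ?_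
      have h1 : L.HolAt (fun z => s i (b.base.map z)) x := hhol i C2 _ _ hxU' hf
      have h2 : AnalyticAt ℂ (fun z => (fibreRatio (s i (b.base.map z)) (b.triv (z, 1)) : ℂ)) x := by
        refine analyticAt_fibreRatio h1 hbh ?_
        filter_upwards [hdom, hf.continuousAt.preimage_mem_nhds ((hUo i).mem_nhds hxU')]
          with z g1 g2
        rw [hps i _ g2, b.proj_triv z g1]
      have h3 := (contDiffAt_log_norm_sq h2 (Units.ne_zero _)).const_smul (1 / 2 : ℝ)
      refine h3.congr_of_eventuallyEq ?_
      filter_upwards [hdom] with z g1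
      simp only [ℓ, b.proj_triv z g1, Real.log_pow, smul_eq_mul]
      push_cast
      ring
    · have h0 : ∀ᶠ y in 𝓝 (b.base.map x), ρ i y = 0 := by
        filter_upwards [(isClosed_tsupport (ρ i)).isOpen_compl.mem_nhds hxU] with y hy
        exact image_eq_zero_of_notMem_tsupport hy
      refine (contDiffAt_const (c := (0 : ℝ))).congr_of_eventuallyEq ?_
      filter_upwards [hf.continuousAt.eventually h0] with z hz
      rw [hz, zero_mul]

end
/-! ### Cauchy integrals with a parameter -/

section

/-- Integration over an interval, as a continuous linear functional on continuous functions. -/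
def iccIntegral {a b : ℝ} (hab : a ≤ b) : C(Icc a b, ℂ) →L[ℂ] ℂ :=
  LinearMap.mkContinuous
    { toFun := fun g => ∫ x in a..b, IccExtend hab g x
      map_add' := fun g h => by
        rw [← intervalIntegral.integral_add (g.continuous.Icc_extend'.intervalIntegrable _ _)
          (h.continuous.Icc_extend'.intervalIntegrable _ _)]
        rfl
      map_smul' := fun c g => by
        simp only [RingHom.id_apply, ← intervalIntegral.integral_smul]
        rfl } |b - a| (by
    intro g
    rw [mul_comm]
    exact intervalIntegral.norm_integral_le_of_norm_le_const fun x _ => g.norm_coe_le_norm _)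

lemma iccIntegral_eq {a b : ℝ} (hab : a ≤ b) (g : C(Icc a b, ℂ)) {F : ℝ → ℂ}
    (h : ∀ x (hx : x ∈ Icc a b), g ⟨x, hx⟩ = F x) : iccIntegral hab g = ∫ x in a..b, F x := by
  change (∫ x in a..b, IccExtend hab g x) = _
  refine intervalIntegral.integral_congr fun x hx => ?_
  rw [uIcc_of_le hab] at hx
  rw [IccExtend_of_mem hab g hx, h]

/-- A family of functions on a compact space depending holomorphically on a complex parameter is a
holomorphic map to the Banach space of continuous functions, by Cauchy's integral formula. -/
lemma exists_analytic_continuousMap {K : Type} [TopologicalSpace K] [CompactSpace K]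
    {γ : K → ℂ} (hγ : Continuous γ) {f : ℂ × ℂ → ℂ} {δ : ℝ}
    (hf : ∀ x, ∀ u ∈ ball 0 δ, AnalyticAt ℂ f (γ x, u)) {u₀ : ℂ} (hu : u₀ ∈ ball 0 δ) :
    ∃ G : ℂ → C(K, ℂ), AnalyticAt ℂ G u₀ ∧ ∀ᶠ u in 𝓝 u₀, ∀ x, G u x = f (γ x, u) := by
  obtain ⟨R, hR, hRδ⟩ := exists_between (mem_ball_zero_iff.1 hu)
  have hR0 : 0 < R := (norm_nonneg _).trans_lt hR
  have hmem : ∀ z ∈ closedBall (0 : ℂ) R, z ∈ ball 0 δ := fun z hz =>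
    mem_ball_zero_iff.2 ((mem_closedBall_zero_iff.1 hz).trans_lt hRδ)
  have hcont : Continuous fun q : closedBall (0 : ℂ) R × K => f (γ q.2, q.1) := by
    refine continuous_iff_continuousAt.2 fun q => ?_
    exact ContinuousAt.comp (f := fun q : closedBall (0 : ℂ) R × K => (γ q.2, (q.1 : ℂ)))
      (hf q.2 _ (hmem _ q.1.2)).continuousAt (by fun_prop)
  let G' : C(closedBall (0 : ℂ) R, C(K, ℂ)) := ContinuousMap.curry ⟨_, hcont⟩
  classical
  let G₀ : ℂ → C(K, ℂ) := fun z => if h : z ∈ closedBall (0 : ℂ) R then G' ⟨z, h⟩ else 0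
  have hG₀ : ContinuousOn G₀ (closedBall (0 : ℂ) R) := by
    rw [continuousOn_iff_continuous_domRestrict]
    refine G'.continuous.congr fun z => ?_
    simp only [Set.domRestrict_apply, G₀, dif_pos z.2]
  have hG₀a : ∀ z ∈ closedBall (0 : ℂ) R, ∀ x, G₀ z x = f (γ x, z) := by
    intro z hz x
    simp only [G₀, dif_pos hz]
    rfl
  have hci : CircleIntegrable G₀ 0 R :=
    (hG₀.mono Metric.sphere_subset_closedBall).circleIntegrable hR0.le
  lift R to NNReal using hR0.le
  have hps := hasFPowerSeriesOn_cauchy_integral hci (by exact_mod_cast hR0)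
  refine ⟨_, hps.analyticAt_of_mem (y := u₀) (by
    rw [Metric.eball_coe, mem_ball_zero_iff]; exact hR), ?_⟩
  filter_upwards [isOpen_ball.mem_nhds (mem_ball_zero_iff.2 hR)] with u hu' x
  have hci' : CircleIntegrable (fun z => (z - u)⁻¹ • G₀ z) 0 R := by
    refine ContinuousOn.circleIntegrable hR0.le ?_
    suffices h : ContinuousOn (fun z => (z - u)⁻¹) (sphere 0 R) from
      h.smul (hG₀.mono Metric.sphere_subset_closedBall)
    refine ContinuousOn.inv₀ (by fun_prop) fun z hz h0 => ?_
    rw [sub_eq_zero] at h0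
    subst h0
    simp only [mem_sphere_iff_norm, sub_zero] at hz
    simp [hz] at hu'
  have hev : (∮ z in C(0, R), (z - u)⁻¹ • G₀ z) x = ∮ z in C(0, R), (z - u)⁻¹ • f (γ x, z) := by
    have h1 := (ContinuousMap.evalCLM ℂ x).intervalIntegral_comp_comm hci'.out
    simp only [circleIntegral]
    rw [show ∀ g : C(K, ℂ), g x = ContinuousMap.evalCLM ℂ x g from fun _ => rfl, ← h1]
    refine intervalIntegral.integral_congr fun θ _ => ?_
    have hm : circleMap 0 R θ ∈ closedBall (0 : ℂ) R :=
      Metric.sphere_subset_closedBall (circleMap_mem_sphere _ hR0.le _)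
    rw [← hG₀a _ hm x]
    rfl
  have hd : ∀ z ∈ closedBall (0 : ℂ) R, DifferentiableAt ℂ (fun z => f (γ x, z)) z := by
    intro z hz
    have h1 := (hf x z (hmem z hz)).differentiableAt
    exact h1.comp z (by fun_prop)
  have h2 := Complex.two_pi_I_inv_smul_circleIntegral_sub_inv_smul_of_differentiable_on_off_countable
    (f := fun z => f (γ x, z)) (s := ∅) countable_empty hu'
    (fun z hz => (hd z hz).continuousAt.continuousWithinAt)
    (fun z hz => hd z (Metric.ball_subset_closedBall hz.1))
  rw [← h2, ContinuousMap.smul_apply, hev]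

/-- An integral of Cauchy type depends holomorphically on the pole and on a further parameter. -/
lemma analyticAt_cauchy_integral {a b : ℝ} (hab : a ≤ b) {γ c α β : ℝ → ℂ} (hγ : Continuous γ)
    (hc : Continuous c) (hα : Continuous α) (hβ : Continuous β) {f : ℂ × ℂ → ℂ} {δ : ℝ}
    (hf : ∀ x ∈ Icc a b, ∀ u ∈ ball 0 δ, AnalyticAt ℂ f (γ x, u)) {p₀ : ℂ × ℂ}
    (hu : p₀.2 ∈ ball 0 δ) (ht : ∀ x ∈ Icc a b, α x + p₀.1 * β x ≠ 0) :
    AnalyticAt ℂ (fun p : ℂ × ℂ => ∫ x in a..b, c x * ((α x + p.1 * β x)⁻¹ * f (γ x, p.2))) p₀ := by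
  obtain ⟨G, hG, hGf⟩ := exists_analytic_continuousMap (K := Icc a b) (γ := fun x => γ x)
    (by fun_prop) (fun x u hu => hf x x.2 u hu) hu
  let A : C(Icc a b, ℂ) := ⟨fun x => α x, by fun_prop⟩
  let B : C(Icc a b, ℂ) := ⟨fun x => β x, by fun_prop⟩
  let C : C(Icc a b, ℂ) := ⟨fun x => c x, by fun_prop⟩
  have hunit : ∀ t : ℂ, (∀ x ∈ Icc a b, α x + t * β x ≠ 0) → IsUnit (A + t • B) := by
    intro t ht
    have hne : ∀ x : Icc a b, (A + t • B) x ≠ 0 := fun x => ht x x.2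
    refine IsUnit.of_mul_eq_one ⟨fun x => ((A + t • B) x)⁻¹, ((A + t • B).continuous).inv₀ hne⟩ ?_
    ext x
    exact mul_inv_cancel₀ (hne x)
  have hinv : ∀ t : ℂ, (∀ x ∈ Icc a b, α x + t * β x ≠ 0) → ∀ x (hx : x ∈ Icc a b),
      Ring.inverse (A + t • B) ⟨x, hx⟩ = (α x + t * β x)⁻¹ := by
    intro t ht x hx
    have h1 := Ring.mul_inverse_cancel _ (hunit t ht)
    have h2 := DFunLike.congr_fun h1 ⟨x, hx⟩
    exact eq_inv_of_mul_eq_one_right h2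
  have hK : AnalyticAt ℂ (fun p : ℂ × ℂ => Ring.inverse (A + p.1 • B)) p₀ := by
    obtain ⟨w, hw⟩ := hunit p₀.1 ht
    have h1 : AnalyticAt ℂ (fun p : ℂ × ℂ => A + p.1 • B) p₀ :=
      analyticAt_const.add (analyticAt_fst.smul analyticAt_const)
    have h2 : AnalyticAt ℂ (Ring.inverse (M₀ := C(Icc a b, ℂ))) (A + p₀.1 • B) := by
      rw [← hw]; exact analyticAt_inverse w
    exact h2.fun_comp_of_eq h1 rfl
  have hG' : AnalyticAt ℂ (fun p : ℂ × ℂ => G p.2) p₀ := hG.comp analyticAt_snd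
  have hmain : AnalyticAt ℂ (fun p : ℂ × ℂ =>
      iccIntegral hab (C * (Ring.inverse (A + p.1 • B) * G p.2))) p₀ :=
    ((iccIntegral hab).analyticAt _).comp (analyticAt_const.mul (hK.mul hG'))
  refine hmain.congr ?_
  have hev : ∀ᶠ p : ℂ × ℂ in 𝓝 p₀, ∀ x ∈ Icc a b, α x + p.1 * β x ≠ 0 := by
    have h1 : Continuous fun q : (ℂ × ℂ) × ℝ => α q.2 + q.1.1 * β q.2 := by fun_prop
    have := (isCompact_Icc (a := a) (b := b)).eventually_forall_of_forall_eventually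
      (x₀ := p₀) (P := fun p x => α x + p.1 * β x ≠ 0)
      (fun x hx => h1.continuousAt.eventually_ne (ht x hx))
    exact this
  filter_upwards [hev, continuousAt_snd.eventually hGf] with p h1 h2
  refine iccIntegral_eq hab _ fun x hx => ?_
  simp only [ContinuousMap.mul_apply]
  rw [hinv _ h1 x hx, h2]
  rfl

/-! ### Splitting holomorphic functions -/

lemma log_sub_log_mul_inv_I {z : ℂ} (hre : 0 < z.re) (him : 0 < z.im) :
    Complex.log z - Complex.log (z * I⁻¹) = Real.pi / 2 * I := by
  have hz : z ≠ 0 := by rintro rfl; simp at hre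
  have h2 : Complex.log (I * (z * I⁻¹)) = Complex.log I + Complex.log (z * I⁻¹) := by
    rw [Complex.log_mul_eq_add_log_iff I_ne_zero (mul_ne_zero hz (inv_ne_zero I_ne_zero))]
    have h3 : (z * I⁻¹).arg < 0 := Complex.arg_neg_iff.2 (by simp [hre])
    have h4 := Complex.neg_pi_lt_arg (z * I⁻¹)
    rw [Complex.arg_I]
    constructor <;> linarith [Real.pi_pos]
  rw [mul_left_comm, mul_inv_cancel₀ I_ne_zero, mul_one] at h2
  rw [h2, Complex.log_I]
  ring

lemma integral_inv_segment (a b : ℝ) {γ : ℝ → ℂ} {v : ℂ} (k : ℂ) (hγ : ∀ x, HasDerivAt γ v x)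
    (h : ∀ x, γ x * k ∈ Complex.slitPlane) :
    v * ∫ x in a..b, (γ x)⁻¹ = Complex.log (γ b * k) - Complex.log (γ a * k) := by
  have h0 x := mul_ne_zero_iff.1 (Complex.slitPlane_ne_zero (h x))
  have hc : Continuous γ := continuous_iff_continuousAt.2 fun x => (hγ x).continuousAt
  rw [← intervalIntegral.integral_const_mul]
  refine intervalIntegral.integral_eq_sub_of_hasDerivAt (f := fun x => Complex.log (γ x * k))
    (fun x _ => ?_) ((continuous_const.mul (hc.inv₀ fun x => (h0 x).1) :
      Continuous fun x => v * (γ x)⁻¹).intervalIntegrable _ _)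
  refine (((hγ x).mul_const k).clog_real (h x)).congr_deriv ?_
  rw [mul_div_mul_right _ _ (h0 x).2, div_eq_mul_inv]

/-- The integral of `f` along the boundary of the rectangle with opposite corners `z` and `w`. -/
def rectIntegral (f : ℂ → ℂ) (x₁ x₂ y₁ y₂ : ℝ) : ℂ :=
  (∫ x : ℝ in x₁..x₂, f (x + y₁ * I)) - (∫ x : ℝ in x₁..x₂, f (x + y₂ * I)) +
    I * (∫ y : ℝ in y₁..y₂, f (x₂ + y * I)) - I * ∫ y : ℝ in y₁..y₂, f (x₁ + y * I)

lemma rectIntegral_inv {x₁ x₂ y₁ y₂ : ℝ} {t : ℂ} (h1 : x₁ < t.re) (h2 : t.re < x₂) (h3 : y₁ < t.im)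
    (h4 : t.im < y₂) : rectIntegral (fun ζ => (ζ - t)⁻¹) x₁ x₂ y₁ y₂ = 2 * Real.pi * I := by
  have hh (y x : ℝ) : HasDerivAt (fun x : ℝ => (x : ℂ) + y * I - t) 1 x := by
    simpa using ((hasDerivAt_id x).ofReal_comp.add_const (y * I)).sub_const t
  have hv (x y : ℝ) : HasDerivAt (fun y : ℝ => (x : ℂ) + y * I - t) I y := by
    simpa using (((hasDerivAt_id y).ofReal_comp.mul_const I).const_add (x : ℂ)).sub_const t
  -- on each side, the factor rotates the side into the slit plane
  have hb := integral_inv_segment x₁ x₂ I (hh y₁) fun x => .inl (by simp; linarith)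
  have ht := integral_inv_segment x₁ x₂ I⁻¹ (hh y₂) fun x => .inl (by simp; linarith)
  have hr := integral_inv_segment y₁ y₂ 1 (hv x₂) fun x => .inl (by simp; linarith)
  have hl := integral_inv_segment y₁ y₂ (-1) (hv x₁) fun x => .inl (by simp; linarith)
  have q1 := log_sub_log_mul_inv_I (z := x₂ + y₂ * I - t) (by simp; linarith) (by simp; linarith)
  have q2 := log_sub_log_mul_inv_I (z := (x₁ + y₂ * I - t) * I⁻¹) (by simp; linarith)
    (by simp; linarith)
  have q3 := log_sub_log_mul_inv_I (z := (x₁ + y₁ * I - t) * -1) (by simp; linarith)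
    (by simp; linarith)
  have q4 := log_sub_log_mul_inv_I (z := (x₂ + y₁ * I - t) * I) (by simp; linarith)
    (by simp; linarith)
  rw [mul_assoc, show I⁻¹ * I⁻¹ = -1 by simp] at q2
  rw [mul_assoc, show -1 * I⁻¹ = I by simp] at q3
  rw [mul_inv_cancel_right₀ I_ne_zero] at q4
  simp only [mul_one] at hr
  rw [rectIntegral]
  linear_combination hb - ht + hr - hl + q1 + q2 + q3 + q4

end
section

/-- The contribution of a side to Cauchy's integral formula. -/
lemma integral_mul_dslope {f : ℂ → ℂ} {t : ℂ} {a b : ℝ} {γ c : ℝ → ℂ} (hγ : Continuous γ)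
    (hc : Continuous c) (h : ∀ x ∈ uIcc a b, γ x ≠ t ∧ DifferentiableAt ℂ f (γ x)) :
    ∫ x in a..b, c x * dslope f t (γ x) = (∫ x in a..b, c x * ((γ x - t)⁻¹ * f (γ x))) -
      (∫ x in a..b, c x * (γ x - t)⁻¹) * f t := by
  have hc1 : ContinuousOn (fun x => (γ x - t)⁻¹) (uIcc a b) :=
    ContinuousOn.inv₀ (by fun_prop) fun x hx => sub_ne_zero.2 (h x hx).1
  have hc2 : ContinuousOn (fun x => f (γ x)) (uIcc a b) := fun x hx =>
    (ContinuousAt.comp (f := γ) (h x hx).2.continuousAt hγ.continuousAt).continuousWithinAt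
  rw [← intervalIntegral.integral_mul_const, ← intervalIntegral.integral_sub
    (f := fun x => c x * ((γ x - t)⁻¹ * f (γ x))) (g := fun x => c x * (γ x - t)⁻¹ * f t)
    (hc.continuousOn.mul (hc1.mul hc2)).intervalIntegrable
    ((hc.continuousOn.mul hc1).mul continuousOn_const).intervalIntegrable]
  refine intervalIntegral.integral_congr fun x hx => ?_
  simp only [dslope_of_ne _ (h x hx).1, slope_def_field, div_eq_inv_mul]
  ring

lemma rectIntegral_dslope {f : ℂ → ℂ} {x₁ x₂ y₁ y₂ : ℝ} {t : ℂ} (h1 : x₁ < t.re) (h2 : t.re < x₂)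
    (h3 : y₁ < t.im) (h4 : t.im < y₂)
    (hf : ∀ z, x₁ ≤ z.re → z.re ≤ x₂ → y₁ ≤ z.im → z.im ≤ y₂ → DifferentiableAt ℂ f z) :
    rectIntegral (fun ζ => (ζ - t)⁻¹ * f ζ) x₁ x₂ y₁ y₂ = 2 * Real.pi * I * f t := by
  have hx : x₁ ≤ x₂ := (h1.trans h2).le
  have hy : y₁ ≤ y₂ := (h3.trans h4).le
  have hR : (uIcc x₁ x₂ ×ℂ uIcc y₁ y₂) ∈ 𝓝 t := by
    refine Filter.mem_of_superset (IsOpen.mem_nhds (IsOpen.reProdIm (isOpen_Ioo (a := x₁) (b := x₂))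
      (isOpen_Ioo (a := y₁) (b := y₂))) ?_) (Complex.reProdIm_subset_iff'.2 (Or.inl ⟨?_, ?_⟩))
    · exact ⟨⟨h1, h2⟩, h3, h4⟩
    · rw [uIcc_of_le hx]; exact Ioo_subset_Icc_self
    · rw [uIcc_of_le hy]; exact Ioo_subset_Icc_self
  have key := Complex.integral_boundary_rect_eq_zero_of_differentiable_on_off_countable
    (dslope f t) ⟨x₁, y₁⟩ ⟨x₂, y₂⟩ {t} (countable_singleton t)
    ((continuousOn_dslope hR).2 ⟨fun z hz => by
      rw [uIcc_of_le hx, uIcc_of_le hy] at hz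
      exact (hf z hz.1.1 hz.1.2 hz.2.1 hz.2.2).continuousAt.continuousWithinAt,
      hf t h1.le h2.le h3.le h4.le⟩)
    (fun z hz => by
      simp only [min_eq_left hx, max_eq_right hx, min_eq_left hy, max_eq_right hy] at hz
      exact (differentiableAt_dslope_of_ne hz.2).2
        (hf z hz.1.1.1.le hz.1.1.2.le hz.1.2.1.le hz.1.2.2.le))
  have hside : ∀ {a b : ℝ} {γ : ℝ → ℂ}, Continuous γ → (∀ x ∈ uIcc a b, γ x ≠ t ∧
      DifferentiableAt ℂ f (γ x)) → ∫ x in a..b, dslope f t (γ x) =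
      (∫ x in a..b, (γ x - t)⁻¹ * f (γ x)) - (∫ x in a..b, (γ x - t)⁻¹) * f t := fun hγ h => by
    simpa only [one_mul] using integral_mul_dslope hγ (continuous_const (y := 1)) h
  simp only [smul_eq_mul] at key
  rw [hside (γ := fun x => x + y₁ * I) (by fun_prop) ?_,
    hside (γ := fun x => x + y₂ * I) (by fun_prop) ?_,
    hside (γ := fun y => x₂ + y * I) (by fun_prop) ?_,
    hside (γ := fun y => x₁ + y * I) (by fun_prop) ?_] at key
  rotate_left
  iterate 4
    intro x hx'
    rw [uIcc_of_le (by assumption)] at hx'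
    refine ⟨by rintro rfl; simp at h1 h2 h3 h4, hf _ ?_ ?_ ?_ ?_⟩ <;> simp <;>
      linarith [hx'.1, hx'.2]
  have hinv := rectIntegral_inv h1 h2 h3 h4
  rw [rectIntegral] at hinv ⊢
  linear_combination key + f t * hinv

/-- A holomorphic function near the common side of two adjacent rectangles is the difference of
functions which are holomorphic near the two rectangles: the contributions of the sides to Cauchy's
integral formula, for a rectangle around the common side. -/
lemma exists_split_rect {b c d η δ : ℝ} (hη : 0 < η) (hcd : c ≤ d) {f : ℂ × ℂ → ℂ}
    (hf : ∀ t u : ℂ, b - η < t.re → t.re < b + η → c - η < t.im → t.im < d + η →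
      u ∈ ball 0 δ → AnalyticAt ℂ f (t, u)) : ∃ f₁ f₂ : ℂ × ℂ → ℂ,
      (∀ t u : ℂ, t.re < b + η / 2 → c - η / 2 < t.im → t.im < d + η / 2 →
        u ∈ ball 0 δ → AnalyticAt ℂ f₁ (t, u)) ∧
      (∀ t u : ℂ, b - η / 2 < t.re → c - η / 2 < t.im → t.im < d + η / 2 →
        u ∈ ball 0 δ → AnalyticAt ℂ f₂ (t, u)) ∧
      (∀ t u : ℂ, b - η / 2 < t.re → t.re < b + η / 2 → c - η / 2 < t.im → t.im < d + η / 2 →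
        u ∈ ball 0 δ → f (t, u) = f₁ (t, u) - f₂ (t, u)) := by
  have hside : ∀ {a₁ a₂ : ℝ} {γ : ℝ → ℂ}, a₁ ≤ a₂ → Continuous γ →
      (∀ x ∈ Icc a₁ a₂, b - η < (γ x).re ∧ (γ x).re < b + η ∧ c - η < (γ x).im ∧
        (γ x).im < d + η) → ∀ t u : ℂ, u ∈ ball 0 δ → (∀ x ∈ Icc a₁ a₂, γ x ≠ t) →
      AnalyticAt ℂ (fun p : ℂ × ℂ => ∫ x in a₁..a₂, (γ x - p.1)⁻¹ * f (γ x, p.2)) (t, u) := by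
    intro a₁ a₂ γ ha hγ h t u hu ht
    have := analyticAt_cauchy_integral (p₀ := (t, u)) ha hγ (c := fun _ => 1) continuous_const
      (α := γ) hγ (β := fun _ => -1) continuous_const (f := f) (δ := δ)
      (fun x hx v hv => hf _ _ (h x hx).1 (h x hx).2.1 (h x hx).2.2.1 (h x hx).2.2.2 hv) hu
      (fun x hx h0 => ht x hx (by linear_combination h0))
    simpa [← sub_eq_add_neg] using this
  refine ⟨fun p => (2 * Real.pi * I)⁻¹ *
    ((∫ x : ℝ in (b - η / 2)..(b + η / 2), ((x + (c - η / 2 : ℝ) * I) - p.1)⁻¹ *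
      f (x + (c - η / 2 : ℝ) * I, p.2)) -
    (∫ x : ℝ in (b - η / 2)..(b + η / 2), ((x + (d + η / 2 : ℝ) * I) - p.1)⁻¹ *
      f (x + (d + η / 2 : ℝ) * I, p.2)) +
    I * ∫ y : ℝ in (c - η / 2)..(d + η / 2), (((b + η / 2 : ℝ) + y * I) - p.1)⁻¹ *
      f ((b + η / 2 : ℝ) + y * I, p.2)),
    fun p => (2 * Real.pi * I)⁻¹ *
      (I * ∫ y : ℝ in (c - η / 2)..(d + η / 2),
        (((b - η / 2 : ℝ) + y * I) - p.1)⁻¹ * f ((b - η / 2 : ℝ) + y * I, p.2)),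
    ?_, ?_, ?_⟩
  · intro t u h1 h2 h3 hu
    refine analyticAt_const.mul (((hside (by linarith) (by fun_prop) ?_ t u hu ?_).sub
      (hside (by linarith) (by fun_prop) ?_ t u hu ?_)).add
      (analyticAt_const.mul (hside (by linarith) (by fun_prop) ?_ t u hu ?_)))
    all_goals intro x hx
    · simp; refine ⟨?_, ?_, ?_, ?_⟩ <;> linarith [hx.1, hx.2]
    · rintro rfl; simp at h2
    · simp; refine ⟨?_, ?_, ?_, ?_⟩ <;> linarith [hx.1, hx.2]
    · rintro rfl; simp at h3
    · simp; refine ⟨?_, ?_, ?_, ?_⟩ <;> linarith [hx.1, hx.2]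
    · rintro rfl; simp at h1
  · intro t u h1 h2 h3 hu
    refine analyticAt_const.mul (analyticAt_const.mul
      (hside (by linarith) (by fun_prop) ?_ t u hu ?_))
    all_goals intro x hx
    · simp; refine ⟨?_, ?_, ?_, ?_⟩ <;> linarith [hx.1, hx.2]
    · rintro rfl; simp at h1
  · intro t u h1 h2 h3 h4 hu
    have := rectIntegral_dslope (f := fun ζ => f (ζ, u)) h1 h2 h3 h4 (fun z g1 g2 g3 g4 =>
      DifferentiableAt.comp (f := fun ζ : ℂ => (ζ, u)) z (hf z u (by linarith) (by linarith) (by linarith) (by linarith)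
        hu).differentiableAt (by fun_prop))
    rw [rectIntegral] at this
    have hpi : (2 * Real.pi * I : ℂ) ≠ 0 := Complex.two_pi_I_ne_zero
    rw [← mul_sub, eq_inv_mul_iff_mul_eq₀ hpi, ← this]

lemma eventually_eq_of_exp_eq_one {V : Type*} [TopologicalSpace V] {d : V → ℂ} {z : V}
    (hd : ContinuousAt d z) (h : ∀ᶠ w in 𝓝 z, Complex.exp (d w) = 1) : ∀ᶠ w in 𝓝 z, d w = d z := by
  filter_upwards [hd.eventually (ball_mem_nhds _ (zero_lt_one' ℝ)), h] with w hw hwe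
  rw [dist_eq_norm] at hw
  have h3 : Complex.exp (d w - d z) = 1 := by rw [Complex.exp_sub, hwe, h.self_of_nhds, div_one]
  rw [Complex.exp_eq_one_iff] at h3
  obtain ⟨n, hn⟩ := h3
  rw [hn, norm_mul, Complex.norm_intCast] at hw
  have h4 : ‖(2 * Real.pi * I : ℂ)‖ = 2 * Real.pi := by simp [abs_of_pos Real.pi_pos]
  rw [h4] at hw
  have h5 : n = 0 := by
    by_contra hne
    have : (1 : ℝ) ≤ |(n : ℝ)| := by exact_mod_cast Int.one_le_abs hne
    nlinarith [Real.pi_gt_three]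
  rw [h5] at hn
  linear_combination hn

/-- A nonvanishing holomorphic function on a convex open set is an exponential. -/
lemma exists_holomorphic_exp {U : Set (ℂ × ℂ)} (hU : IsOpen U) (hc : Convex ℝ U)
    (hn : U.Nonempty) {κ : ℂ × ℂ → ℂ} (hκ : AnalyticOnNhd ℂ κ U) (h0 : ∀ z ∈ U, κ z ≠ 0) :
    ∃ g : ℂ × ℂ → ℂ, AnalyticOnNhd ℂ g U ∧ ∀ z ∈ U, κ z = Complex.exp (g z) := by
  have hs : IsSimplyConnected U := by
    have := hc.contractibleSpace hn
    exact (inferInstance : SimplyConnectedSpace U)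
  obtain ⟨g, hg, hge⟩ := Complex.exists_continuousOn_eqOn_exp_comp hs hU hκ.continuousOn
    (by rintro ⟨z, hz, h⟩; exact h0 z hz h)
  refine ⟨g, fun z hz => ?_, fun z hz => (hge hz).symm⟩
  obtain ⟨l, hl, hle⟩ := (hκ z hz).exists_eventually_exp (h0 z hz)
  have hgc : ContinuousAt g z := hg.continuousAt (hU.mem_nhds hz)
  have hconst := eventually_eq_of_exp_eq_one (d := fun w => g w - l w) (hgc.sub hl.continuousAt) (by
    filter_upwards [hle, hU.mem_nhds hz] with w hwe hwU
    rw [Complex.exp_sub, ← hwe, div_eq_one_iff_eq (h0 w hwU)]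
    exact hge hwU)
  exact (hl.add (analyticAt_const (v := g z - l z))).congr
    (hconst.mono fun w hw => by simp only [Pi.add_apply]; linear_combination -hw)

/-- The product of the annulus `1 / 2 < ‖t‖ < 2` and a disk. -/
def annulus (δ : ℝ) : Set (ℂ × ℂ) := {z | (1 / 2 < ‖z.1‖ ∧ ‖z.1‖ < 2) ∧ z.2 ∈ ball 0 δ}

lemma isOpen_annulus (δ : ℝ) : IsOpen (annulus δ) :=
  ((isOpen_Ioo (a := (1 / 2 : ℝ)) (b := 2)).preimage
    (show Continuous fun z : ℂ × ℂ => ‖z.1‖ by fun_prop)).inter (isOpen_ball.preimage continuous_snd)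

lemma fst_ne_zero_of_mem_annulus {δ : ℝ} {z : ℂ × ℂ} (hz : z ∈ annulus δ) : z.1 ≠ 0 :=
  norm_pos_iff.1 (by linarith [hz.1.1])

/-- A nonvanishing holomorphic function on the product of an annulus and a disk is, up to an
exponential, a power of the coordinate on the annulus. -/
lemma exists_zpow_mul_exp {δ : ℝ} (hδ : 0 < δ) {κ : ℂ × ℂ → ℂ}
    (hκ : AnalyticOnNhd ℂ κ (annulus δ)) (h0 : ∀ z ∈ annulus δ, κ z ≠ 0) :
    ∃ (m : ℤ) (f : ℂ × ℂ → ℂ), AnalyticOnNhd ℂ f (annulus δ) ∧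
      ∀ z ∈ annulus δ, κ z = z.1 ^ m * Complex.exp (f z) := by
  let E : ℂ × ℂ → ℂ × ℂ := fun z => (Complex.exp z.1, z.2)
  let U : Set (ℂ × ℂ) := E ⁻¹' annulus δ
  have hE : ∀ z, AnalyticAt ℂ E z := fun z =>
    (AnalyticAt.comp (f := Prod.fst) analyticAt_cexp analyticAt_fst).prod analyticAt_snd
  have hU : IsOpen U := (isOpen_annulus δ).preimage (by fun_prop)
  have hUc : Convex ℝ U := by
    have : U = (Complex.reLm ∘ₗ LinearMap.fst ℝ ℂ ℂ) ⁻¹' Ioo (-log 2) (log 2) ∩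
        LinearMap.snd ℝ ℂ ℂ ⁻¹' ball 0 δ := by
      ext z
      have h1 : (1 / 2 : ℝ) = Real.exp (-log 2) := by
        rw [Real.exp_neg, Real.exp_log two_pos]; norm_num
      change (1 / 2 < ‖Complex.exp z.1‖ ∧ ‖Complex.exp z.1‖ < 2) ∧ _ ↔ _
      rw [Complex.norm_exp, h1, Real.exp_lt_exp, ← Real.lt_log_iff_exp_lt two_pos]
      rfl
    rw [this]
    exact ((convex_Ioo _ _).linear_preimage _).inter ((convex_ball _ _).linear_preimage _)
  have hUn : ((0 : ℂ), (0 : ℂ)) ∈ U := ⟨by norm_num [E], mem_ball_self hδ⟩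
  obtain ⟨g, hg, hge⟩ := exists_holomorphic_exp (κ := κ ∘ E) hU hUc ⟨_, hUn⟩
    (fun z hz => (hκ _ hz).comp (hE z)) fun z hz => h0 _ hz
  have hEp : ∀ s u, E (s + 2 * Real.pi * I, u) = E (s, u) := fun s u => by
    simp only [E, Complex.exp_periodic s]
  have hshift : ∀ z, ((z.1 + 2 * Real.pi * I, z.2) : ℂ × ℂ) ∈ U ↔ z ∈ U := fun z => by
    simp only [U, mem_preimage, hEp]
  let d : ℂ × ℂ → ℂ := fun z => g (z.1 + 2 * Real.pi * I, z.2) - g z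
  have hd : AnalyticOnNhd ℂ d U := fun z hz => AnalyticAt.sub ((hg _ ((hshift z).2 hz)).comp₂
    (h := g) (analyticAt_fst.add analyticAt_const) analyticAt_snd) (hg z hz)
  have hd1 : ∀ z ∈ U, Complex.exp (d z) = 1 := by
    intro z hz
    rw [Complex.exp_sub, ← hge z hz, ← hge _ ((hshift z).2 hz), Function.comp_apply, hEp]
    exact div_self (h0 _ hz)
  have hdc : EqOn d (fun _ => d (0, 0)) U :=
    hd.eqOn_of_preconnected_of_eventuallyEq analyticOnNhd_const hUc.isPreconnected hUn
      (eventually_eq_of_exp_eq_one (hd _ hUn).continuousAt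
        (Filter.eventually_of_mem (hU.mem_nhds hUn) hd1))
  obtain ⟨m, hm⟩ := Complex.exp_eq_one_iff.1 (hd1 _ hUn)
  classical
  have hper : ∀ u, Function.Periodic (fun s : ℂ => if (s, u) ∈ U then g (s, u) - m * s else 0)
      (2 * Real.pi * I) := by
    intro u s
    simp only [hshift (s, u)]
    split_ifs with h
    · have h1 : d (s, u) = _ := hdc h
      rw [hm] at h1
      simp only [d] at h1
      linear_combination h1
    · rfl
  have hloc : ∀ s s' u : ℂ, (s, u) ∈ U → Complex.exp s = Complex.exp s' →
      g (s, u) - m * s = g (s', u) - m * s' := by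
    intro s s' u hs h
    obtain ⟨n, hn⟩ := Complex.exp_eq_exp_iff_exists_int.1 h
    have h1 := (hper u).int_mul n s'
    have hs' : (s', u) ∈ U := by simpa only [U, E, mem_preimage, h] using hs
    simpa only [← hn, if_pos hs, if_pos hs'] using h1
  refine ⟨m, fun z => g (Complex.log z.1, z.2) - m * Complex.log z.1, ?_, ?_⟩ <;>
    rintro ⟨t, u⟩ hz <;> have ht0 : t ≠ 0 := fst_ne_zero_of_mem_annulus hz
  · obtain ⟨l, hl, hle⟩ := (analyticAt_id (𝕜 := ℂ) (z := t)).exists_eventually_exp ht0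
    have hl0 : (l t, u) ∈ U := by
      simpa only [U, E, mem_preimage, ← show t = _ from hle.self_of_nhds] using hz
    have hl1 : AnalyticAt ℂ (fun z : ℂ × ℂ => l z.1) (t, u) :=
      AnalyticAt.comp (g := l) (f := Prod.fst) hl analyticAt_fst
    have hA : AnalyticAt ℂ (fun z : ℂ × ℂ => g (l z.1, z.2) - m * l z.1) (t, u) :=
      ((hg _ hl0).comp₂ (h := g) hl1 analyticAt_snd).sub (analyticAt_const.mul hl1)
    refine hA.congr ?_
    have h3 : ContinuousAt (fun z : ℂ × ℂ => (l z.1, z.2)) (t, u) :=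
      hl1.continuousAt.prodMk continuousAt_snd
    filter_upwards [h3.preimage_mem_nhds (hU.mem_nhds hl0),
      continuousAt_fst.eventually hle, continuousAt_fst.eventually_ne ht0] with z hz hze hz0
    refine hloc _ _ _ hz ?_
    rw [Complex.exp_log hz0, ← hze]
    rfl
  · have h4 := hge (Complex.log t, u) (by rwa [mem_preimage, show E _ = (t, u) by
      simp only [E, Complex.exp_log ht0]])
    simp only [Function.comp_apply, E, Complex.exp_log ht0] at h4
    rw [h4, Complex.exp_sub, Complex.exp_int_mul, Complex.exp_log ht0,
      mul_div_cancel₀ _ (zpow_ne_zero _ ht0)]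

/-- Laurent decomposition with a holomorphic parameter. -/
lemma exists_split_annulus {δ : ℝ} {f : ℂ × ℂ → ℂ} (hf : AnalyticOnNhd ℂ f (annulus δ)) :
    ∃ f₁ f₂ : ℂ × ℂ → ℂ, (∀ t u : ℂ, ‖t‖ < 3 / 2 → u ∈ ball 0 δ → AnalyticAt ℂ f₁ (t, u)) ∧
      (∀ t u : ℂ, ‖t‖ < 3 / 2 → u ∈ ball 0 δ → AnalyticAt ℂ f₂ (t, u)) ∧
      ∀ t u : ℂ, 2 / 3 < ‖t‖ → ‖t‖ < 3 / 2 → u ∈ ball 0 δ → f (t, u) = f₁ (t, u) - f₂ (t⁻¹, u) := by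
  have hcd : ∀ R, Continuous (deriv (circleMap 0 R)) := fun R => by
    rw [show deriv (circleMap 0 R) = fun x => circleMap 0 R x * I from
      funext fun x => deriv_circleMap 0 R x]
    exact (continuous_circleMap 0 R).mul continuous_const
  have hcn : ∀ {R : ℝ}, 0 < R → ∀ x, ‖circleMap 0 R x‖ = R := fun hR x => by
    rw [norm_circleMap_zero, abs_of_pos hR]
  have hcirc : ∀ {R : ℝ} {α β : ℝ → ℂ}, 1 / 2 < R → R < 2 → Continuous α → Continuous β →
      ∀ t u : ℂ, u ∈ ball 0 δ → (∀ x, α x + t * β x ≠ 0) →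
      AnalyticAt ℂ (fun p : ℂ × ℂ => ∫ x in (0 : ℝ)..(2 * Real.pi), deriv (circleMap 0 R) x *
        ((α x + p.1 * β x)⁻¹ * f (circleMap 0 R x, p.2))) (t, u) := by
    intro R α β hR1 hR2 hα hβ t u hu ht
    refine analyticAt_cauchy_integral (p₀ := (t, u)) Real.two_pi_pos.le (continuous_circleMap 0 R)
      (hcd R) hα hβ (δ := δ) (fun x hx v hv => hf _ ⟨?_, hv⟩) hu (fun x hx => ht x)
    rw [hcn (by linarith)]
    exact ⟨hR1, hR2⟩
  refine ⟨fun p => (2 * Real.pi * I)⁻¹ * ∫ x in (0 : ℝ)..(2 * Real.pi),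
      deriv (circleMap 0 (3 / 2)) x * ((circleMap 0 (3 / 2) x + p.1 * (-1))⁻¹ *
        f (circleMap 0 (3 / 2) x, p.2)),
    fun p => (2 * Real.pi * I)⁻¹ * (p.1 * ∫ x in (0 : ℝ)..(2 * Real.pi),
      deriv (circleMap 0 (2 / 3)) x * ((-1 + p.1 * circleMap 0 (2 / 3) x)⁻¹ *
        f (circleMap 0 (2 / 3) x, p.2))), ?_, ?_, ?_⟩
  · intro t u ht hu
    refine analyticAt_const.mul (hcirc (by norm_num) (by norm_num) (continuous_circleMap _ _)
      continuous_const t u hu fun x h0 => ?_)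
    have : circleMap 0 (3 / 2) x = t := by linear_combination h0
    rw [← this, hcn (by norm_num)] at ht
    exact ht.ne rfl
  · intro t u ht hu
    refine analyticAt_const.mul (analyticAt_fst.mul (hcirc (by norm_num) (by norm_num)
      continuous_const (continuous_circleMap _ _) t u hu fun x h0 => ?_))
    have h1 : t * circleMap 0 (2 / 3) x = 1 := by linear_combination h0
    have h2 := congrArg norm h1
    rw [norm_mul, hcn (by norm_num), norm_one] at h2
    linarith
  · intro t u h1 h2 hu
    have ht0 : t ≠ 0 := by rintro rfl; norm_num at h1
    have hda : ∀ z : ℂ, 1 / 2 < ‖z‖ → ‖z‖ < 2 → DifferentiableAt ℂ (fun ζ => f (ζ, u)) z :=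
      fun z g1 g2 => DifferentiableAt.comp (f := fun ζ : ℂ => (ζ, u)) z
        (hf (z, u) ⟨⟨g1, g2⟩, hu⟩).differentiableAt (by fun_prop)
    have key := Complex.circleIntegral_eq_of_differentiable_on_annulus_off_countable (c := 0)
      (r := 2 / 3) (R := 3 / 2) (by norm_num) (by norm_num) (f := dslope (fun ζ => f (ζ, u)) t)
      (countable_singleton t) ((continuousOn_dslope (by
        refine Filter.mem_of_superset ((isOpen_ball.sdiff Metric.isClosed_closedBall).mem_nhds
          (x := t) (s := ball 0 (3 / 2) \ closedBall 0 (2 / 3)) ?_) ?_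
        · simpa using ⟨h2, h1⟩
        · exact sdiff_subset_sdiff Metric.ball_subset_closedBall Metric.ball_subset_closedBall)).2
        ⟨fun z hz => (hda z ?_ ?_).continuousAt.continuousWithinAt,
          hda t (by linarith) (by linarith)⟩)
      (fun z hz => (differentiableAt_dslope_of_ne hz.2).2 (hda z ?_ ?_))
    rotate_left
    · have := hz.2; simp at this; linarith
    · have := hz.1; simp at this; linarith
    · have := hz.1.2; simp at this; linarith
    · have := hz.1.1; simp at this; linarith
    have hside : ∀ {R : ℝ}, 1 / 2 < R → R < 2 → R ≠ ‖t‖ → _ := fun {R} hR1 hR2 hRt =>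
      integral_mul_dslope (f := fun ζ => f (ζ, u)) (t := t) (a := 0) (b := 2 * Real.pi)
        (continuous_circleMap 0 R) (hcd R) fun x _ => by
          have hn := hcn (show 0 < R by linarith) x
          exact ⟨fun h => hRt (by rw [← hn, h]), hda _ (by rwa [hn]) (by rwa [hn])⟩
    have hone := circleIntegral.integral_sub_inv_of_mem_ball (c := 0) (R := 3 / 2) (w := t)
      (by simpa using h2)
    have hzero : (∮ z in C(0, 2 / 3), (z - t)⁻¹) = 0 := by
      refine DiffContOnCl.circleIntegral_eq_zero (by norm_num) (DifferentiableOn.diffContOnCl ?_)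
      rw [closure_ball _ (by norm_num)]
      refine DifferentiableOn.inv (by fun_prop) fun z hz h0 => ?_
      rw [sub_eq_zero] at h0; subst h0; simp at hz; linarith
    simp only [circleIntegral, smul_eq_mul] at key hone hzero
    rw [hside (by norm_num) (by norm_num) h2.ne', hside (by norm_num) (by norm_num) h1.ne, hone,
      hzero, zero_mul, sub_zero] at key
    rw [← mul_sub, eq_inv_mul_iff_mul_eq₀ Complex.two_pi_I_ne_zero, eq_comm,
      ← intervalIntegral.integral_const_mul]
    have e2 : (∫ x in (0 : ℝ)..(2 * Real.pi), t⁻¹ * (deriv (circleMap 0 (2 / 3)) x *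
        ((-1 + t⁻¹ * circleMap 0 (2 / 3) x)⁻¹ * f (circleMap 0 (2 / 3) x, u)))) =
        ∫ x in (0 : ℝ)..(2 * Real.pi), deriv (circleMap 0 (2 / 3)) x *
          ((circleMap 0 (2 / 3) x - t)⁻¹ * f (circleMap 0 (2 / 3) x, u)) := by
      refine intervalIntegral.integral_congr fun x _ => ?_
      have : circleMap 0 (2 / 3) x - t = t * (-1 + t⁻¹ * circleMap 0 (2 / 3) x) := by
        field_simp; ring
      simp only [this, mul_inv]
      ring
    simp only [e2, mul_neg_one, ← sub_eq_add_neg]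
    linear_combination key

end
/-! ### Triviality over polydiscs -/

/-- The exponential as a map to the multiplicative group. -/
def expUnit (z : ℂ) : ℂˣ := Units.mk0 (Complex.exp z) (Complex.exp_ne_zero z)

lemma analyticAt_expUnit {f : V → ℂ}
    (h : AnalyticAt ℂ f x) : AnalyticAt ℂ (fun z => (expUnit (f z) : ℂ)) x :=
  h.cexp

/-- The bundle `ψ^* L` is trivial near the product of the rectangle `[a, b] × [c, d]` and `0`. -/
def TrivOn (L : CStarBundle OM) (ψ : ℂ × ℂ → Xhat) (a b c d : ℝ) : Prop :=
  ∃ η > 0, ∃ s : ℂ × ℂ → L.Total, ∀ t u : ℂ, a - η < t.re → t.re < b + η → c - η < t.im →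
    t.im < d + η → u ∈ ball 0 η → L.HolAt s (t, u) ∧ L.proj (s (t, u)) = ψ (t, u)

section
variable {L : CStarBundle (ComplexOrbifold.ofManifold Xhat)} {ψ : ℂ × ℂ → Xhat} {a b c d e : ℝ}

/-- Trivializations over adjacent rectangles can be modified so that they agree: their ratio is an
exponential, and its logarithm splits. -/
lemma TrivOn.glue (hcd : c ≤ d) (hab : a ≤ b) (hbe : b ≤ e) (h₁ : TrivOn L ψ a b c d)
    (h₂ : TrivOn L ψ b e c d) : TrivOn L ψ a e c d := by
  obtain ⟨η₁, hη₁, s₁, h₁⟩ := h₁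
  obtain ⟨η₂, hη₂, s₂, h₂⟩ := h₂
  obtain ⟨η, hη, hle₁, hle₂⟩ : ∃ η > 0, η ≤ η₁ ∧ η ≤ η₂ :=
    ⟨min η₁ η₂, lt_min hη₁ hη₂, min_le_left _ _, min_le_right _ _⟩
  have h₁' : ∀ t u : ℂ, a - η < t.re → t.re < b + η → c - η < t.im → t.im < d + η →
      u ∈ ball 0 η → L.HolAt s₁ (t, u) ∧ L.proj (s₁ (t, u)) = ψ (t, u) :=
    fun t u g1 g2 g3 g4 g5 => h₁ t u (by linarith) (by linarith) (by linarith) (by linarith)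
      (ball_subset_ball hle₁ g5)
  have h₂' : ∀ t u : ℂ, b - η < t.re → t.re < e + η → c - η < t.im → t.im < d + η →
      u ∈ ball 0 η → L.HolAt s₂ (t, u) ∧ L.proj (s₂ (t, u)) = ψ (t, u) :=
    fun t u g1 g2 g3 g4 g5 => h₂ t u (by linarith) (by linarith) (by linarith) (by linarith)
      (ball_subset_ball hle₂ g5)
  have er : Continuous fun z : ℂ × ℂ => z.1.re := by fun_prop
  have ei : Continuous fun z : ℂ × ℂ => z.1.im := by fun_prop
  let U : Set (ℂ × ℂ) := {z | (b - η < z.1.re ∧ z.1.re < b + η) ∧ c - η < z.1.im ∧ z.1.im < d + η} ∩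
    {z | z.2 ∈ ball 0 η}
  have hUo : IsOpen U := ((isOpen_Ioo.preimage er).inter (isOpen_Ioo.preimage ei)).inter
    (isOpen_ball.preimage continuous_snd)
  have hUc : Convex ℝ U := by
    refine Convex.inter (Convex.inter ?_ ?_)
      ((convex_ball (0 : ℂ) η).linear_preimage (LinearMap.snd ℝ ℂ ℂ))
    · exact (convex_Ioo (b - η) (b + η)).linear_preimage (Complex.reLm ∘ₗ LinearMap.fst ℝ ℂ ℂ)
    · exact (convex_Ioo (c - η) (d + η)).linear_preimage (Complex.imLm ∘ₗ LinearMap.fst ℝ ℂ ℂ)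
  have hproj : ∀ z ∈ U, L.proj (s₁ z) = L.proj (s₂ z) := by
    rintro ⟨t, u⟩ ⟨⟨⟨g1, g2⟩, g3, g4⟩, g5⟩
    dsimp only at g1 g2 g3 g4 g5
    rw [(h₁' t u (by linarith) g2 g3 g4 g5).2, (h₂' t u g1 (by linarith) g3 g4 g5).2]
  obtain ⟨g, hg, hge⟩ := exists_holomorphic_exp
    (κ := fun z => (fibreRatio (s₁ z) (s₂ z) : ℂ)) hUo hUc
    ⟨(⟨b, c⟩, 0), ⟨⟨⟨by simpa using hη, by simpa using hη⟩, by simpa using hη, by simpa using by linarith⟩,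
      by simpa using hη⟩⟩ (by
      rintro ⟨t, u⟩ hz
      obtain ⟨⟨⟨g1, g2⟩, g3, g4⟩, g5⟩ := id hz
      dsimp only at g1 g2 g3 g4 g5
      exact analyticAt_fibreRatio (h₁' t u (by linarith) g2 g3 g4 g5).1
        (h₂' t u g1 (by linarith) g3 g4 g5).1 (Filter.eventually_of_mem (hUo.mem_nhds hz) hproj))
    (fun z _ => Units.ne_zero _)
  obtain ⟨f₁, f₂, hf₁, hf₂, hf⟩ := exists_split_rect (b := b) (c := c) (d := d) (δ := η) hη hcd
    (f := g) (fun t u g1 g2 g3 g4 g5 => hg _ ⟨⟨⟨g1, g2⟩, g3, g4⟩, g5⟩)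
  have hov : ∀ t u : ℂ, b - η / 2 < t.re → t.re < b + η / 2 → c - η / 2 < t.im →
      t.im < d + η / 2 → u ∈ ball 0 η →
      expUnit (f₂ (t, u)) • s₂ (t, u) = expUnit (f₁ (t, u)) • s₁ (t, u) := by
    intro t u g1 g2 g3 g4 g5
    have hz : (t, u) ∈ U := ⟨⟨⟨by dsimp only; linarith, by dsimp only; linarith⟩,
      by dsimp only; linarith, by dsimp only; linarith⟩, g5⟩
    rw [← fibreRatio_smul (hproj _ hz), smul_smul]
    congr 1
    ext
    simp only [Units.val_mul, hge _ hz, expUnit, Units.val_mk0]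
    rw [← Complex.exp_add, hf t u g1 g2 g3 g4 g5]
    congr 1; ring
  classical
  refine ⟨η / 2, by linarith, fun z => if z.1.re < b then expUnit (f₁ z) • s₁ z else
    expUnit (f₂ z) • s₂ z, fun t u g1 g2 g3 g4 g5 => ?_⟩
  have g5' : u ∈ ball 0 η := ball_subset_ball (by linarith) g5
  by_cases hlt : t.re < b + η / 2
  · have hev : (fun z => expUnit (f₁ z) • s₁ z) =ᶠ[𝓝 (t, u)] fun z => if z.1.re < b then
        expUnit (f₁ z) • s₁ z else expUnit (f₂ z) • s₂ z := by
      filter_upwards [er.continuousAt.preimage_mem_nhds (isOpen_Iio.mem_nhds hlt),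
        ei.continuousAt.preimage_mem_nhds (isOpen_Ioo.mem_nhds ⟨g3, g4⟩),
        continuousAt_snd.preimage_mem_nhds (isOpen_ball.mem_nhds g5')] with z q1 q2 q3
      split_ifs with hzb
      · rfl
      · exact (hov z.1 z.2 (by linarith) q1 q2.1 q2.2 q3).symm
    have hb := h₁' t u (by linarith) (by linarith) (by linarith) (by linarith) g5'
    refine ⟨(hb.1.smul (analyticAt_expUnit (hf₁ t u hlt g3 g4 g5'))).congr hev, ?_⟩
    rw [← hev.self_of_nhds, L.proj_smul, hb.2]
  · rw [not_lt] at hlt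
    have hev : (fun z => expUnit (f₂ z) • s₂ z) =ᶠ[𝓝 (t, u)] fun z => if z.1.re < b then
        expUnit (f₁ z) • s₁ z else expUnit (f₂ z) • s₂ z := by
      have hlt' : b < t.re := by linarith
      filter_upwards [er.continuousAt.preimage_mem_nhds (isOpen_Ioi.mem_nhds hlt')] with z q1
      rw [if_neg (not_lt.2 (le_of_lt q1))]
    have hb := h₂' t u (by linarith) (by linarith) (by linarith) (by linarith) g5'
    refine ⟨(hb.1.smul (analyticAt_expUnit (hf₂ t u (by linarith) g3 g4 g5'))).congr hev, ?_⟩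
    rw [← hev.self_of_nhds, L.proj_smul, hb.2]

lemma TrivOn.rot_iff : TrivOn L (fun z => ψ (I * z.1, z.2)) c d (-b) (-a) ↔ TrivOn L ψ a b c d := by
  constructor
  · rintro ⟨η, hη, s, h⟩
    refine ⟨η, hη, fun z => s (-I * z.1, z.2), fun t u g1 g2 g3 g4 g5 => ?_⟩
    obtain ⟨q1, q2⟩ := h (-I * t) u (by simpa using g3) (by simpa using g4)
      (by simp; linarith) (by simp; linarith) g5
    refine ⟨q1.comp (g := fun z : ℂ × ℂ => (-I * z.1, z.2))
      ((analyticAt_const.mul analyticAt_fst).prod analyticAt_snd), ?_⟩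
    rw [q2]
    simp [← mul_assoc]
  · rintro ⟨η, hη, s, h⟩
    refine ⟨η, hη, fun z => s (I * z.1, z.2), fun t u g1 g2 g3 g4 g5 => ?_⟩
    obtain ⟨q1, q2⟩ := h (I * t) u (by simp; linarith) (by simp; linarith)
      (by simpa using g1) (by simpa using g2) g5
    exact ⟨q1.comp (g := fun z : ℂ × ℂ => (I * z.1, z.2))
      ((analyticAt_const.mul analyticAt_fst).prod analyticAt_snd), q2⟩

lemma TrivOn.glue_vertical (hab : a ≤ b) (hcd : c ≤ d) (hde : d ≤ e) (h₁ : TrivOn L ψ a b c d)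
    (h₂ : TrivOn L ψ a b d e) : TrivOn L ψ a b c e :=
  .rot_iff.1 (.glue (neg_le_neg hab) hcd hde (.rot_iff.2 h₁) (.rot_iff.2 h₂))

lemma exists_trivOn_near {t : ℂ} (h : (OM).Hol ψ (t, 0)) :
    ∃ r > 0, ∀ a b c d, t.re - r < a → b < t.re + r → t.im - r < c → d < t.im + r →
      TrivOn L ψ a b c d := by
  obtain ⟨s, hs, hp⟩ := L.exists_holAt h
  obtain ⟨r, hr, hb⟩ := Metric.eventually_nhds_iff_ball.1 (hs.eventually.and hp)
  refine ⟨r / 4, by linarith, fun a b c d g1 g2 g3 g4 => ⟨r / 4, by linarith, s,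
    fun t' u q1 q2 q3 q4 q5 => hb (t', u) ?_⟩⟩
  rw [Metric.mem_ball, Prod.dist_eq, max_lt_iff]
  constructor
  · rw [dist_eq_norm]
    refine (Complex.norm_le_abs_re_add_abs_im _).trans_lt ?_
    have e1 : |(t' - t).re| < r / 2 := by rw [Complex.sub_re, abs_lt]; constructor <;> linarith
    have e2 : |(t' - t).im| < r / 2 := by rw [Complex.sub_im, abs_lt]; constructor <;> linarith
    linarith
  · exact (Metric.mem_ball.1 q5).trans (by linarith)

/-- Bundles are trivial near a square: subdivide it into small squares and glue. -/
lemma trivOn_square {R : ℝ} (hR : 0 < R)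
    (h : ∀ t : ℂ, |t.re| ≤ R → |t.im| ≤ R → (OM).Hol ψ (t, 0)) : TrivOn L ψ (-R) R (-R) R := by
  let K : Set ℂ := Icc (-R) R ×ℂ Icc (-R) R
  have hK : IsCompact K := isCompact_Icc.reProdIm isCompact_Icc
  choose r hr hloc using fun t : K => exists_trivOn_near (L := L) (ψ := ψ) (t := t)
    (h t (abs_le.2 t.2.1) (abs_le.2 t.2.2))
  obtain ⟨ε, hε, hleb⟩ := lebesgue_number_lemma_of_metric (c := fun t : K => ball (t : ℂ) (r t))
    hK (fun _ => isOpen_ball) (fun t ht => mem_iUnion.2 ⟨⟨t, ht⟩, mem_ball_self (hr _)⟩)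
  obtain ⟨N, hN⟩ := exists_nat_gt (4 * R / ε)
  have hN0 : (0 : ℝ) < N := lt_of_le_of_lt (by positivity) hN
  obtain ⟨l, hl0, hlε, hlN⟩ : ∃ l > 0, 2 * l < ε ∧ N * l = 2 * R := by
    refine ⟨2 * R / N, by positivity, ?_, by field_simp⟩
    rw [div_lt_iff₀ hε] at hN
    rw [← mul_div_assoc, div_lt_iff₀ hN0]
    linarith
  have hsq : ∀ x y l' : ℝ, x ∈ Icc (-R) R → y ∈ Icc (-R) R → 0 ≤ l' → l' ≤ l →
      TrivOn L ψ x (x + l) y (y + l') := by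
    intro x y l' hx hy hl'0 hl'
    obtain ⟨t, ht⟩ := hleb (⟨x, y⟩ : ℂ) ⟨hx, hy⟩
    have hmem : ∀ p q : ℝ, 0 ≤ p → p ≤ l → 0 ≤ q → q ≤ l →
        |x + p - (t : ℂ).re| < r t ∧ |y + q - (t : ℂ).im| < r t := by
      intro p q hp hpl hq hql
      have h1 : (⟨x + p, y + q⟩ : ℂ) ∈ ball (⟨x, y⟩ : ℂ) ε := by
        rw [Metric.mem_ball, dist_eq_norm]
        refine (Complex.norm_le_abs_re_add_abs_im _).trans_lt ?_
        simp only [Complex.sub_re, Complex.sub_im, add_sub_cancel_left, abs_of_nonneg hp,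
          abs_of_nonneg hq]
        linarith
      have h2 := ht h1
      rw [Metric.mem_ball, dist_eq_norm] at h2
      exact ⟨(Complex.abs_re_le_norm _).trans_lt h2, (Complex.abs_im_le_norm _).trans_lt h2⟩
    have m0 := hmem 0 0 le_rfl hl0.le le_rfl hl0.le
    have m1 := hmem l l' hl0.le le_rfl hl'0 hl'
    rw [abs_lt, abs_lt] at m0 m1
    exact hloc t _ _ _ _ (by linarith [m0.1.1]) (by linarith [m1.1.2]) (by linarith [m0.2.1])
      (by linarith [m1.2.2])
  have hgrid : ∀ n : ℕ, n < N → -R + n * l ∈ Icc (-R) R := by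
    intro n hn
    have h1 : (n : ℝ) * l ≤ N * l := by gcongr
    constructor
    · have : 0 ≤ (n : ℝ) * l := by positivity
      linarith
    · linarith
  have hcol : ∀ x ∈ Icc (-R) R, ∀ n : ℕ, n ≤ N → TrivOn L ψ x (x + l) (-R) (-R + n * l) := by
    intro x hx n
    induction n with
    | zero =>
      intro _
      simpa using hsq x (-R) 0 hx ⟨le_rfl, by linarith⟩ le_rfl hl0.le
    | succ n ih =>
      intro hn
      have h1 := hsq x (-R + n * l) l hx (hgrid n hn) hl0.le le_rfl
      have h2 := (ih (Nat.le_of_succ_le hn)).glue_vertical (by linarith)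
        (by linarith [(hgrid n hn).1]) (by linarith) h1
      convert h2 using 1
      push_cast; ring
  have hrow : ∀ n : ℕ, n < N → TrivOn L ψ (-R) (-R + (n + 1) * l) (-R) R := by
    intro n
    have hRN : -R + N * l = R := by linarith
    induction n with
    | zero =>
      intro _
      have := hcol (-R) ⟨le_rfl, by linarith⟩ N le_rfl
      rw [hRN] at this
      simpa using this
    | succ n ih =>
      intro hn
      have h1 := hcol (-R + ((n + 1 : ℕ) : ℝ) * l) (hgrid _ hn) N le_rfl
      rw [hRN] at h1
      have h2 := ih (by omega)
      push_cast at h1 ⊢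
      have h3 := h2.glue (by linarith) (by nlinarith) (by linarith) h1
      convert h3 using 1
      ring
  obtain ⟨n, rfl⟩ : ∃ n, N = n + 1 := ⟨N - 1, by
    have : 0 < N := by exact_mod_cast hN0
    omega⟩
  have := hrow n (by omega)
  convert this using 1
  push_cast at hlN
  linarith

lemma exists_section_disk (h : ∀ t : ℂ, (OM).Hol ψ (t, 0)) :
    ∃ δ > 0, ∃ s : ℂ × ℂ → L.Total, ∀ t u : ℂ, ‖t‖ < 2 → u ∈ ball 0 δ →
      L.HolAt s (t, u) ∧ L.proj (s (t, u)) = ψ (t, u) := by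
  obtain ⟨η, hη, s, hs⟩ := trivOn_square (L := L) (ψ := ψ) (R := 2) two_pos (fun t _ _ => h t)
  refine ⟨η, hη, s, fun t u ht hu => ?_⟩
  have h1 := abs_lt.1 ((Complex.abs_re_le_norm t).trans_lt ht)
  have h2 := abs_lt.1 ((Complex.abs_im_le_norm t).trans_lt ht)
  exact hs t u (by linarith) (by linarith) (by linarith) (by linarith) hu

end
/-! ### Coordinates on the tube -/

/-- The identification of `ℂ × ℂ` with `ℂ²`. -/
def pairE : (ℂ × ℂ) ≃L[ℂ] C2 :=
  LinearEquiv.toContinuousLinearEquiv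
    { toFun := fun y => !₂[y.1, y.2]
      invFun := fun z => (z 0, z 1)
      map_add' := fun x y => by ext j; fin_cases j <;> simp
      map_smul' := fun c x => by ext j; fin_cases j <;> simp
      left_inv := fun y => by simp
      right_inv := fun z => by ext j; fin_cases j <;> simp }

lemma AnalyticAt.fst {E F : Type*} [NormedAddCommGroup E] [NormedSpace ℂ E] [NormedAddCommGroup F]
    [NormedSpace ℂ F] {f : V → E × F} (hf : AnalyticAt ℂ f x) :
    AnalyticAt ℂ (fun z => (f z).1) x := AnalyticAt.comp (g := Prod.fst) analyticAt_fst hf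

lemma AnalyticAt.snd {E F : Type*} [NormedAddCommGroup E] [NormedSpace ℂ E] [NormedAddCommGroup F]
    [NormedSpace ℂ F] {f : V → E × F} (hf : AnalyticAt ℂ f x) :
    AnalyticAt ℂ (fun z => (f z).2) x := AnalyticAt.comp (g := Prod.snd) analyticAt_snd hf

lemma analyticAt_pair {f g : V → ℂ} (hf : AnalyticAt ℂ f x) (hg : AnalyticAt ℂ g x) :
    AnalyticAt ℂ (fun v => (!₂[f v, g v] : C2)) x :=
  (pairE.toContinuousLinearMap.analyticAt _).comp (hf.prod hg)

lemma analyticAt_coord (j : Fin 2) (z : C2) : AnalyticAt ℂ (fun z : C2 => z j) z :=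
  (EuclideanSpace.proj (𝕜 := ℂ) j).analyticAt z

lemma analyticAt_fst_coord (j : Fin 2) (y : C2 × ℂ) : AnalyticAt ℂ (fun y : C2 × ℂ => y.1 j) y :=
  AnalyticAt.comp (g := fun z : C2 => z j) (analyticAt_coord j y.1) analyticAt_fst

lemma norm_sq_C2 (z : C2) : ‖z‖ ^ 2 = ‖z 0‖ ^ 2 + ‖z 1‖ ^ 2 := by
  rw [EuclideanSpace.norm_sq_eq, Fin.sum_univ_two]

lemma isOpen_tube (r : ℝ) : IsOpen (tube r) :=
  (isOpen_ne.preimage continuous_fst).inter (isOpen_lt (f := fun y : C2 × ℂ => ‖y.2‖ * ‖y.1‖ ^ 2) (g := fun _ => r ^ 2) (by fun_prop)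
    continuous_const)

lemma tube_mono {r r' : ℝ} (h0 : 0 ≤ r) (h : r ≤ r') : tube r ⊆ tube r' := fun _ hy =>
  ⟨hy.1, hy.2.trans_le (by gcongr)⟩

lemma smul_mem_tube {r : ℝ} (τ : ℂˣ) {y : C2 × ℂ} (hy : y ∈ tube r) :
    (((τ : ℂ) • y.1, (τ : ℂ)⁻¹ ^ 2 * y.2) : C2 × ℂ) ∈ tube r := by
  refine ⟨smul_ne_zero τ.ne_zero hy.1, ?_⟩
  have : ‖(τ : ℂ)‖ ≠ 0 := norm_ne_zero_iff.2 τ.ne_zero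
  simp only [norm_mul, norm_pow, norm_inv, norm_smul]
  convert hy.2 using 1
  field_simp

/-- The unit given by a complex number, and `1` for the number `0`. -/
def toUnit (z : ℂ) : ℂˣ := if h : z = 0 then 1 else Units.mk0 z h

lemma toUnit_val {z : ℂ} (h : z ≠ 0) : (toUnit z : ℂ) = z := by
  rw [toUnit, dif_neg h, Units.val_mk0]

lemma analyticAt_toUnit {f : V → ℂ}
    (h : AnalyticAt ℂ f x) (h0 : f x ≠ 0) : AnalyticAt ℂ (fun z => (toUnit (f z) : ℂ)) x :=
  h.congr ((h.continuousAt.eventually_ne h0).mono fun _ hz => (toUnit_val hz).symm)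

lemma analyticAt_units_zpow {κ : V → ℂˣ} (h : AnalyticAt ℂ (fun z => (κ z : ℂ)) x) (n : ℤ) :
    AnalyticAt ℂ (fun z => ((κ z ^ n : ℂˣ) : ℂ)) x := by
  simp only [Units.val_zpow_eq_zpow_val]
  exact AnalyticAt.zpow (f := fun z => (κ z : ℂ)) h (Units.ne_zero _)

lemma hol_of_contMDiffAt {f : V → Xhat} {y : V}
    (h : ContMDiffAt 𝓘(ℂ, V) 𝓘(ℂ, C2) ω f y) : (OM).Hol f y := by
  let e := chartAt C2 (f y)
  have hc : ContMDiffAt 𝓘(ℂ, C2) 𝓘(ℂ, C2) ω e (f y) := contMDiffAt_of_mem_maximalAtlas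
    (IsManifold.chart_mem_maximalAtlas (f y)) (mem_chart_source C2 (f y))
  have h2 : AnalyticAt ℂ (fun z => e (f z)) y := (contMDiffAt_iff_contDiffAt.1 (hc.comp y h)).analyticAt
  refine ⟨manifoldChart e, mem_image_of_mem _ (chart_mem_atlas C2 _), fun z => e (f z),
    e.map_source (mem_chart_source C2 _), h2, ?_⟩
  filter_upwards [h.continuousAt.preimage_mem_nhds
    (e.open_source.mem_nhds (mem_chart_source C2 (f y)))] with z hz
  exact e.left_inv hz

lemma Blowup.hol_Φ (B : Blowup O p Xhat) (i : Fin k) {y : C2 × ℂ} (hy : y ∈ tube (B.r i)) :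
    (OM).Hol (B.Φ i) y :=
  hol_of_contMDiffAt ((B.holomorphic_Φ i).contMDiffAt ((isOpen_tube _).mem_nhds hy))

lemma Blowup.Φ_smul (B : Blowup O p Xhat) (i : Fin k) {y : C2 × ℂ} (hy : y ∈ tube (B.r i))
    (τ : ℂˣ) : B.Φ i ((τ : ℂ) • y.1, (τ : ℂ)⁻¹ ^ 2 * y.2) = B.Φ i y :=
  ((B.Φ_eq_iff i y hy _ (smul_mem_tube τ hy)).2 ⟨τ, rfl, rfl⟩).symm

/-- Holomorphic `ℂ^×` bundles on a tube around the exceptional divisor are classified by an integer: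
the pullback of the bundle to `(ℂ² ∖ 0) × ℂ` has a holomorphic section which is equivariant of some
weight.  Over each of the two standard charts of the divisor the bundle is trivial, and the
transition function is reduced to a power of the coordinate by means of a Laurent decomposition. -/
lemma exists_equivariant_section (B : Blowup O p Xhat) (L : CStarBundle OM) (i : Fin k) :
    ∃ (m : ℤ) (δ : ℝ) (S : C2 × ℂ → L.Total), 0 < δ ∧ δ ≤ B.r i ∧ ∀ y ∈ tube δ,
      L.HolAt S y ∧ L.proj (S y) = B.Φ i y ∧
      ∀ τ : ℂˣ, S ((τ : ℂ) • y.1, (τ : ℂ)⁻¹ ^ 2 * y.2) = τ ^ (-m) • S y := by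
  have hr := B.r_pos i
  have hne0 : ∀ t : ℂ, (!₂[1, t] : C2) ≠ 0 := fun t h => by
    have := congrArg (fun z : C2 => z 0) h; simp at this
  have hne1 : ∀ t : ℂ, (!₂[t, 1] : C2) ≠ 0 := fun t h => by
    have := congrArg (fun z : C2 => z 1) h; simp at this
  obtain ⟨δ₀, hδ₀, s₀, hs₀⟩ := exists_section_disk (L := L)
    (ψ := fun z : ℂ × ℂ => B.Φ i (!₂[1, z.1], z.2)) (fun t =>
      (B.hol_Φ i ⟨hne0 t, by simpa using pow_pos hr 2⟩).comp
        (g := fun z : ℂ × ℂ => (!₂[1, z.1], z.2))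
        ((analyticAt_pair analyticAt_const analyticAt_fst).prod analyticAt_snd))
  obtain ⟨δ₁, hδ₁, s₁, hs₁⟩ := exists_section_disk (L := L)
    (ψ := fun z : ℂ × ℂ => B.Φ i (!₂[z.1, 1], z.2)) (fun t =>
      (B.hol_Φ i ⟨hne1 t, by simpa using pow_pos hr 2⟩).comp
        (g := fun z : ℂ × ℂ => (!₂[z.1, 1], z.2))
        ((analyticAt_pair analyticAt_fst analyticAt_const).prod analyticAt_snd))
  obtain ⟨δ, hδ, hδ0, hδ1, hδr⟩ : ∃ δ > 0, δ ≤ δ₀ ∧ 4 * δ ≤ δ₁ ∧ 5 * δ ≤ B.r i ^ 2 := by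
    refine ⟨min δ₀ (min (δ₁ / 4) (B.r i ^ 2 / 5)), by positivity, min_le_left _ _, ?_, ?_⟩
    · have := (min_le_right δ₀ _).trans (min_le_left (δ₁ / 4) (B.r i ^ 2 / 5)); linarith
    · have := (min_le_right δ₀ _).trans (min_le_right (δ₁ / 4) (B.r i ^ 2 / 5)); linarith
  have hball : ∀ {u : ℂ} {ε : ℝ}, u ∈ ball 0 ε ↔ ‖u‖ < ε := mem_ball_zero_iff
  -- The transition function, over an annulus.
  let T : ℂ × ℂ → ℂ × ℂ := fun z => (z.1⁻¹, z.1 ^ 2 * z.2)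
  have hT : ∀ z ∈ annulus δ, L.HolAt (fun z => s₁ (T z)) z ∧ L.proj (s₀ z) = L.proj (s₁ (T z)) := by
    rintro ⟨t, u⟩ hz
    have ht : t ≠ 0 := fst_ne_zero_of_mem_annulus hz
    obtain ⟨⟨h1, h2⟩, hu⟩ := hz
    dsimp only at h1 h2 hu
    have h0 := hball.1 hu
    have h4 : ‖t‖ ^ 2 * ‖u‖ ≤ 4 * ‖u‖ :=
      mul_le_mul_of_nonneg_right (by nlinarith [norm_nonneg t]) (norm_nonneg u)
    obtain ⟨q1, q2⟩ := hs₁ t⁻¹ (t ^ 2 * u)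
      (by rw [norm_inv, inv_lt_comm₀ (by linarith) two_pos]; linarith)
      (by rw [hball, norm_mul, norm_pow]; linarith)
    refine ⟨q1.comp (g := T) ((analyticAt_fst.inv ht).prod
      ((analyticAt_fst.pow 2).mul analyticAt_snd)), ?_⟩
    have hy : ‖u‖ * ‖(!₂[1, t] : C2)‖ ^ 2 < B.r i ^ 2 := by simp [norm_sq_C2]; linarith
    rw [(hs₀ t u h2 (ball_subset_ball hδ0 hu)).2, q2,
      ← B.Φ_smul i (y := (!₂[1, t], u)) ⟨hne0 t, hy⟩ (Units.mk0 t ht)⁻¹]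
    congr 1
    refine Prod.ext ?_ (by simp)
    ext j; fin_cases j <;> simp [ht]
  obtain ⟨m, f, hf, hκf⟩ := exists_zpow_mul_exp hδ
    (κ := fun z => (fibreRatio (s₀ z) (s₁ (T z)) : ℂ)) (fun z hz => analyticAt_fibreRatio
      (hs₀ _ _ hz.1.2 (ball_subset_ball hδ0 hz.2)).1 (hT z hz).1
      (Filter.eventually_of_mem ((isOpen_annulus δ).mem_nhds hz) fun z hz => (hT z hz).2))
    (fun _ _ => Units.ne_zero _)
  obtain ⟨f₁, f₂, hf₁, hf₂, hff⟩ := exists_split_annulus hf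
  -- The sections over the two charts, normalised so that the transition function is a power.
  let σ₀ : ℂ × ℂ → L.Total := fun z => expUnit (f₁ z) • s₀ z
  let σ₁ : ℂ × ℂ → L.Total := fun z => expUnit (f₂ (z.1, z.1 ^ 2 * z.2)) • s₁ z
  have hσ₀ : ∀ t u : ℂ, ‖t‖ < 3 / 2 → ‖u‖ < δ →
      L.HolAt σ₀ (t, u) ∧ L.proj (σ₀ (t, u)) = B.Φ i (!₂[1, t], u) := by
    intro t u ht hu
    have h1 := hs₀ t u (by linarith) (hball.2 (by linarith))
    exact ⟨h1.1.smul (analyticAt_expUnit (hf₁ t u ht (hball.2 hu))), by rw [L.proj_smul, h1.2]⟩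
  have hσ₁ : ∀ t u : ℂ, ‖t‖ < 3 / 2 → ‖u‖ < δ → ‖t ^ 2 * u‖ < δ →
      L.HolAt σ₁ (t, u) ∧ L.proj (σ₁ (t, u)) = B.Φ i (!₂[t, 1], u) := by
    intro t u ht hu htu
    have h1 := hs₁ t u (by linarith) (hball.2 (by linarith))
    refine ⟨h1.1.smul (analyticAt_expUnit (AnalyticAt.comp
      (g := f₂) (f := fun z : ℂ × ℂ => (z.1, z.1 ^ 2 * z.2)) (hf₂ t _ ht (hball.2 htu))
      (analyticAt_fst.prod ((analyticAt_fst.pow 2).mul analyticAt_snd)))), by rw [L.proj_smul, h1.2]⟩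
  have hσ : ∀ t u : ℂ, 2 / 3 < ‖t‖ → ‖t‖ < 3 / 2 → ‖u‖ < δ →
      σ₁ (t⁻¹, t ^ 2 * u) = toUnit t ^ m • σ₀ (t, u) := by
    intro t u h1 h2 hu
    have hz : (t, u) ∈ annulus δ := ⟨⟨by linarith, by linarith⟩, hball.2 hu⟩
    have ht : t ≠ 0 := fst_ne_zero_of_mem_annulus hz
    have h3 : t⁻¹ ^ 2 * (t ^ 2 * u) = u := by field_simp
    simp only [σ₀, σ₁, h3]
    rw [show (t⁻¹, t ^ 2 * u) = T (t, u) from rfl, ← fibreRatio_smul (hT _ hz).2, smul_smul,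
      smul_smul]
    congr 1
    ext
    simp only [Units.val_mul, hκf _ hz, expUnit, Units.val_mk0, Units.val_zpow_eq_zpow_val,
      toUnit_val ht, hff t u h1 h2 hz.2]
    rw [mul_left_comm, ← Complex.exp_add]
    congr 2; ring
  classical
  -- The equivariant extension of a section over the affine chart in which the coordinate `j` is `1`.
  let R : Fin 2 → Fin 2 → (ℂ × ℂ → L.Total) → C2 × ℂ → L.Total := fun j j' σ y =>
    toUnit (y.1 j) ^ (-m) • σ (y.1 j' / y.1 j, y.1 j ^ 2 * y.2)
  have hR : ∀ (j j' : Fin 2) (σ : ℂ × ℂ → L.Total) (A : ℂ → C2),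
      (∀ z : C2, z j ≠ 0 → (z j)⁻¹ • z = A (z j' / z j)) → ∀ y ∈ tube (B.r i), y.1 j ≠ 0 →
      L.HolAt σ (y.1 j' / y.1 j, y.1 j ^ 2 * y.2) ∧ L.proj (σ (y.1 j' / y.1 j, y.1 j ^ 2 * y.2)) =
        B.Φ i (A (y.1 j' / y.1 j), y.1 j ^ 2 * y.2) →
      L.HolAt (R j j' σ) y ∧ L.proj (R j j' σ y) = B.Φ i y ∧
        ∀ τ : ℂˣ, R j j' σ ((τ : ℂ) • y.1, (τ : ℂ)⁻¹ ^ 2 * y.2) = τ ^ (-m) • R j j' σ y := by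
    intro j j' σ A hA y hy h0 h2
    refine ⟨CStarBundle.HolAt.smul (h2.1.comp
      (g := fun y : C2 × ℂ => (y.1 j' / y.1 j, y.1 j ^ 2 * y.2))
      (((analyticAt_fst_coord j' y).div (analyticAt_fst_coord j y) h0).prod
        (((analyticAt_fst_coord j y).pow 2).mul analyticAt_snd)))
      (analyticAt_units_zpow (analyticAt_toUnit (analyticAt_fst_coord j y) h0) _), ?_, fun τ => ?_⟩
    · rw [L.proj_smul, h2.2, ← hA _ h0, ← B.Φ_smul i hy (Units.mk0 _ h0)⁻¹]
      simp
    · simp only [R, PiLp.smul_apply, smul_eq_mul, smul_smul]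
      rw [mul_div_mul_left _ _ τ.ne_zero, show ((τ : ℂ) * y.1 j) ^ 2 * ((τ : ℂ)⁻¹ ^ 2 * y.2) =
        y.1 j ^ 2 * y.2 by field_simp]
      congr 1
      ext
      simp [toUnit_val h0, toUnit_val (mul_ne_zero τ.ne_zero h0), mul_zpow, mul_comm]
  let P := R 0 1 σ₀
  let Q := R 1 0 σ₁
  have hPQ : ∀ y : C2 × ℂ, y.1 0 ≠ 0 → 2 / 3 * ‖y.1 0‖ < ‖y.1 1‖ → ‖y.1 1‖ < 3 / 2 * ‖y.1 0‖ →
      ‖y.1 0 ^ 2 * y.2‖ < δ → P y = Q y := by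
    intro y h0 h1 h2 hu
    have hn0 : 0 < ‖y.1 0‖ := norm_pos_iff.2 h0
    have h1' : y.1 1 ≠ 0 := by rw [← norm_pos_iff]; linarith
    have h3 := hσ (y.1 1 / y.1 0) (y.1 0 ^ 2 * y.2) (by rwa [norm_div, lt_div_iff₀ hn0])
      (by rwa [norm_div, div_lt_iff₀ hn0]) hu
    rw [show (y.1 1 / y.1 0) ^ 2 * (y.1 0 ^ 2 * y.2) = y.1 1 ^ 2 * y.2 by field_simp, inv_div] at h3
    simp only [P, Q, R, h3, smul_smul]
    congr 1
    ext
    simp only [Units.val_mul, Units.val_zpow_eq_zpow_val, toUnit_val h0, toUnit_val h1',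
      toUnit_val (div_ne_zero h1' h0), div_zpow, zpow_neg, Units.val_inv_eq_inv_val]
    field_simp
  obtain ⟨ρ, hρ, hρr, hρδ⟩ : ∃ ρ > 0, ρ ≤ B.r i ∧ ρ ^ 2 ≤ δ := by
    refine ⟨min (B.r i) (Real.sqrt δ), by positivity, min_le_left _ _, ?_⟩
    calc min (B.r i) (Real.sqrt δ) ^ 2 ≤ Real.sqrt δ ^ 2 := by gcongr; exact min_le_right _ _
      _ = δ := Real.sq_sqrt hδ.le
  have hlt : ∀ y ∈ tube ρ, ∀ j : Fin 2, ‖y.1 j ^ 2 * y.2‖ < δ := by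
    intro y hy j
    refine lt_of_le_of_lt ?_ (hy.2.trans_le hρδ)
    rw [norm_mul, norm_pow, mul_comm]
    have := PiLp.norm_apply_le y.1 j
    gcongr
  have c0 : Continuous fun y : C2 × ℂ => ‖y.1 0‖ := by fun_prop
  have c1 : Continuous fun y : C2 × ℂ => ‖y.1 1‖ := by fun_prop
  refine ⟨m, ρ, fun y => if ‖y.1 1‖ ≤ ‖y.1 0‖ then P y else Q y, hρ, hρr, fun y hy => ?_⟩
  have hyr := tube_mono hρ.le hρr hy
  by_cases hle : ‖y.1 1‖ ≤ ‖y.1 0‖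
  · have hp0 : 0 < ‖y.1 0‖ := by
      refine (norm_nonneg _).lt_of_ne fun h => hy.1 ?_
      rw [← norm_eq_zero, ← sq_eq_zero_iff, norm_sq_C2, ← h,
        le_antisymm (h ▸ hle) (norm_nonneg (y.1 1))]
      norm_num
    have h1 := hR 0 1 σ₀ (fun t => !₂[1, t]) (fun z h => by
      ext j; fin_cases j <;> simp [h, div_eq_inv_mul]) y hyr (norm_pos_iff.1 hp0)
      (hσ₀ _ _ (by rw [norm_div, div_lt_iff₀ hp0]; linarith) (hlt y hy 0))
    have hev : P =ᶠ[𝓝 y] fun y => if ‖y.1 1‖ ≤ ‖y.1 0‖ then P y else Q y := by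
      filter_upwards [(isOpen_tube ρ).mem_nhds hy,
        (isOpen_lt c1 (c0.const_mul (3 / 2))).mem_nhds
          (show ‖y.1 1‖ < 3 / 2 * ‖y.1 0‖ by linarith),
        (isOpen_lt continuous_const c0).mem_nhds hp0] with w w1 w2 (w3 : 0 < ‖w.1 0‖)
      split_ifs with hw
      · rfl
      · exact hPQ w (norm_pos_iff.1 w3) (by linarith) w2 (hlt w w1 0)
    refine ⟨h1.1.congr hev, by beta_reduce; rw [if_pos hle, h1.2.1], fun τ => ?_⟩
    beta_reduce
    rw [if_pos hle, if_pos (by simp only [PiLp.smul_apply, norm_smul]; gcongr)]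
    exact h1.2.2 τ
  · rw [not_le] at hle
    have hp0 : 0 < ‖y.1 1‖ := (norm_nonneg _).trans_lt hle
    have h1 := hR 1 0 σ₁ (fun t => !₂[t, 1]) (fun z h => by
      ext j; fin_cases j <;> simp [h, div_eq_inv_mul]) y hyr (norm_pos_iff.1 hp0)
      (hσ₁ _ _ (by rw [norm_div, div_lt_iff₀ hp0]; linarith) (hlt y hy 1) (by
        rw [div_pow, ← mul_assoc, div_mul_cancel₀ _ (pow_ne_zero 2 (norm_pos_iff.1 hp0))]
        exact hlt y hy 0))
    have hev : Q =ᶠ[𝓝 y] fun y => if ‖y.1 1‖ ≤ ‖y.1 0‖ then P y else Q y := by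
      filter_upwards [(isOpen_lt c0 c1).mem_nhds hle] with w w1
      rw [if_neg (not_le.2 w1)]
    refine ⟨h1.1.congr hev, by beta_reduce; rw [if_neg (not_le.2 hle), h1.2.1], fun τ => ?_⟩
    beta_reduce
    have hτ : 0 < ‖(τ : ℂ)‖ := norm_pos_iff.2 τ.ne_zero
    rw [if_neg (not_le.2 hle), if_neg (by
      simp only [PiLp.smul_apply, norm_smul, not_le]; gcongr)]
    exact h1.2.2 τ
/-! ### Local geometry of the blow-up -/

lemma LiftsBihol.trans {X Y Z : Type u} [TopologicalSpace X] [TopologicalSpace Y]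
    [TopologicalSpace Z] {f : X → Y} {g : Y → Z} {c : OrbiChart X} {c' : OrbiChart Y}
    {c'' : OrbiChart Z} {x y z : C2} (h₁ : LiftsBihol f c c' x y) (h₂ : LiftsBihol g c' c'' y z) :
    LiftsBihol (fun v => g (f v)) c c'' x z := by
  obtain ⟨h, k, hl, rfl, hk, hkh, hhk⟩ := h₁
  obtain ⟨h', k', hl', rfl, hk', hkh', hhk'⟩ := h₂
  have hx : k (h x) = x := hkh.self_of_nhds
  have hy : k' (h' (h x)) = h x := hkh'.self_of_nhds
  have hk'' : AnalyticAt ℂ k (k' (h' (h x))) := by rwa [hy]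
  refine ⟨fun v => h' (h v), fun v => k (k' v), ?_, rfl, hk''.comp hk', ?_, ?_⟩
  · rw [isLiftAt_iff] at hl ⊢
    exact ⟨hl.1, LiftAt.post hl.2 hl'⟩
  · filter_upwards [hkh, hl.2.2.1.continuousAt.eventually hkh'] with v h1 h2
    rw [h2, h1]
  · have hhk2 : ∀ᶠ v in 𝓝 (k' (h' (h x))), h (k v) = v := by rwa [hy]
    filter_upwards [hhk', hk'.continuousAt.eventually hhk2] with v h1 h2
    rw [h2, h1]

/-- The inverse function theorem for holomorphic maps. -/
lemma exists_analytic_inverse {E F : Type*} [NormedAddCommGroup E] [NormedSpace ℂ E]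
    [CompleteSpace E] [NormedAddCommGroup F] [NormedSpace ℂ F] [CompleteSpace F] {f : E → F} {x : E}
    {f' : E ≃L[ℂ] F} (hf : AnalyticAt ℂ f x) (hf' : HasFDerivAt f (f' : E →L[ℂ] F) x) :
    ∃ g : F → E, AnalyticAt ℂ g (f x) ∧ g (f x) = x ∧ (∀ᶠ y in 𝓝 (f x), f (g y) = y) ∧
      ∀ᶠ z in 𝓝 x, g (f z) = z :=
  have h := hf.contDiffAt (n := ω)
  have hs := h.hasStrictFDerivAt' hf' (by simp)
  ⟨_, (h.to_localInverse hf' (by simp)).analyticAt, h.localInverse_apply_image hf' (by simp),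
    hs.eventually_right_inverse, hs.eventually_left_inverse⟩

namespace Blowup

section
variable (B : Blowup O p Xhat) (i : Fin k)

lemma zero_mem_dom : (0 : C2) ∈ (B.chart i).dom :=
  B.ball_subset i (mem_ball_self (B.r_pos i))

lemma map_eq_p_iff (hz : z ∈ (B.chart i).dom) : (B.chart i).map z = p i ↔ z = 0 := by
  rw [← B.map_zero i]
  constructor
  · intro h
    obtain ⟨g, -, hg⟩ := ((B.chart i).map_eq_iff _ (B.zero_mem_dom i) _ hz).1 h.symm
    rw [← hg, _root_.map_zero]
  · rintro rfl; rfl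

lemma mem_tube_one {r : ℝ} (hz : z ∈ ball 0 r) (h0 : z ≠ 0) : ((z, 1 ^ 2) : C2 × ℂ) ∈ tube r := by
  refine ⟨h0, ?_⟩
  rw [mem_ball_zero_iff] at hz
  simp only [one_pow, norm_one, one_mul]
  gcongr

lemma q_Φ_one (hz : z ∈ ball 0 (B.r i)) (h0 : z ≠ 0) : B.q (B.Φ i (z, 1)) = (B.chart i).map z := by
  have := B.q_Φ i z 1 (mem_tube_one hz h0)
  rwa [one_pow, one_smul] at this

lemma eq_or_eq_neg {z z' : C2} (hz : z ∈ ball 0 (B.r i)) (hz' : z' ∈ ball 0 (B.r i))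
    (h : (B.chart i).map z ∉ range p) (he : (B.chart i).map z = (B.chart i).map z') :
    z' = z ∨ z' = -z := by
  have hz0 : z ≠ 0 := by rintro rfl; exact h ⟨i, (B.map_zero i).symm⟩
  have hz0' : z' ≠ 0 := by rintro rfl; exact h ⟨i, by rw [he, B.map_zero]⟩
  have e1 := B.q_Φ_one i hz hz0
  have e2 := B.q_Φ_one i hz' hz0'
  have e3 : B.Φ i (z, 1) = B.Φ i (z', 1) := B.bijOn.injOn
    (by rw [mem_preimage, e1]; exact h) (by rw [mem_preimage, e2, ← he]; exact h)
    (by rw [e1, e2, he])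
  have m1 := mem_tube_one hz hz0
  have m2 := mem_tube_one hz' hz0'
  rw [one_pow] at m1 m2
  obtain ⟨t, h1, h2⟩ := (B.Φ_eq_iff i _ m1 _ m2).1 e3
  dsimp only at h1 h2
  have h3 : (t : ℂ) ^ 2 = 1 := by
    have := t.ne_zero
    field_simp at h2
    exact h2
  rcases (sq_eq_sq_iff_eq_or_eq_neg.1 (h3.trans (one_pow 2).symm)) with h4 | h4
  · left; rw [h1, h4, one_smul]
  · right; rw [h1, h4, neg_one_smul]

lemma map_neg (hz : z ∈ ball 0 (B.r i)) : (B.chart i).map (-z) = (B.chart i).map z := by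
  by_cases h0 : z = 0
  · rw [h0, neg_zero]
  have hz' : -z ∈ ball 0 (B.r i) := by simpa using hz
  rw [← B.q_Φ_one i hz h0, ← B.q_Φ_one i hz' (neg_ne_zero.2 h0)]
  have m1 := mem_tube_one hz h0
  rw [one_pow] at m1
  have := B.Φ_smul i m1 (-1)
  simp at this
  rw [this]

end

/-- A radius `ε` for which the disks of radius `ε` around the points `p i` are disjoint. -/
structure Good (B : Blowup O p Xhat) (ε : ℝ) : Prop where
  pos : 0 < ε
  le : ∀ i, ε ≤ B.r i
  disjoint : ∀ i j, i ≠ j → ∀ z ∈ ball 0 ε, ∀ z' ∈ ball 0 ε,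
    (B.chart i).map z ≠ (B.chart j).map z'

lemma exists_good [T2Space X] (B : Blowup O p Xhat) (hp : Function.Injective p) (δ : Fin k → ℝ)
    (hδ : ∀ i, 0 < δ i) : ∃ ε, B.Good ε ∧ ∀ i, ε ≤ δ i := by
  obtain ⟨U, hU, hd⟩ := (Set.finite_range p).t2_separation
  have h1 : ∀ᶠ ε in 𝓝[>] (0 : ℝ), ∀ i, ε ≤ δ i ∧ ε ≤ B.r i ∧
      ball (0 : C2) ε ⊆ (B.chart i).map ⁻¹' U (p i) := by
    refine Filter.eventually_all.2 fun i => ?_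
    have hn : (B.chart i).map ⁻¹' U (p i) ∈ 𝓝 (0 : C2) :=
      ((B.chart i).continuousOn.continuousAt ((B.chart i).isOpen_dom.mem_nhds
        (B.zero_mem_dom i))).preimage_mem_nhds ((hU _).2.mem_nhds (by
          rw [B.map_zero]; exact (hU _).1))
    obtain ⟨ρ, hρ, hb⟩ := Metric.mem_nhds_iff.1 hn
    have h2 : ∀ᶠ ε in 𝓝[>] (0 : ℝ), ε ≤ min (δ i) (min (B.r i) ρ) :=
      Filter.mem_of_superset (Ioc_mem_nhdsGT (lt_min (hδ i) (lt_min (B.r_pos i) hρ)))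
        fun ε h => h.2
    filter_upwards [h2] with ε h
    exact ⟨h.trans (min_le_left _ _), h.trans ((min_le_right _ _).trans (min_le_left _ _)),
      (ball_subset_ball (h.trans ((min_le_right _ _).trans (min_le_right _ _)))).trans hb⟩
  obtain ⟨ε, h, hε⟩ := (h1.and self_mem_nhdsWithin).exists
  refine ⟨ε, ⟨hε, fun i => (h i).2.1, fun i j hij z hz z' hz' he => ?_⟩, fun i => (h i).1⟩
  have h3 : Disjoint (U (p i)) (U (p j)) := hd ⟨i, rfl⟩ ⟨j, rfl⟩ (hp.ne hij)
  exact Set.disjoint_left.1 h3 ((h i).2.2 hz) (he ▸ (h j).2.2 hz')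

lemma Good.mono (hε : B.Good ε) {r : ℝ} (h0 : 0 < r) (h : r ≤ ε) : B.Good r :=
  ⟨h0, fun i => h.trans (hε.le i), fun i j hij z hz z' hz' =>
    hε.disjoint i j hij z (ball_subset_ball h hz) z' (ball_subset_ball h hz')⟩

lemma smul_mem_ball_iff {r : ℝ} (hr : 0 < r) {s : ℂ} (hz : z ≠ 0) :
    s • z ∈ ball 0 r ↔ ((z, s ^ 2) : C2 × ℂ) ∈ tube r := by
  rw [mem_ball_zero_iff, norm_smul]
  constructor
  · intro h
    refine ⟨hz, ?_⟩
    simp only [norm_pow, ← mul_pow]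
    gcongr
  · intro h
    have := h.2
    simp only [norm_pow, ← mul_pow] at this
    exact lt_of_pow_lt_pow_left₀ 2 hr.le this

lemma exists_sq (u : ℂ) : ∃ s : ℂ, s ^ 2 = u := IsAlgClosed.exists_pow_nat_eq u two_pos

section
variable (hε : B.Good ε) (i : Fin k)
include hε

lemma Good.ball_subset_r : ball (0 : C2) ε ⊆ ball 0 (B.r i) := ball_subset_ball (hε.le i)

lemma Good.ball_subset :
    ball (0 : C2) ε ⊆ (B.chart i).dom := (hε.ball_subset_r i).trans (B.ball_subset i)

lemma Good.tube_subset : tube ε ⊆ tube (B.r i) :=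
  tube_mono hε.pos.le (hε.le i)

lemma Good.map_mem_range (hz : z ∈ ball 0 ε) : (B.chart i).map z ∈ range p ↔ z = 0 := by
  constructor
  · rintro ⟨j, hj⟩
    by_cases hij : i = j
    · subst hij
      exact (B.map_eq_p_iff i (hε.ball_subset i hz)).1 hj.symm
    · exact absurd (hj.symm.trans (B.map_zero j).symm)
        (hε.disjoint i j hij z hz 0 (mem_ball_self hε.pos))
  · rintro rfl
    exact ⟨i, (B.map_zero i).symm⟩

lemma Good.map_eq_map {z z' : C2} (hz : z ∈ ball 0 ε)
    (hz' : z' ∈ ball 0 ε) : (B.chart i).map z = (B.chart i).map z' ↔ z' = z ∨ z' = -z := by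
  constructor
  · intro h
    by_cases hr : (B.chart i).map z ∈ range p
    · have h1 := (hε.map_mem_range i hz).1 hr
      rw [h] at hr
      have h2 := (hε.map_mem_range i hz').1 hr
      left; rw [h1, h2]
    · exact B.eq_or_eq_neg i (hε.ball_subset_r i hz) (hε.ball_subset_r i hz') hr h
  · rintro (rfl | rfl)
    · rfl
    · rw [B.map_neg i (hε.ball_subset_r i hz)]

lemma Good.q_Φ_sq {y : C2 × ℂ} (hy : y ∈ tube ε) {s : ℂ}
    (hs : s ^ 2 = y.2) : s • y.1 ∈ ball 0 ε ∧ B.q (B.Φ i y) = (B.chart i).map (s • y.1) := by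
  have h1 : ((y.1, s ^ 2) : C2 × ℂ) ∈ tube ε := by rw [hs]; exact hy
  refine ⟨(smul_mem_ball_iff hε.pos hy.1).2 h1, ?_⟩
  have := B.q_Φ i y.1 s (hε.tube_subset i h1)
  rwa [hs] at this

lemma Good.q_Φ_mem_range {y : C2 × ℂ} (hy : y ∈ tube ε) : B.q (B.Φ i y) ∈ range p ↔ y.2 = 0 := by
  obtain ⟨s, hs⟩ := exists_sq y.2
  obtain ⟨h1, h2⟩ := hε.q_Φ_sq i hy hs
  rw [h2, hε.map_mem_range i h1, smul_eq_zero, or_iff_left hy.1, ← hs, sq_eq_zero_iff]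

lemma Good.exists_tube (hz : z ∈ ball 0 ε) {x : Xhat}
    (hx : B.q x = (B.chart i).map z) : ∃ y ∈ tube ε, B.Φ i y = x := by
  have h1 : x ∈ B.Φ i '' tube (B.r i) := by
    rw [B.image_Φ i]
    exact ⟨z, hε.ball_subset_r i hz, hx.symm⟩
  obtain ⟨y, hy, rfl⟩ := h1
  refine ⟨y, ?_, rfl⟩
  obtain ⟨s, hs⟩ := exists_sq y.2
  have hy' : ((y.1, s ^ 2) : C2 × ℂ) ∈ tube (B.r i) := by rw [hs]; exact hy
  have h2 := B.q_Φ i y.1 s hy'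
  rw [hs] at h2
  have h3 := (smul_mem_ball_iff (B.r_pos i) hy.1).2 hy'
  have h4 : s • y.1 ∈ ball 0 ε := by
    have h5 : (B.chart i).map z = (B.chart i).map (s • y.1) := hx.symm.trans h2
    by_cases hr : (B.chart i).map z ∈ range p
    · have h6 := (hε.map_mem_range i hz).1 hr
      rw [h6, B.map_zero] at h5
      rw [(B.map_eq_p_iff i (B.ball_subset i h3)).1 h5.symm]
      exact mem_ball_self hε.pos
    · rcases B.eq_or_eq_neg i (hε.ball_subset_r i hz) h3 hr h5 with h6 | h6
      · rwa [h6]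
      · rw [h6]; simpa using hz
  have h5 := (smul_mem_ball_iff hε.pos hy.1).1 h4
  rwa [hs] at h5

lemma Good.q_eq_p {x : Xhat} : B.q x = p i ↔ ∃ y ∈ tube ε, y.2 = 0 ∧ B.Φ i y = x := by
  constructor
  · intro h
    obtain ⟨y, hy, hyx⟩ := hε.exists_tube i (mem_ball_self hε.pos) (h.trans (B.map_zero i).symm)
    exact ⟨y, hy, (hε.q_Φ_mem_range i hy).1 (by rw [hyx, h]; exact ⟨i, rfl⟩), hyx⟩
  · rintro ⟨y, hy, h0, rfl⟩
    obtain ⟨h1, h2⟩ := hε.q_Φ_sq i hy (s := 0) (by rw [h0]; simp)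
    rw [h2, zero_smul, B.map_zero]

end

variable (B : Blowup O p Xhat)

lemma hol_q {f : V → Xhat} (hf : (OM).Hol f x)
    (h : B.q (f x) ∉ range p) : O.Hol (fun z => B.q (f z)) x := by
  obtain ⟨c', hc', l, hl⟩ := hf
  obtain ⟨c, hc, y, hy, hyx⟩ := O.cover (B.q (f x))
  obtain ⟨j, hj, -⟩ := (B.bihol c' hc' c hc (l x) hl.1 y hy (by rw [hl.map_eq, hyx])
    (by rw [hyx]; exact h)).exists_isLiftAt
  exact ⟨c, hc, _, hl.post hj⟩

/-- Outside the singular points, `q` has local holomorphic inverses. -/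
lemma exists_local_inverse_q (hc : c ∈ O.charts) {x : C2} (hx : x ∈ c.dom) (h : c.map x ∉ range p) :
    ∃ f : C2 → Xhat, (OM).Hol f x ∧ ∀ᶠ z in 𝓝 x, B.q (f z) = c.map z := by
  obtain ⟨xh, -, hxh⟩ := B.bijOn.surjOn h
  obtain ⟨c', hc', y, hy, hyx⟩ := (OM).cover xh
  obtain ⟨h, l, hl, hhy, hk, hkh, hhk⟩ := B.bihol c' hc' c hc y hy x hx (by rw [hyx, hxh]) h
  have hlx : l x = y := by rw [← hhy, hkh.self_of_nhds]
  refine ⟨fun z => c'.map (l z), ⟨c', hc', l, by rw [hlx]; exact hy, hk, EventuallyEq.rfl⟩, ?_⟩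
  have h1 : ∀ᶠ w in 𝓝 (l x), c.map (h w) = B.q (c'.map w) := by rw [hlx]; exact hl.2.2.2
  filter_upwards [hk.continuousAt.eventually h1, hhk] with z g1 g2
  rw [← g1, g2]

/-- Local holomorphic sections of the submersion `Φ i`, through any given point. -/
lemma exists_section_Φ (i : Fin k) {w : C2 × ℂ} (hw : w ∈ tube (B.r i))
    {c : OrbiChart Xhat} (hc : c ∈ (OM).charts) {x : C2} (hx : x ∈ c.dom) (h : c.map x = B.Φ i w) :
    ∃ l : C2 → C2 × ℂ, AnalyticAt ℂ l x ∧ l x = w ∧ ∀ᶠ z in 𝓝 x, B.Φ i (l z) = c.map z := by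
  let e := chartAt C2 (B.Φ i w)
  have hcm : ContMDiffAt 𝓘(ℂ, C2 × ℂ) 𝓘(ℂ, C2) ω (B.Φ i) w :=
    (B.holomorphic_Φ i).contMDiffAt ((isOpen_tube _).mem_nhds hw)
  have hes := mem_chart_source C2 (B.Φ i w)
  have he : ContMDiffAt 𝓘(ℂ, C2) 𝓘(ℂ, C2) ω e (B.Φ i w) := contMDiffAt_of_mem_maximalAtlas
    (IsManifold.chart_mem_maximalAtlas (B.Φ i w)) hes
  have hF : ContDiffAt ℂ ω (fun y => e (B.Φ i y)) w := contMDiffAt_iff_contDiffAt.1 (he.comp w hcm)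
  have hsurj : Function.Surjective (fderiv ℂ (fun y => e (B.Φ i y)) w) := by
    have h1 := B.submersion_Φ i w hw
    rw [(hcm.mdifferentiableAt (by simp)).mfderiv] at h1
    simp [writtenInExtChartAt, extChartAt, Function.comp_def] at h1
    exact h1
  obtain ⟨R, hR⟩ := (fderiv ℂ (fun y => e (B.Φ i y)) w).exists_rightInverse_of_surjective
    (LinearMap.range_eq_top.2 hsurj)
  -- On the affine subspace `w + R (ℂ²)` the map `Φ` is a local biholomorphism.
  let a : C2 → C2 × ℂ := fun v => w + R v
  have ha : ∀ v, AnalyticAt ℂ a v := fun v => analyticAt_const.add (R.analyticAt v)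
  have ha0 : a 0 = w := by simp [a]
  have hd : HasFDerivAt (fun v => e (B.Φ i (a v))) (ContinuousLinearEquiv.refl ℂ C2 : C2 →L[ℂ] C2) 0 := by
    have h1 : HasFDerivAt (fun y => e (B.Φ i y)) (fderiv ℂ (fun y => e (B.Φ i y)) w) (a 0) := by
      rw [ha0]; exact (hF.differentiableAt (by simp)).hasFDerivAt
    have h2 : HasFDerivAt a R 0 := R.hasFDerivAt.const_add w
    exact (h1.comp (0 : C2) h2).congr_fderiv hR
  have hFa : AnalyticAt ℂ (fun y => e (B.Φ i y)) (a 0) := by rw [ha0]; exact hF.analyticAt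
  obtain ⟨g, hg, hg0, hgr, -⟩ := exists_analytic_inverse (hFa.comp (ha 0)) hd
  rw [Function.comp_apply, ha0] at hg hg0 hgr
  have hc0 : manifoldChart e ∈ (OM).charts := mem_image_of_mem _ (chart_mem_atlas C2 _)
  obtain ⟨j, hj, hjx⟩ := ((OM).compatible c hc _ hc0 x hx
    (e (B.Φ i w)) (e.map_source hes) (h.trans (e.left_inv hes).symm)).exists_isLiftAt
  have hg' : AnalyticAt ℂ g (j x) := by rw [hjx]; exact hg
  refine ⟨fun z => a (g (j z)), (ha _).comp (hg'.comp hj.2.2.1), by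
    beta_reduce; rw [hjx, hg0, ha0], ?_⟩
  have hjc : Tendsto j (𝓝 x) (𝓝 (e (B.Φ i w))) := by
    have := hj.2.2.1.continuousAt
    rwa [ContinuousAt, hjx] at this
  have hsrc : ∀ᶠ y in 𝓝 w, B.Φ i y ∈ e.source :=
    hcm.continuousAt.preimage_mem_nhds (e.open_source.mem_nhds hes)
  have hT : Tendsto (fun v => a (g v)) (𝓝 (e (B.Φ i w))) (𝓝 w) := by
    have h1 := (AnalyticAt.comp (g := a) (f := g) (ha _) hg).continuousAt
    rwa [ContinuousAt, Function.comp_apply, hg0, ha0] at h1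
  filter_upwards [hjc.eventually hgr, (hT.comp hjc).eventually hsrc, hj.2.2.2] with z h1 h2 h3
  simp only [Function.comp_apply] at h1 h2
  rw [← e.left_inv h2, h1]
  exact h3

/-- Two lifts of the same map through `Φ i` differ by the action of a holomorphic function. -/
lemma exists_ratio_Φ (i : Fin k) {l l' : V → C2 × ℂ} (hl : AnalyticAt ℂ l x) (hl' : AnalyticAt ℂ l' x)
    (hm : l x ∈ tube (B.r i)) (hm' : l' x ∈ tube (B.r i))
    (h : ∀ᶠ z in 𝓝 x, B.Φ i (l z) = B.Φ i (l' z)) :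
    ∃ τ : V → ℂˣ, AnalyticAt ℂ (fun z => (τ z : ℂ)) x ∧ ∀ᶠ z in 𝓝 x,
      l' z = ((τ z : ℂ) • (l z).1, (τ z : ℂ)⁻¹ ^ 2 * (l z).2) := by
  obtain ⟨j, hj⟩ : ∃ j, (l x).1 j ≠ 0 := by
    by_contra! h0
    exact hm.1 (by ext j; exact h0 j)
  have ha : ∀ {m : V → C2 × ℂ}, AnalyticAt ℂ m x → AnalyticAt ℂ (fun z => (m z).1 j) x :=
    fun hm => AnalyticAt.comp (g := fun y : C2 × ℂ => y.1 j) (analyticAt_fst_coord j _) hm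
  have key : ∀ᶠ z in 𝓝 x, ∃ t : ℂˣ, (t : ℂ) = (l' z).1 j / (l z).1 j ∧
      l' z = ((t : ℂ) • (l z).1, (t : ℂ)⁻¹ ^ 2 * (l z).2) := by
    filter_upwards [h, hl.continuousAt.preimage_mem_nhds ((isOpen_tube _).mem_nhds hm),
      hl'.continuousAt.preimage_mem_nhds ((isOpen_tube _).mem_nhds hm'),
      (ha hl).continuousAt.eventually_ne hj] with z h1 h2 h3 h4
    obtain ⟨t, h5, h6⟩ := (B.Φ_eq_iff i _ h2 _ h3).1 h1
    refine ⟨t, ?_, Prod.ext h5 h6⟩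
    rw [h5]
    simp [h4]
  have hne : (l' x).1 j / (l x).1 j ≠ 0 := by
    obtain ⟨t, ht, -⟩ := key.self_of_nhds
    rw [← ht]; exact t.ne_zero
  have hdiv : AnalyticAt ℂ (fun z => (l' z).1 j / (l z).1 j) x := (ha hl').div (ha hl) hj
  refine ⟨fun z => toUnit ((l' z).1 j / (l z).1 j), analyticAt_toUnit hdiv hne, ?_⟩
  filter_upwards [key, hdiv.continuousAt.eventually_ne hne] with z h1 h2
  obtain ⟨t, h3, h4⟩ := h1
  rw [toUnit_val h2, ← h3, h4]

end Blowup
/-! ### Functions supported near the singular points and near the exceptional divisor -/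

/-- A smooth cutoff function, which is `1` up to `ε⁴ / 32` and `0` from `ε⁴ / 16` on; it is applied to
`‖z‖⁴` on `ℂ²`, and to the corresponding smooth function `‖u‖² ‖z‖⁴` of `[z; u]` on the blow-up. -/
def cut (ε s : ℝ) : ℝ := Real.smoothTransition (2 - s * (32 / ε ^ 4))

lemma contDiff_cut (ε : ℝ) : ContDiff ℝ ∞ (cut ε) :=
  Real.smoothTransition.contDiff.comp (by fun_prop)

lemma cut_one {ε s : ℝ} (hε : 0 < ε) (h : s ≤ (ε / 3) ^ 4) : cut ε s = 1 := by
  refine Real.smoothTransition.one_of_one_le ?_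
  have h1 : s * (32 / ε ^ 4) ≤ (ε / 3) ^ 4 * (32 / ε ^ 4) := by gcongr
  have h2 : (ε / 3) ^ 4 * (32 / ε ^ 4) = 32 / 81 := by field_simp; norm_num
  linarith

lemma cut_zero {ε s : ℝ} (hε : 0 < ε) (h : (ε / 2) ^ 4 ≤ s) : cut ε s = 0 := by
  refine Real.smoothTransition.zero_of_nonpos ?_
  have h1 : (ε / 2) ^ 4 * (32 / ε ^ 4) ≤ s * (32 / ε ^ 4) := by gcongr
  have h2 : (ε / 2) ^ 4 * (32 / ε ^ 4) = 2 := by field_simp; norm_num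
  linarith

lemma contDiff_norm_sq_C2 : ContDiff ℝ ∞ fun z : C2 => ‖z‖ ^ 2 := contDiff_norm_sq ℂ

lemma contDiffAt_log_norm_C2 (hz : z ≠ 0) : ContDiffAt ℝ ∞ (fun z : C2 => log (‖z‖ ^ 2)) z :=
  contDiff_norm_sq_C2.contDiffAt.log (pow_ne_zero _ (norm_ne_zero_iff.2 hz))

lemma contDiffAt_log_norm_comp [NormedSpace ℝ V] [IsScalarTower ℝ ℂ V] {l : V → C2}
    (hl : AnalyticAt ℂ l x) (h0 : l x ≠ 0) : ContDiffAt ℝ ∞ (fun z => log (‖l z‖ ^ 2)) x :=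
  ContDiffAt.comp (g := fun z : C2 => log (‖z‖ ^ 2)) x (contDiffAt_log_norm_C2 h0)
    hl.contDiffAt_real

/-- The function `log ‖z‖²` changes by a pluriharmonic function if `z` is multiplied by an invertible
holomorphic function. -/
lemma ddc_log_norm_smul [NormedSpace ℝ V]
    [IsScalarTower ℝ ℂ V] {l l' : V → C2} (hl : AnalyticAt ℂ l x) (h0 : l x ≠ 0) {τ : V → ℂˣ}
    (hτ : AnalyticAt ℂ (fun z => (τ z : ℂ)) x) (h : ∀ᶠ z in 𝓝 x, l' z = (τ z : ℂ) • l z) {r : ℝ} :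
    ddc (fun z => r * log (‖l' z‖ ^ 2)) x = ddc (fun z => r * log (‖l z‖ ^ 2)) x := by
  have hev : (fun z => r * log (‖l' z‖ ^ 2)) =ᶠ[𝓝 x]
      fun z => r * log (‖l z‖ ^ 2) + r * log (‖(τ z : ℂ)‖ ^ 2) := by
    filter_upwards [h, hl.continuousAt.eventually_ne h0] with z h1 h2
    rw [h1, norm_smul, mul_pow, Real.log_mul (pow_ne_zero _ (norm_ne_zero_iff.2 (Units.ne_zero _)))
      (pow_ne_zero _ (norm_ne_zero_iff.2 h2))]
    ring
  rw [hev.ddc_eq, ddc_add, ddc_const_mul _ (contDiffAt_log_norm_sq hτ (Units.ne_zero _)),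
    ddc_log_norm_sq hτ (Units.ne_zero _), smul_zero, add_zero]
  · exact contDiffAt_const.mul (contDiffAt_log_norm_comp hl h0)
  · exact contDiffAt_const.mul (contDiffAt_log_norm_sq hτ (Units.ne_zero _))

section
variable [NormedSpace ℝ V] [IsScalarTower ℝ ℂ V]

lemma Potentials.pull_form (P : Potentials O) {c : O.charts} {h : V → C2}
    (hl : LiftAt f c.1 h x) {φ : C2 → ℝ} (hφ : P.IsPot c (h x) φ) :
    pull P.form.1 f x = ddc (fun z => φ (h z)) x := by
  rw [pull_eq _ c hl, P.form_apply hl.1 hφ, ddc_comp (P.smooth c _ hl.1 φ hφ) hl.2.1]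

variable {L : CStarBundle O}

/-- The pullback of the Chern form in terms of a holomorphic section. -/
lemma CStarBundle.HermitianMetric.pull_pot (H : L.HermitianMetric) {s : V → L.Total}
    (hs : L.HolAt s x) : pull H.pot.form.1 (fun z => L.proj (s z)) x =
      ddc (fun z => log (H.len (s z) ^ 2)) x := by
  obtain ⟨c, hc, h, hl⟩ := hs.hol
  obtain ⟨σ, hσ, hσp⟩ := CStarBundle.exists_holAt (L := L) (O.hol_chart hc hl.1)
  rw [H.pot.pull_form (c := ⟨c, hc⟩) hl (φ := fun z => log (H.len (σ z) ^ 2))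
    ⟨σ, hσ, hσp, EventuallyEq.rfl⟩]
  have hσh := hσ.comp hl.2.1
  obtain ⟨κ, hκ, hκe⟩ := hσh.exists_ratio hs (by
    filter_upwards [hl.2.1.continuousAt.eventually hσp, hl.2.2] with z h1 h2
    rw [h1, h2])
  have hev : (fun z => log (H.len (s z) ^ 2)) =ᶠ[𝓝 x]
      fun z => log (‖(κ z : ℂ)‖ ^ 2) + log (H.len (σ (h z)) ^ 2) := by
    filter_upwards [hκe] with z hz
    rw [hz, H.log_smul]
  rw [hev.ddc_eq, ddc_add (contDiffAt_log_norm_sq hκ (Units.ne_zero _)) (H.contDiffAt_log hσh),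
    ddc_log_norm_sq hκ (Units.ne_zero _), zero_add]

/-- The product of a metric with the exponential of a smooth function. -/
def CStarBundle.HermitianMetric.twist (H : L.HermitianMetric) {G : X → ℝ}
    (hG : O.Smooth G) : L.HermitianMetric where
  len m := H.len m * Real.exp (G (L.proj m))
  len_pos m := mul_pos (H.len_pos m) (Real.exp_pos _)
  len_smul t m := by rw [H.len_smul, L.proj_smul, mul_assoc]
  smooth b hb x hx := by
    refine ((H.smooth b hb x hx).mul ?_)
    have h1 := (BundleChart.hol_of_lift hb hx analyticAt_id).hol
    exact (Real.contDiff_exp.contDiffAt.comp x (hG.comp h1)).contDiffWithinAt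

end

namespace Blowup

open Classical in
/-- The function on `X` which is the even function `ρ` in the chart at `p i`, on the disk of radius
`ε`, and `0` elsewhere. -/
def pushX (B : Blowup O p Xhat) (i : Fin k) (ε : ℝ) (ρ : C2 → ℝ) (x : X) : ℝ :=
  if h : ∃ z ∈ ball 0 ε, (B.chart i).map z = x then ρ h.choose else 0

open Classical in
/-- The function on the blow-up which is the invariant function `ρ` on the tube of radius `ε` around
`E i`, and `0` elsewhere. -/
def pushHat (B : Blowup O p Xhat) (i : Fin k) (ε : ℝ) (ρ : C2 × ℂ → ℝ) (x : Xhat) : ℝ :=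
  if h : ∃ y ∈ tube ε, B.Φ i y = x then ρ h.choose else 0

lemma pushX_of_not_mem (i : Fin k) {ρ : C2 → ℝ} {x : X}
    (h : x ∉ (B.chart i).map '' ball 0 ε) : B.pushX i ε ρ x = 0 := dif_neg h

section
variable (hε : B.Good ε) (i : Fin k)
include hε

lemma Good.pushX_map {ρ : C2 → ℝ} (hρ : ∀ z, ρ (-z) = ρ z)
    (hz : z ∈ ball 0 ε) : B.pushX i ε ρ ((B.chart i).map z) = ρ z := by
  have h : ∃ z' ∈ ball 0 ε, (B.chart i).map z' = (B.chart i).map z := ⟨z, hz, rfl⟩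
  rw [pushX, dif_pos h]
  rcases (hε.map_eq_map i hz h.choose_spec.1).1 h.choose_spec.2.symm with h1 | h1
  · rw [h1]
  · rw [h1, hρ]

lemma Good.pushHat_Φ {ρ : C2 × ℂ → ℝ}
    (hρ : ∀ y ∈ tube ε, ∀ τ : ℂˣ, ρ ((τ : ℂ) • y.1, (τ : ℂ)⁻¹ ^ 2 * y.2) = ρ y) {y : C2 × ℂ}
    (hy : y ∈ tube ε) : B.pushHat i ε ρ (B.Φ i y) = ρ y := by
  have h : ∃ y' ∈ tube ε, B.Φ i y' = B.Φ i y := ⟨y, hy, rfl⟩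
  rw [pushHat, dif_pos h]
  obtain ⟨t, h1, h2⟩ := (B.Φ_eq_iff i _ (hε.tube_subset i hy) _
    (hε.tube_subset i h.choose_spec.1)).1 h.choose_spec.2.symm
  rw [← hρ y hy t]
  congr 1
  exact Prod.ext h1 h2

lemma Good.closedBall_half_subset : closedBall (0 : C2) (ε / 2) ⊆ ball 0 ε :=
  Metric.closedBall_subset_ball (by linarith [hε.pos])

variable [T2Space X]

lemma Good.isClosed_image_closedBall : IsClosed ((B.chart i).map '' closedBall (0 : C2) (ε / 2)) :=
  ((isCompact_closedBall 0 _).image_of_continuousOn ((B.chart i).continuousOn.mono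
    (hε.closedBall_half_subset.trans (hε.ball_subset i)))).isClosed

lemma Good.pushX_eventually_zero {ρ : C2 → ℝ}
    (hρ : ∀ z, ρ (-z) = ρ z) (hs : ∀ z, ε / 2 ≤ ‖z‖ → ρ z = 0) {x : X}
    (hx : x ∉ (B.chart i).map '' closedBall 0 (ε / 2)) : ∀ᶠ x' in 𝓝 x, B.pushX i ε ρ x' = 0 := by
  filter_upwards [(hε.isClosed_image_closedBall i).isOpen_compl.mem_nhds hx] with x' hx'
  by_cases h : x' ∈ (B.chart i).map '' ball 0 ε
  · obtain ⟨z, hz, rfl⟩ := h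
    rw [hε.pushX_map i hρ hz]
    refine hs z ?_
    by_contra! hlt
    exact hx' ⟨z, mem_closedBall_zero_iff.2 hlt.le, rfl⟩
  · exact pushX_of_not_mem i h

lemma Good.contDiffAt_pushX {ρ : C2 → ℝ} (hρ : ∀ z, ρ (-z) = ρ z) (hs : ∀ z, ε / 2 ≤ ‖z‖ → ρ z = 0)
    [NormedSpace ℝ V] [IsScalarTower ℝ ℂ V] (hf : O.Hol f x)
    (h : ∀ z ∈ ball 0 ε, (B.chart i).map z = f x → ContDiffAt ℝ ∞ ρ z) :
    ContDiffAt ℝ ∞ (fun z => B.pushX i ε ρ (f z)) x := by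
  by_cases hx : f x ∈ (B.chart i).map '' ball 0 ε
  · obtain ⟨z, hz, hzx⟩ := hx
    obtain ⟨l₀, hl₀⟩ := hf.exists_lift (O.compatible _ (B.chart_mem i))
      ⟨z, hε.ball_subset i hz, hzx⟩
    obtain ⟨g, hg, hgz⟩ := ((B.chart i).map_eq_iff _ hl₀.1 _ (hε.ball_subset i hz)).1
      (by rw [hl₀.map_eq, hzx])
    obtain ⟨l, hl, hlx⟩ : ∃ l, LiftAt f (B.chart i) l x ∧ l x = z := ⟨_, hl₀.group_smul hg, hgz⟩
    have hlz : l x ∈ ball 0 ε ∧ ContDiffAt ℝ ∞ ρ (l x) := by rw [hlx]; exact ⟨hz, h z hz hzx⟩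
    have hev : (fun z => ρ (l z)) =ᶠ[𝓝 x] fun z => B.pushX i ε ρ (f z) := by
      filter_upwards [hl.2.1.continuousAt.preimage_mem_nhds (isOpen_ball.mem_nhds hlz.1),
        hl.2.2] with w h1 h2
      rw [← h2, hε.pushX_map i hρ h1]
    exact (hlz.2.comp x hl.2.1.contDiffAt_real).congr_of_eventuallyEq hev.symm
  · refine (contDiffAt_const (c := (0 : ℝ))).congr_of_eventuallyEq ?_
    exact hf.continuousAt.eventually (hε.pushX_eventually_zero i hρ hs fun h => hx
      (image_mono hε.closedBall_half_subset h))

lemma Good.pushHat_eventually_zero {ρ : C2 × ℂ → ℝ}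
    (hρ : ∀ y ∈ tube ε, ∀ τ : ℂˣ, ρ ((τ : ℂ) • y.1, (τ : ℂ)⁻¹ ^ 2 * y.2) = ρ y)
    (hs : ∀ y, (ε / 2) ^ 2 ≤ ‖y.2‖ * ‖y.1‖ ^ 2 → ρ y = 0) {x : Xhat}
    (hx : B.q x ∉ (B.chart i).map '' ball 0 ε) : ∀ᶠ x' in 𝓝 x, B.pushHat i ε ρ x' = 0 := by
  filter_upwards [B.continuous_q.continuousAt.preimage_mem_nhds
    ((hε.isClosed_image_closedBall i).isOpen_compl.mem_nhds fun h =>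
      hx (image_mono hε.closedBall_half_subset h))] with x' hx'
  by_cases h : ∃ y ∈ tube ε, B.Φ i y = x'
  · obtain ⟨y, hy, rfl⟩ := h
    rw [hε.pushHat_Φ i hρ hy]
    refine hs y ?_
    by_contra! hlt
    obtain ⟨s, hs⟩ := exists_sq y.2
    refine hx' ⟨s • y.1, ?_, (hε.q_Φ_sq i hy hs).2.symm⟩
    rw [mem_closedBall_zero_iff, norm_smul]
    rw [← hs, norm_pow, ← mul_pow] at hlt
    exact (lt_of_pow_lt_pow_left₀ 2 (by linarith [hε.pos]) hlt).le
  · exact dif_neg h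

lemma Good.smooth_pushHat {ρ : C2 × ℂ → ℝ}
    (hρ : ∀ y ∈ tube ε, ∀ τ : ℂˣ, ρ ((τ : ℂ) • y.1, (τ : ℂ)⁻¹ ^ 2 * y.2) = ρ y)
    (hs : ∀ y, (ε / 2) ^ 2 ≤ ‖y.2‖ * ‖y.1‖ ^ 2 → ρ y = 0) (h : ∀ y ∈ tube ε, ContDiffAt ℝ ∞ ρ y) :
    (OM).Smooth (B.pushHat i ε ρ) := by
  intro c hc x hx
  have hcx := (OM).hol_chart hc hx
  by_cases hm : B.q (c.map x) ∈ (B.chart i).map '' ball 0 ε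
  · obtain ⟨z, hz, hzx⟩ := hm
    obtain ⟨w, hw, hwx⟩ := hε.exists_tube i hz hzx.symm
    obtain ⟨l, hl, hlx, hle⟩ := B.exists_section_Φ i (hε.tube_subset i hw) hc hx hwx.symm
    have hev : (fun z => ρ (l z)) =ᶠ[𝓝 x] fun z => B.pushHat i ε ρ (c.map z) := by
      have hlw : l x ∈ tube ε := by rw [hlx]; exact hw
      filter_upwards [hl.continuousAt.preimage_mem_nhds ((isOpen_tube ε).mem_nhds hlw),
        hle] with v h1 h2
      rw [← h2, hε.pushHat_Φ i hρ h1]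
    refine (ContDiffAt.comp (g := ρ) x ?_ hl.contDiffAt_real).congr_of_eventuallyEq hev.symm
    rw [hlx]; exact h w hw
  · refine (contDiffAt_const (c := (0 : ℝ))).congr_of_eventuallyEq ?_
    exact hcx.continuousAt.eventually (hε.pushHat_eventually_zero i hρ hs hm)

end

/-! ### The form representing the Poincaré dual -/

/-- The function `2 log ‖z‖²` near `p i`, cut off. -/
def logF (B : Blowup O p Xhat) (i : Fin k) (ε : ℝ) : X → ℝ :=
  B.pushX i ε fun z => 2 * (cut ε (‖z‖ ^ 4) * log (‖z‖ ^ 2))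

lemma logF_even (z : C2) : 2 * (cut ε (‖-z‖ ^ 4) * log (‖-z‖ ^ 2)) =
    2 * (cut ε (‖z‖ ^ 4) * log (‖z‖ ^ 2)) := by rw [norm_neg]

lemma logF_supp (hε : 0 < ε) (z : C2) (hz : ε / 2 ≤ ‖z‖) :
    2 * (cut ε (‖z‖ ^ 4) * log (‖z‖ ^ 2)) = 0 := by
  rw [cut_zero hε (by gcongr), zero_mul, mul_zero]

lemma tube_third_subset (hε : 0 < ε) : tube (ε / 3) ⊆ tube ε :=
  tube_mono (by linarith) (by linarith)

section
variable (hε : B.Good ε) (i : Fin k) [NormedSpace ℝ V] [IsScalarTower ℝ ℂ V]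
include hε

lemma Good.logF_map (hz : z ∈ ball 0 (ε / 3)) :
    B.logF i ε ((B.chart i).map z) = 2 * log (‖z‖ ^ 2) := by
  have h0 := hε.pos
  rw [logF, hε.pushX_map i logF_even (ball_subset_ball (by linarith) hz), cut_one hε.pos, one_mul]
  rw [mem_ball_zero_iff] at hz
  gcongr

lemma Good.logF_q_Φ {y : C2 × ℂ} (hy : y ∈ tube (ε / 3)) :
    B.logF i ε (B.q (B.Φ i y)) = 2 * log (‖y.2‖ * ‖y.1‖ ^ 2) := by
  obtain ⟨s, hs⟩ := exists_sq y.2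
  have h1 := hε.q_Φ_sq i (tube_third_subset hε.pos hy) hs
  have h2 : s • y.1 ∈ ball 0 (ε / 3) := (smul_mem_ball_iff (by linarith [hε.pos]) hy.1).2
    (by rw [hs]; exact hy)
  rw [h1.2, hε.logF_map i h2, ← hs, norm_smul, mul_pow, norm_pow]

variable [T2Space X]

lemma Good.contDiffAt_logF
    (hf : O.Hol f x) (h : f x ≠ p i) : ContDiffAt ℝ ∞ (fun z => B.logF i ε (f z)) x := by
  refine hε.contDiffAt_pushX i logF_even (logF_supp hε.pos) hf fun z hz hzx => ?_
  have hz0 : z ≠ 0 := by rintro rfl; exact h (by rw [← hzx, B.map_zero])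
  refine contDiffAt_const.mul (ContDiffAt.mul ?_ (contDiffAt_log_norm_C2 hz0))
  refine (contDiff_cut ε).contDiffAt.comp z ?_
  have := (contDiff_norm_sq_C2.pow 2).contDiffAt (x := z)
  simpa only [← pow_mul] using this

/-- The function `log ‖z‖²` of two lifts through `Φ` differs by a pluriharmonic function. -/
lemma Good.ddc_log_norm_lift {l l' : V → C2 × ℂ} (hl : AnalyticAt ℂ l x) (hl' : AnalyticAt ℂ l' x)
    (hlt : l x ∈ tube (ε / 3)) (hlt' : l' x ∈ tube (ε / 3))
    (h : ∀ᶠ z in 𝓝 x, B.Φ i (l z) = B.Φ i (l' z)) (r : ℝ) :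
    ddc (fun z => r * log (‖(l' z).1‖ ^ 2)) x = ddc (fun z => r * log (‖(l z).1‖ ^ 2)) x := by
  obtain ⟨τ, hτ, hτe⟩ := B.exists_ratio_Φ i hl hl' (hε.tube_subset i
    (tube_third_subset hε.pos hlt)) (hε.tube_subset i (tube_third_subset hε.pos hlt')) h
  exact ddc_log_norm_smul hl.fst hlt.1 hτ (hτe.mono fun z hz => congrArg Prod.fst hz)

/-- The potentials of the form representing the Poincaré dual of `E i`: outside `E i` they are
`-2 log ‖z‖²` for the coordinate `z` at `p i`, cut off, and near `E i` this extends, up to a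
pluriharmonic function, as `-2 log ‖z‖²` in terms of `[z; u]`. -/
def dualPot : Potentials OM where
  IsPot c x φ :=
    (B.q (c.1.map x) ≠ p i ∧ φ =ᶠ[𝓝 x] fun z => -B.logF i ε (B.q (c.1.map z))) ∨
    ∃ l : C2 → C2 × ℂ, AnalyticAt ℂ l x ∧ l x ∈ tube (ε / 3) ∧
      (∀ᶠ z in 𝓝 x, B.Φ i (l z) = c.1.map z) ∧ φ =ᶠ[𝓝 x] fun z => -2 * log (‖(l z).1‖ ^ 2)
  exists_pot c x hx := by
    by_cases h : B.q (c.1.map x) = p i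
    · obtain ⟨y, hy, hy0, hyx⟩ := (hε.q_eq_p i).1 h
      obtain ⟨l, hl, hlx, hle⟩ := B.exists_section_Φ i (hε.tube_subset i hy) c.2 hx hyx.symm
      refine ⟨_, Or.inr ⟨l, hl, ?_, hle, EventuallyEq.rfl⟩⟩
      rw [hlx]
      refine ⟨hy.1, ?_⟩
      have := hε.pos
      rw [hy0, norm_zero, zero_mul]
      positivity
    · exact ⟨_, Or.inl ⟨h, EventuallyEq.rfl⟩⟩
  smooth := by
    rintro c x hx φ (⟨h, he⟩ | ⟨l, hl, hlt, hle, he⟩)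
    · refine ContDiffAt.congr_of_eventuallyEq ?_ he
      have hcx := (OM).hol_chart c.2 hx
      by_cases hr : B.q (c.1.map x) ∈ range p
      · obtain ⟨j, hj⟩ := hr
        have hnot : B.q (c.1.map x) ∉ (B.chart i).map '' ball 0 ε := by
          rintro ⟨z, hz, hzx⟩
          have hij : i ≠ j := by rintro rfl; exact h hj.symm
          exact hε.disjoint i j hij z hz 0 (mem_ball_self hε.pos)
            (by rw [hzx, B.map_zero, hj])
        refine (contDiffAt_const (c := (0 : ℝ))).congr_of_eventuallyEq ?_
        have h1 := hε.pushX_eventually_zero i logF_even (logF_supp hε.pos)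
          fun h => hnot (image_mono hε.closedBall_half_subset h)
        filter_upwards [(B.continuous_q.continuousAt.comp hcx.continuousAt).eventually h1] with z hz
        rw [neg_eq_zero]
        exact hz
      · exact (hε.contDiffAt_logF i (B.hol_q hcx hr) h).neg
    · refine ContDiffAt.congr_of_eventuallyEq ?_ he
      exact contDiffAt_const.mul (contDiffAt_log_norm_comp hl.fst hlt.1)
  eventually := by
    rintro c x hx φ (⟨h, he⟩ | ⟨l, hl, hlt, hle, he⟩)
    · have hcx := (OM).hol_chart c.2 hx
      filter_upwards [(B.continuous_q.continuousAt.comp hcx.continuousAt).eventually_ne h,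
        he.eventuallyEq_nhds] with z h1 h2
      exact Or.inl ⟨h1, h2⟩
    · filter_upwards [hl.eventually_analyticAt,
        hl.continuousAt.preimage_mem_nhds ((isOpen_tube _).mem_nhds hlt), hle.eventually_nhds,
        he.eventuallyEq_nhds] with z h1 h2 h3 h4
      exact Or.inr ⟨l, h1, h2, h3, h4⟩
  ddc_eq := by
    have mixed : ∀ (c : (OM).charts) (x : C2) (l : C2 → C2 × ℂ),
        x ∈ c.1.dom → AnalyticAt ℂ l x → l x ∈ tube (ε / 3) →
        (∀ᶠ z in 𝓝 x, B.Φ i (l z) = c.1.map z) → B.q (c.1.map x) ≠ p i →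
        ddc (fun z => -B.logF i ε (B.q (c.1.map z))) x =
          ddc (fun z => -2 * log (‖(l z).1‖ ^ 2)) x := by
      intro c x l hx hl hlt hle h
      have hlt' := tube_third_subset hε.pos hlt
      have hu : (l x).2 ≠ 0 := fun hu => h ((hε.q_eq_p i).2 ⟨l x, hlt', hu, hle.self_of_nhds⟩)
      have hua := hl.snd
      have hev : (fun z => -B.logF i ε (B.q (c.1.map z))) =ᶠ[𝓝 x]
          fun z => -2 * log (‖(l z).1‖ ^ 2) + -1 * log (‖(l z).2‖ ^ 2) := by
        filter_upwards [hl.continuousAt.preimage_mem_nhds ((isOpen_tube _).mem_nhds hlt), hle,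
          hua.continuousAt.eventually_ne hu] with z h1 h2 h3
        rw [← h2, hε.logF_q_Φ i h1, Real.log_mul (norm_ne_zero_iff.2 h3)
          (pow_ne_zero _ (norm_ne_zero_iff.2 h1.1)), Real.log_pow, Real.log_pow]
        push_cast; ring
      rw [hev.ddc_eq, ddc_add, ddc_const_mul _ (contDiffAt_log_norm_sq hua hu),
        ddc_log_norm_sq hua hu, smul_zero, add_zero]
      · exact contDiffAt_const.mul (contDiffAt_log_norm_comp hl.fst hlt.1)
      · exact contDiffAt_const.mul (contDiffAt_log_norm_sq hua hu)
    rintro c x hx φ φ' (⟨h, he⟩ | ⟨l, hl, hlt, hle, he⟩) (⟨h', he'⟩ | ⟨l', hl', hlt', hle', he'⟩)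
    · rw [he.ddc_eq, he'.ddc_eq]
    · rw [he.ddc_eq, he'.ddc_eq, mixed c x l' hx hl' hlt' hle' h]
    · rw [he.ddc_eq, he'.ddc_eq, mixed c x l hx hl hlt hle h']
    · rw [he.ddc_eq, he'.ddc_eq]
      exact hε.ddc_log_norm_lift i hl' hl hlt' hlt
        (by filter_upwards [hle, hle'] with z h1 h2; rw [h1, h2]) _
  comp := by
    rintro c c' h x φ hl (⟨h1, he⟩ | ⟨l, h1, h2, h3, he⟩)
    · refine Or.inl ⟨?_, ?_⟩
      · have h2 : c'.1.map (h x) = c.1.map x := hl.2.2.2.self_of_nhds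
        rwa [← h2]
      · filter_upwards [hl.2.2.1.continuousAt.eventually he, hl.2.2.2] with z g1 g2
        rw [g1, g2]; rfl
    · refine Or.inr ⟨fun z => l (h z), h1.comp hl.2.2.1, h2, ?_, hl.2.2.1.continuousAt.eventually he⟩
      filter_upwards [hl.2.2.1.continuousAt.eventually h3, hl.2.2.2] with z g1 g2
      rw [g1, g2]; rfl

/-- The pullback of the dual form through the tube. -/
lemma Good.pull_dual {l : V → C2 × ℂ} (hl : AnalyticAt ℂ l x) (hlt : l x ∈ tube (ε / 3)) :
    pull (dualPot hε i).form.1 (fun z => B.Φ i (l z)) x =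
      ddc (fun z => -2 * log (‖(l z).1‖ ^ 2)) x := by
  have hlt' := hε.tube_subset i (tube_third_subset hε.pos hlt)
  obtain ⟨c, hc, h, hh⟩ := (B.hol_Φ i hlt').comp hl
  obtain ⟨m, hm, hmx, hme⟩ := B.exists_section_Φ i hlt' hc hh.1 hh.map_eq
  have hmx' : m (h x) ∈ tube (ε / 3) := by rw [hmx]; exact hlt
  have e1 := (dualPot hε i).pull_form (c := ⟨c, hc⟩) hh
    (φ := fun z => -2 * log (‖(m z).1‖ ^ 2)) (Or.inr ⟨m, hm, hmx', hme, EventuallyEq.rfl⟩)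
  exact e1.trans (hε.ddc_log_norm_lift i hl (hm.comp hh.2.1) hlt hmx' (by
    filter_upwards [hh.2.1.continuousAt.eventually hme, hh.2.2] with z h1 h2
    rw [Function.comp_apply, h1, h2]; rfl) _)

/-- The pullback of the dual form outside the exceptional divisor. -/
lemma Good.pull_dual_off {f : V → Xhat} (hf : (OM).Hol f x) (h : B.q (f x) ≠ p i) :
    pull (dualPot hε i).form.1 f x = ddc (fun z => -B.logF i ε (B.q (f z))) x := by
  obtain ⟨c, hc, j, hj⟩ := hf
  rw [(dualPot hε i).pull_form (c := ⟨c, hc⟩) hj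
    (φ := fun z => -B.logF i ε (B.q (c.map z))) (Or.inl ⟨by rw [hj.map_eq]; exact h, EventuallyEq.rfl⟩)]
  refine Filter.EventuallyEq.ddc_eq ?_
  filter_upwards [hj.2.2] with z hz
  rw [hz]

end

/-! ### Normalised hermitian metrics -/

/-- Every metric can be modified so that it is given by the equivariant sections near the exceptional
divisors. -/
lemma Good.exists_normalised_metric [T2Space X] [T2Space Xhat] [SecondCountableTopology Xhat]
    (hε : B.Good ε) (L : CStarBundle OM) (m : Fin k → ℤ) (S : Fin k → C2 × ℂ → L.Total)
    (hS : ∀ i, ∀ y ∈ tube ε, L.HolAt (S i) y ∧ L.proj (S i y) = B.Φ i y ∧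
      ∀ τ : ℂˣ, S i ((τ : ℂ) • y.1, (τ : ℂ)⁻¹ ^ 2 * y.2) = τ ^ (-m i) • S i y) :
    ∃ H : L.HermitianMetric, ∀ i, ∀ y ∈ tube (ε / 3), H.len (S i y) = ‖y.1‖ ^ (-m i) := by
  obtain ⟨H⟩ := nonempty_hermitianMetric L
  let ρ : Fin k → C2 × ℂ → ℝ := fun i y => cut ε ((‖y.2‖ * ‖y.1‖ ^ 2) ^ 2) *
    (-(m i : ℝ) * (1 / 2) * log (‖y.1‖ ^ 2) - (1 / 2) * log (H.len (S i y) ^ 2))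
  have hpos := hε.pos
  have hρ : ∀ i, ∀ y ∈ tube ε, ∀ τ : ℂˣ, ρ i ((τ : ℂ) • y.1, (τ : ℂ)⁻¹ ^ 2 * y.2) = ρ i y := by
    intro i y hy τ
    have hτ : ‖(τ : ℂ)‖ ≠ 0 := norm_ne_zero_iff.2 τ.ne_zero
    have hy0 : ‖y.1‖ ≠ 0 := norm_ne_zero_iff.2 hy.1
    simp only [ρ, (hS i y hy).2.2 τ, H.len_smul, norm_smul, norm_mul, norm_pow, norm_inv]
    congr 1
    · congr 1
      field_simp
    · have hl := (H.len_pos (S i y)).ne'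
      rw [mul_pow, mul_pow, Real.log_mul (pow_ne_zero _ hτ) (pow_ne_zero _ hy0),
        Real.log_mul (pow_ne_zero _ (norm_ne_zero_iff.2 (Units.ne_zero _))) (pow_ne_zero _ hl)]
      simp only [Units.val_zpow_eq_zpow_val, norm_zpow, Real.log_pow, Real.log_zpow]
      push_cast; ring
  have hs : ∀ i y, (ε / 2) ^ 2 ≤ ‖y.2‖ * ‖y.1‖ ^ 2 → ρ i y = 0 := by
    intro i y hy
    simp only [ρ]
    rw [cut_zero hpos, zero_mul]
    calc (ε / 2) ^ 4 = ((ε / 2) ^ 2) ^ 2 := by ring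
      _ ≤ _ := by gcongr
  have hsm : ∀ i, ∀ y ∈ tube ε, ContDiffAt ℝ ∞ (ρ i) y := by
    intro i y hy
    refine ContDiffAt.mul ?_ (ContDiffAt.sub (contDiffAt_const.mul ?_)
      (contDiffAt_const.mul (H.contDiffAt_log (hS i y hy).1)))
    · refine (contDiff_cut ε).contDiffAt.comp y ?_
      have h1 : ContDiff ℝ ∞ fun y : C2 × ℂ => ‖y.2‖ ^ 2 * (‖y.1‖ ^ 2) ^ 2 :=
        ((contDiff_norm_sq ℂ).comp contDiff_snd).mul ((contDiff_norm_sq_C2.comp contDiff_fst).pow 2)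
      refine h1.contDiffAt.congr_of_eventuallyEq (Eventually.of_forall fun y => ?_)
      beta_reduce
      ring
    · exact contDiffAt_log_norm_comp analyticAt_fst hy.1
  have hG : (OM).Smooth fun x => ∑ i, B.pushHat i ε (ρ i) x :=
    fun c hc x hx => ContDiffAt.sum fun i _ => hε.smooth_pushHat i (hρ i) (hs i) (hsm i) c hc x hx
  refine ⟨H.twist hG, fun i y hy => ?_⟩
  have hy' := tube_third_subset hpos hy
  have hlen : (H.twist hG).len (S i y) = H.len (S i y) * Real.exp (∑ j, B.pushHat j ε (ρ j)
    (L.proj (S i y))) := rfl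
  have hsum : ∑ j, B.pushHat j ε (ρ j) (L.proj (S i y)) = ρ i y := by
    rw [(hS i y hy').2.1, Finset.sum_eq_single i, hε.pushHat_Φ i (hρ i) hy']
    · intro j _ hji
      refine dif_neg ?_
      rintro ⟨y', hy1, hy2⟩
      obtain ⟨s, hsy⟩ := exists_sq y.2
      obtain ⟨s', hsy'⟩ := exists_sq y'.2
      have e1 := hε.q_Φ_sq i hy' hsy
      have e2 := hε.q_Φ_sq j hy1 hsy'
      exact hε.disjoint j i hji _ e2.1 _ e1.1 (by rw [← e2.2, ← e1.2, hy2])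
    · simp
  rw [hlen, hsum]
  have hcut : cut ε ((‖y.2‖ * ‖y.1‖ ^ 2) ^ 2) = 1 := by
    refine cut_one hpos ?_
    calc (‖y.2‖ * ‖y.1‖ ^ 2) ^ 2 ≤ ((ε / 3) ^ 2) ^ 2 := by gcongr; exact hy.2.le
      _ = _ := by ring
  have hl := H.len_pos (S i y)
  have hy0 : 0 < ‖y.1‖ := norm_pos_iff.2 hy.1
  simp only [ρ, hcut, one_mul, Real.log_pow]
  rw [show -(m i : ℝ) * (1 / 2) * ((2 : ℕ) * log ‖y.1‖) - 1 / 2 * ((2 : ℕ) *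
    log (H.len (S i y))) = ((-m i : ℤ) : ℝ) * log ‖y.1‖ - log (H.len (S i y)) by
      push_cast; ring, Real.exp_sub, Real.exp_log hl, ← Real.log_zpow, Real.exp_log (by positivity)]
  field_simp

end Blowup
/-! ### The bundle on the orbifold -/

section
variable {L : CStarBundle O}

lemma continuousAt_units {κ : V → ℂˣ} (h : AnalyticAt ℂ (fun z => (κ z : ℂ)) x) : ContinuousAt κ x :=
  (Units.isOpenEmbedding_val (R := ℂ)).isInducing.continuousAt_iff.2 h.continuousAt

lemma CStarBundle.continuous_proj (L : CStarBundle O) : Continuous L.proj := by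
  refine continuous_iff_continuousAt.2 fun m => ?_
  obtain ⟨b, hb, hx⟩ := L.cover (L.proj m)
  obtain ⟨⟨x, w⟩, ⟨hxd, -⟩, rfl⟩ := b.surjOn hx
  rw [ContinuousAt, b.proj_triv x hxd]
  refine tendsto_nhds.2 fun W hW hxW => ?_
  have hU : IsOpen ((b.base.dom ∩ b.base.map ⁻¹' W) ×ˢ (univ : Set ℂˣ)) :=
    (b.base.continuousOn.isOpen_inter_preimage b.base.isOpen_dom hW).prod isOpen_univ
  refine Filter.mem_of_superset ((b.isOpen_image _ (prod_mono_left inter_subset_left) hU).mem_nhds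
    ⟨(x, w), ⟨⟨hxd, hxW⟩, trivial⟩, rfl⟩) ?_
  rintro _ ⟨⟨x', w'⟩, ⟨⟨h1, h2⟩, -⟩, rfl⟩
  rw [mem_preimage, b.proj_triv x' h1]
  exact h2

/-- The map `(z, w) ↦ w • s z` is continuous where the section `s` is holomorphic. -/
lemma CStarBundle.HolAt.continuousAt_smul {s : V → L.Total} (hs : L.HolAt s x) (w : ℂˣ) :
    ContinuousAt (fun y : V × ℂˣ => y.2 • s y.1) (x, w) := by
  obtain ⟨b, hb, h, κ, hx, hh, hκ, he⟩ := hs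
  have hκc := continuousAt_units hκ
  have h1 : ContinuousAt (fun y : V × ℂˣ => b.triv (h y.1, y.2 * κ y.1)) (x, w) := by
    have h2 : ContinuousAt b.triv (h x, w * κ x) := b.continuousOn.continuousAt
      ((b.base.isOpen_dom.prod isOpen_univ).mem_nhds ⟨hx, trivial⟩)
    refine ContinuousAt.comp (f := fun y : V × ℂˣ => (h y.1, y.2 * κ y.1)) h2 ?_
    exact (ContinuousAt.comp (g := h) (f := Prod.fst) hh.continuousAt continuousAt_fst).prodMk
      (continuousAt_snd.mul (ContinuousAt.comp (g := κ) (f := Prod.fst) hκc continuousAt_fst))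
  refine h1.congr ?_
  have h3 : ∀ᶠ z in 𝓝 x, h z ∈ b.base.dom :=
    hh.continuousAt.preimage_mem_nhds (b.base.isOpen_dom.mem_nhds hx)
  filter_upwards [continuousAt_fst.eventually he, continuousAt_fst.eventually h3] with y g1 g2
  rw [g1, b.smul_triv _ g2]

end

namespace Blowup

/-- Outside the exceptional divisor, `q` is an open map. -/
lemma isOpen_image_q (B : Blowup O p Xhat) {V : Set Xhat} (hV : IsOpen V)
    (hVp : ∀ x ∈ V, B.q x ∉ range p) : IsOpen (B.q '' V) := by
  refine isOpen_iff_mem_nhds.2 ?_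
  rintro _ ⟨x, hx, rfl⟩
  obtain ⟨c, hc, y, hy, hyx⟩ := O.cover (B.q x)
  obtain ⟨f, hf, hfe⟩ := B.exists_local_inverse_q hc hy (by rw [hyx]; exact hVp x hx)
  have hfy : f y = x := B.bijOn.injOn
    (by rw [mem_preimage, hfe.self_of_nhds, hyx]; exact hVp x hx) (hVp x hx)
    (by rw [hfe.self_of_nhds, hyx])
  have hn : ∀ᶠ z in 𝓝 y, f z ∈ V :=
    hf.continuousAt.preimage_mem_nhds (hV.mem_nhds (by rw [hfy]; exact hx))
  obtain ⟨N, hN, hNo, hyN⟩ := eventually_nhds_iff.1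
    ((hfe.and hn).and (c.isOpen_dom.mem_nhds hy))
  refine Filter.mem_of_superset ((c.isOpen_image N (fun z hz => (hN z hz).2) hNo).mem_nhds
    ⟨y, hyN, hyx⟩) ?_
  rintro _ ⟨z, hz, rfl⟩
  exact ⟨f z, (hN z hz).1.2, (hN z hz).1.1⟩

lemma isOpen_offE [T2Space X] (B : Blowup O p Xhat) (L : CStarBundle OM) :
    IsOpen {m : L.Total | B.q (L.proj m) ∉ range p} :=
  (Set.finite_range p).isClosed.isOpen_compl.preimage (B.continuous_q.comp L.continuous_proj)

/-- Outside `E i`, the map `z ↦ [z; 1]` is a local biholomorphism. -/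
lemma Good.exists_lift_Φ_one (hε : B.Good ε) (i : Fin k)
    {b : OrbiChart Xhat} (hb : ∀ c ∈ (OM).charts, b.Compatible c)
    {x : C2} (hx : x ∈ b.dom) (hz : z ∈ ball 0 ε) (h0 : z ≠ 0) (h : b.map x = B.Φ i (z, 1)) :
    ∃ f l : C2 → C2, AnalyticAt ℂ f z ∧ f z = x ∧ (∀ᶠ z' in 𝓝 z, b.map (f z') = B.Φ i (z', 1)) ∧
      AnalyticAt ℂ l x ∧ l x = z ∧ ∀ᶠ x' in 𝓝 x, f (l x') = x' := by
  have hq := B.q_Φ_one i (hε.ball_subset_r i hz) h0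
  have hr : (B.chart i).map z ∉ range p := fun hr => h0 ((hε.map_mem_range i hz).1 hr)
  obtain ⟨c', hc', y, hy, hyx⟩ := (OM).cover (b.map x)
  have h1 : LiftsBihol (fun v => B.q (id v)) b (B.chart i) x z :=
    (hb c' hc' x hx y hy hyx.symm).trans (B.bihol c' hc' _ (B.chart_mem i) y hy z
      (hε.ball_subset i hz) (by rw [hyx, h, hq]) hr)
  obtain ⟨l, f, hl, hlx, hf, hfl, hlf⟩ := h1
  have hfz : f z = x := by rw [← hlx, hfl.self_of_nhds]
  refine ⟨f, l, hf, hfz, ?_, hl.2.2.1, hlx, hfl⟩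
  have h2 : ∀ᶠ w in 𝓝 (f z), (B.chart i).map (l w) = B.q (b.map w) := by rw [hfz]; exact hl.2.2.2
  have h3 : ∀ᶠ z' in 𝓝 z, z' ∈ ball 0 ε := isOpen_ball.mem_nhds hz
  filter_upwards [hf.continuousAt.eventually h2, hlf, h3, eventually_ne_nhds h0] with z' g1 g2 g3 g4
  rw [g2] at g1
  have hq' := B.q_Φ_one i (hε.ball_subset_r i g3) g4
  have hr' : (B.chart i).map z' ∉ range p := fun hr => g4 ((hε.map_mem_range i g3).1 hr)
  exact B.bijOn.injOn (by rw [mem_preimage, ← g1]; exact hr') (by rw [mem_preimage, hq']; exact hr')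
    (by rw [← g1, hq'])

/-- A bundle on the blow-up together with equivariant sections of its pullback to the tubes. -/
structure TubeSections (B : Blowup O p Xhat) (ε : ℝ) (L : CStarBundle OM) where
  m : Fin k → ℤ
  S : Fin k → C2 × ℂ → L.Total
  spec : ∀ i, ∀ y ∈ tube ε, L.HolAt (S i) y ∧ L.proj (S i y) = B.Φ i y ∧
      ∀ τ : ℂˣ, S i ((τ : ℂ) • y.1, (τ : ℂ)⁻¹ ^ 2 * y.2) = τ ^ (-m i) • S i y

variable {L : CStarBundle (ComplexOrbifold.ofManifold Xhat)}

/-- The fibre of the bundle over a singular point: the quotient of `ℂ^×` by the action of the isotropy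
group. -/
abbrev SingFibre (n : ℤ) : Type := ℂˣ ⧸ Subgroup.zpowers ((-1 : ℂˣ) ^ n)

/-- The total space of the bundle on the orbifold: the given bundle over the complement of the
exceptional divisor, and `ℂ^× / ⟨(-1)^m⟩` over a singular point. -/
def DTotal (T : TubeSections B ε L) : Type u :=
  {m : L.Total // B.q (L.proj m) ∉ range p} ⊕ Σ i, SingFibre (T.m i)

variable (T : TubeSections B ε L)

instance : MulAction ℂˣ (DTotal T) where
  smul t
    | Sum.inl m => Sum.inl ⟨t • m.1, by rw [L.proj_smul]; exact m.2⟩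
    | Sum.inr w => Sum.inr ⟨w.1, t • w.2⟩
  one_smul
    | Sum.inl m => congrArg Sum.inl (Subtype.ext (one_smul _ _))
    | Sum.inr w => congrArg Sum.inr (Sigma.ext rfl (heq_of_eq (one_smul _ _)))
  mul_smul s t
    | Sum.inl m => congrArg Sum.inl (Subtype.ext (mul_smul _ _ _))
    | Sum.inr w => congrArg Sum.inr (Sigma.ext rfl (heq_of_eq (mul_smul _ _ _)))

/-- The projection of the bundle on the orbifold. -/
def dProj : DTotal T → X
  | Sum.inl m => B.q (L.proj m.1)
  | Sum.inr w => p w.1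

open Classical in
/-- The inclusion of the given bundle, outside the exceptional divisor (with arbitrary values over
the exceptional divisor). -/
def toTotal (m : L.Total) : DTotal T :=
  if h : B.q (L.proj m) ∉ range p then Sum.inl ⟨m, h⟩ else Sum.inr ⟨(not_not.1 h).choose, QuotientGroup.mk 1⟩

open Classical in
/-- The trivialization over the orbifold chart at a singular point. -/
def trivAt (i : Fin k) (y : C2 × ℂˣ) : DTotal T :=
  if y.1 = 0 then Sum.inr ⟨i, QuotientGroup.mk y.2⟩ else toTotal T (y.2 • T.S i (y.1, 1))

variable {T}

lemma toTotal_eq {m : L.Total} (h : B.q (L.proj m) ∉ range p) : toTotal T m = Sum.inl ⟨m, h⟩ :=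
  dif_pos h

lemma toTotal_inj {m m' : L.Total} (h : B.q (L.proj m) ∉ range p) (h' : B.q (L.proj m') ∉ range p) :
    toTotal T m = toTotal T m' ↔ m = m' := by
  rw [toTotal_eq h, toTotal_eq h']
  exact ⟨fun h => congrArg Subtype.val (Sum.inl.inj h), fun h => by subst h; rfl⟩

lemma dProj_toTotal {m : L.Total} (h : B.q (L.proj m) ∉ range p) :
    dProj T (toTotal T m) = B.q (L.proj m) := by rw [toTotal_eq h]; rfl

lemma smul_toTotal {m : L.Total} (h : B.q (L.proj m) ∉ range p) (t : ℂˣ) :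
    t • toTotal T m = toTotal T (t • m) := by
  rw [toTotal_eq h, toTotal_eq (by rw [L.proj_smul]; exact h)]; rfl

lemma trivAt_zero (i : Fin k) (w : ℂˣ) :
    trivAt T i (0, w) = Sum.inr ⟨i, QuotientGroup.mk w⟩ := if_pos rfl

lemma trivAt_ne {i : Fin k} (hz : z ≠ 0) (w : ℂˣ) :
    trivAt T i (z, w) = toTotal T (w • T.S i (z, 1)) := if_neg hz

lemma mem_tube_one' {r : ℝ} (hz : z ∈ ball 0 r) (h0 : z ≠ 0) : ((z, 1) : C2 × ℂ) ∈ tube r := by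
  have := mem_tube_one hz h0
  rwa [one_pow] at this

lemma TubeSections.holAt_one (i : Fin k) (hz : z ∈ ball 0 ε) (h0 : z ≠ 0) :
    L.HolAt (fun z => T.S i (z, 1)) z :=
  (T.spec i _ (mem_tube_one' hz h0)).1.comp (g := fun z : C2 => (z, (1 : ℂ)))
    (analyticAt_id.prod analyticAt_const)

lemma trivAt_neg (i : Fin k) (hz : z ∈ ball 0 ε) (w : ℂˣ) :
    trivAt T i (-z, (-1) ^ T.m i * w) = trivAt T i (z, w) := by
  by_cases h0 : z = 0
  · subst h0
    rw [neg_zero, trivAt_zero, trivAt_zero]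
    congr 2
    refine QuotientGroup.eq.2 ?_
    rw [mul_inv, mul_assoc, inv_mul_cancel, mul_one]
    exact Subgroup.inv_mem _ (Subgroup.mem_zpowers _)
  · rw [trivAt_ne (neg_ne_zero.2 h0), trivAt_ne h0]
    have h1 := (T.spec i _ (mem_tube_one' hz h0)).2.2 (-1)
    simp only [Units.val_neg, Units.val_one, neg_smul, one_smul, mul_one, inv_neg, inv_one, even_two,
      Even.neg_pow, one_pow] at h1
    rw [h1, smul_smul]
    congr 2
    rw [mul_right_comm, ← zpow_add, add_neg_cancel, zpow_zero, one_mul]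

section
variable (hε : B.Good ε) (i : Fin k)
include hε

lemma q_proj_S (hz : z ∈ ball 0 ε) (h0 : z ≠ 0) (w : ℂˣ) :
    B.q (L.proj (w • T.S i (z, 1))) = (B.chart i).map z := by
  rw [L.proj_smul, (T.spec i _ (mem_tube_one' hz h0)).2.1, B.q_Φ_one i (hε.ball_subset_r i hz) h0]

lemma q_proj_S_not_mem (hz : z ∈ ball 0 ε) (h0 : z ≠ 0) (w : ℂˣ) :
    B.q (L.proj (w • T.S i (z, 1))) ∉ range p := by
  rw [q_proj_S hε i hz h0, hε.map_mem_range i hz]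
  exact h0

lemma dProj_trivAt (hz : z ∈ ball 0 ε) (w : ℂˣ) :
    dProj T (trivAt T i (z, w)) = (B.chart i).map z := by
  by_cases h0 : z = 0
  · subst h0
    rw [trivAt_zero, B.map_zero]; rfl
  · rw [trivAt_ne h0, dProj_toTotal (q_proj_S_not_mem hε i hz h0 w), q_proj_S hε i hz h0]

lemma smul_trivAt (hz : z ∈ ball 0 ε) (t w : ℂˣ) :
    trivAt T i (z, t * w) = t • trivAt T i (z, w) := by
  by_cases h0 : z = 0
  · subst h0
    rw [trivAt_zero, trivAt_zero]; rfl
  · rw [trivAt_ne h0, trivAt_ne h0, smul_toTotal (q_proj_S_not_mem hε i hz h0 w), mul_smul]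

/-- A trivialization at `p i` meets the given bundle only outside the zero of the chart. -/
lemma eq_smul_of_toTotal_eq_trivAt {m : L.Total} (hm : B.q (L.proj m) ∉ range p)
    (hz : z ∈ ball 0 ε) {w : ℂˣ} (h : toTotal T m = trivAt T i (z, w)) :
    z ≠ 0 ∧ m = w • T.S i (z, 1) := by
  have h0 : z ≠ 0 := by
    rintro rfl
    have := congrArg (dProj T) h
    rw [dProj_toTotal hm, dProj_trivAt hε i hz, B.map_zero] at this
    exact hm (this ▸ ⟨i, rfl⟩)
  rw [trivAt_ne h0, toTotal_inj hm (q_proj_S_not_mem hε i hz h0 w)] at h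
  exact ⟨h0, h⟩

lemma trivAt_eq_iff {z z' : C2} (hz : z ∈ ball 0 ε)
    (hz' : z' ∈ ball 0 ε) (v w : ℂˣ) : trivAt T i (z, v) = trivAt T i (z', w) ↔
      (z' = z ∧ w = v) ∨ (z' = -z ∧ w = (-1) ^ T.m i * v) := by
  constructor
  · intro h
    have hm : (B.chart i).map z = (B.chart i).map z' := by
      rw [← dProj_trivAt hε i hz v, h, dProj_trivAt hε i hz' w]
    by_cases h0 : z = 0
    · subst h0
      have h0' : z' = 0 := by
        rcases (hε.map_eq_map i hz hz').1 hm with h1 | h1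
        · exact h1
        · rw [h1, neg_zero]
      subst h0'
      rw [trivAt_zero, trivAt_zero] at h
      have h2 := eq_of_heq (Sigma.mk.inj (Sum.inr.inj h)).2
      obtain ⟨n, hn⟩ := Subgroup.mem_zpowers_iff.1 (QuotientGroup.eq.1 h2)
      have h3 : w = ((-1) ^ T.m i) ^ n * v := by rw [hn]; rw [mul_comm v⁻¹ w]; simp
      rw [← zpow_mul, mul_comm (T.m i), zpow_mul] at h3
      rcases Int.even_or_odd n with hn' | hn'
      · left; rw [hn'.neg_one_zpow, one_zpow, one_mul] at h3; exact ⟨rfl, h3⟩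
      · right; rw [hn'.neg_one_zpow] at h3; exact ⟨neg_zero.symm, h3⟩
    · have key : ∀ v' : ℂˣ, trivAt T i (z, v') = trivAt T i (z, v) → v' = v := by
        intro v' h'
        rw [trivAt_ne h0, trivAt_ne h0, toTotal_inj (q_proj_S_not_mem hε i hz h0 _)
          (q_proj_S_not_mem hε i hz h0 _)] at h'
        exact smul_left_cancel' h'
      rcases (hε.map_eq_map i hz hz').1 hm with h1 | h1
      · left
        subst h1
        exact ⟨rfl, key w h.symm⟩
      · right
        subst h1
        refine ⟨rfl, ?_⟩
        have h2 := trivAt_neg (T := T) i hz ((-1) ^ (-T.m i) * w)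
        rw [← mul_assoc, ← zpow_add, add_neg_cancel, zpow_zero, one_mul] at h2
        have h3 := key _ (h2.symm.trans h.symm)
        rw [← h3, ← mul_assoc, ← zpow_add, add_neg_cancel, zpow_zero, one_mul]
  · rintro (⟨rfl, rfl⟩ | ⟨rfl, rfl⟩)
    · rfl
    · exact (trivAt_neg i hz v).symm

end

variable (T)

/-- A set is open if its preimages in the given bundle and in all `ball 0 ε × ℂ^×` are open. -/
instance [T2Space X] : TopologicalSpace (DTotal T) where
  IsOpen U := IsOpen {m : L.Total | B.q (L.proj m) ∉ range p ∧ toTotal T m ∈ U} ∧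
    ∀ i, IsOpen {y : C2 × ℂˣ | y.1 ∈ ball 0 ε ∧ trivAt T i y ∈ U}
  isOpen_univ := by
    refine ⟨?_, fun i => ?_⟩
    · simpa only [mem_univ, and_true] using isOpen_offE B L
    · simp only [mem_univ, and_true]
      exact isOpen_ball.preimage continuous_fst
  isOpen_inter := by
    rintro U V ⟨h1, h2⟩ ⟨h1', h2'⟩
    refine ⟨?_, fun i => ?_⟩
    · convert h1.inter h1' using 1
      ext m; simp only [mem_ofPred_eq, mem_inter_iff]; tauto
    · convert (h2 i).inter (h2' i) using 1
      ext m; simp only [mem_ofPred_eq, mem_inter_iff]; tauto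
  isOpen_sUnion := by
    intro s hs
    refine ⟨?_, fun i => ?_⟩
    · convert isOpen_biUnion fun U hU => (hs U hU).1 using 1
      ext m; simp only [mem_ofPred_eq, mem_sUnion, mem_iUnion]; tauto
    · convert isOpen_biUnion fun U hU => (hs U hU).2 i using 1
      ext m; simp only [mem_ofPred_eq, mem_sUnion, mem_iUnion]; tauto

variable {T} [T2Space X]

section
variable (hε : B.Good ε) (i : Fin k)
include hε

lemma isOpen_image_toTotal {V : Set L.Total} (hV : IsOpen V)
    (hVp : ∀ m ∈ V, B.q (L.proj m) ∉ range p) : IsOpen (toTotal T '' V) := by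
  refine ⟨?_, fun i => ?_⟩
  · convert hV using 1
    ext m
    constructor
    · rintro ⟨h1, m', h2, h3⟩
      rwa [← (toTotal_inj (hVp m' h2) h1).1 h3]
    · exact fun h => ⟨hVp m h, m, h, rfl⟩
  · refine isOpen_iff_mem_nhds.2 ?_
    rintro ⟨z, w⟩ ⟨hz, m, hm, hmz⟩
    dsimp only at hz
    obtain ⟨h0, hmz'⟩ := eq_smul_of_toTotal_eq_trivAt hε i (hVp m hm) hz hmz
    have hc := (T.holAt_one i hz h0).continuousAt_smul w
    have hV' : V ∈ 𝓝 (w • T.S i (z, 1)) := hV.mem_nhds (by rwa [← hmz'])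
    filter_upwards [hc.preimage_mem_nhds hV',
      continuousAt_fst.preimage_mem_nhds (isOpen_ball.mem_nhds hz),
      continuousAt_fst.eventually_ne h0] with y h1 h2 h3
    exact ⟨h2, _, h1, (trivAt_ne h3 y.2).symm⟩

lemma isOpen_image_trivAt {U : Set (C2 × ℂˣ)} (hU : IsOpen U)
    (hUb : U ⊆ ball 0 ε ×ˢ univ) : IsOpen (trivAt T i '' U) := by
  refine ⟨?_, fun j => ?_⟩
  · refine isOpen_iff_mem_nhds.2 ?_
    rintro m ⟨hm, ⟨z, w⟩, hzw, hmz⟩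
    have hz : z ∈ ball 0 ε := (hUb hzw).1
    obtain ⟨h0, hmz'⟩ := eq_smul_of_toTotal_eq_trivAt hε i hm hz hmz.symm
    have hsp := T.spec i _ (mem_tube_one' hz h0)
    obtain ⟨b, hb, x, hx, hxm⟩ := L.cover (L.proj m)
    have hxΦ : b.base.map x = B.Φ i (z, 1) := by rw [hxm, hmz', L.proj_smul, hsp.2.1]
    obtain ⟨f, l, hf, hfz, hfe, hl, hlx, hfl⟩ :=
      hε.exists_lift_Φ_one i b.base_compatible hx hz h0 hxΦ
    have hfd : f z ∈ b.base.dom := by rw [hfz]; exact hx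
    have hball : ∀ᶠ z' in 𝓝 z, z' ∈ ball 0 ε := isOpen_ball.mem_nhds hz
    have hfd' : ∀ᶠ z' in 𝓝 z, f z' ∈ b.base.dom :=
      hf.continuousAt.preimage_mem_nhds (b.base.isOpen_dom.mem_nhds hfd)
    obtain ⟨κ, hκ, hκe⟩ := (BundleChart.hol_of_lift hb hfd hf).exists_ratio (T.holAt_one i hz h0) (by
      filter_upwards [hfe, hball, hfd', eventually_ne_nhds h0] with z' g1 g2 g3 g4
      rw [b.proj_triv _ g3, g1, (T.spec i _ (mem_tube_one' g2 g4)).2.1])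
    have hκc := continuousAt_units hκ
    have hm2 : m = b.triv (x, w * κ z) := by
      have := hκe.self_of_nhds
      rw [b.smul_triv x hx, hmz', this, hfz, ← b.triv_mul hx]
    -- Near `m`, the inverse of `(z, w) ↦ w • S z` is `(x', w') ↦ (l x', w' κ⁻¹)`.
    have hlt : Tendsto l (𝓝 x) (𝓝 z) := by
      have := hl.continuousAt
      rwa [ContinuousAt, hlx] at this
    have hev : ∀ᶠ y : C2 × ℂˣ in 𝓝 (x, w * κ z), (l y.1, y.2 * (κ (l y.1))⁻¹) ∈ U ∧ l y.1 ≠ 0 ∧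
        l y.1 ∈ ball 0 ε ∧ y.1 ∈ b.base.dom ∧
        (y.2 * (κ (l y.1))⁻¹) • T.S i (l y.1, 1) = b.triv y := by
      have hl1 : Tendsto (fun y : C2 × ℂˣ => l y.1) (𝓝 (x, w * κ z)) (𝓝 z) :=
        hlt.comp continuousAt_fst
      have h1 : Tendsto (fun y : C2 × ℂˣ => (l y.1, y.2 * (κ (l y.1))⁻¹)) (𝓝 (x, w * κ z))
          (𝓝 (z, w)) := by
        refine hl1.prodMk_nhds ?_
        have h3 : Tendsto (Prod.snd : C2 × ℂˣ → ℂˣ) (𝓝 (x, w * κ z)) (𝓝 (w * κ z)) :=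
          continuous_snd.tendsto _
        have h2 : Tendsto (fun y : C2 × ℂˣ => y.2 * (κ (l y.1))⁻¹) (𝓝 (x, w * κ z))
          (𝓝 (w * κ z * (κ z)⁻¹)) := h3.mul ((Tendsto.comp hκc hl1).inv)
        rwa [mul_inv_cancel_right] at h2
      filter_upwards [h1.eventually (hU.mem_nhds hzw), hl1.eventually (eventually_ne_nhds h0),
        hl1.eventually hball, continuousAt_fst.preimage_mem_nhds (b.base.isOpen_dom.mem_nhds hx),
        hl1.eventually hκe, continuousAt_fst.eventually hfl] with y g1 g2 g3 g4 g5 g6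
      refine ⟨g1, g2, g3, g4, ?_⟩
      rw [g5, smul_smul, inv_mul_cancel_right, g6, ← b.triv_mul g4]
    obtain ⟨N, hN, hNo, hxN⟩ := eventually_nhds_iff.1 hev
    refine Filter.mem_of_superset ((b.isOpen_image N
      (fun y hy => ⟨(hN y hy).2.2.2.1, trivial⟩) hNo).mem_nhds ⟨_, hxN, hm2.symm⟩) ?_
    rintro _ ⟨y, hy, rfl⟩
    obtain ⟨g1, g2, g3, g4, g5⟩ := hN y hy
    refine ⟨?_, _, g1, ?_⟩
    · rw [← g5]; exact q_proj_S_not_mem hε i g3 g2 _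
    · rw [trivAt_ne g2, g5]
  · by_cases hij : j = i
    · subst hij
      have hγ : Continuous fun y : C2 × ℂˣ => (-y.1, ((-1) ^ T.m j)⁻¹ * y.2) := by fun_prop
      convert hU.union ((hU.preimage hγ).inter (isOpen_ball.preimage continuous_fst)) using 1
      ext ⟨z, w⟩
      constructor
      · rintro ⟨hz, ⟨z', w'⟩, h1, h2⟩
        rcases (trivAt_eq_iff hε j (hUb h1).1 hz w' w).1 h2 with ⟨rfl, rfl⟩ | ⟨rfl, rfl⟩
        · exact Or.inl h1
        · refine Or.inr ⟨?_, hz⟩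
          rw [mem_preimage, neg_neg, inv_mul_cancel_left]
          exact h1
      · rintro (h | ⟨h, hz⟩)
        · exact ⟨(hUb h).1, _, h, rfl⟩
        · refine ⟨hz, _, h, ?_⟩
          have := trivAt_neg (T := T) j (hUb h).1 (((-1) ^ T.m j)⁻¹ * w)
          rwa [neg_neg, mul_inv_cancel_left, eq_comm] at this
    · convert isOpen_empty using 1
      refine eq_empty_of_forall_notMem ?_
      rintro ⟨z, w⟩ ⟨hz, ⟨z', w'⟩, h1, h2⟩
      have := congrArg (dProj T) h2
      rw [dProj_trivAt hε i (hUb h1).1, dProj_trivAt hε j hz] at this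
      exact hε.disjoint i j (Ne.symm hij) z' (hUb h1).1 z hz this

end

lemma continuousOn_toTotal : ContinuousOn (toTotal T) {m | B.q (L.proj m) ∉ range p} := by
  refine (continuousOn_open_iff (isOpen_offE B L)).2 fun U hU => ?_
  exact hU.1

lemma continuousOn_trivAt (i : Fin k) : ContinuousOn (trivAt T i) (ball 0 ε ×ˢ univ) := by
  refine (continuousOn_open_iff (isOpen_ball.prod isOpen_univ)).2 fun U hU => ?_
  convert hU.2 i using 1
  ext y
  simp only [mem_inter_iff, mem_prod, mem_univ, and_true, mem_preimage, mem_ofPred_eq]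

end Blowup
/-- Multiplication by `-1` on `ℂ²`. -/
def negEquiv : C2 ≃L[ℂ] C2 := ContinuousLinearEquiv.neg ℂ

lemma negEquiv_apply (x : C2) : negEquiv x = -x := rfl

lemma negEquiv_mul_self : negEquiv * negEquiv = 1 := by
  refine ContinuousLinearEquiv.ext (funext fun x => ?_)
  change negEquiv (negEquiv x) = x
  rw [negEquiv_apply, negEquiv_apply, neg_neg]

lemma negEquiv_ne_one : negEquiv ≠ 1 := by
  intro h
  have : (-1 : ℂ) = 1 := congrArg (fun g : C2 ≃L[ℂ] C2 => g !₂[1, 0] 0) h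
  norm_num at this

/-- The group `{1, -1}` acting on `ℂ²`. -/
def negGroup : Subgroup (C2 ≃L[ℂ] C2) where
  carrier := {1, negEquiv}
  one_mem' := Or.inl rfl
  mul_mem' := by
    rintro _ _ (rfl | rfl) (rfl | rfl)
    · exact Or.inl (one_mul _)
    · exact Or.inr (one_mul _)
    · exact Or.inr (mul_one _)
    · exact Or.inl negEquiv_mul_self
  inv_mem' := by
    rintro _ (rfl | rfl)
    · exact Or.inl inv_one
    · exact Or.inr (inv_eq_of_mul_eq_one_left negEquiv_mul_self)

lemma exists_negGroup {P : (C2 ≃L[ℂ] C2) → Prop} : (∃ g ∈ negGroup, P g) ↔ P 1 ∨ P negEquiv := by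
  constructor
  · rintro ⟨g, rfl | rfl, h⟩
    exacts [Or.inl h, Or.inr h]
  · rintro (h | h)
    exacts [⟨_, Or.inl rfl, h⟩, ⟨_, Or.inr rfl, h⟩]

namespace Blowup

variable {L : CStarBundle (ComplexOrbifold.ofManifold Xhat)}

/-- The orbifold chart at `p i`, restricted to the ball of radius `ε`. -/
def Good.ballChart (hε : B.Good ε) (i : Fin k) : OrbiChart X where
  dom := ball 0 ε
  Γ := negGroup
  map := (B.chart i).map
  isOpen_dom := isOpen_ball
  finite := (Set.toFinite {1, negEquiv}).to_subtype
  apply_mem := by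
    rintro g (rfl | rfl) x hx
    · exact hx
    · rwa [negEquiv_apply, mem_ball_zero_iff, norm_neg, ← mem_ball_zero_iff]
  continuousOn := (B.chart i).continuousOn.mono (hε.ball_subset i)
  isOpen_image U hU hUo := (B.chart i).isOpen_image U (hU.trans (hε.ball_subset i)) hUo
  map_eq_iff x hx y hy := by
    rw [hε.map_eq_map i hx hy, exists_negGroup, negEquiv_apply, eq_comm (a := -x)]
    exact or_congr eq_comm Iff.rfl

lemma Good.ballChart_compatible (hε : B.Good ε) (i : Fin k)
    (hc : c ∈ O.charts) : (hε.ballChart i).Compatible c := by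
  intro x hx y hy hxy
  obtain ⟨h, k, h1, h2⟩ := O.compatible _ (B.chart_mem i) c hc x (hε.ball_subset i hx) y hy hxy
  exact ⟨h, k, ⟨hx, h1.2⟩, h2⟩

variable (B) in
/-- The part of a chart of the blow-up outside the exceptional divisor, regarded as a chart of the
orbifold. -/
def offChart [T2Space X] (c : OrbiChart Xhat) : OrbiChart X where
  dom := c.dom ∩ c.map ⁻¹' (B.q ⁻¹' (range p)ᶜ)
  Γ := c.Γ
  map x := B.q (c.map x)
  isOpen_dom := c.continuousOn.isOpen_inter_preimage c.isOpen_dom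
    ((Set.finite_range p).isClosed.isOpen_compl.preimage B.continuous_q)
  finite := c.finite
  apply_mem g hg x hx := by
    have h := c.apply_mem g hg x hx.1
    refine ⟨h, ?_⟩
    rw [mem_preimage, ← (c.map_eq_iff x hx.1 _ h).2 ⟨g, hg, rfl⟩]
    exact hx.2
  continuousOn := B.continuous_q.comp_continuousOn (c.continuousOn.mono inter_subset_left)
  isOpen_image U hU hUo := by
    rw [← Function.comp_def, image_comp]
    refine B.isOpen_image_q (c.isOpen_image U (hU.trans inter_subset_left) hUo) ?_
    rintro _ ⟨x, hx, rfl⟩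
    exact (hU hx).2
  map_eq_iff x hx y hy := by rw [B.bijOn.injOn.eq_iff hx.2 hy.2, c.map_eq_iff x hx.1 y hy.1]

lemma offChart_compatible [T2Space X] {c : OrbiChart Xhat}
    (hc : ∀ c' ∈ (OM).charts, c.Compatible c') {c' : OrbiChart X}
    (hc' : c' ∈ O.charts) : (B.offChart c).Compatible c' := by
  intro x hx y hy hxy
  obtain ⟨c'', hc'', z, hz, hzx⟩ := (OM).cover (c.map x)
  have hr : c'.map y ∉ range p := by rw [← hxy]; exact hx.2
  obtain ⟨h, k, h1, h2⟩ := (hc c'' hc'' x hx.1 z hz hzx.symm).trans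
    (B.bihol c'' hc'' c' hc' z hz y hy (by rw [hzx]; exact hxy) hr)
  exact ⟨h, k, ⟨hx, h1.2⟩, h2⟩

variable [T2Space X]

lemma q_proj_triv (b : BundleChart OM L.proj) {x : C2} (hx : x ∈ (B.offChart b.base).dom) (w : ℂˣ) :
    B.q (L.proj (b.triv (x, w))) ∉ range p := by
  rw [b.proj_triv x hx.1]; exact hx.2

/-- A trivialization of the bundle on the blow-up, regarded as a trivialization of the bundle on the
orbifold, outside the singular points. -/
def Good.offTriv (hε : B.Good ε) (T : TubeSections B ε L)
    (b : BundleChart OM L.proj) : BundleChart O (dProj T) where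
  base := B.offChart b.base
  base_compatible c hc := offChart_compatible b.base_compatible hc
  mult := b.mult
  analytic_mult g hg := (b.analytic_mult g hg).mono inter_subset_left
  mult_mul g hg h hh x hx := b.mult_mul g hg h hh x hx.1
  triv y := toTotal T (b.triv y)
  proj_triv x hx w := by
    rw [dProj_toTotal (q_proj_triv b hx w), b.proj_triv x hx.1]; rfl
  smul_triv x hx t w := by
    rw [b.smul_triv x hx.1, smul_toTotal (q_proj_triv b hx w)]
  surjOn := by
    rintro (m | w) ⟨x, hx, hxm⟩
    · have h1 : b.base.map x = L.proj m.1 := B.bijOn.injOn hx.2 m.2 hxm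
      obtain ⟨⟨x', w⟩, hx', hm⟩ := b.surjOn ⟨x, hx.1, h1⟩
      refine ⟨(x', w), ⟨⟨hx'.1, ?_⟩, trivial⟩, ?_⟩
      · change B.q (b.base.map x') ∉ range p
        rw [← b.proj_triv x' hx'.1 w, hm]; exact m.2
      · exact (congrArg (toTotal T) hm).trans (toTotal_eq m.2)
    · exact absurd ⟨w.1, hxm.symm⟩ hx.2
  continuousOn := by
    refine continuousOn_toTotal.comp (b.continuousOn.mono (prod_mono_left inter_subset_left)) ?_
    exact fun y hy => q_proj_triv b hy.1 y.2
  isOpen_image U hU hUo := by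
    rw [← Function.comp_def, image_comp]
    refine isOpen_image_toTotal hε
      (b.isOpen_image U (hU.trans (prod_mono_left inter_subset_left)) hUo) ?_
    rintro _ ⟨y, hy, rfl⟩
    exact q_proj_triv b (hU hy).1 y.2
  triv_eq_iff x hx y hy v w := by
    rw [toTotal_inj (q_proj_triv b hx v) (q_proj_triv b hy w), b.triv_eq_iff x hx.1 y hy.1]
    rfl

open Classical in
/-- The trivialization of the bundle on the orbifold over the chart at `p i`. -/
def Good.singTriv (hε : B.Good ε) (T : TubeSections B ε L) (i : Fin k) :
    BundleChart O (dProj T) where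
  base := hε.ballChart i
  base_compatible c hc := hε.ballChart_compatible i hc
  mult g _ := if g = 1 then 1 else (-1) ^ T.m i
  analytic_mult _ _ := analyticOnNhd_const
  mult_mul := by
    have hsq : ((-1 : ℂˣ) ^ T.m i) * (-1) ^ T.m i = 1 := by
      rw [← zpow_add, Even.neg_one_zpow ⟨_, rfl⟩]
    rintro g (rfl | rfl) h (rfl | rfl) x -
    · simp
    · simp
    · simp
    · rw [negEquiv_mul_self, if_pos rfl, if_neg negEquiv_ne_one, hsq]
  triv := trivAt T i
  proj_triv x hx w := dProj_trivAt hε i hx w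
  smul_triv x hx t w := smul_trivAt hε i hx t w
  surjOn := by
    rintro (m | ⟨j, w⟩) ⟨z, hz, hzm⟩
    · have hr : (B.chart i).map z ∉ range p := by
        change (B.chart i).map z = B.q (L.proj m.1) at hzm
        rw [hzm]; exact m.2
      have h0 : z ≠ 0 := fun h => hr ((hε.map_mem_range i hz).2 h)
      have hq := q_proj_S (T := T) hε i hz h0 1
      have h1 : L.proj (T.S i (z, 1)) = L.proj m.1 := by
        rw [one_smul] at hq
        exact B.bijOn.injOn (by rw [mem_preimage, hq]; exact hr) m.2 (by rw [hq]; exact hzm)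
      obtain ⟨t, ht⟩ := L.exists_smul_eq h1
      refine ⟨(z, t), ⟨hz, trivial⟩, ?_⟩
      rw [trivAt_ne h0, ht, toTotal_eq m.2]
    · have hz0 : z = 0 := (hε.map_mem_range i hz).1 ⟨j, hzm.symm⟩
      subst hz0
      have hji : j = i := by
        by_contra hne
        refine hε.disjoint i j (Ne.symm hne) 0 hz 0 hz ?_
        rw [B.map_zero j]; exact hzm
      subst hji
      obtain ⟨t, rfl⟩ := QuotientGroup.mk_surjective w
      exact ⟨(0, t), ⟨hz, trivial⟩, trivAt_zero j t⟩
  continuousOn := continuousOn_trivAt i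
  isOpen_image U hU hUo := isOpen_image_trivAt hε i hUo hU
  triv_eq_iff x hx y hy v w := by
    refine (trivAt_eq_iff hε i hx hy v w).trans (Iff.trans ?_ exists_negGroup.symm)
    rw [if_pos rfl, if_neg negEquiv_ne_one, one_mul, negEquiv_apply]
    exact or_congr (and_congr eq_comm eq_comm) (and_congr eq_comm eq_comm)

/-- The transition function between the trivialization at `p i` and one outside the exceptional
divisor. -/
lemma exists_transition (hε : B.Good ε) (T : TubeSections B ε L) {b : BundleChart OM L.proj}
    (hb : b ∈ L.charts) (i : Fin k) {f g : C2 → C2} {x : C2} (hf : AnalyticAt ℂ f x)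
    (hg : AnalyticAt ℂ g x) (hfx : f x ∈ ball 0 ε) (hgx : g x ∈ (B.offChart b.base).dom)
    (he : ∀ᶠ z in 𝓝 x, (B.chart i).map (f z) = B.q (b.base.map (g z))) :
    ∃ κ : C2 → ℂˣ, AnalyticAt ℂ (fun z => (κ z : ℂ)) x ∧ ∀ᶠ z in 𝓝 x, ∀ w,
      trivAt T i (f z, κ z * w) = toTotal T (b.triv (g z, w)) := by
  have hev : ∀ᶠ z in 𝓝 x, g z ∈ b.base.dom ∧ f z ∈ ball 0 ε ∧ f z ≠ 0 ∧
      L.proj (T.S i (f z, 1)) = L.proj (b.triv (g z, 1)) := by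
    filter_upwards [he, hg.continuousAt.preimage_mem_nhds ((B.offChart b.base).isOpen_dom.mem_nhds hgx),
      hf.continuousAt.preimage_mem_nhds (isOpen_ball.mem_nhds hfx)] with z h1 h2 h3
    have h0 : f z ≠ 0 := fun h0 => h2.2 (by rw [← h1]; exact (hε.map_mem_range i h3).2 h0)
    have hq := q_proj_S (T := T) hε i h3 h0 1
    rw [one_smul] at hq
    refine ⟨h2.1, h3, h0, B.bijOn.injOn ?_ ?_ ?_⟩
    · rw [mem_preimage, hq, h1]; exact h2.2
    · rw [mem_preimage, b.proj_triv _ h2.1]; exact h2.2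
    · rw [hq, b.proj_triv _ h2.1, h1]
  have hx := hev.self_of_nhds
  obtain ⟨κ, hκ, hκe⟩ := ((T.holAt_one i hx.2.1 hx.2.2.1).comp hf).exists_ratio
    (BundleChart.hol_of_lift hb hx.1 hg) (hev.mono fun z hz => hz.2.2.2)
  refine ⟨κ, hκ, ?_⟩
  filter_upwards [hκe, hev] with z h1 h2 w
  rw [trivAt_ne h2.2.2.1, b.triv_mul h2.1, h1, smul_smul, mul_comm]

/-- The bundle on the orbifold: the given bundle outside the exceptional divisor, extended over the
singular points by means of the equivariant sections over the tubes. -/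
def Good.descent (hε : B.Good ε) (T : TubeSections B ε L) : CStarBundle O where
  Total := DTotal T
  proj := dProj T
  charts := hε.offTriv T '' L.charts ∪ range (hε.singTriv T)
  cover x := by
    by_cases hx : x ∈ range p
    · obtain ⟨i, rfl⟩ := hx
      exact ⟨_, Or.inr ⟨i, rfl⟩, 0, mem_ball_self hε.pos, B.map_zero i⟩
    · obtain ⟨y, hy, rfl⟩ := B.bijOn.surjOn hx
      obtain ⟨b, hb, z, hz, rfl⟩ := L.cover y
      exact ⟨_, Or.inl ⟨b, hb, rfl⟩, z, ⟨hz, hx⟩, rfl⟩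
  compatible := by
    rintro _ (⟨b, hb, rfl⟩ | ⟨i, rfl⟩) _ (⟨b', hb', rfl⟩ | ⟨j, rfl⟩) h x ⟨hx, hhx, hh, he⟩
    · have he' : ∀ᶠ z in 𝓝 x, z ∈ (B.offChart b.base).dom ∧ h z ∈ (B.offChart b'.base).dom ∧
          b'.base.map (h z) = b.base.map z := by
        filter_upwards [he, (B.offChart b.base).isOpen_dom.mem_nhds hx,
          hh.continuousAt.preimage_mem_nhds ((B.offChart b'.base).isOpen_dom.mem_nhds hhx)]
          with z h1 h2 h3
        exact ⟨h2, h3, B.bijOn.injOn h3.2 h2.2 h1⟩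
      obtain ⟨κ, hκ, hκe⟩ := L.compatible b hb b' hb' h x
        ⟨hx.1, hhx.1, hh, he'.mono fun z hz => hz.2.2⟩
      exact ⟨κ, hκ, hκe.mono fun z hz w => congrArg (toTotal T) (hz w)⟩
    · exact exists_transition hε T hb j hh analyticAt_id hhx hx he
    · obtain ⟨κ, hκ, hκe⟩ := exists_transition hε T hb' i analyticAt_id hh hx hhx
        (he.mono fun z hz => hz.symm)
      refine ⟨fun z => (κ z)⁻¹, analyticAt_units_inv hκ, hκe.mono fun z hz w => ?_⟩
      exact (hz _).symm.trans (by rw [mul_inv_cancel_left]; rfl)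
    · have hij : i = j := by
        by_contra hne
        exact hε.disjoint i j hne x hx (h x) hhx he.self_of_nhds.symm
      subst hij
      obtain ⟨g, hg, hgh⟩ := (LiftAt.self (c := hε.ballChart i) hx).unique
        (⟨hhx, hh, he⟩ : LiftAt (hε.ballChart i).map (hε.ballChart i) h x)
      have hball : ∀ᶠ z in 𝓝 x, z ∈ ball 0 ε := isOpen_ball.mem_nhds hx
      rcases hg with rfl | rfl
      · refine ⟨fun _ => 1, analyticAt_const, ?_⟩
        filter_upwards [hgh] with z h1 w
        rw [h1, one_mul]; rfl
      · refine ⟨fun _ => (-1) ^ T.m i, analyticAt_const, ?_⟩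
        filter_upwards [hgh, hball] with z h1 h2 w
        rw [h1]
        exact trivAt_neg i h2 w

end Blowup
/-! ### The Euler class of the bundle on the orbifold -/

section
lemma CStarBundle.HermitianMetric.contDiffAt_len {L : CStarBundle O} (H : L.HermitianMetric)
    [NormedSpace ℝ V] [IsScalarTower ℝ ℂ V]
    {s : V → L.Total} (hs : L.HolAt s x) : ContDiffAt ℝ ∞ (fun z => H.len (s z)) x := by
  refine ((H.contDiffAt_log hs).const_smul (1 / 2 : ℝ)).exp.congr_of_eventuallyEq
    (Eventually.of_forall fun z => ?_)
  have h := H.len_pos (s z)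
  simp only [smul_eq_mul, Real.log_pow]
  rw [show (1 / 2 : ℝ) * ((2 : ℕ) * log (H.len (s z))) = log (H.len (s z)) by
    push_cast; ring, Real.exp_log h]

lemma ddc_sum {ι : Type*} (s : Finset ι) (r : ι → ℝ)
    [NormedSpace ℝ V] [IsScalarTower ℝ ℂ V] {f : ι → V → ℝ} (hf : ∀ i, ContDiffAt ℝ ∞ (f i) x) :
    ddc (fun z => ∑ i ∈ s, r i * f i z) x = ∑ i ∈ s, r i • ddc (f i) x := by
  classical
  induction s using Finset.induction_on with
  | empty => simpa using ddc_const (V := V) 0 x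
  | insert i s his ih =>
    simp only [Finset.sum_insert his]
    rw [ddc_add (contDiffAt_const.mul (hf i)) (ContDiffAt.sum fun j _ => contDiffAt_const.mul (hf j)),
      ddc_const_mul _ (hf i), ih]

/-- The value of a closed form at a point of a chart, as a linear map. -/
def ComplexOrbifold.evalAt {k : ℕ} (c : O.charts) (x : C2) :
    O.Closed k →ₗ[ℝ] C2 [⋀^Fin k]→L[ℝ] ℝ where
  toFun η := η.1.1 c x
  map_add' _ _ := rfl
  map_smul' _ _ := rfl

end

namespace Blowup

variable {L : CStarBundle (ComplexOrbifold.ofManifold Xhat)}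

lemma Good.third (hε : B.Good ε) : B.Good (ε / 3) :=
  hε.mono (by linarith [hε.pos]) (by linarith [hε.pos])

lemma Good.ball_third_subset (hε : B.Good ε) : ball (0 : C2) (ε / 3) ⊆ ball 0 ε :=
  ball_subset_ball (by linarith [hε.pos])

lemma Good.logF_other (hε : B.Good ε) {i j : Fin k} (hij : j ≠ i)
    (hz : z ∈ ball 0 ε) : B.logF j ε ((B.chart i).map z) = 0 := by
  refine pushX_of_not_mem j ?_
  rintro ⟨z', hz', h⟩
  exact hε.disjoint j i hij z' hz' z hz h

variable {T : TubeSections B ε L}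

/-- The exponent of the factor by which the metric on the blow-up is changed. -/
def exponent (T : TubeSections B ε L) (x : X) : ℝ := ∑ i, (T.m i : ℝ) / 4 * B.logF i ε x

lemma Good.exponent_map (hε : B.Good ε) (T : TubeSections B ε L) (i : Fin k)
    (hz : z ∈ ball 0 (ε / 3)) : exponent T ((B.chart i).map z) = T.m i * log ‖z‖ := by
  rw [exponent, Finset.sum_eq_single i, hε.logF_map i hz, Real.log_pow]
  · push_cast; ring
  · intro j _ hj
    rw [hε.logF_other hj (hε.ball_third_subset hz), mul_zero]
  · simp

lemma Good.contDiffAt_exponent [T2Space X] (hε : B.Good ε) (T : TubeSections B ε L) [NormedSpace ℝ V] [IsScalarTower ℝ ℂ V]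
    (hf : O.Hol f x) (h : f x ∉ range p) : ContDiffAt ℝ ∞ (fun z => exponent T (f z)) x :=
  ContDiffAt.sum fun i _ => contDiffAt_const.mul
    (hε.contDiffAt_logF i hf fun h' => h ⟨i, h'.symm⟩)

lemma norm_eq_of_mem_zpowers {n : ℤ} {a b : ℂˣ}
    (h : a⁻¹ * b ∈ Subgroup.zpowers ((-1 : ℂˣ) ^ n)) : ‖(a : ℂ)‖ = ‖(b : ℂ)‖ := by
  obtain ⟨j, hj⟩ := Subgroup.mem_zpowers_iff.1 h
  have h1 : b = a * ((-1) ^ n) ^ j := by rw [hj, mul_inv_cancel_left]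
  rw [h1, Units.val_mul, norm_mul, Units.val_zpow_eq_zpow_val, Units.val_zpow_eq_zpow_val, norm_zpow,
    norm_zpow, Units.val_neg, norm_neg, Units.val_one, norm_one, one_zpow, one_zpow, mul_one]

/-- The length on the bundle on the orbifold. -/
def dLen (T : TubeSections B ε L) (H : L.HermitianMetric) : DTotal T → ℝ
  | Sum.inl m => H.len m.1 * Real.exp (exponent T (B.q (L.proj m.1)))
  | Sum.inr w => Quotient.liftOn' w.2 (fun t : ℂˣ => ‖(t : ℂ)‖) fun _ _ h =>
      norm_eq_of_mem_zpowers (QuotientGroup.leftRel_apply.1 h)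

lemma dLen_toTotal {H : L.HermitianMetric} {m : L.Total} (h : B.q (L.proj m) ∉ range p) :
    dLen T H (toTotal T m) = H.len m * Real.exp (exponent T (B.q (L.proj m))) := by
  rw [toTotal_eq h]; rfl

variable [T2Space X]

/-- Outside the exceptional divisor, sections of the bundle on the blow-up are sections of the bundle
on the orbifold. -/
lemma Good.holAt_toTotal (hε : B.Good ε) (T : TubeSections B ε L) {s : V → L.Total} (hs : L.HolAt s x)
    (h : B.q (L.proj (s x)) ∉ range p) :
    (hε.descent T).HolAt (fun z => (toTotal T (s z) : (hε.descent T).Total)) x := by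
  obtain ⟨b, hb, g, κ, hx, hg, hκ, he⟩ := hs
  refine ⟨_, Or.inl ⟨b, hb, rfl⟩, g, κ, ⟨hx, ?_⟩, hg, hκ, ?_⟩
  · change B.q _ ∉ range p
    rwa [← b.proj_triv _ hx (κ x), ← he.self_of_nhds]
  · exact he.mono fun z hz => congrArg (toTotal T) hz

/-- The closed form on the blow-up to which the form `-ζ` of the bundle on the orbifold pulls back. -/
def Good.pullbackForm (hε : B.Good ε) (T : TubeSections B ε L)
    (H : L.HermitianMetric) : (OM).Closed 2 :=
  -H.pot.form + ∑ i, ((1 / 2 : ℝ) * (T.m i : ℝ)) • (dualPot hε i).form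

lemma Good.pullbackForm_apply (hε : B.Good ε) (T : TubeSections B ε L) (H : L.HermitianMetric)
    (c : (OM).charts) {x : C2} (hx : x ∈ c.1.dom) :
    (hε.pullbackForm T H).1.1 c x = -pull H.pot.form.1 c.1.map x +
      ∑ i, ((1 / 2 : ℝ) * (T.m i : ℝ)) • pull (dualPot hε i).form.1 c.1.map x := by
  change ComplexOrbifold.evalAt c x (hε.pullbackForm T H) = _
  rw [pullbackForm, map_add, _root_.map_neg, map_sum]
  simp only [map_smul, pull_chart _ c hx]
  rfl

variable (B ε) in
/-- The disks of radius `ε / 3` around the singular points. -/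
def disks : Set X := ⋃ i, (B.chart i).map '' ball 0 (ε / 3)

variable (hε : B.Good ε) {H : L.HermitianMetric}
    (hH : ∀ i, ∀ y ∈ tube (ε / 3), H.len (T.S i y) = ‖y.1‖ ^ (-T.m i))
include hε

/-- A lift to the chart at `p i`, restricted to a ball. -/
lemma Good.exists_lift_ballChart (hf : O.Hol f x) {i : Fin k} {r : ℝ} (hr : r ≤ ε)
    (hz : z ∈ ball 0 r) (hzx : (B.chart i).map z = f x) :
    ∃ h, LiftAt f (hε.ballChart i) h x ∧ ∀ᶠ y in 𝓝 x, h y ∈ ball 0 r := by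
  have hz' := ball_subset_ball hr hz
  obtain ⟨h, hl⟩ := hf.exists_lift (fun c' hc' => hε.ballChart_compatible i hc') ⟨z, hz', hzx⟩
  refine ⟨h, hl, hl.2.1.continuousAt.preimage_mem_nhds (isOpen_ball.mem_nhds ?_)⟩
  rcases (hε.map_eq_map i hz' hl.1).1 (by rw [hzx]; exact hl.map_eq.symm) with h1 | h1 <;> rw [h1]
  · exact hz
  · rwa [mem_ball_zero_iff, norm_neg, ← mem_ball_zero_iff]

include hH

/-- The factor `‖z‖^m` cancels the length `‖z‖^(-m)` of the section, so that the section has length one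
near the singular point and the metric extends smoothly over it. -/
lemma Good.dLen_trivAt (i : Fin k) (hz : z ∈ ball 0 (ε / 3)) (w : ℂˣ) : dLen T H (trivAt T i (z, w)) = ‖(w : ℂ)‖ := by
  by_cases h0 : z = 0
  · subst h0; rw [trivAt_zero]; rfl
  · have hz' := hε.ball_third_subset hz
    have hn : 0 < ‖z‖ := norm_pos_iff.2 h0
    rw [trivAt_ne h0, dLen_toTotal (q_proj_S_not_mem hε i hz' h0 w), q_proj_S hε i hz' h0 w,
      hε.exponent_map T i hz, H.len_smul, hH i _ (mem_tube_one' hz h0), ← Real.log_zpow,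
      Real.exp_log (zpow_pos hn _), mul_assoc, ← zpow_add₀ hn.ne', neg_add_cancel, zpow_zero, mul_one]

/-- The hermitian metric on the bundle on the orbifold. -/
def Good.descentMetric : (hε.descent T).HermitianMetric where
  len := dLen T H
  len_pos := by
    rintro (m | ⟨i, w⟩)
    · exact mul_pos (H.len_pos _) (Real.exp_pos _)
    · obtain ⟨t, rfl⟩ := QuotientGroup.mk_surjective w
      exact norm_pos_iff.2 t.ne_zero
  len_smul := by
    rintro t (m | ⟨i, w⟩)
    · change H.len (t • m.1) * Real.exp (exponent T (B.q (L.proj (t • m.1)))) = _ *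
        (H.len m.1 * Real.exp (exponent T (B.q (L.proj m.1))))
      rw [L.proj_smul, H.len_smul, mul_assoc]
    · obtain ⟨v, rfl⟩ := QuotientGroup.mk_surjective w
      exact norm_mul (t : ℂ) (v : ℂ)
  smooth := by
    rintro _ (⟨b, hb, rfl⟩ | ⟨i, rfl⟩) x hx
    · have h1 : L.HolAt (fun z => b.triv (z, 1)) x :=
        BundleChart.hol_of_lift hb (h := fun z => z) hx.1 analyticAt_id
      have hq := q_proj_triv b hx 1
      refine (((H.contDiffAt_len h1).mul (hε.contDiffAt_exponent T
        (B.hol_q h1.hol hq) hq).exp).congr_of_eventuallyEq ?_).contDiffWithinAt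
      filter_upwards [(B.offChart b.base).isOpen_dom.mem_nhds hx] with z hz
      exact dLen_toTotal (q_proj_triv b hz 1)
    · by_cases h0 : x = 0
      · subst h0
        refine ((contDiffAt_const (c := (1 : ℝ))).congr_of_eventuallyEq ?_).contDiffWithinAt
        filter_upwards [ball_mem_nhds (0 : C2) hε.third.pos] with z hz
        refine (hε.dLen_trivAt hH i hz 1).trans ?_
        rw [Units.val_one, norm_one]
      · have h1 := T.holAt_one i hx h0
        have hq : (B.chart i).map x ∉ range p := fun h => h0 ((hε.map_mem_range i hx).1 h)
        refine (((H.contDiffAt_len h1).mul (hε.contDiffAt_exponent T (O.hol_chart (B.chart_mem i)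
          (hε.ball_subset i hx)) hq).exp).congr_of_eventuallyEq ?_).contDiffWithinAt
        filter_upwards [(hε.ballChart i).isOpen_dom.mem_nhds hx, eventually_ne_nhds h0] with z hz hz0
        change dLen T H (trivAt T i (z, 1)) = _
        rw [trivAt_ne hz0, dLen_toTotal (q_proj_S_not_mem hε i hz hz0 1), q_proj_S hε i hz hz0 1,
          one_smul]

lemma Good.vanishesOn_pot :
    VanishesOn (hε.descentMetric hH).pot.form.1 (B.disks ε) := by
  intro c x hx hxW
  obtain ⟨i, z, hz, hzx⟩ := mem_iUnion.1 hxW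
  obtain ⟨h, hl, hball⟩ := hε.exists_lift_ballChart (O.hol_chart c.2 hx)
    (by linarith [hε.pos] : ε / 3 ≤ ε) hz hzx
  have hs : (hε.descent T).HolAt (fun z => ((hε.singTriv T i).triv (h z, 1) :
      (hε.descent T).Total)) x :=
    BundleChart.hol_of_lift (L := hε.descent T) (Or.inr ⟨i, rfl⟩) hl.1 hl.2.1
  rw [← pull_chart _ c hx]
  have h1 := (hε.descentMetric hH).pull_pot hs
  rw [pull_congr (f' := c.1.map)] at h1
  · rw [h1]
    have h2 : (fun z => log ((hε.descentMetric hH).len ((hε.singTriv T i).triv (h z, 1)) ^ 2))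
        =ᶠ[𝓝 x] fun _ => 0 := by
      filter_upwards [hball] with z hz
      have : (hε.descentMetric hH).len ((hε.singTriv T i).triv (h z, 1)) = 1 :=
        (hε.dLen_trivAt hH i hz 1).trans (by rw [Units.val_one, norm_one])
      rw [this, one_pow, Real.log_one]
    rw [h2.ddc_eq, ddc_const]
  · filter_upwards [hl.2.2, hball] with z h2 h3
    exact (dProj_trivAt hε i (hε.ball_third_subset h3) 1).trans h2

lemma Good.vanishesOn_pullbackForm :
    VanishesOn (hε.pullbackForm T H).1 (B.q ⁻¹' B.disks ε) := by
  intro c x hx hxW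
  obtain ⟨i, z, hz, hzx⟩ := mem_iUnion.1 hxW
  obtain ⟨y, hy, hyx⟩ := hε.third.exists_tube i hz hzx.symm
  have hyε := tube_third_subset hε.pos hy
  obtain ⟨l, hl, hlx, hle⟩ := B.exists_section_Φ i (hε.tube_subset i hyε) c.2 hx hyx.symm
  rw [← hlx] at hy hyε
  have hlt : ∀ᶠ z in 𝓝 x, l z ∈ tube (ε / 3) :=
    hl.continuousAt.preimage_mem_nhds ((isOpen_tube _).mem_nhds hy)
  have hlog := contDiffAt_log_norm_comp hl.fst hy.1
  rw [hε.pullbackForm_apply T H c hx]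
  have e1 : pull H.pot.form.1 c.1.map x = -(T.m i : ℝ) • ddc (fun z => log (‖(l z).1‖ ^ 2)) x := by
    have h1 := H.pull_pot ((T.spec i _ hyε).1.comp hl)
    rw [pull_congr (f' := c.1.map)] at h1
    · rw [h1, ← ddc_const_mul _ hlog]
      refine EventuallyEq.ddc_eq ?_
      filter_upwards [hlt] with z hz
      rw [hH i _ hz, Real.log_pow, Real.log_pow, Real.log_zpow]
      push_cast; ring
    · filter_upwards [hlt, hle] with z h2 h3
      rw [(T.spec i _ (tube_third_subset hε.pos h2)).2.1, h3]
  have e2 : pull (dualPot hε i).form.1 c.1.map x =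
      (-2 : ℝ) • ddc (fun z => log (‖(l z).1‖ ^ 2)) x := by
    have h1 := hε.pull_dual i hl hy
    rwa [pull_congr (f' := c.1.map) _ hle, ddc_const_mul _ hlog] at h1
  have e3 : ∀ j ≠ i, pull (dualPot hε j).form.1 c.1.map x = 0 := by
    intro j hj
    have hcx := (OM).hol_chart c.2 hx
    have hW : ∀ᶠ z in 𝓝 x, B.q (c.1.map z) ∈ (B.chart i).map '' ball 0 ε :=
      (B.continuous_q.continuousAt.comp hcx.continuousAt).preimage_mem_nhds
        (((B.chart i).isOpen_image _ (hε.ball_subset i) isOpen_ball).mem_nhds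
          ⟨z, hε.ball_third_subset hz, hzx⟩)
    rw [hε.pull_dual_off j hcx]
    · have h2 : (fun z => -B.logF j ε (B.q (c.1.map z))) =ᶠ[𝓝 x] fun _ => 0 := by
        filter_upwards [hW] with z hz
        obtain ⟨z', hz', h⟩ := hz
        rw [← h, hε.logF_other hj hz', neg_zero]
      rw [h2.ddc_eq, ddc_const]
    · intro h
      refine hε.disjoint i j (Ne.symm hj) z (hε.ball_third_subset hz) 0
        (mem_ball_self hε.pos) ?_
      rw [hzx, h, B.map_zero]
  rw [Finset.sum_eq_single i (fun j _ hj => by rw [e3 j hj, smul_zero]) (by simp), e1, e2]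
  module

lemma Good.pullbackForm_lift (c' : (OM).charts) (c : O.charts) {h : C2 → C2} {x : C2}
    (hl : IsLiftAt B.q c'.1 c.1 h x) (hr : B.q (c'.1.map x) ∉ range p) :
    (hε.pullbackForm T H).1.1 c' x =
      pullForm h ((-(hε.descentMetric hH).pot.form : O.Closed 2).1.1 c) x := by
  have hcx := (OM).hol_chart c'.2 hl.1
  obtain ⟨s, hs, hsp⟩ := CStarBundle.exists_holAt (L := L) hcx
  have hsx : B.q (L.proj (s x)) ∉ range p := by rw [hsp.self_of_nhds]; exact hr
  have hqx := B.hol_q hcx hr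
  have hoff : ∀ᶠ z in 𝓝 x, B.q (c'.1.map z) ∉ range p := hqx.continuousAt.preimage_mem_nhds
    ((Set.finite_range p).isClosed.isOpen_compl.mem_nhds hr)
  have hF : ∀ i, ContDiffAt ℝ ∞ (fun z => B.logF i ε (B.q (c'.1.map z))) x := fun i =>
    hε.contDiffAt_logF i hqx fun h' => hr ⟨i, h'.symm⟩
  have e1 : pull (hε.descentMetric hH).pot.form.1 (fun z => B.q (c'.1.map z)) x =
      ddc (fun z => log (H.len (s z) ^ 2)) x +
        ddc (fun z => 2 * exponent T (B.q (c'.1.map z))) x := by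
    have h1 := (hε.descentMetric hH).pull_pot (hε.holAt_toTotal T hs hsx)
    rw [pull_congr (f' := fun z => B.q (c'.1.map z))] at h1
    · rw [h1, ← ddc_add (H.contDiffAt_log hs)
        (contDiffAt_const.mul (hε.contDiffAt_exponent T hqx hr))]
      refine EventuallyEq.ddc_eq ?_
      filter_upwards [hsp, hoff] with z g1 g2
      have g3 : (hε.descentMetric hH).len (toTotal T (s z)) =
          H.len (s z) * Real.exp (exponent T (B.q (c'.1.map z))) := by
        rw [← g1]
        exact dLen_toTotal (by rw [g1]; exact g2)
      rw [g3, mul_pow, Real.log_mul (pow_ne_zero _ (H.len_pos _).ne')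
        (pow_ne_zero _ (Real.exp_ne_zero _)), Real.log_pow (Real.exp _), Real.log_exp]
      push_cast; ring
    · filter_upwards [hsp, hoff] with z g1 g2
      exact (dProj_toTotal (by rw [g1]; exact g2)).trans (by rw [g1])
  have e2 : pull H.pot.form.1 c'.1.map x = ddc (fun z => log (H.len (s z) ^ 2)) x := by
    rw [← H.pull_pot hs]
    exact (pull_congr _ hsp).symm
  have e3 : ddc (fun z => 2 * exponent T (B.q (c'.1.map z))) x =
      ∑ i, ((1 / 2 : ℝ) * (T.m i : ℝ)) • ddc (fun z => B.logF i ε (B.q (c'.1.map z))) x := by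
    rw [← ddc_sum _ _ hF]
    refine congrArg (fun f => ddc f x) (funext fun z => ?_)
    rw [exponent, Finset.mul_sum]
    exact Finset.sum_congr rfl fun i _ => by ring
  have e4 : pullForm h ((-(hε.descentMetric hH).pot.form : O.Closed 2).1.1 c) x =
      -pull (hε.descentMetric hH).pot.form.1 (fun z => B.q (c'.1.map z)) x := by
    rw [pull_eq _ c hl.2]
    rfl
  rw [e4, e1, e3, hε.pullbackForm_apply T H c' hl.1, e2, neg_add, ← Finset.sum_neg_distrib]
  congr 1
  refine Finset.sum_congr rfl fun i _ => ?_
  have h1 := ddc_const_mul (-1) (hF i)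
  simp only [neg_one_mul] at h1
  rw [hε.pull_dual_off i hcx fun h' => hr ⟨i, h'.symm⟩, h1]
  module

end Blowup
namespace Blowup

lemma Good.isPullbackClass [T2Space X] {L : CStarBundle OM} (hε : B.Good ε) {T : TubeSections B ε L}
    {H : L.HermitianMetric} (hH : ∀ i, ∀ y ∈ tube (ε / 3), H.len (T.S i y) = ‖y.1‖ ^ (-T.m i)) :
    IsPullbackClass OM O B.q p (-O.cls (hε.descentMetric hH).pot.form)
      ((OM).cls (hε.pullbackForm T H)) := by
  have hv : VanishesOn (-(hε.descentMetric hH).pot.form : O.Closed 2).1 (B.disks ε) := by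
    intro c x hx hxW
    have := hε.vanishesOn_pot hH c x hx hxW
    change -((hε.descentMetric hH).pot.form.1.1 c x) = 0
    rw [this, neg_zero]
  have hp : range p ⊆ B.disks ε := by
    rintro _ ⟨i, rfl⟩
    exact mem_iUnion.2 ⟨i, 0, mem_ball_self hε.third.pos, B.map_zero i⟩
  refine ⟨-(hε.descentMetric hH).pot.form, hε.pullbackForm T H, B.disks ε, rfl, rfl,
    isOpen_iUnion fun i => (B.chart i).isOpen_image _ (hε.third.ball_subset i) isOpen_ball,
    hp, hv, hε.vanishesOn_pullbackForm hH, fun c' c h x hl => ?_⟩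
  by_cases hr : B.q (c'.1.map x) ∈ range p
  · rw [hε.vanishesOn_pullbackForm hH c' x hl.1 (hp hr), pullForm, hv c (h x) hl.2.1 (by
      rw [hl.2.2.2.self_of_nhds]; exact hp hr)]
    rfl
  · exact hε.pullbackForm_lift hH c' c hl hr

end Blowup

/-! ### When the total space is a manifold -/

section
/-- The open embedding of `ℂ² × ℂ^×` into `ℂ² × ℂ`. -/
def unitsChart : OpenPartialHomeomorph (C2 × ℂˣ) (C2 × ℂ) :=
  (OpenPartialHomeomorph.refl C2).prod
    (Units.isOpenEmbedding_val.toOpenPartialHomeomorph (Units.val : ℂˣ → ℂ))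

lemma unitsChart_apply (y : C2 × ℂˣ) : unitsChart y = (y.1, (y.2 : ℂ)) := rfl

lemma mem_unitsChart_source (y : C2 × ℂˣ) : y ∈ unitsChart.source := ⟨trivial, trivial⟩

lemma contMDiff_unitsChart :
    ContMDiff (𝓘(ℂ, C2).prod 𝓘(ℂ, ℂ)) 𝓘(ℂ, C2 × ℂ) ω (unitsChart : C2 × ℂˣ → C2 × ℂ) :=
  contMDiff_fst.prodMk_space (Units.contMDiff_val.comp contMDiff_snd)

lemma contMDiffOn_unitsChart_symm :
    ContMDiffOn 𝓘(ℂ, C2 × ℂ) (𝓘(ℂ, C2).prod 𝓘(ℂ, ℂ)) ω unitsChart.symm unitsChart.target := by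
  refine ContMDiffOn.prodMk (contMDiff_iff_contDiff.2 contDiff_fst).contMDiffOn ?_
  refine ContMDiffOn.comp (contMDiffOn_isOpenEmbedding_symm Units.isOpenEmbedding_val)
    (contMDiff_iff_contDiff.2 contDiff_snd).contMDiffOn ?_
  rintro y ⟨-, h⟩
  rwa [Topology.IsOpenEmbedding.toOpenPartialHomeomorph_target] at h

variable {L : CStarBundle O}

/-- The restriction of a trivialization to an open set on which it is injective. -/
def BundleChart.localTriv {Lt : Type u} [TopologicalSpace Lt] [MulAction ℂˣ Lt]
    {pr : Lt → X} (b : BundleChart O pr) {N : Set (C2 × ℂˣ)}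
    (hN : IsOpen N) (hd : N ⊆ b.base.dom ×ˢ univ) (hi : InjOn b.triv N) :
    OpenPartialHomeomorph (C2 × ℂˣ) Lt :=
  OpenPartialHomeomorph.ofContinuousOpenRestrict (hi.toPartialEquiv b.triv N)
    (b.continuousOn.mono hd) (by
      intro U hU
      have h : (hi.toPartialEquiv b.triv N).source.domRestrict (hi.toPartialEquiv b.triv N) '' U =
          b.triv '' ((↑) '' U) := by rw [image_image]; rfl
      rw [h]
      refine b.isOpen_image _ ?_ (hN.isOpenMap_subtype_val U hU)
      rintro _ ⟨y, -, rfl⟩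
      exact hd y.2) hN

/-- Two trivializations are related by a holomorphic transition, taking given points over the same
point of the total space to each other. -/
lemma BundleChart.exists_transition {b b' : BundleChart O L.proj} (hb : b ∈ L.charts)
    (hb' : b' ∈ L.charts) {y y' : C2 × ℂˣ} (hy : y.1 ∈ b.base.dom) (hy' : y'.1 ∈ b'.base.dom)
    (h : b.triv y = b'.triv y') : ∃ (j : C2 → C2) (κ : C2 → ℂˣ), AnalyticAt ℂ j y.1 ∧
      AnalyticAt ℂ (fun z => (κ z : ℂ)) y.1 ∧ j y.1 = y'.1 ∧ κ y.1 * y.2 = y'.2 ∧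
      ∀ᶠ z in 𝓝 y.1, ∀ w, b'.triv (j z, κ z * w) = b.triv (z, w) := by
  obtain ⟨x, w⟩ := y
  obtain ⟨x', w'⟩ := y'
  dsimp only at hy hy' ⊢
  have hbase : b.base.map x = b'.base.map x' := by
    rw [← b.proj_triv x hy w, h, b'.proj_triv x' hy' w']
  obtain ⟨j, hj, hjx⟩ := (b.base_compat b' x hy x' hy' hbase).exists_isLiftAt
  obtain ⟨κ, hκ, he⟩ := L.compatible b hb b' hb' j x hj
  have h1 := he.self_of_nhds w
  rw [h, hjx] at h1
  obtain ⟨g, hg, hgx, hgw⟩ := (b'.triv_eq_iff x' hy' x' hy' _ _).1 h1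
  have hjd : ∀ᶠ z in 𝓝 x, j z ∈ b'.base.dom :=
    hj.2.2.1.continuousAt.preimage_mem_nhds (b'.base.isOpen_dom.mem_nhds hj.2.1)
  refine ⟨fun z => g (j z), fun z => b'.mult g (j z) * κ z,
    (g : C2 →L[ℂ] C2).analyticAt _ |>.comp hj.2.2.1,
    analyticAt_units_mul (BundleChart.analyticAt_mult b' hg hj.2.1 hj.2.2.1) hκ, (congrArg g hjx).trans hgx,
    by rw [mul_assoc, hjx]; exact hgw, ?_⟩
  filter_upwards [he, hjd] with z h2 h3 v
  rw [← h2 v]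
  refine ((b'.triv_eq_iff _ h3 _ (b'.base.apply_mem g hg _ h3) _ _).2 ⟨g, hg, rfl, ?_⟩).symm
  rw [mul_assoc]

/-- If the group of the chart acts freely on `dom × ℂ^×`, then the trivialization is locally
injective. -/
lemma BundleChart.exists_injOn {Lt : Type u} [TopologicalSpace Lt] [MulAction ℂˣ Lt] {pr : Lt → X}
    (b : BundleChart O pr)
    (hfree : ∀ g ∈ b.base.Γ, ∀ x ∈ b.base.dom, g x = x → b.mult g x = 1 → g = 1) {y : C2 × ℂˣ}
    (hy : y.1 ∈ b.base.dom) : ∃ N, IsOpen N ∧ y ∈ N ∧ N ⊆ b.base.dom ×ˢ univ ∧ InjOn b.triv N := by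
  have hfin := b.base.finite
  have h1 : ∀ g : b.base.Γ, g.1 ≠ 1 → ∃ U ∈ 𝓝 y, ∀ y' ∈ U, y'.1 ∈ b.base.dom →
      (g.1 y'.1, b.mult g.1 y'.1 * y'.2) ∉ U := by
    intro g hg
    have hc : ContinuousAt (fun y : C2 × ℂˣ => (g.1 y.1, b.mult g.1 y.1 * y.2)) y := by
      have hm := continuousAt_units (b.analytic_mult g.1 g.2 _ hy)
      exact (g.1.continuous.continuousAt.comp continuousAt_fst).prodMk
        ((ContinuousAt.comp (g := b.mult g.1) (f := Prod.fst) hm continuousAt_fst).mul continuousAt_snd)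
    have hne : (g.1 y.1, b.mult g.1 y.1 * y.2) ≠ y := by
      intro h
      refine hg (hfree g.1 g.2 _ hy (congrArg Prod.fst h) ?_)
      exact mul_eq_right.1 (congrArg Prod.snd h)
    obtain ⟨U, V, hU, hV, hyU, hyV, hd⟩ := t2_separation hne
    refine ⟨_ ∩ V, inter_mem (hc.preimage_mem_nhds (hU.mem_nhds hyU)) (hV.mem_nhds hyV),
      fun y' h' _ h'' => Set.disjoint_left.1 hd h'.1 h''.2⟩
  choose! U hU hUe using h1
  have hfin' : ∀ᶠ y' in 𝓝 y, ∀ g : b.base.Γ, g.1 ≠ 1 → y' ∈ U g :=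
    Filter.eventually_all.2 fun g => by
      by_cases hg : g.1 = 1
      · exact Eventually.of_forall fun _ h => absurd hg h
      · filter_upwards [hU g hg] with y' h _ using h
  obtain ⟨N, hN, hNo, hyN⟩ := eventually_nhds_iff.1
    (hfin'.and ((b.base.isOpen_dom.prod isOpen_univ).mem_nhds ⟨hy, trivial⟩))
  refine ⟨N, hNo, hyN, fun y' h => (hN y' h).2, fun y₁ h₁ y₂ h₂ he => ?_⟩
  obtain ⟨g, hg, hgx, hgw⟩ := (b.triv_eq_iff _ (hN y₁ h₁).2.1 _ (hN y₂ h₂).2.1 y₁.2 y₂.2).1 he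
  have he' : (g y₁.1, b.mult g y₁.1 * y₁.2) = y₂ := Prod.ext hgx hgw
  by_cases hg1 : g = 1
  · have h4 := b.mult_mul 1 (one_mem _) 1 (one_mem _) y₁.1 (hN y₁ h₁).2.1
    rw [mul_one] at h4
    have h5 : b.mult 1 y₁.1 = 1 := mul_eq_right.1 h4.symm
    rw [← he', hg1, h5, one_mul]
    rfl
  · refine absurd ?_ (hUe ⟨g, hg⟩ hg1 y₁ ((hN y₁ h₁).1 ⟨g, hg⟩ hg1) (hN y₁ h₁).2.1)
    rw [he']
    exact (hN y₂ h₂).1 ⟨g, hg⟩ hg1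

/-- If all isotropy groups of the total space are trivial, then the total space is a manifold. -/
lemma CStarBundle.isComplexManifold_of_free (L : CStarBundle O)
    (hfree : ∀ b ∈ L.charts, ∀ g ∈ b.base.Γ, ∀ x ∈ b.base.dom, g x = x → b.mult g x = 1 → g = 1) :
    L.IsComplexManifold := by
  let A : Set (OpenPartialHomeomorph L.Total (C2 × ℂ)) := {e | ∃ b ∈ L.charts, ∃ (N : _) (hN : IsOpen N)
    (hd : N ⊆ b.base.dom ×ˢ univ) (hi : InjOn b.triv N), e = (b.localTriv hN hd hi).symm.trans unitsChart}
  have hA : ∀ m : L.Total, ∃ e ∈ A, m ∈ e.source := by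
    intro m
    obtain ⟨b, hb, hx⟩ := L.cover (L.proj m)
    obtain ⟨y, hy, rfl⟩ := b.surjOn hx
    obtain ⟨N, hN, hyN, hd, hi⟩ := b.exists_injOn (hfree b hb) hy.1
    refine ⟨_, ⟨b, hb, N, hN, hd, hi, rfl⟩, ?_⟩
    rw [OpenPartialHomeomorph.trans_source]
    exact ⟨⟨y, hyN, rfl⟩, mem_unitsChart_source _⟩
  choose ch hch hmem using hA
  let C : ChartedSpace (C2 × ℂ) L.Total := ⟨A, ch, hmem, hch⟩
  have hM : IsManifold 𝓘(ℂ, C2 × ℂ) ω L.Total := by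
    refine isManifold_of_contDiffOn _ _ _ ?_
    rintro _ _ ⟨b, hb, N, hN, hd, hi, rfl⟩ ⟨b', hb', N', hN', hd', hi', rfl⟩
    rintro y ⟨hy, -⟩
    rw [modelWithCornersSelf_coe_symm, preimage_id] at hy
    refine ContDiffAt.contDiffWithinAt ?_
    set t := b.localTriv hN hd hi
    set t' := b'.localTriv hN' hd' hi'
    obtain ⟨⟨hyJ, hyN⟩, hyt, -⟩ := hy
    have hyN : unitsChart.symm y ∈ N := hyN
    have hyt : b.triv (unitsChart.symm y) ∈ b'.triv '' N' := hyt
    obtain ⟨y', hy', hyy⟩ := hyt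
    obtain ⟨j, κ, hj, hκ, hjy, hκy, he⟩ := BundleChart.exists_transition hb hb' (hd hyN).1 (hd' hy').1
      hyy.symm
    have e1 : (unitsChart.symm y).1 = y.1 := rfl
    have hJ : ∀ y ∈ unitsChart.target, ((unitsChart.symm y).2 : ℂ) = y.2 := fun y hy =>
      congrArg Prod.snd (unitsChart.right_inv hy)
    rw [e1] at hj hκ hjy hκy he
    have hsymm := (unitsChart.symm.continuousAt hyJ)
    have hκc := continuousAt_units hκ
    have hcont : ContinuousAt (fun y₁ : C2 × ℂ => (j y₁.1, κ y₁.1 * (unitsChart.symm y₁).2)) y :=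
      (ContinuousAt.comp (g := j) (f := Prod.fst) hj.continuousAt continuousAt_fst).prodMk
        ((ContinuousAt.comp (g := κ) (f := Prod.fst) hκc continuousAt_fst).mul
          (continuous_snd.continuousAt.comp hsymm))
    have hN'' : ∀ᶠ y₁ in 𝓝 y, (j y₁.1, κ y₁.1 * (unitsChart.symm y₁).2) ∈ N' := by
      refine hcont.preimage_mem_nhds (hN'.mem_nhds ?_)
      rw [hjy, hκy]; exact hy'
    have hsm : ContDiffAt ℂ ω (fun y₁ : C2 × ℂ => (j y₁.1, (κ y₁.1 : ℂ) * y₁.2)) y :=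
      (hj.contDiffAt.comp (f := Prod.fst) y contDiffAt_fst).prodMk
        ((hκ.contDiffAt.comp (f := Prod.fst) y contDiffAt_fst).mul contDiffAt_snd)
    refine hsm.congr_of_eventuallyEq ?_
    filter_upwards [hN'', unitsChart.open_target.mem_nhds hyJ, continuousAt_fst.eventually he]
      with y₁ h1 h2 h3
    have h4 : t'.symm (b.triv (unitsChart.symm y₁)) =
        (j y₁.1, κ y₁.1 * (unitsChart.symm y₁).2) := by
      rw [show unitsChart.symm y₁ = (y₁.1, (unitsChart.symm y₁).2) from rfl, ← h3]
      exact t'.left_inv h1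
    change unitsChart (t'.symm (b.triv (unitsChart.symm y₁))) = _
    rw [h4, unitsChart_apply, Units.val_mul, hJ _ h2]
  refine ⟨C, hM, fun b hb => ?_⟩
  rintro ⟨y, hy⟩
  obtain ⟨N, hN, hyN, hd, hi⟩ := b.exists_injOn (hfree b hb) hy.1
  set t := b.localTriv hN hd hi with ht
  set e := t.symm.trans unitsChart with he
  have heA : e ∈ atlas (C2 × ℂ) L.Total := ⟨b, hb, N, hN, hd, hi, rfl⟩
  have heM := IsManifold.subset_maximalAtlas (I := 𝓘(ℂ, C2 × ℂ)) (n := ω) heA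
  refine ⟨⟨t.toPartialEquiv, t.open_source, t.open_target, ?_, ?_⟩, hyN, fun _ _ => rfl⟩
  · have h1 : ContMDiffOn (𝓘(ℂ, C2).prod 𝓘(ℂ, ℂ)) 𝓘(ℂ, C2 × ℂ) ω (e.symm ∘ unitsChart) t.source := by
      refine (contMDiffOn_symm_of_mem_maximalAtlas heM).comp contMDiff_unitsChart.contMDiffOn ?_
      intro y₁ h1
      refine ⟨unitsChart.map_source (mem_unitsChart_source _), ?_⟩
      change unitsChart.symm (unitsChart y₁) ∈ t.source
      rwa [unitsChart.left_inv (mem_unitsChart_source _)]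
    refine h1.congr fun y₁ h1 => ?_
    change t y₁ = t (unitsChart.symm (unitsChart y₁))
    rw [unitsChart.left_inv (mem_unitsChart_source _)]
  · have h1 : ContMDiffOn 𝓘(ℂ, C2 × ℂ) (𝓘(ℂ, C2).prod 𝓘(ℂ, ℂ)) ω (unitsChart.symm ∘ e) t.target := by
      refine contMDiffOn_unitsChart_symm.comp ((contMDiffOn_of_mem_maximalAtlas heM).mono ?_) ?_
      · exact fun m hm => ⟨hm, mem_unitsChart_source _⟩
      · exact fun m hm => unitsChart.map_source (mem_unitsChart_source _)
    refine h1.congr fun m hm => ?_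
    change t.symm m = unitsChart.symm (unitsChart (t.symm m))
    rw [unitsChart.left_inv (mem_unitsChart_source _)]

end

namespace Blowup

lemma Good.isComplexManifold_iff [T2Space X] {L : CStarBundle OM} (hε : B.Good ε) (T : TubeSections B ε L) :
    (hε.descent T).IsComplexManifold ↔ ∀ i, Odd (T.m i) := by
  constructor
  · rintro ⟨C, -, h⟩ i
    by_contra hm
    rw [Int.not_odd_iff_even] at hm
    obtain ⟨Ψ, h0, he⟩ := h (hε.singTriv T i) (Or.inr ⟨i, rfl⟩)
      ⟨(0, 1), mem_ball_self hε.pos, trivial⟩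
    have hc : ContinuousAt (fun z : C2 => ((z, 1) : C2 × ℂˣ)) 0 := by fun_prop
    have hc' : ContinuousAt (fun z : C2 => ((-z, 1) : C2 × ℂˣ)) 0 := by fun_prop
    have hev : ∀ᶠ z in 𝓝 (0 : C2), ((z, 1) : C2 × ℂˣ) ∈ Ψ.source ∧ ((-z, 1) : C2 × ℂˣ) ∈ Ψ.source ∧
        z ∈ ball 0 ε := by
      filter_upwards [hc.preimage_mem_nhds (Ψ.open_source.mem_nhds h0),
        hc'.preimage_mem_nhds (Ψ.open_source.mem_nhds (by rwa [neg_zero])),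
        ball_mem_nhds _ hε.pos] with z h1 h2 h3 using ⟨h1, h2, h3⟩
    obtain ⟨z, hz, hz0⟩ := ((hev.filter_mono nhdsWithin_le_nhds).and
      (self_mem_nhdsWithin : {(0 : C2)}ᶜ ∈ 𝓝[≠] 0)).exists
    have h1 : Ψ (-z, 1) = Ψ (z, 1) := by
      rw [← he hz.1, ← he hz.2.1]
      have := trivAt_neg (T := T) i hz.2.2 1
      rw [hm.neg_one_zpow, mul_one] at this
      exact this
    have h2 := congrArg Prod.fst (Ψ.injOn hz.2.1 hz.1 h1)
    have h3 : (2 : ℂ) • z = 0 := by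
      rw [two_smul]
      nth_rw 1 [← show -z = z from h2]
      exact neg_add_cancel z
    exact hz0 ((smul_eq_zero.1 h3).resolve_left two_ne_zero)
  · intro hm
    refine (hε.descent T).isComplexManifold_of_free ?_
    rintro _ (⟨b, hb, rfl⟩ | ⟨i, rfl⟩) g hg x hx hgx h1
    · exact ofManifold_free b.base_compatible hx.1 hg hgx
    · by_contra hg1
      have h2 : (hε.singTriv T i).mult g x = (-1) ^ T.m i := if_neg hg1
      rw [h2, (hm i).neg_one_zpow] at h1
      have := congrArg Units.val h1
      rw [Units.val_neg, Units.val_one] at this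
      norm_num at this

end Blowup
/-! ### Uniqueness of the class on the orbifold -/

lemma extDeriv_eq_zero_of_eventuallyEq {W : Type*} [NormedAddCommGroup W] [NormedSpace ℝ W] {m : ℕ}
    {β : W → W [⋀^Fin m]→L[ℝ] ℝ} {x : W} (h : β =ᶠ[𝓝 x] fun _ => 0) : extDeriv β x = 0 := by
  rw [h.extDeriv_eq, extDeriv, fderiv_fun_const]
  exact map_zero (ContinuousAlternatingMap.alternatizeUncurryFinCLM ℝ W ℝ (n := m))

section
variable [NormedSpace ℝ V] [IsScalarTower ℝ ℂ V]
  {V' : Type*} [NormedAddCommGroup V'] [NormedSpace ℂ V'] [NormedSpace ℝ V'] [IsScalarTower ℝ ℂ V']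

/-- Alternating 1-forms are linear forms. -/
def lin : (V [⋀^Fin 1]→L[ℝ] ℝ) ≃ₗᵢ[ℝ] (V →L[ℝ] ℝ) :=
  (ContinuousAlternatingMap.ofSubsingletonLIE (𝕜 := ℝ) (E := V) (F := ℝ) (0 : Fin 1)).symm

lemma lin_apply (β : V [⋀^Fin 1]→L[ℝ] ℝ) (v : V) : lin β v = β ![v] := by
  change β _ = β _
  congr 1
  ext i
  fin_cases i
  rfl

/-- The differential of a function, as an alternating form. -/
def dForm (F : V → ℝ) (x : V) : V [⋀^Fin 1]→L[ℝ] ℝ := lin.symm (fderiv ℝ F x)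

lemma lin_dForm (F : V → ℝ) (x : V) : lin (dForm F x) = fderiv ℝ F x := lin.apply_symm_apply _

lemma dForm_apply (F : V → ℝ) (x v : V) : dForm F x ![v] = fderiv ℝ F x v := by
  rw [← lin_apply, lin_dForm]

lemma ContDiffAt.dForm {F : V → ℝ} (h : ContDiffAt ℝ ∞ F x) : ContDiffAt ℝ ∞ (dForm F) x :=
  (lin (V := V)).symm.contDiff.contDiffAt.comp x (h.fderiv_right (m := ∞) (by simp))

lemma dForm_comp {F : V' → ℝ} {h : V → V'} (hF : DifferentiableAt ℝ F (h x))
    (hh : DifferentiableAt ℝ h x) :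
    dForm (fun z => F (h z)) x = (dForm F (h x)).compContinuousLinearMap (fderiv ℝ h x) := by
  refine lin.injective ?_
  rw [lin_dForm, fderiv_fun_comp x hF hh]
  ext v
  rw [lin_apply]
  change _ = dForm F (h x) (fderiv ℝ h x ∘ ![v])
  rw [show (fderiv ℝ h x ∘ ![v] : Fin 1 → V') = ![fderiv ℝ h x v] by ext i; fin_cases i; rfl,
    dForm_apply]
  rfl

lemma extDeriv_dForm {F : V → ℝ} (h : ContDiffAt ℝ ∞ F x) : extDeriv (dForm F) x = 0 := by
  ext v
  obtain ⟨a, b, rfl⟩ : ∃ a b, v = ![a, b] := ⟨v 0, v 1, by ext i; fin_cases i <;> rfl⟩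
  have hd : DifferentiableAt ℝ (fderiv ℝ F) x :=
    (h.fderiv_right (m := ∞) (by simp)).differentiableAt (by simp)
  have hc : ∀ c d : V, fderiv ℝ (fun z => dForm F z ![c]) x d = fderiv ℝ (fderiv ℝ F) x d c := by
    intro c d
    simp only [dForm_apply]
    rw [fderiv_clm_apply hd (differentiableAt_const c)]
    simp
  rw [extDeriv_one_apply (h.dForm.differentiableAt (by simp)), hc, hc]
  exact sub_eq_zero.2 (h.isSymmSndFDerivAt (by simpa using two_le_infty) a b)

lemma contDiffAt_pull_one [FiniteDimensional ℝ V] (α : O.Form 1)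
    (hf : O.Hol f x) : ContDiffAt ℝ ∞ (pull α f) x := by
  obtain ⟨N, hN, hNo, hxN⟩ := eventually_nhds_iff.1 hf.eventually
  have h1 : ContDiffOn ℝ ∞ (fun z => lin (pull α f z)) N := by
    refine contDiffOn_clm_apply.2 fun v z hz => ?_
    simp only [lin_apply]
    exact (contDiffAt_pull_apply α (hN z hz) _).contDiffWithinAt
  have h2 := (lin (V := V)).symm.contDiff.contDiffAt.comp x (h1.contDiffAt (hNo.mem_nhds hxN))
  exact h2.congr_of_eventuallyEq (Eventually.of_forall fun z => (lin.symm_apply_apply _).symm)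

/-- The Poincaré lemma for the pullback of a 1-form to a convex set. -/
lemma exists_primitive_of_convex (α : O.Form 1) {S : Set V} (hS : Convex ℝ S) (hSo : IsOpen S)
    (hf : ∀ x ∈ S, O.Hol f x) (hd : ∀ x ∈ S, extDeriv (pull α f) x = 0) :
    ∃ F : V → ℝ, ∀ x ∈ S, HasFDerivAt F (lin (pull α f x)) x := by
  have hdiff : ∀ x ∈ S, DifferentiableAt ℝ (fun x => lin (pull α f x)) x := fun x hx =>
    (lin (V := V)).differentiable.differentiableAt.comp x (differentiableAt_pull α (hf x hx))
  refine hS.exists_forall_hasFDerivAt_of_fderiv_symmetric hSo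
    (fun x hx => (hdiff x hx).differentiableWithinAt) fun x hx a b => ?_
  have hc : ∀ c d : V, fderiv ℝ (fun z => pull α f z ![c]) x d =
      fderiv ℝ (fun x => lin (pull α f x)) x d c := by
    intro c d
    simp only [← lin_apply]
    rw [fderiv_clm_apply (hdiff x hx) (differentiableAt_const c)]
    simp
  have h1 := extDeriv_one_apply (differentiableAt_pull α (hf x hx)) a b
  rw [hd x hx, hc, hc] at h1
  exact (sub_eq_zero.1 h1.symm)

/-- Primitives of pulled back 1-forms are compatible with composition. -/
lemma hasFDerivAt_primitive_comp (α : O.Form 1) {f : V' → X} {g : V → V'} (hf : O.Hol f (g x))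
    (hg : AnalyticAt ℂ g x) [CompleteSpace V'] {F : V' → ℝ}
    (hF : HasFDerivAt F (lin (pull α f (g x))) (g x)) :
    HasFDerivAt (fun z => F (g z)) (lin (pull α (f ∘ g) x)) x := by
  have h1 := hF.comp x (hg.contDiffAt_real (n := 1)).differentiableAt_one.hasFDerivAt
  refine h1.congr_fderiv ?_
  ext v
  rw [lin_apply, pull_comp α hf hg]
  change lin _ _ = pull α f (g x) (fderiv ℝ g x ∘ ![v])
  rw [lin_apply]
  congr 1
  ext i; fin_cases i; rfl

end

/-- An annulus times a disk is connected. -/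
lemma isPreconnected_annulus_prod (c : ℝ) :
    IsPreconnected {y : ℂ × ℂ | 1 / 2 < ‖y.1‖ ∧ ‖y.1‖ < 2 ∧ ‖y.2‖ < c} := by
  have h1 : Convex ℝ ((Complex.re ⁻¹' Ioo (log (1 / 2)) (log 2)) ×ˢ ball (0 : ℂ) c) :=
    ((convex_Ioo _ _).linear_preimage Complex.reLm).prod (convex_ball _ _)
  have h2 := h1.isPreconnected.image (fun y => (Complex.exp y.1, y.2))
    (by fun_prop : Continuous fun y : ℂ × ℂ => (Complex.exp y.1, y.2)).continuousOn
  convert h2 using 1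
  ext ⟨t, u⟩
  constructor
  · rintro ⟨g1, g2, g3⟩
    dsimp only at g1 g2 g3
    have h0 : t ≠ 0 := by rintro rfl; norm_num at g1
    refine ⟨(Complex.log t, u), ⟨?_, by simpa using g3⟩, by simp [Complex.exp_log h0]⟩
    rw [mem_preimage, Complex.log_re]
    exact ⟨Real.log_lt_log (by norm_num) g1, Real.log_lt_log (norm_pos_iff.2 h0) g2⟩
  · rintro ⟨⟨s, v⟩, ⟨hs, hv⟩, he⟩
    obtain ⟨rfl, rfl⟩ := Prod.mk.inj he
    rw [mem_preimage] at hs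
    refine ⟨?_, ?_, by simpa using hv⟩ <;> dsimp only <;> rw [Complex.norm_exp]
    · rw [← Real.log_lt_iff_lt_exp (by norm_num)]; exact hs.1
    · rw [← Real.lt_log_iff_exp_lt (by norm_num)]; exact hs.2

namespace Blowup

/-- The affine charts `(t, u) ↦ [1, t; u]` and `(t, u) ↦ [t, 1; u]` of the tube. -/
def aff (j : Bool) (y : ℂ × ℂ) : C2 × ℂ := (if j then !₂[y.1, 1] else !₂[1, y.1], y.2)

lemma analyticAt_aff (j : Bool) (y : ℂ × ℂ) : AnalyticAt ℂ (aff j) y := by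
  cases j
  · exact (analyticAt_pair analyticAt_const analyticAt_fst).prod analyticAt_snd
  · exact (analyticAt_pair analyticAt_fst analyticAt_const).prod analyticAt_snd

lemma aff_mem_tube {r : ℝ} (j : Bool) {y : ℂ × ℂ} (h : ‖y.2‖ * (1 + ‖y.1‖ ^ 2) < r ^ 2) :
    aff j y ∈ tube r := by
  cases j
  · refine ⟨fun h0 => ?_, ?_⟩
    · have := congrArg (fun z : C2 => z 0) h0
      simp [aff] at this
    · change ‖y.2‖ * ‖(!₂[1, y.1] : C2)‖ ^ 2 < _
      rw [norm_sq_C2]; simpa using h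
  · refine ⟨fun h0 => ?_, ?_⟩
    · have := congrArg (fun z : C2 => z 1) h0
      simp [aff] at this
    · change ‖y.2‖ * ‖(!₂[y.1, 1] : C2)‖ ^ 2 < _
      rw [norm_sq_C2]; simpa [add_comm] using h

/-- The change of the affine coordinates on the blow-up. -/
def affInv (y : ℂ × ℂ) : ℂ × ℂ := (y.1⁻¹, y.1 ^ 2 * y.2)

lemma analyticAt_affInv {y : ℂ × ℂ} (h : y.1 ≠ 0) : AnalyticAt ℂ affInv y :=
  (analyticAt_fst.inv h).prod ((analyticAt_fst.pow 2).mul analyticAt_snd)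

lemma Φ_aff_inv (B : Blowup O p Xhat) (i : Fin k) (j : Bool) {y : ℂ × ℂ} (h0 : y.1 ≠ 0)
    (h : ‖y.2‖ * (1 + ‖y.1‖ ^ 2) < B.r i ^ 2) :
    B.Φ i (aff (!j) (affInv y)) = B.Φ i (aff j y) := by
  have h1 := B.Φ_smul i (aff_mem_tube j h) (Units.mk0 y.1 h0)⁻¹
  rw [← h1]
  congr 1
  refine Prod.ext ?_ ?_
  · ext l
    cases j <;> fin_cases l <;> simp [aff, affInv, h0]
  · cases j <;> simp [aff, affInv]

/-- For `z ≠ 0` in the respective affine chart, `[z; 1]` is the point with coordinates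
`(z₁ / z₀, z₀²)` or `(z₀ / z₁, z₁²)`. -/
def toAff (j : Bool) (z : C2) : ℂ × ℂ := if j then (z 0 / z 1, z 1 ^ 2) else (z 1 / z 0, z 0 ^ 2)

/-- The coordinate whose vanishing is the complement of the affine chart. -/
def affCoord (j : Bool) (z : C2) : ℂ := if j then z 1 else z 0

lemma norm_sq_affCoord (j : Bool) (z : C2) :
    ‖z‖ ^ 2 = ‖affCoord j z‖ ^ 2 + ‖affCoord (!j) z‖ ^ 2 := by
  rw [norm_sq_C2]
  cases j
  · rfl
  · exact add_comm _ _

lemma norm_toAff (j : Bool) (z : C2) : ‖(toAff j z).1‖ = ‖affCoord (!j) z‖ / ‖affCoord j z‖ ∧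
    ‖(toAff j z).2‖ = ‖affCoord j z‖ ^ 2 := by
  cases j <;> simp [toAff, affCoord]

lemma continuous_affCoord (j : Bool) : Continuous (affCoord j) := by
  cases j
  · exact (by fun_prop : Continuous fun z : C2 => z 0)
  · exact (by fun_prop : Continuous fun z : C2 => z 1)

lemma analyticAt_toAff (j : Bool) (h : affCoord j z ≠ 0) : AnalyticAt ℂ (toAff j) z := by
  have h0 : AnalyticAt ℂ (fun z : C2 => z 0) z := analyticAt_coord 0 z
  have h1 : AnalyticAt ℂ (fun z : C2 => z 1) z := analyticAt_coord 1 z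
  cases j
  · exact (h1.div h0 h).prod (h0.pow 2)
  · exact (h0.div h1 h).prod (h1.pow 2)

lemma Φ_toAff (B : Blowup O p Xhat) (i : Fin k) (j : Bool) (h : affCoord j z ≠ 0)
    (hz : z ∈ ball 0 (B.r i)) : B.Φ i (aff j (toAff j z)) = B.Φ i (z, 1) := by
  have h0 : z ≠ 0 := by rintro rfl; cases j <;> simp [affCoord] at h
  have h1 := B.Φ_smul i (mem_tube_one' hz h0) (Units.mk0 _ h)⁻¹
  rw [← h1]
  congr 1
  refine Prod.ext ?_ ?_
  · ext l
    cases j <;> fin_cases l <;> simp [aff, affCoord, toAff] at h ⊢ <;> field_simp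
  · cases j <;> simp [aff, toAff, affCoord]

/-- A 1-form on the blow-up which is closed near `E i` has a primitive outside `E i` near `E i`, because
`E i` is simply connected; moreover it is a function on the punctured disk in the quotient by `±1`. -/
lemma Good.exists_primitive (hε : B.Good ε) (i : Fin k) (α : (OM).Form 1)
    (hcl : ∀ c, ∀ x ∈ c.1.dom, B.q (c.1.map x) ∈ (B.chart i).map '' ball 0 ε →
      extDeriv (α.1 c) x = 0) : ∃ G : C2 → ℝ, (∀ z, G (-z) = G z) ∧ ∀ z ∈ ball 0 (ε / 5), z ≠ 0 →
      HasFDerivAt G (lin (pull α (fun z => B.Φ i (z, 1)) z)) z := by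
  have hpos := hε.pos
  set c : ℝ := ε ^ 2 / 5 with hc
  let S : Set (ℂ × ℂ) := ball 0 2 ×ˢ ball 0 c
  have hS : ∀ y : ℂ × ℂ, y ∈ S ↔ ‖y.1‖ < 2 ∧ ‖y.2‖ < c := fun y => by
    simp only [S, mem_prod, mem_ball_zero_iff]
  have htube : ∀ y ∈ S, ‖y.2‖ * (1 + ‖y.1‖ ^ 2) < ε ^ 2 := by
    intro y hy
    obtain ⟨h1, h2⟩ := (hS y).1 hy
    have h3 : 1 + ‖y.1‖ ^ 2 ≤ 5 := by nlinarith [norm_nonneg y.1]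
    calc ‖y.2‖ * (1 + ‖y.1‖ ^ 2) ≤ ‖y.2‖ * 5 := by gcongr
      _ < c * 5 := by gcongr
      _ = ε ^ 2 := by rw [hc]; ring
  have hr : ε ^ 2 ≤ B.r i ^ 2 := pow_le_pow_left₀ hpos.le (hε.le i) 2
  have hhol : ∀ j, ∀ y ∈ S, (OM).Hol (fun y => B.Φ i (aff j y)) y :=
    fun j y hy => (B.hol_Φ i (hε.tube_subset i (aff_mem_tube j (htube y hy)))).comp
      (analyticAt_aff j y)
  have hF : ∀ j, ∃ F : ℂ × ℂ → ℝ, ∀ y ∈ S,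
      HasFDerivAt F (lin (pull α (fun y => B.Φ i (aff j y)) y)) y := by
    intro j
    refine exists_primitive_of_convex α ((convex_ball _ _).prod (convex_ball _ _))
      (isOpen_ball.prod isOpen_ball) (hhol j) fun y hy => ?_
    obtain ⟨c', hc', h, hl⟩ := hhol j y hy
    rw [extDeriv_pull (c := ⟨c', hc'⟩) hl, hcl ⟨c', hc'⟩ _ hl.1]
    · rfl
    · obtain ⟨s, hs⟩ := exists_sq (aff j y).2
      obtain ⟨h1, h2⟩ := hε.q_Φ_sq i (aff_mem_tube j (htube y hy)) hs
      exact ⟨_, h1, by rw [← h2]; exact congrArg B.q hl.map_eq.symm⟩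
  choose F hF using hF
  -- On the overlap of the two affine charts the primitives differ by a constant.
  let A : Set (ℂ × ℂ) := {y | 1 / 2 < ‖y.1‖ ∧ ‖y.1‖ < 2 ∧ ‖y.2‖ < c / 4}
  have hAo : IsOpen A := by
    refine (isOpen_lt (f := fun _ : ℂ × ℂ => (1 / 2 : ℝ)) (g := fun y => ‖y.1‖) ?_ ?_).inter
      ((isOpen_lt (f := fun y : ℂ × ℂ => ‖y.1‖) (g := fun _ => 2) ?_ ?_).inter
      (isOpen_lt (f := fun y : ℂ × ℂ => ‖y.2‖) (g := fun _ => c / 4) ?_ ?_)) <;> fun_prop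
  have hc0 : 0 < c := by positivity
  have hAS : A ⊆ S := fun y hy => (hS y).2 ⟨hy.2.1, hy.2.2.trans (by linarith)⟩
  have hA0 : ∀ y ∈ A, y.1 ≠ 0 := by
    rintro y ⟨h1, -⟩ h0
    rw [h0, norm_zero] at h1
    norm_num at h1
  have hgS : ∀ y ∈ A, affInv y ∈ S := by
    rintro y ⟨h1, h2, h3⟩
    refine (hS _).2 ⟨?_, ?_⟩
    · rw [affInv, norm_inv]
      exact inv_lt_of_inv_lt₀ (by linarith) (by linarith)
    · rw [affInv, norm_mul, norm_pow]
      calc ‖y.1‖ ^ 2 * ‖y.2‖ ≤ 2 ^ 2 * ‖y.2‖ := by gcongr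
        _ < 2 ^ 2 * (c / 4) := by gcongr
        _ = c := by ring
  have hgF : ∀ y ∈ A, HasFDerivAt (fun y => F true (affInv y))
      (lin (pull α (fun y => B.Φ i (aff false y)) y)) y := by
    intro y hy
    have h1 := hasFDerivAt_primitive_comp α (hhol true _ (hgS y hy)) (analyticAt_affInv (hA0 y hy))
      (hF true _ (hgS y hy))
    rwa [pull_congr (f' := fun y => B.Φ i (aff false y))] at h1
    filter_upwards [hAo.mem_nhds hy] with y' hy'
    exact B.Φ_aff_inv i false (hA0 y' hy') ((htube _ (hAS hy')).trans_le hr)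
  obtain ⟨C, hC⟩ := hAo.exists_eq_add_of_fderiv_eq (isPreconnected_annulus_prod (c / 4))
    (fun y hy => (hF false y (hAS hy)).differentiableAt.differentiableWithinAt)
    (fun y hy => (hgF y hy).differentiableAt.differentiableWithinAt)
    (fun y hy => by rw [(hF false y (hAS hy)).fderiv, (hgF y hy).fderiv])
  let G : C2 → ℝ := fun z => if ‖z 1‖ < 2 * ‖z 0‖ then F false (toAff false z)
    else F true (toAff true z) + C
  have hsq : ∀ j, ∀ z ∈ ball 0 (ε / 5), ‖affCoord j z‖ ^ 2 < c / 4 := by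
    intro j z hz
    rw [mem_ball_zero_iff] at hz
    have h1 := norm_sq_affCoord j z
    have h2 : ‖z‖ ^ 2 < (ε / 5) ^ 2 := by gcongr
    rw [hc]
    nlinarith [sq_nonneg ‖affCoord (!j) z‖]
  have hreg : ∀ j z, z ∈ ball 0 (ε / 5) → ‖affCoord (!j) z‖ < 2 * ‖affCoord j z‖ →
      G z = F j (toAff j z) + if j then C else 0 := by
    intro j z hz h
    cases j
    · exact (if_pos h).trans (by simp)
    · by_cases h' : ‖z 1‖ < 2 * ‖z 0‖
      · have h : ‖z 0‖ < 2 * ‖z 1‖ := h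
        have hz0 : z 0 ≠ 0 := fun h0 => by rw [h0, norm_zero] at h'; linarith [norm_nonneg (z 1)]
        have hz1 : z 1 ≠ 0 := fun h0 => by rw [h0, norm_zero] at h; linarith [norm_nonneg (z 0)]
        have hn := norm_toAff false z
        have hmem : toAff false z ∈ A := by
          have p0 := norm_pos_iff.2 hz0
          refine ⟨?_, ?_, ?_⟩
          · rw [hn.1]; change 1 / 2 < ‖z 1‖ / ‖z 0‖
            rw [lt_div_iff₀ p0]; linarith
          · rw [hn.1]; change ‖z 1‖ / ‖z 0‖ < 2
            rwa [div_lt_iff₀ p0]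
          · rw [hn.2]; exact hsq false z hz
        have hg : affInv (toAff false z) = toAff true z := by
          refine Prod.ext ?_ ?_
          · simp [affInv, toAff]
          · simp only [affInv, toAff, if_true, Bool.false_eq_true, if_false]
            field_simp
        have h2 := hC hmem
        rw [show G z = F false (toAff false z) from if_pos h', h2, if_pos rfl, ← hg]
      · exact (if_neg h').trans (by simp)
  refine ⟨G, fun z => ?_, fun z hz hz0 => ?_⟩
  · have h1 : ∀ j, toAff j (-z) = toAff j z := by intro j; cases j <;> simp [toAff, neg_div_neg_eq]
    simp only [G, h1, PiLp.neg_apply, norm_neg]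
  · obtain ⟨j, hj⟩ : ∃ j, ‖affCoord (!j) z‖ < 2 * ‖affCoord j z‖ := by
      by_contra! h
      have h1 : ‖z 0‖ ≥ 2 * ‖z 1‖ := h true
      have h2 : ‖z 1‖ ≥ 2 * ‖z 0‖ := h false
      have h3 : ‖z 0‖ = 0 := by linarith [norm_nonneg (z 0), norm_nonneg (z 1)]
      have h4 : ‖z 1‖ = 0 := by linarith [norm_nonneg (z 0), norm_nonneg (z 1)]
      have h5 := norm_sq_C2 z
      rw [h3, h4] at h5
      exact hz0 (norm_eq_zero.1 (pow_eq_zero_iff two_ne_zero |>.1 (by rw [h5]; norm_num)))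
    have hne : affCoord j z ≠ 0 := fun h0 => by
      rw [h0, norm_zero] at hj; linarith [norm_nonneg (affCoord (!j) z)]
    have hmem : toAff j z ∈ S := by
      have hn := norm_toAff j z
      refine (hS _).2 ⟨?_, ?_⟩
      · rwa [hn.1, div_lt_iff₀ (norm_pos_iff.2 hne)]
      · rw [hn.2]; linarith [hsq j z hz]
    have h1 := hasFDerivAt_primitive_comp α (hhol j _ hmem) (analyticAt_toAff j hne) (hF j _ hmem)
    have hev : ∀ᶠ z' in 𝓝 z, z' ∈ ball 0 (ε / 5) ∧
        ‖affCoord (!j) z'‖ < 2 * ‖affCoord j z'‖ := by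
      refine Filter.Eventually.and (isOpen_ball.mem_nhds hz) ((isOpen_lt ?_ ?_).mem_nhds hj)
      · exact (continuous_affCoord _).norm
      · exact continuous_const.mul (continuous_affCoord _).norm
    rw [pull_congr (f' := fun z => B.Φ i (z, 1))] at h1
    · refine (h1.add_const (if j then C else 0)).congr_of_eventuallyEq ?_
      filter_upwards [hev] with z' hz'
      exact hreg j z' hz'.1 hz'.2
    · filter_upwards [hev, (continuous_affCoord j).continuousAt.eventually_ne hne] with z' hz' hn
      exact B.Φ_toAff i j hn (hε.ball_subset_r i
        (ball_subset_ball (by linarith) hz'.1))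

end Blowup
namespace Blowup

/-- `f` is a local holomorphic lift of the chart `c` to the blow-up, outside the singular points. -/
structure IsSec (B : Blowup O p Xhat) (c : O.charts) (x : C2) (f : C2 → Xhat) : Prop where
  mem : x ∈ c.1.dom
  hol : (OM).Hol f x
  not_mem : c.1.map x ∉ range p
  lift : ∀ᶠ z in 𝓝 x, B.q (f z) = c.1.map z

lemma exists_isSec (B : Blowup O p Xhat) {c : O.charts} {x : C2} (hx : x ∈ c.1.dom)
    (h : c.1.map x ∉ range p) : ∃ f, B.IsSec c x f := by
  obtain ⟨f, h1, h2⟩ := B.exists_local_inverse_q c.2 hx h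
  exact ⟨f, hx, h1, h, h2⟩

lemma IsSec.eventually [T2Space X] {c : O.charts} {x : C2} {f : C2 → Xhat} (h : B.IsSec c x f) :
    ∀ᶠ z in 𝓝 x, B.IsSec c z f := by
  filter_upwards [h.hol.eventually, h.lift.eventually_nhds, c.1.isOpen_dom.mem_nhds h.mem,
    (c.1.continuousOn.continuousAt (c.1.isOpen_dom.mem_nhds h.mem)).preimage_mem_nhds
      ((Set.finite_range p).isClosed.isOpen_compl.mem_nhds h.not_mem)] with z h1 h2 h3 h4
  exact ⟨h3, h1, h4, h2⟩

lemma IsSec.eventuallyEq [T2Space X] {c : O.charts} {x : C2} {f f' : C2 → Xhat}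
    (h : B.IsSec c x f) (h' : B.IsSec c x f') : f =ᶠ[𝓝 x] f' := by
  filter_upwards [h.eventually, h'.eventually] with z h1 h2
  have e1 := h1.lift.self_of_nhds
  have e2 := h2.lift.self_of_nhds
  exact B.bijOn.injOn (by rw [mem_preimage, e1]; exact h1.not_mem)
    (by rw [mem_preimage, e2]; exact h1.not_mem) (e1.trans e2.symm)

lemma IsSec.comp {c c' : O.charts} {x : C2} {f : C2 → Xhat} {h : C2 → C2}
    (hl : IsLiftAt id c.1 c'.1 h x) (hf : B.IsSec c' (h x) f) : B.IsSec c x (f ∘ h) := by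
  refine ⟨hl.1, hf.hol.comp hl.2.2.1, ?_, ?_⟩
  · rw [show c.1.map x = c'.1.map (h x) from hl.2.2.2.self_of_nhds.symm]
    exact hf.not_mem
  · filter_upwards [hl.2.2.1.continuousAt.eventually hf.lift, hl.2.2.2] with z h1 h2
    exact h1.trans h2

open Classical in
/-- The family `(q⁻¹)^* α + dψ` on the charts of the orbifold, extended by zero over the singular
points. -/
def descendFam (B : Blowup O p Xhat) (α : (OM).Form 1)
    (ψ : X → ℝ) (c : O.charts) (x : C2) : C2 [⋀^Fin 1]→L[ℝ] ℝ :=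
  if h : ∃ f, B.IsSec c x f then pull α h.choose x + dForm (fun z => ψ (c.1.map z)) x else 0

lemma IsSec.descendFam_eq [T2Space X] {c : O.charts} {x : C2} {f : C2 → Xhat}
    (h : B.IsSec c x f) (α : (OM).Form 1) (ψ : X → ℝ) :
    B.descendFam α ψ c x = pull α f x + dForm (fun z => ψ (c.1.map z)) x := by
  have h' : ∃ f, B.IsSec c x f := ⟨f, h⟩
  rw [descendFam, dif_pos h', pull_congr α (h'.choose_spec.eventuallyEq h)]

lemma descendFam_of_not_mem {c : O.charts} {x : C2} (h : x ∉ c.1.dom ∨ c.1.map x ∈ range p)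
    (α : (OM).Form 1) (ψ : X → ℝ) : B.descendFam α ψ c x = 0 := by
  refine dif_neg ?_
  rintro ⟨f, hf⟩
  rcases h with h | h
  exacts [h hf.mem, hf.not_mem h]

/-- A closed form which vanishes near the singular points and whose pullback to the blow-up is exact,
is exact: a primitive on the blow-up is corrected by the differential of a function so that it
vanishes near the exceptional divisor. -/
lemma exact_of_pullback_exact [T2Space X] (B : Blowup O p Xhat) (hp : Function.Injective p)
    (η : O.Closed 2) (α : (OM).Form 1) {W : Set X} (hW : IsOpen W)
    (hpW : range p ⊆ W) (hη : VanishesOn η.1 W)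
    (hv : ∀ c, ∀ x ∈ c.1.dom, B.q (c.1.map x) ∈ W → extDeriv (α.1 c) x = 0)
    (hlift : ∀ c' c h x, IsLiftAt B.q c'.1 c.1 h x → extDeriv (α.1 c') x = pullForm h (η.1.1 c) x) :
    η ∈ O.Exact2 := by
  have hδ : ∀ i, ∃ δ > 0, ball (0 : C2) δ ⊆ (B.chart i).map ⁻¹' W := fun i =>
    Metric.mem_nhds_iff.1 (((B.chart i).continuousOn.continuousAt
      ((B.chart i).isOpen_dom.mem_nhds (B.zero_mem_dom i))).preimage_mem_nhds
        (hW.mem_nhds (by rw [B.map_zero]; exact hpW ⟨i, rfl⟩)))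
  choose δ hδ0 hδW using hδ
  obtain ⟨ε, hε, hεδ⟩ := B.exists_good hp δ hδ0
  have hεW : ∀ i, (B.chart i).map '' ball 0 ε ⊆ W := by
    rintro i _ ⟨z, hz, rfl⟩
    exact hδW i (ball_subset_ball (hεδ i) hz)
  have hG := fun i => hε.exists_primitive i α fun c x hx h => hv c x hx (hεW i h)
  choose G hGe hGd using hG
  have hε5 : B.Good (ε / 5) := hε.mono (by linarith [hε.pos]) (by linarith [hε.pos])
  have hb5 : ball (0 : C2) (ε / 5) ⊆ ball 0 ε := ball_subset_ball (by linarith [hε.pos])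
  have hΦ1 : ∀ i, ∀ z ∈ ball 0 (ε / 5), z ≠ 0 → (OM).Hol (fun z => B.Φ i (z, 1)) z := fun i z hz h0 =>
    (B.hol_Φ i (mem_tube_one' (hε5.ball_subset_r i hz) h0)).comp (g := fun z => (z, (1 : ℂ)))
      (analyticAt_id.prod analyticAt_const)
  have hGs : ∀ i, ContDiffOn ℝ ∞ (G i) (ball 0 (ε / 5) \ {0}) := by
    intro i
    refine (contDiffOn_infty_iff_fderiv_of_isOpen
      (isOpen_ball.sdiff isClosed_singleton)).2
      ⟨fun z hz => (hGd i z hz.1 hz.2).differentiableAt.differentiableWithinAt, ?_⟩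
    have h1 : ContDiffOn ℝ ∞ (fun z => lin (pull α (fun z => B.Φ i (z, 1)) z))
        (ball 0 (ε / 5) \ {0}) := fun z hz => ((lin (V := C2)).contDiff.contDiffAt.comp z
      (contDiffAt_pull_one α (hΦ1 i z hz.1 hz.2))).contDiffWithinAt
    exact h1.congr fun z hz => (hGd i z hz.1 hz.2).fderiv
  let ρ : Fin k → C2 → ℝ := fun i z => cut (ε / 5) (‖z‖ ^ 4) * G i z
  have hρe : ∀ i z, ρ i (-z) = ρ i z := fun i z => by simp only [ρ, norm_neg, hGe]
  have hρs : ∀ i z, ε / 5 / 2 ≤ ‖z‖ → ρ i z = 0 := fun i z hz => by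
    simp only [ρ]
    rw [cut_zero hε5.pos (by have := hε5.pos; gcongr), zero_mul]
  let ψ : X → ℝ := fun x => ∑ i, -1 * B.pushX i (ε / 5) (ρ i) x
  have hψ : ∀ (c : O.charts), ∀ x ∈ c.1.dom, c.1.map x ∉ range p →
      ContDiffAt ℝ ∞ (fun z => ψ (c.1.map z)) x := by
    intro c x hx hr
    refine ContDiffAt.sum fun i _ => contDiffAt_const.mul (hε5.contDiffAt_pushX i (hρe i) (hρs i)
      (O.hol_chart c.2 hx) fun z hz hzx => ContDiffAt.mul ?_ ?_)
    · refine (contDiff_cut _).contDiffAt.comp z ?_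
      have := (contDiff_norm_sq_C2.pow 2).contDiffAt (x := z)
      simpa only [← pow_mul] using this
    · have hz0 : z ≠ 0 := by rintro rfl; exact hr ⟨i, by rw [← hzx, B.map_zero]⟩
      exact (hGs i).contDiffAt ((isOpen_ball.sdiff isClosed_singleton).mem_nhds ⟨hz, hz0⟩)
  have hDo : IsOpen (B.disks (ε / 5)) := isOpen_iUnion fun i =>
    (B.chart i).isOpen_image _ (hε5.third.ball_subset i) isOpen_ball
  have hDp : range p ⊆ B.disks (ε / 5) := by
    rintro _ ⟨i, rfl⟩
    exact mem_iUnion.2 ⟨i, 0, mem_ball_self hε5.third.pos, B.map_zero i⟩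
  have hDW : B.disks (ε / 5) ⊆ W := by
    intro x hx
    obtain ⟨i, z, hz, rfl⟩ := mem_iUnion.1 hx
    exact hεW i ⟨z, hb5 (hε5.ball_third_subset hz), rfl⟩
  have hzero : ∀ (c : O.charts), ∀ x ∈ c.1.dom, c.1.map x ∈ B.disks (ε / 5) →
      B.descendFam α ψ c x = 0 := by
    intro c x hx hxD
    by_cases hr : c.1.map x ∈ range p
    · exact descendFam_of_not_mem (Or.inr hr) α ψ
    obtain ⟨f, hf⟩ := B.exists_isSec hx hr
    obtain ⟨i, z, hz, hzx⟩ := mem_iUnion.1 hxD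
    obtain ⟨h, hl, hball⟩ := hε5.exists_lift_ballChart (O.hol_chart c.2 hx)
      (by linarith [hε5.pos] : ε / 5 / 3 ≤ ε / 5) hz hzx
    have hl2 : ∀ᶠ z in 𝓝 x, (B.chart i).map (h z) = c.1.map z := hl.2.2
    have h0 : ∀ᶠ z in 𝓝 x, h z ≠ 0 := by
      filter_upwards [hf.eventually, hl2, hball] with z h1 h2 h3 h4
      refine h1.not_mem ?_
      rw [← h2, h4, B.map_zero]
      exact ⟨i, rfl⟩
    have hd := hasFDerivAt_primitive_comp α (hΦ1 i _ hl.1 h0.self_of_nhds) hl.2.1 (hGd i _ hl.1 h0.self_of_nhds)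
    have hfe : (fun z => B.Φ i (z, 1)) ∘ h =ᶠ[𝓝 x] f := by
      filter_upwards [hf.eventually, hl2, hball, h0] with z h1 h2 h3 h4
      have e1 : B.q (B.Φ i (h z, 1)) = c.1.map z := by
        rw [B.q_Φ_one i (hε5.third.ball_subset_r i h3) h4, h2]
      have e2 := h1.lift.self_of_nhds
      exact B.bijOn.injOn (by rw [mem_preimage]; exact e1 ▸ h1.not_mem)
        (by rw [mem_preimage, e2]; exact h1.not_mem) (e1.trans e2.symm)
    have hψe : (fun z => ψ (c.1.map z)) =ᶠ[𝓝 x] fun z => -G i (h z) := by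
      filter_upwards [hl2, hball] with z h2 h3
      have h3' := hε5.ball_third_subset h3
      have e1 : ∀ j ≠ i, B.pushX j (ε / 5) (ρ j) ((B.chart i).map (h z)) = 0 := by
        intro j hj
        refine pushX_of_not_mem j ?_
        rintro ⟨z', hz', h⟩
        exact hε5.disjoint j i hj z' hz' _ h3' h
      have e2 : cut (ε / 5) (‖h z‖ ^ 4) = 1 := by
        refine cut_one hε5.pos ?_
        rw [mem_ball_zero_iff] at h3
        gcongr
      rw [← h2]
      simp only [ψ]
      rw [Finset.sum_eq_single i (fun j _ hj => by rw [e1 j hj, mul_zero]) (by simp),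
        hε5.pushX_map i (hρe i) h3']
      simp only [ρ, e2]
      ring
    rw [hf.descendFam_eq]
    refine lin.injective ?_
    rw [map_add, lin_dForm, hψe.fderiv_eq, hd.fun_neg.fderiv, pull_congr α hfe, _root_.map_zero, add_neg_cancel]
  have hzero' : ∀ (c : O.charts), ∀ x ∈ c.1.dom, c.1.map x ∈ range p →
      B.descendFam α ψ c =ᶠ[𝓝 x] fun _ => 0 := by
    intro c x hx hr
    filter_upwards [c.1.isOpen_dom.mem_nhds hx,
      (c.1.continuousOn.continuousAt (c.1.isOpen_dom.mem_nhds hx)).preimage_mem_nhds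
        (hDo.mem_nhds (hDp hr))] with z h1 h2
    exact hzero c z h1 h2
  let β : O.Form 1 := ⟨B.descendFam α ψ, by
    refine ⟨fun c x hx => descendFam_of_not_mem (Or.inl hx) α ψ, fun c x hx => ?_,
      fun c c' h x hl => ?_⟩
    · refine ContDiffAt.contDiffWithinAt ?_
      by_cases hr : c.1.map x ∈ range p
      · exact (contDiffAt_const (c := 0)).congr_of_eventuallyEq (hzero' c x hx hr)
      · obtain ⟨f, hf⟩ := B.exists_isSec hx hr
        refine ((contDiffAt_pull_one α hf.hol).add (hψ c x hx hr).dForm).congr_of_eventuallyEq ?_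
        filter_upwards [hf.eventually] with z hz
        exact hz.descendFam_eq α ψ
    · have hm : c'.1.map (h x) = c.1.map x := hl.2.2.2.self_of_nhds
      by_cases hr : c'.1.map (h x) ∈ range p
      · rw [descendFam_of_not_mem (Or.inr (hm ▸ hr)), pullForm, descendFam_of_not_mem (Or.inr hr)]
        rfl
      · obtain ⟨f, hf⟩ := B.exists_isSec hl.2.1 hr
        rw [(hf.comp hl).descendFam_eq, pullForm, hf.descendFam_eq, pull_comp α hf.hol hl.2.2.1]
        have h1 : (fun z => ψ (c.1.map z)) =ᶠ[𝓝 x] fun z => ψ (c'.1.map (h z)) := by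
          filter_upwards [hl.2.2.2] with z hz
          rw [hz]; rfl
        have h2 : dForm (fun z => ψ (c.1.map z)) x =
            (dForm (fun z => ψ (c'.1.map z)) (h x)).compContinuousLinearMap (fderiv ℝ h x) := by
          rw [← dForm_comp (F := fun z => ψ (c'.1.map z)) ((hψ c' _ hl.2.1 hr).differentiableAt (by simp))
            (hl.2.2.1.contDiffAt_real (n := 1)).differentiableAt_one, dForm, dForm, h1.fderiv_eq]
        rw [h2]
        rfl⟩
  refine ⟨β, fun c x hx => ?_⟩
  change _ = extDeriv (B.descendFam α ψ c) x
  by_cases hr : c.1.map x ∈ range p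
  · rw [hη c x hx (hpW hr), extDeriv_eq_zero_of_eventuallyEq (hzero' c x hx hr)]
  · obtain ⟨f, hf⟩ := B.exists_isSec hx hr
    have h1 : B.descendFam α ψ c =ᶠ[𝓝 x]
        fun z => pull α f z + dForm (fun z => ψ (c.1.map z)) z := by
      filter_upwards [hf.eventually] with z hz
      exact hz.descendFam_eq α ψ
    rw [h1.extDeriv_eq, extDeriv_fun_add (differentiableAt_pull α hf.hol)
      ((hψ c x hx hr).dForm.differentiableAt (by simp)), extDeriv_dForm (hψ c x hx hr), add_zero]
    obtain ⟨c', hc', h, hl⟩ := hf.hol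
    have hcy := (OM).hol_chart hc' hl.1
    have hqy : B.q (c'.map (h x)) ∉ range p := by rw [hl.map_eq, hf.lift.self_of_nhds]; exact hr
    have hq := B.hol_q hcy hqy
    obtain ⟨c'', hc'', g, hg⟩ := id hq
    rw [extDeriv_pull (c := ⟨c', hc'⟩) hl, hlift ⟨c', hc'⟩ ⟨c'', hc''⟩ g (h x) ⟨hl.1, hg⟩, pullForm,
      ← pull_eq η.1 ⟨c'', hc''⟩ hg, ← pull_comp η.1 hq hl.2.1, ← pull_chart η.1 c hx]
    refine (pull_congr _ ?_).symm
    filter_upwards [hl.2.2, hf.lift] with z h2 h3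
    change B.q (c'.map (h z)) = _
    rw [h2, h3]

lemma isPullbackClass_unique [T2Space X] (B : Blowup O p Xhat) (hp : Function.Injective p)
    {a a' : O.H2} {b : (OM).H2} (h : IsPullbackClass OM O B.q p a b)
    (h' : IsPullbackClass OM O B.q p a' b) : a = a' := by
  obtain ⟨η, θ, W, rfl, rfl, hW, hpW, hη, hθ, hl⟩ := h
  obtain ⟨η', θ', W', rfl, hθe, hW', hpW', hη', hθ', hl'⟩ := h'
  obtain ⟨α, hα⟩ : θ - θ' ∈ (OM).Exact2 := (Submodule.Quotient.eq _).1 hθe.symm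
  have hα' : ∀ c, ∀ x ∈ c.1.dom, extDeriv (α.1 c) x = θ.1.1 c x - θ'.1.1 c x := fun c x hx =>
    (hα c x hx).symm
  refine (Submodule.Quotient.eq _).2 (B.exact_of_pullback_exact hp (η - η') α (hW.inter hW')
    (subset_inter hpW hpW') ?_ ?_ ?_)
  · intro c x hx hxW
    change η.1.1 c x - η'.1.1 c x = 0
    rw [hη c x hx hxW.1, hη' c x hx hxW.2, sub_zero]
  · intro c x hx hxW
    rw [hα' c x hx, hθ c x hx hxW.1, hθ' c x hx hxW.2, sub_zero]
  · intro c' c h x hlx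
    rw [hα' c' x hlx.1, hl c' c h x hlx, hl' c' c h x hlx]
    rfl

end Blowup
/-! ### Integrals of top-degree forms -/

section TopForms

variable {V : Type*} [NormedAddCommGroup V] [NormedSpace ℂ V] [FiniteDimensional ℂ V]
  [MeasurableSpace V] [BorelSpace V] (μ : Measure V) [μ.IsAddHaarMeasure]
  {ι : Type*} [Fintype ι] [DecidableEq ι]

lemma AlternatingMap.map_comp_of_card {V : Type*} [AddCommGroup V] [Module ℝ V]
    [FiniteDimensional ℝ V] (hc : Module.finrank ℝ V = Fintype.card ι) (A : V [⋀^ι]→ₗ[ℝ] ℝ)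
    (L : V →ₗ[ℝ] V) (v : ι → V) : A (fun j => L (v j)) = LinearMap.det L * A v := by
  let e : Module.Basis ι ℝ V :=
    (Module.finBasisOfFinrankEq ℝ V hc).reindex (Fintype.equivFin ι).symm
  rw [A.eq_smul_basis_det e]
  simp only [AlternatingMap.smul_apply, smul_eq_mul]
  rw [show (fun j => L (v j)) = L ∘ v from rfl, e.det_comp]
  ring

lemma det_restrictScalars_nonneg (L : V →L[ℂ] V) : 0 ≤ (L.restrictScalars ℝ).det := by
  have : (L.restrictScalars ℝ).det = LinearMap.det ((L : V →ₗ[ℂ] V).restrictScalars ℝ) := rfl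
  rw [this, LinearMap.det_restrictScalars, Algebra.norm_complex_apply]
  exact Complex.normSq_nonneg _

variable {S : Set V} {h : V → V} (hS : MeasurableSet S) (hh : ∀ x ∈ S, AnalyticAt ℂ h x)
  (hi : InjOn h S) (hc : Module.finrank ℝ V = Fintype.card ι) (Ω : V → V [⋀^ι]→ₗ[ℝ] ℝ) (v : ι → V)

include hh hc in
lemma abs_det_smul_top {x : V} (hx : x ∈ S) :
    |(fderiv ℝ h x).det| • Ω (h x) v = Ω (h x) (fun j => fderiv ℝ h x (v j)) := by
  have : FiniteDimensional ℝ V := FiniteDimensional.complexToReal V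
  have h1 : fderiv ℝ h x = (fderiv ℂ h x).restrictScalars ℝ :=
    (hh x hx).differentiableAt.fderiv_restrictScalars ℝ
  rw [h1, abs_of_nonneg (det_restrictScalars_nonneg _), smul_eq_mul]
  exact (AlternatingMap.map_comp_of_card hc (Ω (h x))
    ((fderiv ℂ h x).restrictScalars ℝ : V →ₗ[ℝ] V) v).symm

include hS hh hi hc in
/-- Change of variables: holomorphic maps preserve the orientation, so the integral of a form of top
degree over the image is the integral of its pullback. -/
lemma integral_image_top : (IntegrableOn (fun x => Ω x v) (h '' S) μ ↔
      IntegrableOn (fun x => Ω (h x) (fun j => fderiv ℝ h x (v j))) S μ) ∧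
    ∫ x in h '' S, Ω x v ∂μ = ∫ x in S, Ω (h x) (fun j => fderiv ℝ h x (v j)) ∂μ := by
  have : FiniteDimensional ℝ V := FiniteDimensional.complexToReal V
  have hd : ∀ x ∈ S, HasFDerivWithinAt h (fderiv ℝ h x) S x := fun x hx =>
    ((hh x hx).differentiableAt.restrictScalars ℝ).hasFDerivAt.hasFDerivWithinAt
  rw [integral_image_eq_integral_abs_det_fderiv_smul μ hS hd hi,
    integrableOn_image_iff_integrableOn_abs_det_fderiv_smul μ hS hd hi]
  exact ⟨integrableOn_congr_fun (fun x hx => abs_det_smul_top hh hc Ω v hx) hS,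
    setIntegral_congr_fun hS fun x hx => abs_det_smul_top hh hc Ω v hx⟩

end TopForms

lemma integral_fderiv_eq_zero {V : Type*} [NormedAddCommGroup V] [NormedSpace ℝ V]
    [FiniteDimensional ℝ V] [MeasurableSpace V] [BorelSpace V] {μ : Measure V}
    [μ.IsAddHaarMeasure] {f : V → ℝ} (hf : ContDiff ℝ ∞ f) (hs : HasCompactSupport f) (v : V) :
    Integrable (fun x => fderiv ℝ f x v) μ ∧ ∫ x, fderiv ℝ f x v ∂μ = 0 := by
  have h1 : Continuous fun x => fderiv ℝ f x v :=
    (hf.continuous_fderiv (by simp)).clm_apply continuous_const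
  have h2 : Integrable (fun x => fderiv ℝ f x v) μ :=
    h1.integrable_of_hasCompactSupport (hs.fderiv_apply ℝ v)
  refine ⟨h2, ?_⟩
  have := integral_mul_fderiv_eq_neg_fderiv_mul_of_integrable (𝕜 := ℝ) (f := fun _ => (1 : ℝ))
    (g := f) (v := v) (μ := μ) (by simp) (by simpa using h2)
    (by simpa using hf.continuous.integrable_of_hasCompactSupport hs)
    (fun _ _ => by fun_prop) (fun x _ => (hf.differentiable (by simp)).differentiableAt)
  simpa using this

lemma ContDiffAt.alternating_apply {W : Type*} [NormedAddCommGroup W] [NormedSpace ℝ W] {k : ℕ}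
    {β : W → W [⋀^Fin k]→L[ℝ] ℝ} {x : W} (h : ContDiffAt ℝ ∞ β x) (v : Fin k → W) :
    ContDiffAt ℝ ∞ (fun z => β z v) x :=
  ((ContinuousMultilinearMap.apply ℝ (fun _ : Fin k => W) ℝ v).comp
    (ContinuousAlternatingMap.toContinuousMultilinearMapCLM ℝ)).contDiff.contDiffAt.comp x h

section Sphere

lemma extDeriv_one_integral {a : ℂ → ℂ [⋀^Fin 1]→L[ℝ] ℝ} (ha : ContDiff ℝ ∞ a)
    (hs : HasCompactSupport a) :
    Integrable (fun t => extDeriv a t ![1, I]) ∧ ∫ t, extDeriv a t ![1, I] = 0 := by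
  have hd : ∀ v : ℂ, ContDiff ℝ ∞ fun t => a t ![v] := fun v =>
    contDiff_iff_contDiffAt.2 fun t => ha.contDiffAt.alternating_apply _
  have hk : ∀ v : ℂ, HasCompactSupport fun t => a t ![v] := fun v => by
    refine hs.comp_left (g := fun β : ℂ [⋀^Fin 1]→L[ℝ] ℝ => β ![v]) rfl
  have h1 := integral_fderiv_eq_zero (μ := volume) (hd I) (hk I) 1
  have h2 := integral_fderiv_eq_zero (μ := volume) (hd 1) (hk 1) I
  simp only [extDeriv_one_apply (ha.differentiable (by simp)).differentiableAt]
  exact ⟨h1.1.sub h2.1, by rw [integral_sub h1.1 h2.1, h1.2, h2.2, sub_zero]⟩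

/-- A smooth cutoff function on `ℂ`, which is `1` for `|t|² ≤ 3/5` and `0` for `|t|² ≥ 5/3`; together
with its pullback under `t ↦ t⁻¹` it is a partition of unity on the Riemann sphere. -/
def bump (t : ℂ) : ℝ := Real.smoothTransition (1 / 2 + 2 * ((1 - ‖t‖ ^ 2) / (1 + ‖t‖ ^ 2)))

lemma contDiff_bump : ContDiff ℝ ∞ bump := by
  refine Real.smoothTransition.contDiff.comp (contDiff_const.add (contDiff_const.mul ?_))
  exact (contDiff_const.sub (contDiff_norm_sq ℝ)).div (contDiff_const.add (contDiff_norm_sq ℝ))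
    fun t => by positivity

lemma bump_one {t : ℂ} (h : ‖t‖ ^ 2 ≤ 3 / 5) : bump t = 1 := by
  refine Real.smoothTransition.one_of_one_le ?_
  have : 1 / 4 ≤ (1 - ‖t‖ ^ 2) / (1 + ‖t‖ ^ 2) := by rw [le_div_iff₀ (by positivity)]; linarith
  linarith

lemma bump_zero {t : ℂ} (h : 5 / 3 ≤ ‖t‖ ^ 2) : bump t = 0 := by
  refine Real.smoothTransition.zero_of_nonpos ?_
  have : (1 - ‖t‖ ^ 2) / (1 + ‖t‖ ^ 2) ≤ -(1 / 4) := by rw [div_le_iff₀ (by positivity)]; linarith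
  linarith

lemma Real.smoothTransition_one_sub (x : ℝ) :
    Real.smoothTransition (1 - x) = 1 - Real.smoothTransition x := by
  have := Real.smoothTransition.pos_denom x
  simp only [Real.smoothTransition, sub_sub_cancel]
  rw [eq_sub_iff_add_eq, add_comm (expNegInvGlue (1 - x)), ← add_div, add_comm, div_self this.ne']

lemma bump_inv {t : ℂ} (h : t ≠ 0) : bump t⁻¹ = 1 - bump t := by
  rw [bump, bump, ← Real.smoothTransition_one_sub]
  congr 1
  have : ‖t‖ ≠ 0 := norm_ne_zero_iff.2 h
  rw [norm_inv]
  field_simp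
  ring

lemma hasCompactSupport_of_norm_sq {E : Type*} [Zero E] {f : ℂ → E}
    (h : ∀ t, 7 / 4 ≤ ‖t‖ ^ 2 → f t = 0) : HasCompactSupport f :=
  HasCompactSupport.intro (isCompact_closedBall 0 2) fun t ht => h t (by
    have := not_le.1 (mt mem_closedBall_zero_iff.2 ht)
    nlinarith)

lemma hasCompactSupport_bump : HasCompactSupport bump :=
  hasCompactSupport_of_norm_sq fun _ h => bump_zero (by linarith)

lemma integral_inv_top (ω₂ : ℂ → ℂ [⋀^Fin 2]→L[ℝ] ℝ) (hI : Integrable fun t => ω₂ t ![1, I]) :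
    Integrable (fun t => (ω₂ t⁻¹).compContinuousLinearMap (fderiv ℝ Inv.inv t) ![1, I]) ∧
    ∫ t, (ω₂ t⁻¹).compContinuousLinearMap (fderiv ℝ Inv.inv t) ![1, I] = ∫ t, ω₂ t ![1, I] := by
  have hS : MeasurableSet ({0}ᶜ : Set ℂ) := (measurableSet_singleton 0).compl
  have him : (Inv.inv '' ({0}ᶜ : Set ℂ)) = {0}ᶜ := by rw [image_inv_eq_inv]; ext t; simp
  have hae : (({0}ᶜ : Set ℂ)) =ᵐ[volume] univ := ae_eq_univ.2 (by simp)
  have hh : ∀ t ∈ ({0}ᶜ : Set ℂ), AnalyticAt ℂ (Inv.inv : ℂ → ℂ) t := fun t ht => analyticAt_inv ht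
  obtain ⟨h1, h2⟩ := integral_image_top volume hS hh (inv_injective.injOn) (ι := Fin 2)
    (by simp) (fun t => (ω₂ t).toAlternatingMap) ![1, I]
  rw [him] at h1 h2
  rw [← integrableOn_univ, ← integrableOn_congr_set_ae hae, ← setIntegral_univ,
    ← setIntegral_congr_set hae, ← setIntegral_univ (f := fun t => ω₂ t ![1, I]),
    ← setIntegral_congr_set (f := fun t => ω₂ t ![1, I]) hae]
  exact ⟨h1.1 hI.integrableOn, h2.symm⟩

/-- The integral of an exact form over the Riemann sphere vanishes: `a` and `b` are the expressions
of a smooth 1-form in the coordinates `t` and `t⁻¹`. -/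
lemma integral_extDeriv_sphere {a b : ℂ → ℂ [⋀^Fin 1]→L[ℝ] ℝ} (ha : ContDiff ℝ ∞ a)
    (hb : ContDiff ℝ ∞ b)
    (hab : ∀ t ≠ 0, a t = (b t⁻¹).compContinuousLinearMap (fderiv ℝ Inv.inv t)) :
    Integrable (fun t => extDeriv a t ![1, I]) ∧ ∫ t, extDeriv a t ![1, I] = 0 := by
  have ha' : ContDiff ℝ ∞ fun t => bump t • a t := contDiff_bump.smul ha
  have hb' : ContDiff ℝ ∞ fun t => bump t • b t := contDiff_bump.smul hb
  have h1 := extDeriv_one_integral ha' hasCompactSupport_bump.smul_right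
  have h2 := extDeriv_one_integral hb' hasCompactSupport_bump.smul_right
  obtain ⟨h3, h4⟩ := integral_inv_top _ h2.1
  have key : ∀ᵐ t : ℂ, extDeriv a t ![1, I] = extDeriv (fun t => bump t • a t) t ![1, I]
      + (extDeriv (fun t => bump t • b t) t⁻¹).compContinuousLinearMap (fderiv ℝ Inv.inv t)
        ![1, I] := by
    filter_upwards [compl_mem_ae_iff.2 (measure_singleton (0 : ℂ))] with t ht
    have hi : AnalyticAt ℂ (Inv.inv : ℂ → ℂ) t := analyticAt_inv ht
    rw [← extDeriv_pullback ((hb'.differentiable (by simp)).differentiableAt)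
      (hi.contDiffAt_real (n := ∞)) (by simpa using two_le_infty)]
    have e : (fun t => (bump t⁻¹ • b t⁻¹).compContinuousLinearMap (fderiv ℝ Inv.inv t)) =ᶠ[𝓝 t]
        fun t => (1 - bump t) • a t := by
      filter_upwards [isOpen_ne.mem_nhds ht] with s hs
      rw [hab s hs, bump_inv hs]
      rfl
    have d1 : DifferentiableAt ℝ (fun t => bump t • a t) t :=
      (ha'.differentiable (by simp)).differentiableAt
    have d2 : DifferentiableAt ℝ (fun t => (1 - bump t) • a t) t :=
      (((contDiff_const.sub contDiff_bump).smul ha).differentiable (by simp)).differentiableAt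
    rw [e.extDeriv_eq, ← ContinuousAlternatingMap.add_apply, ← extDeriv_fun_add d1 d2]
    congr 2
    ext s : 1
    module
  refine ⟨(h1.1.add h3).congr (key.mono fun t ht => ht.symm), ?_⟩
  rw [integral_congr_ae key, integral_add h1.1 h3, h4, h1.2, h2.2, add_zero]

end Sphere
section FubiniStudy

/-- The potential `log (1 + |t|²)` of the Fubini-Study form, in an affine coordinate. -/
def fsPot (t : ℂ) : ℝ := log (1 + ‖t‖ ^ 2)

lemma contDiff_fsPot : ContDiff ℝ ∞ fsPot :=
  (contDiff_const.add (contDiff_norm_sq ℝ)).log fun t => by positivity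

lemma ddc_fsPot (t : ℂ) : ddc fsPot t ![1, I] = Real.pi⁻¹ * ((1 + ‖t‖ ^ 2) ^ 2)⁻¹ := by
  have hq : ∀ z : ℂ, HasFDerivAt (fun z : ℂ => 1 + ‖z‖ ^ 2) (2 • innerSL ℝ z) z := fun z =>
    (hasStrictFDerivAt_norm_sq z).hasFDerivAt.const_add 1
  have hp : ∀ z : ℂ, (1 + ‖z‖ ^ 2 : ℝ) ≠ 0 := fun z => by positivity
  have hf : ∀ z : ℂ, HasFDerivAt fsPot ((1 + ‖z‖ ^ 2)⁻¹ • 2 • innerSL ℝ z) z := fun z =>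
    (hq z).log (hp z)
  have e : ∀ z w : ℂ, dc fsPot z ![w] =
      -(1 / (2 * Real.pi)) * (inner ℝ z (I * w) / (1 + ‖z‖ ^ 2)) := by
    intro z w
    rw [dc_apply, dcLin_apply, (hf z).fderiv]
    simp
    field_simp
    norm_num
  have hre := Complex.reCLM.hasFDerivAt (x := t)
  have him := Complex.imCLM.hasFDerivAt (x := t)
  rw [ddc, extDeriv_one_apply (contDiff_fsPot.contDiffAt.dc.differentiableAt (by simp))]
  have e1 : (fun z => dc fsPot z ![I]) =
      fun z => (1 / (2 * Real.pi)) * (Complex.reCLM z * (1 + ‖z‖ ^ 2)⁻¹) := by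
    ext z; rw [e]; simp [Complex.inner]; ring
  have e2 : (fun z => dc fsPot z ![1]) =
      fun z => -(1 / (2 * Real.pi)) * (Complex.imCLM z * (1 + ‖z‖ ^ 2)⁻¹) := by
    ext z; rw [e]; simp [Complex.inner, div_eq_mul_inv]
  have hv : HasFDerivAt (fun z : ℂ => (1 + ‖z‖ ^ 2)⁻¹) _ t :=
    (hasDerivAt_inv (hp t)).comp_hasFDerivAt t (hq t)
  rw [e1, e2, ((hre.fun_mul hv).const_mul _).fderiv, ((him.fun_mul hv).const_mul _).fderiv]
  have h3 : ‖t‖ ^ 2 = t.re ^ 2 + t.im ^ 2 := by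
    rw [← Complex.normSq_eq_norm_sq, Complex.normSq_apply]; ring
  have h4 : (1 + (t.re ^ 2 + t.im ^ 2)) ≠ 0 := by positivity
  simp [Complex.inner, h3]
  field_simp
  ring

lemma integral_fsPot : Integrable (fun t => ddc fsPot t ![1, I]) ∧
    ∫ t, ddc fsPot t ![1, I] = 1 := by
  simp only [ddc_fsPot]
  constructor
  · refine Integrable.const_mul ?_ _
    have := integrable_rpow_neg_one_add_norm_sq (E := ℂ) (μ := volume) (r := 4) (by simp; norm_num)
    refine this.congr (Eventually.of_forall fun t => ?_)
    simp only
    rw [show (-4 / 2 : ℝ) = -(2 : ℕ) by norm_num, Real.rpow_neg (by positivity), Real.rpow_natCast]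
  · rw [integral_const_mul, ← Complex.integral_comp_polarCoord_symm]
    have e : ∀ p ∈ polarCoord.target, p.1 • ((1 + ‖Complex.polarCoord.symm p‖ ^ 2) ^ 2)⁻¹ =
        p.1 * ((1 + p.1 ^ 2) ^ 2)⁻¹ * 1 := by
      intro p hp
      rw [Complex.norm_polarCoord_symm, sq_abs]
      simp
    rw [setIntegral_congr_fun polarCoord.open_target.measurableSet e, polarCoord_target,
      Measure.volume_eq_prod, setIntegral_prod_mul (fun r : ℝ => r * ((1 + r ^ 2) ^ 2)⁻¹)
        (fun _ => (1 : ℝ)) (Ioi 0) (Ioo (-Real.pi) Real.pi)]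
    have hd : ∀ x ∈ Ici (0 : ℝ), HasDerivAt (fun r : ℝ => -(1 / 2) * (1 + r ^ 2)⁻¹)
        (x * ((1 + x ^ 2) ^ 2)⁻¹) x := by
      intro x _
      have h1 : HasDerivAt (fun r : ℝ => 1 + r ^ 2) (2 * x) x := by
        simpa using (hasDerivAt_pow 2 x).const_add 1
      convert! (h1.inv (by positivity)).const_mul (-(1 / 2) : ℝ) using 1
      field_simp
    have ht : Tendsto (fun r : ℝ => -(1 / 2) * (1 + r ^ 2)⁻¹) atTop (𝓝 (-(1 / 2) * 0)) :=
      (tendsto_inv_atTop_zero.comp (tendsto_const_nhds.add_atTop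
        (tendsto_pow_atTop two_ne_zero))).const_mul _
    rw [integral_Ioi_of_hasDerivAt_of_nonneg' hd (fun x hx => mul_nonneg (le_of_lt hx)
      (by positivity)) ht]
    have := Real.pi_pos.le
    simp [this]
    field_simp
    norm_num

/-- The total mass of `ddc P`, for a function `P` with `P u = log |u|²` near infinity. -/
lemma integral_ddc_eq_one {P : ℂ → ℝ} (hP : ContDiff ℝ ∞ P) (R : ℝ)
    (h : ∀ u, R ≤ ‖u‖ → P u = log (‖u‖ ^ 2)) :
    Integrable (fun t => ddc P t ![1, I]) ∧ ∫ t, ddc P t ![1, I] = 1 := by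
  -- `P - log (1 + |t|²)` extends to a smooth function on the sphere
  set g : ℂ → ℝ := fun t => P t + -1 * fsPot t with hg
  set l : ℂ → ℝ := fun v => if v = 0 then 0 else g v⁻¹ with hl
  have hgs : ContDiff ℝ ∞ g := hP.add (contDiff_const.mul contDiff_fsPot)
  have hl0 : l =ᶠ[𝓝 0] fun v => -1 * fsPot v := by
    have : ∀ᶠ v : ℂ in 𝓝 0, ‖v‖ * R < 1 :=
      (continuous_norm.mul continuous_const).continuousAt.eventually_lt continuousAt_const (by simp)
    filter_upwards [this] with v hv
    by_cases h0 : v = 0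
    · simp [hl, h0, fsPot]
    · have hn : 0 < ‖v‖ := norm_pos_iff.2 h0
      rw [hl]
      simp only [h0, if_false]
      rw [hg]
      simp only
      rw [h _ (by rw [norm_inv, ← one_div, le_div_iff₀ hn]; linarith), fsPot, fsPot, norm_inv,
        show 1 + ‖v‖⁻¹ ^ 2 = (1 + ‖v‖ ^ 2) * ‖v‖⁻¹ ^ 2 by field_simp; ring,
        Real.log_mul (by positivity) (by positivity)]
      ring
  have hls : ContDiff ℝ ∞ l := by
    refine contDiff_iff_contDiffAt.2 fun v => ?_
    by_cases h0 : v = 0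
    · rw [h0]
      exact (contDiff_const.mul contDiff_fsPot).contDiffAt.congr_of_eventuallyEq hl0
    · refine (hgs.contDiffAt.comp v (analyticAt_inv h0).contDiffAt_real).congr_of_eventuallyEq ?_
      filter_upwards [isOpen_ne.mem_nhds h0] with w hw
      simp only [hl, if_neg (show w ≠ 0 from hw), Function.comp_apply]
  have hgl : ∀ t ≠ 0, dc g t = (dc l t⁻¹).compContinuousLinearMap (fderiv ℝ Inv.inv t) := by
    intro t ht
    rw [← dc_comp (hls.differentiable (by simp)).differentiableAt (analyticAt_inv ht).differentiableAt]
    refine EventuallyEq.eq_of_nhds (EventuallyEq.dc ?_)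
    filter_upwards [isOpen_ne.mem_nhds ht] with w hw
    have : w⁻¹ ≠ 0 := inv_ne_zero hw
    simp only [hl, if_neg this, inv_inv]
  obtain ⟨h1, h2⟩ := integral_extDeriv_sphere (contDiff_iff_contDiffAt.2 fun t => hgs.contDiffAt.dc)
    (contDiff_iff_contDiffAt.2 fun t => hls.contDiffAt.dc) hgl
  have e : ∀ t, ddc P t ![1, I] = extDeriv (dc g) t ![1, I] + ddc fsPot t ![1, I] := by
    intro t
    have := ddc_add (x := t) hgs.contDiffAt contDiff_fsPot.contDiffAt
    rw [show (fun z => g z + fsPot z) = P by ext z; simp [hg]] at this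
    rw [this]
    rfl
  obtain ⟨h3, h4⟩ := integral_fsPot
  simp only [e]
  exact ⟨h1.add h3, by rw [integral_add h1 h3, h2, h4, zero_add]⟩

end FubiniStudy
/-! ### The wedge product on `ℂ × ℂ` and Stokes' theorem -/

instance isAddHaarMeasure_volume_prod : (volume : Measure (ℂ × ℂ)).IsAddHaarMeasure :=
  inferInstanceAs ((volume : Measure ℂ).prod (volume : Measure ℂ)).IsAddHaarMeasure

/-- The real basis of `ℂ × ℂ` that is used for the coefficients of forms. -/
def stdFrame : Fin 4 → ℂ × ℂ := ![(1, 0), (I, 0), (0, 1), (0, I)]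

section Wedge

variable (A B : (ℂ × ℂ) [⋀^Fin 2]→L[ℝ] ℝ)

/-- `A ∧ B`, on a quadruple of vectors. -/
def wedgeOn (v : Fin 4 → ℂ × ℂ) : ℝ :=
  A ![v 0, v 1] * B ![v 2, v 3] - A ![v 0, v 2] * B ![v 1, v 3] + A ![v 0, v 3] * B ![v 1, v 2]
    + A ![v 1, v 2] * B ![v 0, v 3] - A ![v 1, v 3] * B ![v 0, v 2] + A ![v 2, v 3] * B ![v 0, v 1]

lemma alternating_two {W : Type*} [NormedAddCommGroup W] [NormedSpace ℝ W]
    (A : W [⋀^Fin 2]→L[ℝ] ℝ) : ∃ b : W →ₗ[ℝ] W →ₗ[ℝ] ℝ,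
      (∀ x y, A ![x, y] = b x y) ∧ ∀ x y, b x y = -b y x := by
  have h0 : ∀ a x y : W, Function.update ![x, y] 0 a = ![a, y] := fun a x y => by
    ext i; fin_cases i <;> rfl
  have h1 : ∀ a x y : W, Function.update ![x, y] 1 a = ![x, a] := fun a x y => by
    ext i; fin_cases i <;> rfl
  refine ⟨LinearMap.mk₂ ℝ (fun x y => A ![x, y]) (fun x x' y => ?_) (fun c x y => ?_)
    (fun x y y' => ?_) (fun c x y => ?_), fun x y => rfl, fun x y => ?_⟩
  · simpa only [h0] using A.map_update_add ![x, y] 0 x x'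
  · simpa only [h0] using A.map_update_smul ![x, y] 0 c x
  · simpa only [h1] using A.map_update_add ![x, y] 1 y y'
  · simpa only [h1] using A.map_update_smul ![x, y] 1 c y
  · have := A.map_swap ![x, y] (i := 0) (j := 1) (by decide)
    have e : ![x, y] ∘ Equiv.swap (0 : Fin 2) 1 = ![y, x] := by ext i; fin_cases i <;> rfl
    rw [e] at this
    exact (neg_eq_iff_eq_neg.2 this).symm

lemma exists_wedgeOn : ∃ Ω : (ℂ × ℂ) [⋀^Fin 4]→ₗ[ℝ] ℝ, ∀ v, Ω v = wedgeOn A B v := by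
  obtain ⟨a, ha, ha'⟩ := alternating_two A
  obtain ⟨b, hb, hb'⟩ := alternating_two B
  have ha0 : ∀ x, a x x = 0 := fun x => by linarith [ha' x x]
  have hb0 : ∀ x, b x x = 0 := fun x => by linarith [hb' x x]
  refine ⟨⟨⟨wedgeOn A B, @fun inst m i x y => ?_, @fun inst m i c x => ?_⟩, fun v i j h hij => ?_⟩,
    fun v => rfl⟩
  · obtain rfl := Subsingleton.elim inst (instDecidableEqFin 4)
    fin_cases i <;> simp [wedgeOn, ha, hb] <;> ring
  · obtain rfl := Subsingleton.elim inst (instDecidableEqFin 4)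
    fin_cases i <;> simp [wedgeOn, ha, hb] <;> ring
  · simp only [wedgeOn, ha, hb]
    have n : ∀ i j, a (v j) (v i) = -a (v i) (v j) := fun i j => ha' _ _
    have n' : ∀ i j, b (v j) (v i) = -b (v i) (v j) := fun i j => hb' _ _
    fin_cases i <;> fin_cases j <;> first | exact absurd rfl hij | skip
    all_goals
      simp only [Fin.zero_eta, Fin.mk_one, Fin.reduceFinMk] at h
      simp only [h, ha0, hb0, n 0 1, n 0 2, n 1 2, n 1 3, n 2 3, n' 0 1, n' 0 2,
        n' 1 2, n' 1 3, n' 2 3]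
      ring

end Wedge

section Stokes

/-- The coefficient of the orientation form in `A ∧ B`. -/
def wedge (A B : (ℂ × ℂ) [⋀^Fin 2]→L[ℝ] ℝ) : ℝ := wedgeOn A B stdFrame

lemma wedge_add_left (A A' B : (ℂ × ℂ) [⋀^Fin 2]→L[ℝ] ℝ) :
    wedge (A + A') B = wedge A B + wedge A' B := by
  simp only [wedge, wedgeOn, ContinuousAlternatingMap.add_apply]; ring

lemma wedge_add_right (A B B' : (ℂ × ℂ) [⋀^Fin 2]→L[ℝ] ℝ) :
    wedge A (B + B') = wedge A B + wedge A B' := by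
  simp only [wedge, wedgeOn, ContinuousAlternatingMap.add_apply]; ring

lemma wedge_zero_left (B : (ℂ × ℂ) [⋀^Fin 2]→L[ℝ] ℝ) : wedge 0 B = 0 := by simp [wedge, wedgeOn]

lemma wedge_zero_right (A : (ℂ × ℂ) [⋀^Fin 2]→L[ℝ] ℝ) : wedge A 0 = 0 := by simp [wedge, wedgeOn]

lemma ContDiffAt.wedge {A B : ℂ × ℂ → (ℂ × ℂ) [⋀^Fin 2]→L[ℝ] ℝ} {y : ℂ × ℂ}
    (hA : ContDiffAt ℝ ∞ A y) (hB : ContDiffAt ℝ ∞ B y) :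
    ContDiffAt ℝ ∞ (fun y => wedge (A y) (B y)) y := by
  have h : ∀ v w, ContDiffAt ℝ ∞ (fun y => A y v * B y w) y := fun v w =>
    (hA.alternating_apply v).mul (hB.alternating_apply w)
  exact (((((h _ _).sub (h _ _)).add (h _ _)).add (h _ _)).sub (h _ _)).add (h _ _)

lemma wedge_comm (A B : (ℂ × ℂ) [⋀^Fin 2]→L[ℝ] ℝ) : wedge A B = wedge B A := by
  simp only [wedge, wedgeOn]; ring

lemma wedgeOn_comp (A B : (ℂ × ℂ) [⋀^Fin 2]→L[ℝ] ℝ) (l : ℂ × ℂ →L[ℝ] ℂ × ℂ) (v : Fin 4 → ℂ × ℂ) :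
    wedgeOn A B (fun j => l (v j)) =
      wedgeOn (A.compContinuousLinearMap l) (B.compContinuousLinearMap l) v := by
  have : ∀ a b : ℂ × ℂ, ![l a, l b] = l ∘ ![a, b] := fun a b => by ext i : 1; fin_cases i <;> rfl
  simp only [wedgeOn, ContinuousAlternatingMap.compContinuousLinearMap_apply, this]

lemma integral_wedge_image (A B : ℂ × ℂ → (ℂ × ℂ) [⋀^Fin 2]→L[ℝ] ℝ) {S : Set (ℂ × ℂ)}
    {h : ℂ × ℂ → ℂ × ℂ} (hS : MeasurableSet S) (hh : ∀ y ∈ S, AnalyticAt ℂ h y) (hi : InjOn h S) :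
    (IntegrableOn (fun y => wedge (A y) (B y)) (h '' S) ↔
      IntegrableOn (fun y => wedge ((A (h y)).compContinuousLinearMap (fderiv ℝ h y))
        ((B (h y)).compContinuousLinearMap (fderiv ℝ h y))) S) ∧ ∫ y in h '' S, wedge (A y) (B y) =
      ∫ y in S, wedge ((A (h y)).compContinuousLinearMap (fderiv ℝ h y))
        ((B (h y)).compContinuousLinearMap (fderiv ℝ h y)) := by
  choose Ω hΩ using fun y => exists_wedgeOn (A y) (B y)
  have := integral_image_top volume hS hh hi (by simp) Ω stdFrame
  simp only [hΩ, wedgeOn_comp] at this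
  exact this

lemma extDeriv_two_apply {W : Type*} [NormedAddCommGroup W] [NormedSpace ℝ W]
    {ψ : W → W [⋀^Fin 2]→L[ℝ] ℝ} {x : W} (h : DifferentiableAt ℝ ψ x) (a b c : W) :
    extDeriv ψ x ![a, b, c] = fderiv ℝ (fun z => ψ z ![b, c]) x a -
      fderiv ℝ (fun z => ψ z ![a, c]) x b + fderiv ℝ (fun z => ψ z ![a, b]) x c := by
  rw [extDeriv_apply h, Fin.sum_univ_three]
  have e0 : (0 : Fin 3).removeNth ![a, b, c] = ![b, c] := by ext i; fin_cases i <;> rfl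
  have e1 : (1 : Fin 3).removeNth ![a, b, c] = ![a, c] := by ext i; fin_cases i <;> rfl
  have e2 : (2 : Fin 3).removeNth ![a, b, c] = ![a, b] := by ext i; fin_cases i <;> rfl
  rw [e0, e1, e2]
  simp
  ring

/-- Stokes' theorem for `d (γ ∧ ψ) = dγ ∧ ψ`, where `ψ` is closed and `γ ∧ ψ` has compact support. -/
lemma integral_extDeriv_wedge {γ : ℂ × ℂ → (ℂ × ℂ) [⋀^Fin 1]→L[ℝ] ℝ}
    {ψ : ℂ × ℂ → (ℂ × ℂ) [⋀^Fin 2]→L[ℝ] ℝ} {U K : Set (ℂ × ℂ)} (hU : IsOpen U) (hK : IsCompact K)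
    (hKU : K ⊆ U) (hγ : ∀ y ∈ U, ContDiffAt ℝ ∞ γ y) (hψ : ∀ y ∈ U, ContDiffAt ℝ ∞ ψ y)
    (hd : ∀ y ∈ U, extDeriv ψ y = 0) (h0 : ∀ y ∈ U, y ∉ K → γ y = 0 ∨ ψ y = 0) :
    IntegrableOn (fun y => wedge (extDeriv γ y) (ψ y)) U ∧
      ∫ y in U, wedge (extDeriv γ y) (ψ y) = 0 := by
  let g : Fin 4 → ℂ × ℂ → ℝ := fun i y => γ y ![stdFrame i]
  let p : Fin 4 → Fin 4 → ℂ × ℂ → ℝ := fun i j y => ψ y ![stdFrame i, stdFrame j]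
  let f : Fin 4 → ℂ × ℂ → ℝ := ![fun y => g 1 y * p 2 3 y - g 2 y * p 1 3 y + g 3 y * p 1 2 y,
    fun y => -(g 0 y * p 2 3 y) + g 2 y * p 0 3 y - g 3 y * p 0 2 y,
    fun y => g 0 y * p 1 3 y - g 1 y * p 0 3 y + g 3 y * p 0 1 y,
    fun y => -(g 0 y * p 1 2 y) + g 1 y * p 0 2 y - g 2 y * p 0 1 y]
  have hg : ∀ i, ∀ y ∈ U, ContDiffAt ℝ ∞ (g i) y := fun i y hy => (hγ y hy).alternating_apply _
  have hp : ∀ i j, ∀ y ∈ U, ContDiffAt ℝ ∞ (p i j) y := fun i j y hy =>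
    (hψ y hy).alternating_apply _
  have hgp : ∀ i j l, ∀ y ∈ U, ContDiffAt ℝ ∞ (fun y => g i y * p j l y) y := fun i j l y hy =>
    (hg i y hy).mul (hp j l y hy)
  have hf : ∀ m, ∀ y ∈ U, ContDiffAt ℝ ∞ (f m) y := by
    intro m y hy
    fin_cases m
    · exact ((hgp _ _ _ y hy).sub (hgp _ _ _ y hy)).add (hgp _ _ _ y hy)
    · exact ((hgp _ _ _ y hy).neg.add (hgp _ _ _ y hy)).sub (hgp _ _ _ y hy)
    · exact ((hgp _ _ _ y hy).sub (hgp _ _ _ y hy)).add (hgp _ _ _ y hy)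
    · exact ((hgp _ _ _ y hy).neg.add (hgp _ _ _ y hy)).sub (hgp _ _ _ y hy)
  have hf0 : ∀ m, ∀ y ∈ U, y ∉ K → f m y = 0 := by
    intro m y hy hyK
    rcases h0 y hy hyK with h | h <;> fin_cases m <;> simp [f, g, p, h]
  let F : Fin 4 → ℂ × ℂ → ℝ := fun m => U.indicator (f m)
  have hF0 : ∀ m, ∀ y ∉ K, F m y = 0 := by
    intro m y hy
    by_cases hyU : y ∈ U
    · simp only [F, indicator_of_mem hyU, hf0 m y hyU hy]
    · exact indicator_of_notMem hyU _
  have hFU : ∀ m, ∀ y ∈ U, F m =ᶠ[𝓝 y] f m := fun m y hy => by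
    filter_upwards [hU.mem_nhds hy] with z hz using indicator_of_mem hz _
  have hFK : ∀ m, ∀ y ∉ U, F m =ᶠ[𝓝 y] fun _ => 0 := fun m y hy => by
    filter_upwards [hK.isClosed.isOpen_compl.mem_nhds fun h => hy (hKU h)] with z hz using hF0 m z hz
  have hF : ∀ m, ContDiff ℝ ∞ (F m) := fun m => contDiff_iff_contDiffAt.2 fun y => by
    by_cases hy : y ∈ U
    · exact (hf m y hy).congr_of_eventuallyEq (hFU m y hy)
    · exact contDiffAt_const.congr_of_eventuallyEq (hFK m y hy)
  have hFs : ∀ m, HasCompactSupport (F m) := fun m =>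
    HasCompactSupport.intro hK (hF0 m)
  have hI := fun m => integral_fderiv_eq_zero (μ := volume) (hF m) (hFs m) (stdFrame m)
  have key : U.indicator (fun y => wedge (extDeriv γ y) (ψ y)) =
      fun y => ∑ m, fderiv ℝ (F m) y (stdFrame m) := by
    ext y
    by_cases hy : y ∈ U
    · have dg : ∀ i, HasFDerivAt (g i) (fderiv ℝ (g i) y) y := fun i =>
        ((hg i y hy).differentiableAt (by simp)).hasFDerivAt
      have dp : ∀ i j, HasFDerivAt (p i j) (fderiv ℝ (p i j) y) y := fun i j =>
        ((hp i j y hy).differentiableAt (by simp)).hasFDerivAt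
      have dgp := fun i j l => (dg i).fun_mul (dp j l)
      have c : ∀ i j l : Fin 4, fderiv ℝ (p j l) y (stdFrame i) - fderiv ℝ (p i l) y (stdFrame j)
          + fderiv ℝ (p i j) y (stdFrame l) = 0 := fun i j l => by
        rw [← extDeriv_two_apply ((hψ y hy).differentiableAt (by simp)), hd y hy]; rfl
      have w : ∀ i j : Fin 4, extDeriv γ y ![stdFrame i, stdFrame j] =
          fderiv ℝ (g j) y (stdFrame i) - fderiv ℝ (g i) y (stdFrame j) := fun i j =>
        extDeriv_one_apply ((hγ y hy).differentiableAt (by simp)) _ _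
      have e0 := (((dgp 1 2 3).fun_sub (dgp 2 1 3)).fun_add (dgp 3 1 2)).fderiv
      have e1 := (((dgp 0 2 3).fun_neg.fun_add (dgp 2 0 3)).fun_sub (dgp 3 0 2)).fderiv
      have e2 := (((dgp 0 1 3).fun_sub (dgp 1 0 3)).fun_add (dgp 3 0 1)).fderiv
      have e3 := (((dgp 0 1 2).fun_neg.fun_add (dgp 1 0 2)).fun_sub (dgp 2 0 1)).fderiv
      rw [indicator_of_mem hy, Fin.sum_univ_four, (hFU 0 y hy).fderiv_eq, (hFU 1 y hy).fderiv_eq,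
        (hFU 2 y hy).fderiv_eq, (hFU 3 y hy).fderiv_eq]
      change _ = fderiv ℝ (fun y => g 1 y * p 2 3 y - g 2 y * p 1 3 y + g 3 y * p 1 2 y) y _ +
        fderiv ℝ (fun y => -(g 0 y * p 2 3 y) + g 2 y * p 0 3 y - g 3 y * p 0 2 y) y _ +
        fderiv ℝ (fun y => g 0 y * p 1 3 y - g 1 y * p 0 3 y + g 3 y * p 0 1 y) y _ +
        fderiv ℝ (fun y => -(g 0 y * p 1 2 y) + g 1 y * p 0 2 y - g 2 y * p 0 1 y) y _
      rw [e0, e1, e2, e3]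
      have hw : wedge (extDeriv γ y) (ψ y) = wedgeOn (extDeriv γ y) (ψ y) stdFrame := rfl
      rw [hw, wedgeOn, w, w, w, w, w, w]
      simp only [add_apply, sub_apply, neg_apply, smul_apply, smul_eq_mul]
      change (_ * p 2 3 y - _ * p 1 3 y + _ * p 1 2 y + _ * p 0 3 y - _ * p 0 2 y + _ * p 0 1 y) = _
      linear_combination g 0 y * c 1 2 3 - g 1 y * c 0 2 3 + g 2 y * c 0 1 3 - g 3 y * c 0 1 2
    · rw [indicator_of_notMem hy]
      exact (Finset.sum_eq_zero fun m _ => by simp [(hFK m y hy).fderiv_eq]).symm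
  rw [← integrable_indicator_iff hU.measurableSet, ← integral_indicator hU.measurableSet, key]
  refine ⟨integrable_finsetSum _ fun m _ => (hI m).1, ?_⟩
  rw [integral_finsetSum _ fun m _ => (hI m).1]
  exact Finset.sum_eq_zero fun m _ => (hI m).2

end Stokes
section Slices

variable {ρ : ℂ × ℂ → (ℂ × ℂ) [⋀^Fin 2]→L[ℝ] ℝ} {r : ℝ}

/-- The integral of a closed form over the lines `ℂ × {u}` does not depend on `u`, if the support of
the form is bounded in the direction of these lines. -/
lemma integral_slice_const (hρ : ∀ y : ℂ × ℂ, ‖y.2‖ < r → ContDiffAt ℝ ∞ ρ y)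
    (hd : ∀ y : ℂ × ℂ, ‖y.2‖ < r → extDeriv ρ y = 0) (hs : ∀ y : ℂ × ℂ, 7 / 4 ≤ ‖y.1‖ ^ 2 → ρ y = 0)
    {u : ℂ} (hu : ‖u‖ < r) : ∫ t, ρ (t, u) ![(1, 0), (I, 0)] = ∫ t, ρ (t, 0) ![(1, 0), (I, 0)] := by
  let θ := Real.smoothTransition
  let T : ℂ × ℝ → ℂ × ℂ := fun q => (q.1, θ q.2 • u)
  have hθ : ContDiff ℝ ∞ θ := Real.smoothTransition.contDiff
  have hT : ContDiff ℝ ∞ T := contDiff_fst.prodMk ((hθ.comp contDiff_snd).smul contDiff_const)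
  have hTr : ∀ q, ‖(T q).2‖ < r := fun q => by
    simp only [T, norm_smul, Real.norm_of_nonneg (Real.smoothTransition.nonneg _), θ]
    exact (mul_le_of_le_one_left (norm_nonneg _) (Real.smoothTransition.le_one _)).trans_lt hu
  have hc : ∀ v, ContDiff ℝ ∞ fun q => ρ (T q) v := fun v => contDiff_iff_contDiffAt.2 fun q =>
    ((hρ _ (hTr q)).alternating_apply v).comp q hT.contDiffAt
  let F : ℂ × ℝ → ℝ := fun q => ρ (T q) ![(1, 0), (I, 0)]
  let H : ℂ → ℝ → ℝ := fun t s => fderiv ℝ F (t, s) (0, 1)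
  have hFs : ∀ t s, HasDerivAt (fun s => F (t, s)) (H t s) s := fun t s => by
    exact ((hc ![(1, 0), (I, 0)]).differentiable (by simp) (t, s)).hasFDerivAt.comp_hasDerivAt s
      ((hasDerivAt_const s t).prodMk (hasDerivAt_id s))
  have hHc : Continuous (Function.uncurry H) :=
    ((hc _).continuous_fderiv (by simp)).clm_apply continuous_const
  have hle : ∀ t s, s ≤ 0 → F (t, s) = F (t, 0) := fun t s h => by
    simp [F, T, θ, Real.smoothTransition.zero_of_nonpos h]
  have hge : ∀ t s, 1 ≤ s → F (t, s) = F (t, 1) := fun t s h => by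
    simp [F, T, θ, Real.smoothTransition.one_of_one_le h]
  have hρ0 : ∀ t s v, 7 / 4 ≤ ‖t‖ ^ 2 → ρ (T (t, s)) v = 0 := fun t s v h => by
    rw [hs (T (t, s)) h]; rfl
  have hk : ∀ s v, ContDiff ℝ ∞ (fun t => ρ (T (t, s)) v) ∧
      HasCompactSupport fun t => ρ (T (t, s)) v := fun s v =>
    ⟨(hc v).comp (contDiff_prodMk_left s), hasCompactSupport_of_norm_sq fun t => hρ0 t s v⟩
  have hH0 : ∀ q ∉ closedBall (0 : ℂ) 2 ×ˢ Icc (0 : ℝ) 1, Function.uncurry H q = 0 := by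
    rintro ⟨t, s⟩ hq
    change H t s = 0
    have hlim : ∀ c : ℝ, (fun s => F (t, s)) =ᶠ[𝓝 s] (fun _ => c) → H t s = 0 := fun c h => by
      rw [← (hFs t s).deriv, h.deriv_eq, deriv_const]
    by_cases ht : ‖t‖ ≤ 2
    · rcases lt_or_ge s 0 with h | h
      · exact hlim _ ((gt_mem_nhds h).mono fun s' h' => hle t s' h'.le)
      · have : 1 < s := by
          by_contra! h'
          exact hq ⟨mem_closedBall_zero_iff.2 ht, h, h'⟩
        exact hlim _ ((lt_mem_nhds this).mono fun s' h' => hge t s' h'.le)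
    · exact hlim 0 (Eventually.of_forall fun s' => hρ0 t s' _ (by nlinarith))
  have hHs : HasCompactSupport (Function.uncurry H) :=
    HasCompactSupport.intro ((isCompact_closedBall _ _).prod isCompact_Icc) hH0
  have hHt : ∀ t, ∫ s, H t s = F (t, 1) - F (t, 0) := fun t => by
    refine integral_of_hasDerivAt_of_tendsto (hFs t)
      ((hHc.comp (Continuous.prodMk_right t)).integrable_of_hasCompactSupport ?_)
      (tendsto_const_nhds.congr' ((eventually_le_atBot 0).mono fun s h => (hle t s h).symm))
      (tendsto_const_nhds.congr' ((eventually_ge_atTop 1).mono fun s h => (hge t s h).symm))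
    exact HasCompactSupport.intro isCompact_Icc fun s h => hH0 (t, s) fun h' => h h'.2
  have hHz : ∀ s, ∫ t, H t s = 0 := fun s => by
    have h1 := integral_fderiv_eq_zero (μ := volume) (hk s ![(0, u), (I, 0)]).1 (hk _ _).2 1
    have h2 := integral_fderiv_eq_zero (μ := volume) (hk s ![(0, u), (1, 0)]).1 (hk _ _).2 I
    have e : ∀ t, H t s = deriv θ s * (fderiv ℝ (fun t => ρ (T (t, s)) ![(0, u), (I, 0)]) t 1 -
        fderiv ℝ (fun t => ρ (T (t, s)) ![(0, u), (1, 0)]) t I) := fun t => by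
      have hD : ∀ v w, HasFDerivAt (fun y => ρ y ![v, w])
          (fderiv ℝ (fun y => ρ y ![v, w]) (T (t, s))) (T (t, s)) := fun v w =>
        (((hρ _ (hTr (t, s))).alternating_apply _).differentiableAt (by simp)).hasFDerivAt
      have hx : ∀ v w a, fderiv ℝ (fun t => ρ (T (t, s)) ![v, w]) t a =
          fderiv ℝ (fun y => ρ y ![v, w]) (T (t, s)) (a, 0) := fun v w a => by
        have := (hD v w).comp t (f := fun t => T (t, s))
          ((hasFDerivAt_id t).prodMk (hasFDerivAt_const (θ s • u) t))
        rw [show (fun t => ρ (T (t, s)) ![v, w]) = (fun y => ρ y ![v, w]) ∘ fun t => T (t, s) from rfl,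
          this.fderiv]
        rfl
      have hy : H t s = fderiv ℝ (fun y => ρ y ![(1, 0), (I, 0)]) (T (t, s))
          (0, deriv θ s • u) := by
        rw [← (hFs t s).deriv]
        exact ((hD _ _).comp_hasDerivAt s (f := fun s => T (t, s)) ((hasDerivAt_const s t).prodMk
          ((hθ.differentiable (by simp) s).hasDerivAt.smul_const u))).deriv
      have h3 := extDeriv_two_apply ((hρ _ (hTr (t, s))).differentiableAt (by simp)) (0, u) (1, 0)
        (I, 0)
      rw [hd _ (hTr (t, s))] at h3
      rw [hx, hx, hy, show ((0 : ℂ), deriv θ s • u) = deriv θ s • ((0 : ℂ), u) by simp, map_smul,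
        smul_eq_mul]
      congr 1
      have h4 : (0 : (ℂ × ℂ) [⋀^Fin 3]→L[ℝ] ℝ) ![((0 : ℂ), u), (1, 0), (I, 0)] = 0 := rfl
      linarith
    simp only [e]
    rw [integral_const_mul, integral_sub h1.1 h2.1, h1.2, h2.2, sub_zero, mul_zero]
  have hI : ∀ s, Integrable fun t => F (t, s) := fun s =>
    (hk s _).1.continuous.integrable_of_hasCompactSupport (hk s _).2
  have := integral_integral_swap_of_hasCompactSupport hHc hHs (μ := volume) (ν := volume)
  simp only [hHt, hHz, integral_zero] at this
  rw [integral_sub (hI 1) (hI 0), sub_eq_zero] at this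
  simpa [F, T, θ, Real.smoothTransition.zero, Real.smoothTransition.one] using this

end Slices

section Model

/-- The function `|u| ‖z‖²` on the blow-up, in an affine coordinate of the exceptional divisor. -/
def affNorm (y : ℂ × ℂ) : ℝ := ‖y.2‖ * (1 + ‖y.1‖ ^ 2)

lemma continuous_affNorm : Continuous affNorm := by unfold affNorm; fun_prop

lemma isOpen_affNorm_lt (c : ℝ) : IsOpen {y | affNorm y < c} :=
  isOpen_lt continuous_affNorm continuous_const

lemma isCompact_affNorm_le (c : ℝ) : IsCompact {y : ℂ × ℂ | affNorm y ≤ c ∧ ‖y.1‖ ^ 2 ≤ 7 / 4} := by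
  refine Metric.isCompact_of_isClosed_isBounded ((isClosed_le continuous_affNorm
    continuous_const).inter (isClosed_le (f := fun y : ℂ × ℂ => ‖y.1‖ ^ 2)
    (g := fun _ => 7 / 4) (by fun_prop) continuous_const))
    (((Metric.isBounded_closedBall (x := (0 : ℂ)) (r := 2)).prod
      (Metric.isBounded_closedBall (x := (0 : ℂ)) (r := c))).subset fun y hy => ⟨?_, ?_⟩)
  · have h1 : ‖y.1‖ ^ 2 ≤ 7 / 4 := hy.2
    exact mem_closedBall_zero_iff.2 (by nlinarith [norm_nonneg y.1])
  · have h1 : ‖y.2‖ * (1 + ‖y.1‖ ^ 2) ≤ c := hy.1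
    exact mem_closedBall_zero_iff.2 (by
      nlinarith [norm_nonneg y.2, mul_nonneg (norm_nonneg y.2) (sq_nonneg ‖y.1‖)])

/-- The potential of the form which is dual to the exceptional divisor, in an affine coordinate. It
is the sum of `log |u|²` and of a function with compact support in the direction of the fibres. -/
def dualModel (ε : ℝ) (y : ℂ × ℂ) : ℝ :=
  (1 - cut ε (affNorm y ^ 2)) * log (‖y.2‖ ^ 2) - 2 * (cut ε (affNorm y ^ 2) * log (1 + ‖y.1‖ ^ 2))

/-- A smooth function with the value `log |u|²` outside of a disk. -/
def logModel (ε : ℝ) (u : ℂ) : ℝ := (1 - cut ε (‖u‖ ^ 2)) * log (‖u‖ ^ 2)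

variable {ε : ℝ} (hε : 0 < ε)
include hε

lemma cut_affNorm_one {a : ℝ} (h0 : 0 ≤ a) (h : a ≤ ε ^ 2 / 9) : cut ε (a ^ 2) = 1 :=
  cut_one hε ((pow_le_pow_left₀ h0 h 2).trans_eq (by ring))

lemma cut_affNorm_zero {a : ℝ} (h : ε ^ 2 / 4 ≤ a) : cut ε (a ^ 2) = 0 :=
  cut_zero hε (le_trans (by ring_nf; rfl) (pow_le_pow_left₀ (by positivity) h 2))

lemma contDiff_logModel : ContDiff ℝ ∞ (logModel ε) := by
  refine contDiff_iff_contDiffAt.2 fun u => ?_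
  by_cases hu : u = 0
  · have : logModel ε =ᶠ[𝓝 u] fun _ => 0 := by
      have : ∀ᶠ v : ℂ in 𝓝 u, ‖v‖ < ε ^ 2 / 9 :=
        continuous_norm.continuousAt.eventually_lt continuousAt_const (by rw [hu]; simp; positivity)
      filter_upwards [this] with v hv
      rw [logModel, cut_affNorm_one hε (norm_nonneg _) hv.le]
      ring
    exact contDiffAt_const.congr_of_eventuallyEq this
  · exact (contDiffAt_const.sub ((contDiff_cut ε).comp (contDiff_norm_sq ℝ)).contDiffAt).mul
      (contDiffAt_log_norm_sq analyticAt_id hu)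

lemma dualModel_inner {y : ℂ × ℂ} (h : affNorm y ≤ ε ^ 2 / 9) :
    dualModel ε y = -2 * log (1 + ‖y.1‖ ^ 2) := by
  rw [dualModel, cut_affNorm_one hε (by unfold affNorm; positivity) h]
  ring

lemma dualModel_outer {y : ℂ × ℂ} (h : ε ^ 2 / 4 ≤ affNorm y) :
    dualModel ε y = log (‖y.2‖ ^ 2) := by
  rw [dualModel, cut_affNorm_zero hε h]
  ring

lemma contDiff_dualModel : ContDiff ℝ ∞ (dualModel ε) := by
  refine contDiff_iff_contDiffAt.2 fun y => ?_
  have h1 : ContDiff ℝ ∞ fun y : ℂ × ℂ => 1 + ‖y.1‖ ^ 2 :=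
    contDiff_const.add ((contDiff_norm_sq ℝ).comp contDiff_fst)
  have h2 : ContDiff ℝ ∞ fun y : ℂ × ℂ => log (1 + ‖y.1‖ ^ 2) := h1.log fun y => by positivity
  by_cases hu : y.2 = 0
  · have : ∀ᶠ z in 𝓝 y, affNorm z < ε ^ 2 / 9 :=
      continuous_affNorm.continuousAt.eventually_lt continuousAt_const (by
        rw [affNorm, hu]; simp; positivity)
    exact (contDiff_const.mul h2).contDiffAt.congr_of_eventuallyEq
      (this.mono fun z hz => dualModel_inner hε hz.le)
  · have h3 : ContDiff ℝ ∞ fun y : ℂ × ℂ => cut ε (affNorm y ^ 2) := by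
      have : (fun y : ℂ × ℂ => affNorm y ^ 2) = fun y => ‖y.2‖ ^ 2 * (1 + ‖y.1‖ ^ 2) ^ 2 := by
        ext y; rw [affNorm]; ring
      exact (contDiff_cut ε).comp (this ▸ ((contDiff_norm_sq ℝ).comp contDiff_snd).mul (h1.pow 2))
    exact ((contDiff_const.sub h3).contDiffAt.mul (contDiffAt_log_norm_sq analyticAt_snd hu)).sub
      (contDiff_const.mul (h3.mul h2)).contDiffAt

lemma ddc_dualModel_outer {y : ℂ × ℂ} (h : ε ^ 2 / 4 < affNorm y) : ddc (dualModel ε) y = 0 := by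
  have h2 : y.2 ≠ 0 := fun h0 => by
    rw [affNorm, h0, norm_zero, zero_mul] at h; linarith [sq_nonneg ε]
  have : dualModel ε =ᶠ[𝓝 y] fun z => log (‖z.2‖ ^ 2) := by
    filter_upwards [continuous_affNorm.continuousAt.eventually (lt_mem_nhds h)] with z hz
      using dualModel_outer hε (le_of_lt hz)
  rw [this.ddc_eq, ddc_log_norm_sq analyticAt_snd h2]

/-- The integral of the wedge product of the dual form with a closed form `ρ`, whose support is
bounded in the direction of `E`, is the integral of `ρ` over `E`: by Stokes' theorem, the potential
may be replaced by one which depends on `u` only. -/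
lemma integral_wedge_dualModel {ρ : ℂ × ℂ → (ℂ × ℂ) [⋀^Fin 2]→L[ℝ] ℝ}
    (hρ : ∀ y, affNorm y < ε ^ 2 / 3 → ContDiffAt ℝ ∞ ρ y)
    (hd : ∀ y, affNorm y < ε ^ 2 / 3 → extDeriv ρ y = 0)
    (hs : ∀ y : ℂ × ℂ, 7 / 4 ≤ ‖y.1‖ ^ 2 → ρ y = 0) :
    IntegrableOn (fun y => wedge (ddc (dualModel ε) y) (ρ y)) {y | affNorm y < ε ^ 2 / 3} ∧
    ∫ y in {y | affNorm y < ε ^ 2 / 3}, wedge (ddc (dualModel ε) y) (ρ y) =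
      ∫ t, ρ (t, 0) ![(1, 0), (I, 0)] := by
  have hε2 : 0 < ε / 2 := by positivity
  set D := {y : ℂ × ℂ | affNorm y < ε ^ 2 / 3} with hD
  let p : ℂ → ℝ := logModel (ε / 2)
  have hp : ContDiff ℝ ∞ p := contDiff_logModel hε2
  have hp2 : ∀ u : ℂ, ε ^ 2 / 16 ≤ ‖u‖ → p u = log (‖u‖ ^ 2) := fun u hu => by
    change (1 - cut (ε / 2) (‖u‖ ^ 2)) * _ = _
    rw [cut_affNorm_zero hε2 (by linarith)]
    ring
  obtain ⟨hk1, hk2⟩ := integral_ddc_eq_one hp _ hp2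
  let f : ℂ × ℂ → ℝ := fun y => dualModel ε y + -1 * p y.2
  have hpy : ContDiff ℝ ∞ fun y : ℂ × ℂ => p y.2 := hp.comp contDiff_snd
  have hf : ContDiff ℝ ∞ f := (contDiff_dualModel hε).add (contDiff_const.mul hpy)
  have hε' : 0 < ε ^ 2 := by positivity
  obtain ⟨hi, h0⟩ := integral_extDeriv_wedge (γ := dc f) (ψ := ρ) (isOpen_affNorm_lt _)
    (isCompact_affNorm_le (ε ^ 2 / 4)) (fun y hy => hy.1.trans_lt (by linarith))
    (fun y _ => hf.contDiffAt.dc) hρ hd fun y hy hyK => by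
      by_cases ht : ‖y.1‖ ^ 2 ≤ 7 / 4
      · left
        have hN : ε ^ 2 / 4 < affNorm y := by by_contra! h; exact hyK ⟨h, ht⟩
        have hN' : ‖y.2‖ * (1 + ‖y.1‖ ^ 2) > ε ^ 2 / 4 := hN
        have hu : ε ^ 2 / 16 < ‖y.2‖ := by nlinarith [norm_nonneg y.2]
        have : f =ᶠ[𝓝 y] fun _ => 0 := by
          filter_upwards [continuous_affNorm.continuousAt.eventually (lt_mem_nhds hN),
            continuous_snd.norm.continuousAt.eventually (lt_mem_nhds hu)] with z h1 h2
          simp only [f, dualModel_outer hε (le_of_lt h1), hp2 _ (le_of_lt h2)]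
          ring
        rw [this.dc.eq_of_nhds]
        ext v
        simp [dc_apply, dcLin_apply]
      · exact Or.inr (hs y (not_le.1 ht).le)
  have e1 : ∀ y, wedge (ddc (dualModel ε) y) (ρ y) = wedge (extDeriv (dc f) y) (ρ y) +
      wedge (ddc (fun y : ℂ × ℂ => p y.2) y) (ρ y) := fun y => by
    have := ddc_add (x := y) hf.contDiffAt hpy.contDiffAt
    rw [show (fun z : ℂ × ℂ => f z + p z.2) = dualModel ε from funext fun z => by simp [f]] at this
    exact (congrArg (wedge · (ρ y)) this).trans (wedge_add_left _ _ _)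
  have e2 : ∀ y : ℂ × ℂ, wedge (ddc (fun y : ℂ × ℂ => p y.2) y) (ρ y) =
      ddc p y.2 ![1, I] * ρ y ![(1, 0), (I, 0)] := fun y => by
    rw [ddc_comp (f := p) (h := Prod.snd) hp.contDiffAt analyticAt_snd, fderiv_snd]
    obtain ⟨b, hb, hb'⟩ := alternating_two (ddc p y.2)
    have hc : ∀ v w : ℂ × ℂ, (ddc p y.2).compContinuousLinearMap (ContinuousLinearMap.snd ℝ ℂ ℂ)
        ![v, w] = b v.2 w.2 := fun v w => by
      rw [← hb]
      exact congrArg (ddc p y.2) (funext fun i => by fin_cases i <;> rfl)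
    simp [wedge, wedgeOn, hc, stdFrame, hb]
  have hk0 : ∀ u : ℂ, ε ^ 2 / 16 < ‖u‖ → ddc p u = 0 := fun u hu => by
    have h1 : p =ᶠ[𝓝 u] fun u => log (‖u‖ ^ 2) := by
      filter_upwards [continuous_norm.continuousAt.eventually (lt_mem_nhds hu)] with z hz
        using hp2 z (le_of_lt hz)
    rw [h1.ddc_eq]
    exact ddc_log_norm_sq (κ := id) analyticAt_id (norm_pos_iff.1 ((by positivity : 0 < ε ^ 2 / 16).trans hu))
  have hsm : ∀ y : ℂ × ℂ, ‖y.2‖ < ε ^ 2 / 9 → ContDiffAt ℝ ∞ ρ y ∧ extDeriv ρ y = 0 := by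
    intro y hy
    by_cases ht : ‖y.1‖ ^ 2 ≤ 7 / 4
    · have : affNorm y < ε ^ 2 / 3 := by rw [affNorm]; nlinarith [norm_nonneg y.2]
      exact ⟨hρ y this, hd y this⟩
    · have : ρ =ᶠ[𝓝 y] fun _ => 0 := by
        filter_upwards [(continuous_fst.norm.pow 2).continuousAt.eventually
          (lt_mem_nhds (not_le.1 ht))] with z hz using hs z (le_of_lt hz)
      exact ⟨contDiffAt_const.congr_of_eventuallyEq this, extDeriv_eq_zero_of_eventuallyEq this⟩
  let G : ℂ × ℂ → ℝ := fun y => ddc p y.2 ![1, I] * ρ y ![(1, 0), (I, 0)]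
  have hG1 : ∀ y : ℂ × ℂ, 7 / 4 ≤ ‖y.1‖ ^ 2 → G y = 0 := fun y h => by
    simp only [G, hs y h]; exact mul_zero _
  have hG2 : ∀ y : ℂ × ℂ, ε ^ 2 / 16 < ‖y.2‖ → G y = 0 := fun y h => by
    simp only [G, hk0 _ h]; exact zero_mul _
  have hGc : Continuous G := (contDiff_iff_contDiffAt (n := ∞).2 fun y => by
    by_cases hu : ‖y.2‖ < ε ^ 2 / 9
    · exact ((hp.contDiffAt.ddc.alternating_apply _).comp y contDiffAt_snd).mul
        ((hsm y hu).1.alternating_apply _)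
    · have h9 : ε ^ 2 / 16 < ‖y.2‖ := by linarith [not_lt.1 hu]
      exact contDiffAt_const.congr_of_eventuallyEq
        ((continuous_snd.norm.continuousAt.eventually (lt_mem_nhds h9)).mono hG2)).continuous
  have hGs : HasCompactSupport G := HasCompactSupport.intro (isCompact_affNorm_le (ε ^ 2 / 4))
    fun y hy => by
      by_cases ht : ‖y.1‖ ^ 2 ≤ 7 / 4
      · refine hG2 y ?_
        have : ¬ ‖y.2‖ * (1 + ‖y.1‖ ^ 2) ≤ ε ^ 2 / 4 := fun h => hy ⟨h, ht⟩
        nlinarith [norm_nonneg y.2]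
      · exact hG1 y (not_le.1 ht).le
  have hGi : Integrable G := hGc.integrable_of_hasCompactSupport hGs
  have hGD : ∫ y in D, G y = ∫ y, G y := by
    refine setIntegral_eq_integral_of_forall_compl_eq_zero fun y hy => ?_
    by_cases ht : 7 / 4 ≤ ‖y.1‖ ^ 2
    · exact hG1 y ht
    · refine hG2 y ?_
      have : ¬ ‖y.2‖ * (1 + ‖y.1‖ ^ 2) < ε ^ 2 / 3 := hy
      nlinarith [norm_nonneg y.2]
  simp only [e1, e2]
  refine ⟨hi.add hGi.integrableOn, ?_⟩
  rw [integral_add hi hGi.integrableOn, h0, zero_add, hGD, Measure.volume_eq_prod,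
    integral_prod_symm _ hGi]
  have e3 : ∀ u : ℂ, ∫ t, G (t, u) = ddc p u ![1, I] *
      ∫ t, ρ (t, 0) ![(1, 0), (I, 0)] := fun u => by
    simp only [G]
    rw [integral_const_mul]
    by_cases hu : ‖u‖ < ε ^ 2 / 9
    · rw [integral_slice_const (fun y hy => (hsm y hy).1) (fun y hy => (hsm y hy).2) hs hu]
    · rw [hk0 u (by linarith [not_lt.1 hu])]
      simp
  simp only [e3]
  rw [integral_mul_const, hk2, one_mul]

end Model
section PoincareLemma

variable {W : Type*} [NormedAddCommGroup W] [NormedSpace ℝ W] {E : Type*} [NormedAddCommGroup E]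
  [NormedSpace ℝ E] [CompleteSpace E]

/-- Smoothness of an integral over a compact interval which depends on parameters. -/
lemma contDiffOn_parametric_integral {S : Set W} (hS : IsOpen S) {g : W → ℝ → E}
    (hg : ContDiffOn ℝ ∞ (Function.uncurry g) (S ×ˢ univ))
    (h0 : ∀ p ∈ S, ∀ s ∉ Icc (-1 : ℝ) 1, g p s = 0) : ContDiffOn ℝ ∞ (fun p => ∫ s, g p s) S ∧
      ∀ p ∈ S, ∀ v, Integrable (fun s => fderiv ℝ (fun q => g q s) p v) ∧
        fderiv ℝ (fun p => ∫ s, g p s) p v = ∫ s, fderiv ℝ (fun q => g q s) p v := by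
  have hf : LocallyIntegrable (fun _ : ℝ => (1 : ℝ)) := continuous_const.locallyIntegrable
  have hk : ∀ p s, p ∈ S → s ∉ Icc (-1 : ℝ) 1 → g p s = 0 := fun p s hp => h0 p hp s
  let L := ContinuousLinearMap.lsmul ℝ ℝ (E := E)
  have e : (fun p => ∫ s, g p s) = fun p => (convolution (fun _ => (1 : ℝ)) (g p) L volume) 0 := by
    ext p
    simp only [convolution_def, L, ContinuousLinearMap.lsmul_apply, one_smul, zero_sub]
    exact (integral_neg_eq_self (fun s => g p s) volume).symm
  constructor
  · rw [e]
    exact (contDiffOn_convolution_right_with_param (n := ⊤) L hS isCompact_Icc hk hf hg).comp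
      (contDiff_prodMk_left (0 : ℝ)).contDiffOn fun p hp => ⟨hp, mem_univ _⟩
  · intro p hp v
    have h1 := (hasFDerivAt_convolution_right_with_param L hS isCompact_Icc hk hf
      (hg.of_le (by simp)) (p, 0) hp).comp p (f := fun p => (p, (0 : ℝ)))
      ((hasFDerivAt_id p).prodMk (hasFDerivAt_const (0 : ℝ) p))
    have hd : ∀ s, HasFDerivAt (Function.uncurry g) (fderiv ℝ (Function.uncurry g) (p, s)) (p, s) :=
      fun s => ((hg.contDiffAt ((hS.prod isOpen_univ).mem_nhds ⟨hp, mem_univ s⟩)).differentiableAt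
        (by simp)).hasFDerivAt
    have hx : ∀ s, fderiv ℝ (fun q => g q s) p v = fderiv ℝ (Function.uncurry g) (p, s) (v, 0) :=
      fun s => by
        have := (hd s).comp p (f := fun q => (q, s)) ((hasFDerivAt_id p).prodMk (hasFDerivAt_const s p))
        rw [show (fun q => g q s) = Function.uncurry g ∘ fun q => (q, s) from rfl, this.fderiv]
        rfl
    have hc : Continuous fun s => fderiv ℝ (Function.uncurry g) (p, s) := by
      have := hg.continuousOn_fderiv_of_isOpen (hS.prod isOpen_univ) (by simp)
      exact this.comp_continuous (Continuous.prodMk_right p) fun s => ⟨hp, mem_univ s⟩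
    have hz : ∀ s ∉ Icc (-1 : ℝ) 1, fderiv ℝ (Function.uncurry g) (p, s) = 0 := fun s hs => by
      have : Function.uncurry g =ᶠ[𝓝 (p, s)] fun _ => 0 := by
        filter_upwards [(hS.prod isClosed_Icc.isOpen_compl).mem_nhds (show (p, s) ∈ S ×ˢ _ from
          ⟨hp, hs⟩)] with q hq using h0 q.1 hq.1 q.2 hq.2
      rw [this.fderiv_eq, fderiv_fun_const]
      rfl
    have hi : Integrable fun s => fderiv ℝ (Function.uncurry g) (p, s) :=
      hc.integrable_of_hasCompactSupport (HasCompactSupport.intro isCompact_Icc hz)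
    simp only [hx]
    refine ⟨hi.apply_continuousLinearMap _, ?_⟩
    rw [e]
    have h2 : HasFDerivAt (fun p => (convolution (fun _ => (1 : ℝ)) (g p) L volume) 0) _ p := h1
    rw [h2.fderiv, ContinuousLinearMap.comp_apply]
    have h3 : (convolution (fun _ : ℝ => (1 : ℝ)) (fun x => fderiv ℝ (Function.uncurry g) (p, x))
        (L.precompR (W × ℝ)) volume) 0 = ∫ s, fderiv ℝ (Function.uncurry g) (p, s) := by
      rw [convolution_def, ← integral_neg_eq_self]
      refine integral_congr_ae (Eventually.of_forall fun s => ContinuousLinearMap.ext fun v => ?_)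
      simp [L, ContinuousLinearMap.precompR_apply]
    refine (congrArg (fun A : W × ℝ →L[ℝ] E => A (v, 0)) h3).trans ?_
    exact ContinuousLinearMap.integral_apply hi _

/-- A 2-form as a bilinear map. -/
def bilin : (W [⋀^Fin 2]→L[ℝ] ℝ) →L[ℝ] W →L[ℝ] W →L[ℝ] ℝ :=
  (ContinuousLinearMap.compL ℝ W _ _
    ((continuousMultilinearCurryFin1 ℝ W ℝ).toContinuousLinearEquiv : (W [×1]→L[ℝ] ℝ) →L[ℝ] W →L[ℝ] ℝ)).comp
  (((continuousMultilinearCurryLeftEquiv (n := 1) ℝ (fun _ => W) ℝ).toContinuousLinearEquiv :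
    (W [×2]→L[ℝ] ℝ) →L[ℝ] W →L[ℝ] W [×1]→L[ℝ] ℝ).comp (ContinuousAlternatingMap.toContinuousMultilinearMapCLM ℝ))

lemma bilin_apply (A : W [⋀^Fin 2]→L[ℝ] ℝ) (v w : W) : bilin A v w = A ![v, w] := by
  refine congrArg A (funext fun i => ?_)
  fin_cases i <;> rfl

lemma contDiff_bilin : ContDiff ℝ ∞ (⇑(bilin (W := W))) := by exact ContinuousLinearMap.contDiff _

lemma hasFDerivAt_bilin (A : W [⋀^Fin 2]→L[ℝ] ℝ) : HasFDerivAt (⇑(bilin (W := W))) bilin A := by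
  exact ContinuousLinearMap.hasFDerivAt _

variable [NormedSpace ℂ W] [IsScalarTower ℝ ℂ W]

/-- The Poincaré lemma for 2-forms, on star-shaped open sets. -/
lemma exists_extDeriv_eq {S : Set W} (hS : IsOpen S) (hst : StarConvex ℝ 0 S)
    {ψ : W → W [⋀^Fin 2]→L[ℝ] ℝ} (hψ : ∀ y ∈ S, ContDiffAt ℝ ∞ ψ y)
    (hd : ∀ y ∈ S, extDeriv ψ y = 0) :
    ∃ α : W → W [⋀^Fin 1]→L[ℝ] ℝ, (∀ y ∈ S, ContDiffAt ℝ ∞ α y) ∧ ∀ y ∈ S, extDeriv α y = ψ y := by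
  let θ := Real.smoothTransition
  have hθ : ContDiff ℝ ∞ θ := Real.smoothTransition.contDiff
  have hθd : ∀ s, HasDerivAt θ (deriv θ s) s := fun s => (hθ.differentiable (by simp) s).hasDerivAt
  have hθ0 : ∀ s ∉ Icc (0 : ℝ) 1, deriv θ s = 0 := fun s hs => by
    rcases lt_or_ge s 0 with h | h
    · have : θ =ᶠ[𝓝 s] fun _ => 0 := (gt_mem_nhds h).mono fun s' h' =>
        Real.smoothTransition.zero_of_nonpos h'.le
      rw [this.deriv_eq, deriv_const]
    · have h1 : 1 < s := by by_contra! h'; exact hs ⟨h, h'⟩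
      have : θ =ᶠ[𝓝 s] fun _ => 1 := (lt_mem_nhds h1).mono fun s' h' =>
        Real.smoothTransition.one_of_one_le h'.le
      rw [this.deriv_eq, deriv_const]
  have hθS : ∀ y ∈ S, ∀ s, θ s • y ∈ S := fun y hy s =>
    hst.smul_mem hy (Real.smoothTransition.nonneg _) (Real.smoothTransition.le_one _)
  let m : ℝ → ℝ := fun s => θ s * deriv θ s
  have hm : ContDiff ℝ ∞ m := hθ.mul ((contDiff_infty_iff_deriv.1 hθ).2)
  let g : W → ℝ → W →L[ℝ] ℝ := fun y s => m s • bilin (ψ (θ s • y)) y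
  have hg : ContDiffOn ℝ ∞ (Function.uncurry g) (S ×ˢ univ) := fun q hq => by
    have h1 : ContDiffAt ℝ ∞ (fun q : W × ℝ => θ q.2 • q.1) q :=
      ((hθ.comp contDiff_snd).smul contDiff_fst).contDiffAt
    have h2 := (contDiff_bilin.contDiffAt.comp q ((hψ _ (hθS q.1 hq.1 q.2)).comp q h1))
    exact ((hm.comp contDiff_snd).contDiffAt.smul (h2.clm_apply contDiffAt_fst)).contDiffWithinAt
  have hg0 : ∀ p ∈ S, ∀ s ∉ Icc (-1 : ℝ) 1, g p s = 0 := fun p _ s hs => by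
    simp only [g, m, hθ0 s fun h => hs ⟨by linarith [h.1], h.2⟩, mul_zero, zero_smul]
  obtain ⟨h1, h2⟩ := contDiffOn_parametric_integral hS hg hg0
  set F : W → W →L[ℝ] ℝ := fun p => ∫ s, g p s with hF
  have hFs : ∀ y ∈ S, ContDiffAt ℝ ∞ F y := fun y hy => h1.contDiffAt (hS.mem_nhds hy)
  let α : W → W [⋀^Fin 1]→L[ℝ] ℝ := fun y => lin.symm (F y)
  have hα : ∀ y ∈ S, ContDiffAt ℝ ∞ α y := fun y hy =>
    (lin (V := W)).symm.contDiff.contDiffAt.comp y (hFs y hy)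
  have hαF : ∀ y w, α y ![w] = F y w := fun y w => by
    rw [← lin_apply]; exact congrArg (fun A : W →L[ℝ] ℝ => A w) (lin.apply_symm_apply (F y))
  refine ⟨α, hα, fun y hy => ?_⟩
  -- the derivative of the integrand in the direction of `v`
  have hD : ∀ v w s, fderiv ℝ (fun q => g q s) y v w =
      m s * (θ s * fderiv ℝ (fun z => ψ z ![y, w]) (θ s • y) v + ψ (θ s • y) ![v, w]) := by
    intro v w s
    have hx := ((hψ _ (hθS y hy s)).differentiableAt (by simp)).hasFDerivAt
    have hy' : HasFDerivAt (fun q => θ s • q) (θ s • ContinuousLinearMap.id ℝ W) y :=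
      (hasFDerivAt_id y).const_smul (θ s)
    have hb1 : HasFDerivAt (fun q => bilin (ψ (θ s • q)))
        ((bilin (W := W)).comp ((fderiv ℝ ψ (θ s • y)).comp (θ s • ContinuousLinearMap.id ℝ W))) y := by
      refine HasFDerivAt.comp (g := bilin (W := W)) (f := fun q => ψ (θ s • q)) y ?_ (hx.comp y hy')
      exact hasFDerivAt_bilin _
    have hb := hb1.clm_apply (hasFDerivAt_id y)
    have hh := hb.const_smul (m s)
    have : fderiv ℝ (fun q => g q s) y = _ := hh.fderiv
    rw [this, fderiv_apply_const_alternating hx.differentiableAt]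
    simp [bilin_apply]
    ring
  have hFd : ∀ v w, fderiv ℝ (fun z => α z ![w]) y v = ∫ s, fderiv ℝ (fun q => g q s) y v w := by
    intro v w
    have := ((hFs y hy).differentiableAt (by simp)).hasFDerivAt.clm_apply (hasFDerivAt_const w y)
    simp only [hαF]
    rw [this.fderiv, ← ContinuousLinearMap.integral_apply (h2 y hy v).1, ← (h2 y hy v).2]
    simp
  -- closedness turns the difference of the two derivatives into a total derivative
  have key : ∀ v w, extDeriv α y ![v, w] = ψ y ![v, w] := by
    intro v w
    have hi := fun a b => (ContinuousLinearMap.apply ℝ ℝ b).integrable_comp (h2 y hy a).1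
    rw [extDeriv_one_apply ((hα y hy).differentiableAt (by simp)), hFd, hFd]
    refine (integral_sub (hi v w) (hi w v)).symm.trans ?_
    have hpd : ∀ s, HasDerivAt (fun s => θ s ^ 2 * ψ (θ s • y) ![v, w])
        (fderiv ℝ (fun q => g q s) y v w - fderiv ℝ (fun q => g q s) y w v) s := by
      intro s
      have hc := extDeriv_two_apply ((hψ _ (hθS y hy s)).differentiableAt (by simp)) y v w
      rw [hd _ (hθS y hy s)] at hc
      have hc' : (0 : W [⋀^Fin 3]→L[ℝ] ℝ) ![y, v, w] = 0 := rfl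
      obtain ⟨b, hb, hb'⟩ := alternating_two (ψ (θ s • y))
      have h3 := (((hψ _ (hθS y hy s)).alternating_apply ![v, w]).differentiableAt
        (by simp)).hasFDerivAt.comp_hasDerivAt s ((hθd s).smul_const y)
      have h4 := ((hθd s).fun_pow 2).fun_mul h3
      convert! h4 using 1
      rw [hD, hD, map_smul, hb v w, hb w v, hb' w v]
      simp only [m, Function.comp_apply, smul_eq_mul, hb v w]
      push_cast
      linear_combination (θ s ^ 2 * deriv θ s) * (hc - hc')
    have hT := integral_of_hasDerivAt_of_tendsto (m := 0) (n := ψ y ![v, w]) hpd ((hi v w).sub (hi w v))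
      (tendsto_const_nhds.congr' ((eventually_le_atBot 0).mono fun s h => by
        simp only [θ, Real.smoothTransition.zero_of_nonpos h]
        ring))
      (tendsto_const_nhds.congr' ((eventually_ge_atTop 1).mono fun s h => by
        simp only [θ, Real.smoothTransition.one_of_one_le h, one_pow, one_mul, one_smul]))
    exact hT.trans (sub_zero _)
  ext v
  rw [show v = ![v 0, v 1] from by ext i; fin_cases i <;> rfl]
  exact key _ _

end PoincareLemma
/-! ### The form dual to an exceptional divisor in affine coordinates -/

section TwoForms

variable [NormedSpace ℝ V] [IsScalarTower ℝ ℂ V]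
  [FiniteDimensional ℝ V]

lemma exists_leftInverse_of_finiteDimensional {E F : Type*} [NormedAddCommGroup E] [NormedSpace ℝ E]
    [NormedAddCommGroup F] [NormedSpace ℝ F] [FiniteDimensional ℝ F] {f : E → F}
    (hl : IsLinearMap ℝ f) (hf : Function.Injective f) : ∃ g : F →L[ℝ] E, ∀ x, g (f x) = x := by
  obtain ⟨g, hg⟩ := (hl.mk' f).exists_leftInverse_of_injective (LinearMap.ker_eq_bot.2 hf)
  exact ⟨⟨g, g.continuous_of_finiteDimensional⟩, LinearMap.congr_fun hg⟩

lemma contDiffAt_two {β : V → V [⋀^Fin 2]→L[ℝ] ℝ}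
    (h : ∀ᶠ z in 𝓝 x, ∀ v w, ContDiffAt ℝ ∞ (fun y => β y ![v, w]) z) : ContDiffAt ℝ ∞ β x := by
  obtain ⟨N, hN, hNo, hxN⟩ := eventually_nhds_iff.1 h
  have : FiniteDimensional ℝ (V →L[ℝ] ℝ) := inferInstance
  obtain ⟨g, hg⟩ := exists_leftInverse_of_finiteDimensional (f := bilin (W := V))
    ⟨fun _ _ => rfl, fun _ _ => rfl⟩ fun A B h => by
      ext v
      rw [show v = ![v 0, v 1] by ext i; fin_cases i <;> rfl, ← bilin_apply, ← bilin_apply, h]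
  have h1 : ContDiffOn ℝ ∞ (fun y => bilin (β y)) N := by
    refine contDiffOn_clm_apply.2 fun v => contDiffOn_clm_apply.2 fun w z hz => ?_
    simp only [bilin_apply]
    exact (hN z hz v w).contDiffWithinAt
  have h2 := g.contDiff.contDiffAt.comp x (h1.contDiffAt (hNo.mem_nhds hxN))
  exact h2.congr_of_eventuallyEq (Eventually.of_forall fun y => (hg (β y)).symm)

lemma contDiffAt_pull_two (η : O.Form 2) (hf : O.Hol f x) : ContDiffAt ℝ ∞ (pull η f) x :=
  contDiffAt_two (hf.eventually.mono fun _ hz _ _ => contDiffAt_pull_apply η hz _)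

lemma contDiffAt_comp_two {β : V → V [⋀^Fin 2]→L[ℝ] ℝ} {h : V → V}
    (hβ : ∀ᶠ z in 𝓝 (h x), ContDiffAt ℝ ∞ β z) (hh : AnalyticAt ℂ h x) :
    ContDiffAt ℝ ∞ (fun z => (β (h z)).compContinuousLinearMap (fderiv ℝ h z)) x := by
  have : FiniteDimensional ℂ V := FiniteDimensional.right ℝ ℂ V
  have := FiniteDimensional.complete ℂ V
  refine contDiffAt_two ?_
  filter_upwards [hh.continuousAt.eventually hβ, hh.eventually_analyticAt] with z h1 h2 v w
  have hf : ContDiffAt ℝ ∞ (fderiv ℝ h) z := (h2.contDiffAt_real (n := ∞)).fderiv_right (m := ∞) (by simp)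
  have hb : ContDiffAt ℝ ∞ (fun z => bilin (β (h z))) z :=
    contDiff_bilin.contDiffAt.comp z (h1.comp z h2.contDiffAt_real)
  refine ((hb.clm_apply (hf.clm_apply (contDiffAt_const (c := v)))).clm_apply
    (hf.clm_apply (contDiffAt_const (c := w)))).congr_of_eventuallyEq
    (Eventually.of_forall fun y => ?_)
  refine Eq.trans ?_ (bilin_apply _ _ _).symm
  exact congrArg (β (h y)) (funext fun i => by fin_cases i <;> rfl)

end TwoForms

lemma integrableOn_of_compact {f : ℂ × ℂ → ℝ} {U K : Set (ℂ × ℂ)} (hU : IsOpen U)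
    (hK : IsCompact K) (hKU : K ⊆ U) (hf : ContinuousOn f U) (h0 : ∀ y ∈ U, y ∉ K → f y = 0) :
    IntegrableOn f U :=
  ((hf.mono hKU).integrableOn_compact hK).of_forall_sdiff_eq_zero hU.measurableSet
    fun y hy => h0 y hy.1 hy.2

lemma extDeriv_fun_sub {m : ℕ} {V : Type*} [NormedAddCommGroup V] [NormedSpace ℝ V]
    {a b : V → V [⋀^Fin m]→L[ℝ] ℝ} {x : V} (ha : DifferentiableAt ℝ a x)
    (hb : DifferentiableAt ℝ b x) :
    extDeriv (fun y => a y - b y) x = extDeriv a x - extDeriv b x := by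
  rw [extDeriv, fderiv_fun_sub ha hb]
  exact map_sub (ContinuousAlternatingMap.alternatizeUncurryFinCLM ℝ V ℝ (n := m)) _ _

namespace Blowup

lemma affInv_ne {y : ℂ × ℂ} (h : y.1 ≠ 0) : (affInv y).1 ≠ 0 := inv_ne_zero h

lemma affInv_affInv {y : ℂ × ℂ} (h : y.1 ≠ 0) : affInv (affInv y) = y := by
  refine Prod.ext (by simp [affInv]) ?_
  simp only [affInv]
  field_simp

lemma affNorm_affInv {y : ℂ × ℂ} (h : y.1 ≠ 0) : affNorm (affInv y) = affNorm y := by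
  have : ‖y.1‖ ≠ 0 := norm_ne_zero_iff.2 h
  simp only [affNorm, affInv, norm_mul, norm_pow, norm_inv]
  field_simp
  ring

variable [T2Space X]

/-- The affine coordinates near the exceptional divisor. -/
def affMap (B : Blowup O p Xhat) (i : Fin k) (j : Bool) (y : ℂ × ℂ) : Xhat := B.Φ i (aff j y)

lemma norm_sq_aff (j : Bool) (y : ℂ × ℂ) : ‖(aff j y).1‖ ^ 2 = 1 + ‖y.1‖ ^ 2 := by
  rw [norm_sq_C2]
  cases j <;> simp [aff, add_comm]

lemma eventually_affNorm_lt {c : ℝ} {y : ℂ × ℂ} (hy : affNorm y < c) : ∀ᶠ z in 𝓝 y, affNorm z < c :=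
  continuous_affNorm.continuousAt.eventually_lt continuousAt_const hy

variable (hε : B.Good ε) (i : Fin k)
include hε

lemma Good.hol_affMap (j : Bool) {y : ℂ × ℂ} (hy : affNorm y < ε ^ 2) : (OM).Hol (B.affMap i j) y :=
  (B.hol_Φ i (hε.tube_subset i (aff_mem_tube j hy))).comp (analyticAt_aff j y)

lemma Good.affMap_affInv (j : Bool) {y : ℂ × ℂ} (h0 : y.1 ≠ 0) (hy : affNorm y < ε ^ 2) :
    B.affMap i (!j) (affInv y) = B.affMap i j y :=
  B.Φ_aff_inv i j h0 (hy.trans_le (pow_le_pow_left₀ hε.pos.le (hε.le i) 2))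

lemma Good.pull_affInv (j : Bool) {m : ℕ} (η : (OM).Form m) {y : ℂ × ℂ} (h0 : y.1 ≠ 0)
    (hy : affNorm y < ε ^ 2) : pull η (B.affMap i j) y =
      (pull η (B.affMap i (!j)) (affInv y)).compContinuousLinearMap (fderiv ℝ affInv y) := by
  rw [← pull_comp η (hε.hol_affMap i (!j) (by rwa [affNorm_affInv h0])) (analyticAt_affInv h0)]
  refine pull_congr η ?_
  filter_upwards [eventually_affNorm_lt hy, (isOpen_ne.preimage continuous_fst).mem_nhds h0]
    with z h1 h2 using (hε.affMap_affInv i j h2 h1).symm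

lemma Good.logF_affMap (j : Bool) {y : ℂ × ℂ} (hy : affNorm y < ε ^ 2) :
    B.logF i ε (B.q (B.affMap i j y)) = 2 * (cut ε (affNorm y ^ 2) * log (affNorm y)) := by
  obtain ⟨s, hs⟩ := exists_sq y.2
  obtain ⟨h1, h2⟩ := hε.q_Φ_sq i (aff_mem_tube (r := ε) j hy) (s := s) hs
  rw [affMap, h2, logF, hε.pushX_map i logF_even h1]
  have : ‖s • (aff j y).1‖ ^ 2 = affNorm y := by
    rw [norm_smul, mul_pow, norm_sq_aff, ← norm_pow, hs, affNorm]
  rw [show ‖s • (aff j y).1‖ ^ 4 = (‖s • (aff j y).1‖ ^ 2) ^ 2 by ring, this]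

/-- In affine coordinates, the form which is dual to the exceptional divisor has a global potential. -/
lemma Good.pull_dual_aff (j : Bool) {y : ℂ × ℂ} (hy : affNorm y < ε ^ 2) :
    pull (dualPot hε i).form.1 (B.affMap i j) y = ddc (dualModel ε) y := by
  have hpos := hε.pos
  by_cases h0 : y.2 = 0
  · have h9 : affNorm y < (ε / 3) ^ 2 := by rw [affNorm, h0, norm_zero, zero_mul]; positivity
    refine (hε.pull_dual i (analyticAt_aff j y) (aff_mem_tube j h9)).trans
      (Filter.EventuallyEq.ddc_eq ?_)
    filter_upwards [eventually_affNorm_lt h9] with z hz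
    rw [norm_sq_aff, dualModel_inner hpos (by rw [show ε ^ 2 / 9 = (ε / 3) ^ 2 by ring]; exact hz.le)]
  · have hq : B.q (B.affMap i j y) ≠ p i := fun h => h0
      ((hε.q_Φ_mem_range i (aff_mem_tube j hy)).1 ⟨i, h.symm⟩)
    rw [hε.pull_dual_off i (hε.hol_affMap i j hy) hq]
    have e : (fun z => -B.logF i ε (B.q (B.affMap i j z))) =ᶠ[𝓝 y]
        fun z => dualModel ε z + -1 * log (‖z.2‖ ^ 2) := by
      filter_upwards [eventually_affNorm_lt hy, (isOpen_ne.preimage continuous_snd).mem_nhds h0]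
        with z h1 h2
      have h3 : ‖z.2‖ ≠ 0 := norm_ne_zero_iff.2 h2
      rw [hε.logF_affMap i j h1, dualModel, affNorm, Real.log_mul h3 (by positivity), Real.log_pow]
      push_cast
      ring
    have h4 := contDiffAt_log_norm_sq (x := y) (analyticAt_snd (𝕜 := ℂ)) h0
    rw [e.ddc_eq, ddc_add (contDiff_dualModel hpos).contDiffAt (contDiffAt_const.mul h4),
      ddc_const_mul _ h4, ddc_log_norm_sq analyticAt_snd h0, smul_zero, add_zero]

/-- Duality in affine coordinates. The closed form `η` is the sum of a closed form `ρ` which vanishes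
near the point at infinity of `E` and an exact form `w` with a primitive supported near infinity;
`w` contributes nothing to either side, and `ρ` is treated by `integral_wedge_dualModel`. -/
lemma Good.integral_wedge_dual (η : (OM).Closed 2) :
    Integrable (fun t : ℂ => pull η.1 (B.affMap i false) (t, 0) ![(1, 0), (I, 0)]) ∧
    ∫ y in {y | affNorm y < ε ^ 2 / 3},
      wedge (ddc (dualModel ε) y) (pull η.1 (B.affMap i false) y) =
    ∫ t, pull η.1 (B.affMap i false) (t, 0) ![(1, 0), (I, 0)] := by
  have hpos := hε.pos
  have hε2 : 0 < ε ^ 2 := by positivity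
  set D := {y : ℂ × ℂ | affNorm y < ε ^ 2 / 3} with hD
  have hDo : IsOpen D := isOpen_affNorm_lt _
  have hD1 : ∀ y ∈ D, affNorm y < ε ^ 2 := fun y hy => by
    have : affNorm y < ε ^ 2 / 3 := hy
    linarith
  have hD0 : ∀ t : ℂ, ((t, 0) : ℂ × ℂ) ∈ D := fun t => by
    change affNorm _ < _
    simp only [affNorm, norm_zero, zero_mul]
    positivity
  set ψ : Bool → ℂ × ℂ → (ℂ × ℂ) [⋀^Fin 2]→L[ℝ] ℝ := fun j => pull η.1 (B.affMap i j) with hψ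
  have hψs : ∀ j y, affNorm y < ε ^ 2 → ContDiffAt ℝ ∞ (ψ j) y := fun j y hy =>
    contDiffAt_pull_two η.1 (hε.hol_affMap i j hy)
  have hψd : ∀ j y, affNorm y < ε ^ 2 → extDeriv (ψ j) y = 0 := fun j y hy =>
    extDeriv_pull_eq_zero η (hε.hol_affMap i j hy)
  -- a primitive near the point at infinity, in the second affine coordinate
  let S : Set (ℂ × ℂ) := ball 0 (13 / 10) ×ˢ ball 0 (ε ^ 2 / 3)
  have hSo : IsOpen S := isOpen_ball.prod isOpen_ball
  have hSc : StarConvex ℝ 0 S := ((convex_ball _ _).prod (convex_ball _ _)).starConvex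
    ⟨mem_ball_self (by norm_num), mem_ball_self (by positivity)⟩
  have hS : ∀ y ∈ S, affNorm y < ε ^ 2 := fun y hy => by
    have h1 : ‖y.1‖ < 13 / 10 := mem_ball_zero_iff.1 hy.1
    have h2 : ‖y.2‖ < ε ^ 2 / 3 := mem_ball_zero_iff.1 hy.2
    have h3 : ‖y.1‖ ^ 2 ≤ (13 / 10) ^ 2 := pow_le_pow_left₀ (norm_nonneg _) h1.le 2
    rw [affNorm]
    nlinarith [norm_nonneg y.2]
  obtain ⟨α, hα, hαd⟩ := exists_extDeriv_eq hSo hSc (fun y hy => hψs true y (hS y hy))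
    fun y hy => hψd true y (hS y hy)
  set β : ℂ × ℂ → (ℂ × ℂ) [⋀^Fin 1]→L[ℝ] ℝ := fun y => bump y.1 • α y with hβ
  have hβ0 : ∀ y : ℂ × ℂ, 5 / 3 < ‖y.1‖ ^ 2 → β =ᶠ[𝓝 y] fun _ => 0 := fun y hy => by
    filter_upwards [(continuous_fst.norm.pow 2).continuousAt.eventually (lt_mem_nhds hy)] with z hz
    rw [hβ]; simp only; rw [bump_zero (le_of_lt hz), zero_smul]
  have hβs : ∀ y ∈ D, ContDiffAt ℝ ∞ β y := fun y hy => by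
    by_cases h1 : ‖y.1‖ < 13 / 10
    · refine (contDiff_bump.contDiffAt.comp y contDiffAt_fst).smul (hα y ⟨mem_ball_zero_iff.2 h1,
        mem_ball_zero_iff.2 ?_⟩)
      have : ‖y.2‖ * (1 + ‖y.1‖ ^ 2) < ε ^ 2 / 3 := hy
      nlinarith [norm_nonneg y.2, mul_nonneg (norm_nonneg y.2) (sq_nonneg ‖y.1‖)]
    · exact contDiffAt_const.congr_of_eventuallyEq (hβ0 y (by nlinarith [not_lt.1 h1]))
  have hβd : ∀ y ∈ D, extDeriv (extDeriv β) y = 0 := fun y hy =>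
    extDeriv_extDeriv_apply (hβs y hy) (by simpa using two_le_infty)
  have hβψ : ∀ y ∈ D, ‖y.1‖ ^ 2 < 3 / 5 → extDeriv β y = ψ true y := fun y hy h => by
    have : β =ᶠ[𝓝 y] α := by
      filter_upwards [(continuous_fst.norm.pow 2).continuousAt.eventually (gt_mem_nhds h)] with z hz
      rw [hβ]; simp only; rw [bump_one (le_of_lt hz), one_smul]
    rw [this.extDeriv_eq]
    refine hαd y ⟨mem_ball_zero_iff.2 (by nlinarith [norm_nonneg y.1]), mem_ball_zero_iff.2 ?_⟩
    have : ‖y.2‖ * (1 + ‖y.1‖ ^ 2) < ε ^ 2 / 3 := hy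
    nlinarith [norm_nonneg y.2, mul_nonneg (norm_nonneg y.2) (sq_nonneg ‖y.1‖)]
  have hinvD : ∀ y ∈ D, y.1 ≠ 0 → affInv y ∈ D := fun y hy h => by
    change affNorm _ < _
    rw [affNorm_affInv h]; exact hy
  -- the exact part, in the first coordinate
  set w : ℂ × ℂ → (ℂ × ℂ) [⋀^Fin 2]→L[ℝ] ℝ := fun y => if y.1 = 0 then 0 else
    (extDeriv β (affInv y)).compContinuousLinearMap (fderiv ℝ affInv y) with hw
  have hw1 : ∀ y : ℂ × ℂ, y.1 ≠ 0 →
      w y = (extDeriv β (affInv y)).compContinuousLinearMap (fderiv ℝ affInv y) := fun y hy => if_neg hy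
  have hw0 : ∀ y : ℂ × ℂ, ‖y.1‖ ^ 2 < 3 / 5 → w y = 0 := fun y hy => by
    by_cases h : y.1 = 0
    · exact if_pos h
    · rw [hw1 y h, extDeriv_eq_zero_of_eventuallyEq (hβ0 _ ?_)]
      · rfl
      · have : 0 < ‖y.1‖ := norm_pos_iff.2 h
        simp only [affInv, norm_inv, inv_pow]
        rw [lt_inv_comm₀ (by norm_num) (by positivity)]
        linarith
  have hw1' : ∀ y : ℂ × ℂ, y.1 ≠ 0 → w =ᶠ[𝓝 y] fun y =>
      (extDeriv β (affInv y)).compContinuousLinearMap (fderiv ℝ affInv y) := fun y hy => by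
    filter_upwards [(isOpen_ne.preimage continuous_fst).mem_nhds hy] with z hz using hw1 z hz
  have hwsd : ∀ y ∈ D, ContDiffAt ℝ ∞ w y ∧ extDeriv w y = 0 := fun y hy => by
    by_cases h : y.1 = 0
    · have : w =ᶠ[𝓝 y] fun _ => 0 := by
        filter_upwards [(continuous_fst.norm.pow 2).continuousAt.eventually (gt_mem_nhds
          (show ‖y.1‖ ^ 2 < 3 / 5 by rw [h]; norm_num))] with z hz using hw0 z hz
      exact ⟨contDiffAt_const.congr_of_eventuallyEq this, extDeriv_eq_zero_of_eventuallyEq this⟩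
    · have h1 := hinvD y hy h
      refine ⟨(contDiffAt_comp_two ?_ (analyticAt_affInv h)).congr_of_eventuallyEq (hw1' y h), ?_⟩
      · filter_upwards [hDo.mem_nhds h1] with z hz using contDiffAt_extDeriv (hβs z hz)
      · rw [(hw1' y h).extDeriv_eq, extDeriv_pullback
          ((contDiffAt_extDeriv (hβs _ h1)).differentiableAt (by simp))
          ((analyticAt_affInv h).contDiffAt_real (n := ∞)) (by simpa using two_le_infty), hβd _ h1]
        rfl
  set ρ : ℂ × ℂ → (ℂ × ℂ) [⋀^Fin 2]→L[ℝ] ℝ := fun y => if 7 / 4 ≤ ‖y.1‖ ^ 2 then 0 else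
    ψ false y - w y with hρ
  have hρ1 : ∀ y ∈ D, ρ y = ψ false y - w y := fun y hy => by
    by_cases h : 7 / 4 ≤ ‖y.1‖ ^ 2
    · have h0 : y.1 ≠ 0 := fun h0 => by rw [h0, norm_zero] at h; norm_num at h
      have h1 : ‖(affInv y).1‖ ^ 2 < 3 / 5 := by
        simp only [affInv, norm_inv, inv_pow]
        rw [inv_lt_comm₀ (by linarith) (by norm_num)]
        linarith
      rw [hw1 y h0, hβψ _ (hinvD y hy h0) h1]
      have := hε.pull_affInv i false η.1 h0 (hD1 y hy)
      simp only [hρ, h, if_true]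
      exact (sub_eq_zero.2 this).symm
    · simp only [hρ, h, if_false]
  have hρ1' : ∀ y ∈ D, ρ =ᶠ[𝓝 y] fun y => ψ false y - w y := fun y hy => by
    filter_upwards [hDo.mem_nhds hy] with z hz using hρ1 z hz
  have hρ0 : ∀ y : ℂ × ℂ, 7 / 4 ≤ ‖y.1‖ ^ 2 → ρ y = 0 := fun y hy => if_pos hy
  have hρs : ∀ y ∈ D, ContDiffAt ℝ ∞ ρ y := fun y hy =>
    ((hψs false y (hD1 y hy)).sub (hwsd y hy).1).congr_of_eventuallyEq (hρ1' y hy)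
  have hρd : ∀ y ∈ D, extDeriv ρ y = 0 := fun y hy => by
    rw [(hρ1' y hy).extDeriv_eq, extDeriv_fun_sub ((hψs false y (hD1 y hy)).differentiableAt (by simp))
      ((hwsd y hy).1.differentiableAt (by simp)), hψd false y (hD1 y hy), (hwsd y hy).2, sub_zero]
  obtain ⟨hi1, hI1⟩ := integral_wedge_dualModel hpos hρs hρd hρ0
  -- the integral of the exact part vanishes by Stokes' theorem in the second coordinate
  obtain ⟨hi2, hI2⟩ := integral_extDeriv_wedge hDo (isCompact_affNorm_le (ε ^ 2 / 4))
    (fun y hy => hy.1.trans_lt (by linarith)) hβs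
    (fun y _ => (contDiff_dualModel hpos).contDiffAt.ddc)
    (fun y _ => extDeriv_ddc (contDiff_dualModel hpos).contDiffAt) fun y hy hyK => by
      by_cases h : affNorm y ≤ ε ^ 2 / 4
      · exact Or.inl ((hβ0 y (by
          have : ¬ ‖y.1‖ ^ 2 ≤ 7 / 4 := fun h' => hyK ⟨h, h'⟩
          linarith)).eq_of_nhds)
      · exact Or.inr (ddc_dualModel_outer hpos (not_le.1 h))
  let D' := D ∩ {y | y.1 ≠ 0}
  have hD'm : MeasurableSet D' := (hDo.inter (isOpen_ne.preimage continuous_fst)).measurableSet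
  have hmap : MapsTo affInv D' D' := fun y hy => ⟨hinvD y hy.1 hy.2, affInv_ne hy.2⟩
  have himg : affInv '' D' = D' :=
    hmap.image_subset.antisymm fun y hy => ⟨_, hmap hy, affInv_affInv hy.2⟩
  have hinj : InjOn affInv D' := fun y hy z hz h => by
    rw [← affInv_affInv hy.2, h, affInv_affInv hz.2]
  have hae : D' =ᵐ[volume] D := by
    have h0 : volume {y : ℂ × ℂ | y.1 = 0} = 0 := by
      rw [show {y : ℂ × ℂ | y.1 = 0} = ({0} : Set ℂ) ×ˢ univ by ext y; simp, Measure.volume_eq_prod,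
        Measure.prod_prod, measure_singleton, zero_mul]
    refine (inter_ae_eq_left_of_ae_eq_univ (ae_eq_univ.2 ?_))
    convert! h0 using 2
    ext y; simp
  obtain ⟨hcvi, hcv⟩ := integral_wedge_image (extDeriv β) (ddc (dualModel ε)) hD'm
    (fun y hy => analyticAt_affInv hy.2) hinj
  have hΩ2 : EqOn (fun y => wedge ((extDeriv β (affInv y)).compContinuousLinearMap (fderiv ℝ affInv y))
      ((ddc (dualModel ε) (affInv y)).compContinuousLinearMap (fderiv ℝ affInv y)))
      (fun y => wedge (ddc (dualModel ε) y) (w y)) D' := fun y hy => by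
    have h1 := hε.pull_affInv i false (dualPot hε i).form.1 hy.2 (hD1 y hy.1)
    rw [hε.pull_dual_aff i _ (hD1 y hy.1), hε.pull_dual_aff i _ (hD1 _ (hmap hy).1)] at h1
    simp only
    rw [← h1, ← hw1 y hy.2, wedge_comm]
  rw [himg] at hcv hcvi
  rw [setIntegral_congr_set hae, hI2, setIntegral_congr_fun hD'm hΩ2, setIntegral_congr_set hae] at hcv
  rw [integrableOn_congr_fun hΩ2 hD'm, integrableOn_congr_set_ae hae, integrableOn_congr_set_ae hae]
    at hcvi
  have hi3 := hcvi.1 hi2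
  -- the restriction to the exceptional divisor
  let ι : ℂ → ℂ × ℂ := fun t => (t, 0)
  have hι : ∀ t, AnalyticAt ℂ ι t := fun t => analyticAt_id.prod analyticAt_const
  have hιd : ∀ t v, fderiv ℝ ι t v = (v, 0) := fun t v => by
    have : HasFDerivAt ι _ t := (hasFDerivAt_id (𝕜 := ℝ) t).prodMk (hasFDerivAt_const (0 : ℂ) t)
    rw [this.fderiv]
    rfl
  let b : ℂ → ℂ [⋀^Fin 1]→L[ℝ] ℝ := fun t => (β (ι t)).compContinuousLinearMap (fderiv ℝ ι t)
  have hb : ContDiff ℝ ∞ b := contDiff_iff_contDiffAt.2 fun t => by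
    have h1 : ContDiff ℝ ∞ fun t => lin (b t) := by
      refine contDiff_clm_apply_iff.2 fun v => contDiff_iff_contDiffAt.2 fun t => ?_
      have h2 := ((hβs (ι t) (hD0 t)).alternating_apply ![(v, 0)]).comp t (hι t).contDiffAt_real
      refine h2.congr_of_eventuallyEq (Eventually.of_forall fun s => ?_)
      change lin (b s) v = _
      rw [lin_apply]
      exact congrArg (β (ι s)) (funext fun i => by fin_cases i; exact hιd s v)
    exact ((lin (V := ℂ)).symm.contDiff.contDiffAt.comp t h1.contDiffAt).congr_of_eventuallyEq
      (Eventually.of_forall fun z => (lin.symm_apply_apply _).symm)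
  have hbc : HasCompactSupport b := hasCompactSupport_of_norm_sq fun t h => by
    simp only [b, (hβ0 (ι t) (by simp only [ι]; linarith)).eq_of_nhds]
    rfl
  have hbd : ∀ t, extDeriv b t = (extDeriv β (ι t)).compContinuousLinearMap (fderiv ℝ ι t) :=
    fun t => extDeriv_pullback ((hβs _ (hD0 t)).differentiableAt (by simp))
      ((hι t).contDiffAt_real (n := ∞)) (by simpa using two_le_infty)
  obtain ⟨hb1, hb2⟩ := extDeriv_one_integral hb hbc
  obtain ⟨hb3, hb4⟩ := integral_inv_top (extDeriv b) hb1
  have hbw : ∀ᵐ t : ℂ, (extDeriv b t⁻¹).compContinuousLinearMap (fderiv ℝ Inv.inv t) ![1, I] =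
      w (t, 0) ![(1, 0), (I, 0)] := by
    filter_upwards [compl_mem_ae_iff.2 (measure_singleton (0 : ℂ))] with t ht
    have ht : t ≠ 0 := ht
    have e1 : affInv ∘ ι = ι ∘ Inv.inv := funext fun t => by simp [affInv, ι]
    have ha := analyticAt_affInv (y := ι t) ht
    have hinv : AnalyticAt ℂ (Inv.inv : ℂ → ℂ) t := analyticAt_inv ht
    have e2 : ∀ v, fderiv ℝ affInv (ι t) (v, 0) = fderiv ℝ ι t⁻¹ (fderiv ℝ Inv.inv t v) := fun v => by
      have h1 := fderiv_comp t (ha.differentiableAt.restrictScalars ℝ)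
        ((hι t).differentiableAt.restrictScalars ℝ)
      rw [e1, fderiv_comp (g := ι) (f := Inv.inv) t ((hι t⁻¹).differentiableAt.restrictScalars ℝ)
        (hinv.differentiableAt.restrictScalars ℝ)] at h1
      have := congrArg (fun A : ℂ →L[ℝ] ℂ × ℂ => A v) h1
      simp only [ContinuousLinearMap.comp_apply, hιd t] at this
      exact this.symm
    rw [hbd, hw1 (t, 0) ht]
    have e3 : affInv (t, 0) = ι t⁻¹ := congrFun e1 t
    simp only [ContinuousAlternatingMap.compContinuousLinearMap_apply, e3]
    refine congrArg (extDeriv β (ι t⁻¹)) (funext fun i => ?_)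
    fin_cases i
    · exact (e2 1).symm
    · exact (e2 I).symm
  have hwi := hb3.congr hbw
  have hwI : ∫ t : ℂ, w (t, 0) ![(1, 0), (I, 0)] = 0 := by rw [← integral_congr_ae hbw, hb4, hb2]
  have hρi : Integrable fun t : ℂ => ρ (t, 0) ![(1, 0), (I, 0)] := by
    refine Continuous.integrable_of_hasCompactSupport (contDiff_iff_contDiffAt (n := ∞).2 fun t =>
      ((hρs (ι t) (hD0 t)).alternating_apply _).comp t (hι t).contDiffAt_real).continuous
      (hasCompactSupport_of_norm_sq fun t h => by rw [hρ0 (t, 0) h]; rfl)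
  have hsplit : ∀ y ∈ D, ψ false y = ρ y + w y := fun y hy => by rw [hρ1 y hy]; abel
  have e5 : ∀ t : ℂ, ψ false (t, 0) ![(1, 0), (I, 0)] =
      ρ (t, 0) ![(1, 0), (I, 0)] + w (t, 0) ![(1, 0), (I, 0)] := fun t => by
    rw [hsplit _ (hD0 t)]; rfl
  have e6 : ∀ y ∈ D, wedge (ddc (dualModel ε) y) (ψ false y) =
      wedge (ddc (dualModel ε) y) (ρ y) + wedge (ddc (dualModel ε) y) (w y) := fun y hy => by
    rw [hsplit y hy, wedge_add_right]
  constructor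
  · exact (hρi.add hwi).congr (Eventually.of_forall fun t => (e5 t).symm)
  · rw [setIntegral_congr_fun hDo.measurableSet e6, integral_add hi1 hi3, hI1, ← hcv, add_zero]
    have h := integral_add hρi hwi
    rw [hwI, add_zero] at h
    rw [← h]
    exact integral_congr_ae (Eventually.of_forall fun t => (e5 t).symm)

end Blowup
/-! ### Integrals over the exceptional divisors -/

lemma pull_eq_extDeriv {X : Type u} [TopologicalSpace X] {O : ComplexOrbifold X} [NormedSpace ℝ V] [IsScalarTower ℝ ℂ V]
    {η : O.Form 2} {α : O.Form 1} (h : ∀ c, ∀ x ∈ c.1.dom, η.1 c x = extDeriv (α.1 c) x)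
    {f : V → X} {x : V} (hf : O.Hol f x) : pull η f x = extDeriv (pull α f) x := by
  obtain ⟨c, hc, j, hj⟩ := hf
  rw [pull_eq η ⟨c, hc⟩ hj, extDeriv_pull (c := ⟨c, hc⟩) hj, h ⟨c, hc⟩ _ hj.1]

lemma liftAt_chart {M : Type u} [TopologicalSpace M] [ChartedSpace C2 M] [IsManifold 𝓘(ℂ, C2) ω M]
    {e : OpenPartialHomeomorph M C2} (he : e ∈ atlas C2 M)
    {f : V → M} (hf : (ComplexOrbifold.ofManifold M).Hol f x)
    (hx : f x ∈ e.source) : LiftAt f (manifoldChart e) (fun z => e (f z)) x := by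
  obtain ⟨j, hj⟩ := hf.exists_lift (fun c' hc' =>
    (ComplexOrbifold.ofManifold M).compatible _ (mem_image_of_mem manifoldChart he) _ hc')
    ⟨_, e.map_source hx, e.left_inv hx⟩
  have h1 : ∀ᶠ z in 𝓝 x, j z = e (f z) ∧ e.symm (e (f z)) = f z := by
    filter_upwards [hj.eventually] with z hz
    have h2 : e.symm (j z) = f z := hz.map_eq
    rw [← h2, e.right_inv hz.1]
    exact ⟨rfl, rfl⟩
  exact ⟨e.map_source hx, hj.2.1.congr (h1.mono fun _ hz => hz.1), h1.mono fun _ hz => hz.2⟩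

namespace Blowup

variable [T2Space X]

lemma analyticAt_zeroSection (t : ℂ) : AnalyticAt ℂ (fun t : ℂ => ((t, 0) : ℂ × ℂ)) t :=
  analyticAt_id.prod analyticAt_const

lemma affNorm_zeroSection (t : ℂ) : affNorm (t, 0) = 0 := by simp [affNorm]

lemma density_eq_pull (i : Fin k) (η : (OM).Form 2) {t : ℂ} (h : (OM).Hol (B.curve i) t) :
    B.density i η t = pull η (B.curve i) t ![1, I] := by
  have hs := mem_chart_source C2 (B.curve i t)
  rw [pull_eq η (chartAtPt (B.curve i t)) (liftAt_chart (chart_mem_atlas C2 _) h hs), density]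
  exact congrArg (η.1 (chartAtPt (B.curve i t)) (chartAt C2 (B.curve i t) (B.curve i t)))
    (funext fun a => by fin_cases a <;> rfl)

variable (hε : B.Good ε) (i : Fin k)
include hε

lemma Good.hol_affCurve (j : Bool) (t : ℂ) : (OM).Hol (fun t => B.affMap i j (t, 0)) t :=
  (hε.hol_affMap i j (by rw [affNorm_zeroSection]; exact pow_pos hε.pos 2)).comp
    (analyticAt_zeroSection t)

lemma Good.density_eq (η : (OM).Form 2) (t : ℂ) : B.density i η t =
    pull η (B.affMap i false) (t, 0) ![(1, 0), (I, 0)] := by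
  rw [density_eq_pull i η (hε.hol_affCurve i false t)]
  refine (congrArg (fun A : ℂ [⋀^Fin 2]→L[ℝ] ℝ => A ![1, I]) (pull_comp η
    (g := fun t : ℂ => ((t, 0) : ℂ × ℂ)) (hε.hol_affMap i false (by
      rw [affNorm_zeroSection]; exact pow_pos hε.pos 2)) (analyticAt_zeroSection t))).trans ?_
  have : HasFDerivAt (fun t : ℂ => ((t, 0) : ℂ × ℂ)) _ t :=
    (hasFDerivAt_id (𝕜 := ℝ) t).prodMk (hasFDerivAt_const (0 : ℂ) t)
  rw [this.fderiv]
  exact congrArg (pull η (B.affMap i false) (t, 0)) (funext fun a => by fin_cases a <;> rfl)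

/-- The integral of an exact form over `E i` vanishes, by Stokes' theorem on the Riemann sphere. -/
lemma Good.integral_exact (α : (OM).Form 1) :
    Integrable (fun t => extDeriv (pull α (B.curve i)) t ![1, I]) ∧
      ∫ t, extDeriv (pull α (B.curve i)) t ![1, I] = 0 := by
  refine integral_extDeriv_sphere (b := pull α fun t => B.affMap i true (t, 0))
    (contDiff_iff_contDiffAt.2 fun t => contDiffAt_pull_one α (hε.hol_affCurve i false t))
    (contDiff_iff_contDiffAt.2 fun t => contDiffAt_pull_one α (hε.hol_affCurve i true t))
    fun t ht => ?_
  rw [← pull_comp α (hε.hol_affCurve i true t⁻¹) (analyticAt_inv ht)]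
  refine pull_congr α ?_
  filter_upwards [isOpen_ne.mem_nhds ht] with s hs
  have := hε.affMap_affInv i false (y := (s, 0)) hs
    (by rw [affNorm_zeroSection]; exact pow_pos hε.pos 2)
  simp only [affInv, mul_zero] at this
  exact this.symm

/-- In terms of the equivariant section, the Chern form of the normalised metric restricts to a
multiple of the Fubini–Study form of `E i`. -/
lemma Good.hasIntegralE {L : CStarBundle (OM)} (T : TubeSections B ε L) (H : L.HermitianMetric)
    (hH : ∀ i, ∀ y ∈ tube (ε / 3), H.len (T.S i y) = ‖y.1‖ ^ (-T.m i)) :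
    B.HasIntegralE i (-(OM).cls H.pot.form) (T.m i) := by
  intro η hη
  have hdens := hε.density_eq i η.1
  refine ⟨(hε.integral_wedge_dual i η).1.congr (Eventually.of_forall fun t => (hdens t).symm), ?_⟩
  obtain ⟨α, hα⟩ : η + H.pot.form ∈ (OM).Exact2 := by
    rw [← Submodule.Quotient.mk_eq_zero, Submodule.Quotient.mk_add]
    exact eq_neg_iff_add_eq_zero.1 hη
  have hpot : ∀ t, pull H.pot.form.1 (B.curve i) t = (-(T.m i : ℝ)) • ddc fsPot t := fun t => by
    have hy : ∀ t : ℂ, affNorm (t, 0) < (ε / 3) ^ 2 := fun t => by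
      rw [affNorm_zeroSection]; exact pow_pos hε.third.pos 2
    have ha : ∀ t, aff false (t, 0) ∈ tube (ε / 3) := fun t => aff_mem_tube false (hy t)
    have hs : L.HolAt (fun t : ℂ => T.S i (aff false (t, 0))) t :=
      ((T.spec i _ (tube_third_subset hε.pos (ha t))).1.comp
        (g := fun t : ℂ => aff false (t, 0))
        (AnalyticAt.comp (f := fun t : ℂ => ((t, 0) : ℂ × ℂ)) (analyticAt_aff false (t, 0))
          (analyticAt_zeroSection t)))
    have e : (fun t : ℂ => L.proj (T.S i (aff false (t, 0)))) = B.curve i := funext fun t =>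
      (T.spec i _ (tube_third_subset hε.pos (ha t))).2.1
    rw [← e, H.pull_pot hs, ← ddc_const_mul _ contDiff_fsPot.contDiffAt]
    refine Filter.EventuallyEq.ddc_eq (Eventually.of_forall fun s => ?_)
    simp only
    rw [hH i _ (ha s), ← zpow_natCast, zpow_comm, zpow_natCast, norm_sq_aff, Real.log_zpow, fsPot]
    push_cast
    rfl
  have hd : ∀ t, B.density i η.1 t = (T.m i : ℝ) * ddc fsPot t ![1, I] +
      extDeriv (pull α (B.curve i)) t ![1, I] := fun t => by
    have h1 := pull_eq_extDeriv (η := (η + H.pot.form).1) hα (hε.hol_affCurve i false t)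
    have h2 : pull η.1 (B.curve i) t + pull H.pot.form.1 (B.curve i) t =
      extDeriv (pull α (B.curve i)) t := (pull_add _ _ _ _).symm.trans h1
    rw [hpot] at h2
    rw [density_eq_pull i η.1 (hε.hol_affCurve i false t), ← h2]
    simp only [ContinuousAlternatingMap.add_apply, ContinuousAlternatingMap.smul_apply, smul_eq_mul]
    ring
  obtain ⟨i1, I1⟩ := integral_fsPot
  obtain ⟨i2, I2⟩ := hε.integral_exact i α
  rw [integralE]
  simp only [hd]
  rw [integral_add (i1.const_mul _) i2, integral_const_mul, I1, I2]
  ring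

end Blowup
/-! ### The Poincaré dual of an exceptional divisor -/

lemma wedgeCoeff_eq_wedge (A B : C2 [⋀^Fin 2]→L[ℝ] ℝ) (y : ℂ × ℂ) :
    wedgeCoeff A B = wedge (A.compContinuousLinearMap (fderiv ℝ pairE y))
      (B.compContinuousLinearMap (fderiv ℝ pairE y)) := by
  have h : HasFDerivAt pairE _ y := ((pairE : (ℂ × ℂ) →L[ℂ] C2).restrictScalars ℝ).hasFDerivAt
  have e : ∀ a b : ℂ × ℂ, ⇑(fderiv ℝ pairE y) ∘ ![a, b] = ![pairE a, pairE b] := fun a b => by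
    rw [h.fderiv]
    ext i : 1; fin_cases i <;> rfl
  simp only [wedge, wedgeOn, ContinuousAlternatingMap.compContinuousLinearMap_apply, e]
  rfl

section Multiply

variable {m : ℕ}

/-- The product of a form and a smooth function. -/
def smulForm {F : X → ℝ} (hF : O.Smooth F) (η : O.Form m) : O.Form m :=
  ⟨fun c x => F (c.1.map x) • η.1 c x, by
    refine ⟨fun c x hx => ?_, fun c x hx => ?_, fun c c' h x hl => ?_⟩
    · simp only
      rw [η.2.1 c x hx, smul_zero]
    · exact ((hF c.1 c.2 x hx).smul (η.contDiffAt c hx)).contDiffWithinAt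
    · simp only
      rw [η.2.2.2 c c' h x hl, ← show c'.1.map (h x) = c.1.map x from hl.2.2.2.self_of_nhds]
      rfl⟩

variable [NormedSpace ℝ V] [IsScalarTower ℝ ℂ V]

lemma pull_smulForm {F : X → ℝ} (hF : O.Smooth F) (η : O.Form m)
    (hf : O.Hol f x) : pull (smulForm hF η) f x = F (f x) • pull η f x := by
  obtain ⟨c, hc, h, hl⟩ := hf
  rw [pull_eq _ ⟨c, hc⟩ hl, pull_eq _ ⟨c, hc⟩ hl, ← hl.map_eq]
  rfl

lemma VanishesOn.pull_eq_zero {η : O.Form m} {W : Set X} (h : VanishesOn η W)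
    (hx : f x ∈ W) : pull η f x = 0 := by
  by_cases H : ∃ c : O.charts, ∃ h, LiftAt f c.1 h x
  · obtain ⟨c, j, hl⟩ := H
    rw [pull_eq η c hl, h c _ hl.1 (by rwa [hl.map_eq])]
    rfl
  · exact dif_neg H

lemma pull_sum {ι : Type*} (s : Finset ι) (η : ι → O.Form m) (f : V → X) (x : V) :
    pull (∑ j ∈ s, η j) f x = ∑ j ∈ s, pull (η j) f x :=
  map_sum (AddMonoidHom.mk' (fun η : O.Form m => pull η f x) fun _ _ => pull_add _ _ _ _) _ _

end Multiply

namespace Blowup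

variable [T2Space X]

lemma exists_affMap (B : Blowup O p Xhat) (i : Fin k) {r : ℝ} (h0 : 0 < r) (hr : r ≤ B.r i)
    {w : C2 × ℂ} (hw : w ∈ tube r) : ∃ j y, (j = false ∨ y.1 = 0) ∧ affNorm y < r ^ 2 ∧
      B.affMap i j y = B.Φ i w := by
  have key : ∀ (j : Bool) (y : ℂ × ℂ) (τ : ℂˣ), aff j y = ((τ : ℂ) • w.1, (τ : ℂ)⁻¹ ^ 2 * w.2) →
      affNorm y < r ^ 2 ∧ B.affMap i j y = B.Φ i w := fun j y τ h => by
    constructor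
    · have h1 := (smul_mem_tube τ hw).2
      rw [← h] at h1
      simp only [norm_sq_aff] at h1
      exact h1
    · rw [affMap, h, B.Φ_smul i (tube_mono h0.le hr hw)]
  by_cases h1 : w.1 0 = 0
  · have h2 : w.1 1 ≠ 0 := fun h2 => hw.1 (by ext j; fin_cases j; exacts [h1, h2])
    refine ⟨true, (0, (w.1 1) ^ 2 * w.2), Or.inr rfl, key true _ (Units.mk0 _ h2)⁻¹ ?_⟩
    refine Prod.ext ?_ (by simp [aff])
    ext j
    fin_cases j <;> simp [aff, h1, h2]
  · refine ⟨false, (w.1 1 / w.1 0, (w.1 0) ^ 2 * w.2), Or.inl rfl, key false _ (Units.mk0 _ h1)⁻¹ ?_⟩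
    refine Prod.ext ?_ (by simp [aff])
    ext j
    fin_cases j <;> simp [aff, h1, div_eq_inv_mul]

variable (hε : B.Good ε) (i : Fin k)
include hε

lemma Good.affMap_injOn : InjOn (B.affMap i false) {y | affNorm y < ε ^ 2} := by
  intro y hy z hz h
  obtain ⟨τ, h1, h2⟩ := (B.Φ_eq_iff i _ (hε.tube_subset i (aff_mem_tube false hy)) _
    (hε.tube_subset i (aff_mem_tube false hz))).1 h
  have h3 := congrArg (fun z : C2 => z 0) h1
  have h4 := congrArg (fun z : C2 => z 1) h1
  simp [aff] at h2 h3 h4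
  rw [← h3] at h2 h4
  exact Prod.ext (by simpa using h4.symm) (by simpa using h2.symm)

lemma Good.pull_dual_eq_zero [NormedSpace ℝ V]
    [IsScalarTower ℝ ℂ V] {f : V → Xhat} (hf : (OM).Hol f x)
    (h : B.q (f x) ∉ (B.chart i).map '' closedBall 0 (ε / 2)) :
    pull (dualPot hε i).form.1 f x = 0 := by
  rw [hε.pull_dual_off i hf fun hp => h ⟨0, Metric.mem_closedBall_self (by linarith [hε.pos]),
    (B.map_zero i).trans hp.symm⟩]
  have h1 : (fun z => -B.logF i ε (B.q (f z))) =ᶠ[𝓝 x] fun _ => 0 := by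
    filter_upwards [(B.continuous_q.continuousAt.comp hf.continuousAt).eventually
      (hε.pushX_eventually_zero i logF_even (logF_supp hε.pos) h)] with z hz
    exact neg_eq_zero.2 hz
  rw [h1.ddc_eq, ddc_const]

/-- The integral of the product of the dual form with a form supported in a chart, computed in the
affine coordinates near the exceptional divisor: these cover the support of the dual form, up to a
null set. -/
lemma Good.integral_wedge_chart (e : atlas C2 Xhat) {φ : (OM).Form 2}
    (hφ : CompactSupportIn φ e.1.source) :
    IntegrableOn (fun y => wedge (ddc (dualModel ε) y) (pull φ (B.affMap i false) y))
      {y | affNorm y < ε ^ 2 / 3} ∧ ∫ y : ℂ × ℂ, wedgeCoeff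
      ((dualPot hε i).form.1.1 ⟨_, mem_image_of_mem manifoldChart e.2⟩ !₂[y.1, y.2])
      (φ.1 ⟨_, mem_image_of_mem manifoldChart e.2⟩ !₂[y.1, y.2]) =
    ∫ y in {y | affNorm y < ε ^ 2 / 3},
      wedge (ddc (dualModel ε) y) (pull φ (B.affMap i false) y) := by
  have hpos := hε.pos
  have hε2 : 0 < ε ^ 2 := by positivity
  obtain ⟨K, hKs, hK, hv⟩ := hφ
  set dual := (dualPot hε i).form.1 with hdual
  let c : (OM).charts := ⟨_, mem_image_of_mem manifoldChart e.2⟩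
  let G : ℂ × ℂ → Xhat := fun y => e.1.symm (pairE y)
  let T : Set (ℂ × ℂ) := pairE ⁻¹' e.1.target
  have hTo : IsOpen T := e.1.open_target.preimage pairE.continuous
  have hp : ∀ y, AnalyticAt ℂ pairE y := fun y => (pairE : (ℂ × ℂ) →L[ℂ] C2).analyticAt y
  have hG : ∀ y ∈ T, (OM).Hol G y := fun y hy => ((OM).hol_chart c.2 hy).comp (hp y)
  let F : ℂ × ℂ → ℝ := fun y => wedge (pull dual G y) (pull φ G y)
  have hF : ∀ y ∈ T, wedgeCoeff (dual.1 c !₂[y.1, y.2]) (φ.1 c !₂[y.1, y.2]) = F y := fun y hy => by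
    have h1 : ∀ η : (OM).Form 2, pull η G y = (η.1 c (pairE y)).compContinuousLinearMap
        (fderiv ℝ pairE y) := fun η =>
      pull_eq η c ⟨hy, hp y, Eventually.of_forall fun _ => rfl⟩
    simp only [F, h1]
    exact wedgeCoeff_eq_wedge _ _ y
  -- the left-hand side is the integral of `F` over `T`
  have hT : ∫ y : ℂ × ℂ, wedgeCoeff (dual.1 c !₂[y.1, y.2]) (φ.1 c !₂[y.1, y.2]) = ∫ y in T, F y := by
    rw [← setIntegral_congr_fun hTo.measurableSet hF]
    refine (setIntegral_eq_integral_of_forall_compl_eq_zero fun y hy => ?_).symm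
    have : φ.1 c !₂[y.1, y.2] = 0 := φ.2.1 c _ hy
    simp [this, wedgeCoeff]
  let K' : Set (ℂ × ℂ) := pairE.symm '' (e.1 '' K)
  have hK' : IsCompact K' := (hK.image_of_continuousOn (e.1.continuousOn.mono hKs)).image
    pairE.symm.continuous
  have hK'T : K' ⊆ T := by
    rintro _ ⟨_, ⟨x, hx, rfl⟩, rfl⟩
    simpa [T] using e.1.map_source (hKs hx)
  have hGe : ∀ y ∈ T, pairE.symm (e.1 (G y)) = y := fun y hy => by
    simp only [G]
    rw [e.1.right_inv hy, pairE.symm_apply_apply]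
  have hFi : IntegrableOn F T := integrableOn_of_compact hTo hK' hK'T (fun y hy =>
    (ContDiffAt.wedge (contDiffAt_pull_two dual (hG y hy)) (contDiffAt_pull_two φ
      (hG y hy))).continuousAt.continuousWithinAt) fun y hy hyK => by
      have : pull φ G y = 0 := hv.pull_eq_zero fun h => hyK ⟨_, ⟨_, h, rfl⟩, hGe y hy⟩
      simp only [F, this, wedge_zero_right]
  -- the transition from the affine coordinates to the chart
  let h : Bool → ℂ × ℂ → ℂ × ℂ := fun j y => pairE.symm (e.1 (B.affMap i j y))
  have hGh : ∀ j y, B.affMap i j y ∈ e.1.source → G (h j y) = B.affMap i j y := fun j y hy => by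
    simp only [G, h, pairE.apply_symm_apply]
    exact e.1.left_inv hy
  have hh : ∀ j y, affNorm y < ε ^ 2 → B.affMap i j y ∈ e.1.source → AnalyticAt ℂ (h j) y :=
    fun j y hy hs => ((pairE.symm : C2 →L[ℂ] ℂ × ℂ).analyticAt _).comp
      (liftAt_chart e.2 (hε.hol_affMap i j hy) hs).2.1
  set D := {y : ℂ × ℂ | affNorm y < ε ^ 2 / 3} with hD
  have hDo : IsOpen D := isOpen_affNorm_lt _
  have hD1 : ∀ y ∈ D, affNorm y < ε ^ 2 := fun y hy => by
    have : affNorm y < ε ^ 2 / 3 := hy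
    linarith
  let V : Set (ℂ × ℂ) := D ∩ B.affMap i false ⁻¹' e.1.source
  have hVo : IsOpen V := ContinuousOn.isOpen_inter_preimage (fun y hy =>
    (hε.hol_affMap i false (hD1 y hy)).continuousAt.continuousWithinAt) hDo e.1.open_source
  have hhV : ∀ y ∈ V, AnalyticAt ℂ (h false) y := fun y hy => hh false y (hD1 y hy.1) hy.2
  have hinj : InjOn (h false) V := fun y hy z hz hyz => by
    refine hε.affMap_injOn i (hD1 y hy.1) (hD1 z hz.1) ?_
    rw [← hGh false y hy.2, hyz, hGh false z hz.2]
  have himg : h false '' V ⊆ T := by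
    rintro _ ⟨y, hy, rfl⟩
    simpa [T, h] using e.1.map_source hy.2
  -- the part of the support of the dual form which is not covered by the coordinates is null
  let Z : Set (ℂ × ℂ) := {y | y.1 = 0 ∧ affNorm y < ε ^ 2 ∧ B.affMap i true y ∈ e.1.source}
  have hZ : volume (h true '' Z) = 0 := by
    refine addHaar_image_eq_zero_of_differentiableOn_of_addHaar_eq_zero volume
      (fun y hy => ((hh true y hy.2.1 hy.2.2).differentiableAt.restrictScalars
        ℝ).differentiableWithinAt) (measure_mono_null (t := ({0} : Set ℂ) ×ˢ univ)
        (fun y hy => ⟨hy.1, trivial⟩) ?_)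
    rw [Measure.volume_eq_prod, Measure.prod_prod, measure_singleton, zero_mul]
  have hcover : ∀ᵐ y : ℂ × ℂ, y ∈ T \ h false '' V → F y = 0 := by
    filter_upwards [compl_mem_ae_iff.2 hZ] with y hyZ hy
    by_contra hne
    have hq : B.q (G y) ∈ (B.chart i).map '' closedBall 0 (ε / 2) := by
      by_contra hq
      refine hne ?_
      simp only [F, hdual, hε.pull_dual_eq_zero i (hG y hy.1) hq, wedge_zero_left]
    obtain ⟨z, hz, hzy⟩ := hq
    have hr := hε.mono (r := 11 / 20 * ε) (by positivity) (by linarith)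
    obtain ⟨w, hw, hwy⟩ := hr.exists_tube i (Metric.closedBall_subset_ball (by linarith) hz)
      hzy.symm
    obtain ⟨j, y', hj, hy', hjy⟩ := B.exists_affMap i hr.pos (hr.le i) hw
    have hs : B.affMap i j y' ∈ e.1.source := by rw [hjy, hwy]; exact e.1.map_target hy.1
    have hyy : h j y' = y := by
      simp only [h]
      rw [hjy, hwy, hGe y hy.1]
    have hlt : affNorm y' < ε ^ 2 / 3 := hy'.trans (by nlinarith)
    cases j with
    | false => exact hy.2 ⟨y', ⟨hlt, hs⟩, hyy⟩
    | true => exact hyZ ⟨y', ⟨hj.resolve_left (by simp), hD1 y' hlt, hs⟩, hyy⟩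
  have hmeas : MeasurableSet (h false '' V) := measurable_image_of_fderivWithin hVo.measurableSet
    (fun y hy => ((hhV y hy).differentiableAt.restrictScalars ℝ).hasFDerivAt.hasFDerivWithinAt) hinj
  have hTV : ∫ y in T, F y = ∫ y in h false '' V, F y :=
    setIntegral_eq_of_subset_of_ae_sdiff_eq_zero hTo.measurableSet.nullMeasurableSet himg hcover
  -- the change of variables
  have hpull : ∀ y ∈ V, ∀ η : (OM).Form 2, (pull η G (h false y)).compContinuousLinearMap
      (fderiv ℝ (h false) y) = pull η (B.affMap i false) y := fun y hy η => by
    rw [← pull_comp η (hG _ (himg ⟨y, hy, rfl⟩)) (hhV y hy)]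
    refine pull_congr η ?_
    filter_upwards [hVo.mem_nhds hy] with z hz using hGh false z hz.2
  have hΩ2 : EqOn (fun y => wedge ((pull dual G (h false y)).compContinuousLinearMap
      (fderiv ℝ (h false) y)) ((pull φ G (h false y)).compContinuousLinearMap (fderiv ℝ (h false) y)))
      (fun y => wedge (ddc (dualModel ε) y) (pull φ (B.affMap i false) y)) V := fun y hy => by
    simp only
    rw [hpull y hy, hpull y hy, hε.pull_dual_aff i false (hD1 y hy.1)]
  obtain ⟨hcvi, hcv⟩ := integral_wedge_image (pull dual G) (pull φ G) hVo.measurableSet hhV hinj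
  rw [setIntegral_congr_fun hVo.measurableSet hΩ2] at hcv
  rw [integrableOn_congr_fun hΩ2 hVo.measurableSet] at hcvi
  have h0 : ∀ y ∈ D \ V, wedge (ddc (dualModel ε) y) (pull φ (B.affMap i false) y) = 0 :=
    fun y hy => by rw [hv.pull_eq_zero fun hyK => hy.2 ⟨hy.1, hKs hyK⟩, wedge_zero_right]
  refine ⟨(hcvi.1 (hFi.mono_set himg)).of_forall_sdiff_eq_zero hDo.measurableSet h0, ?_⟩
  rw [hT, hTV, hcv]
  exact (setIntegral_eq_of_subset_of_forall_sdiff_eq_zero hDo.measurableSet inter_subset_left h0).symm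

lemma Good.isPoincareDualE [T2Space Xhat] [SecondCountableTopology Xhat] :
    B.IsPoincareDualE i ((OM).cls (dualPot hε i).form) := by
  classical
  refine ⟨_, rfl, fun ψ hψ => ?_⟩
  obtain ⟨K, -, hK, hv⟩ := hψ
  obtain ⟨f, hf⟩ := exists_partition (fun m : Xhat => (chartAt C2 m).source)
    (fun m => (chartAt C2 m).open_source) fun m => ⟨m, mem_chart_source C2 m⟩
  let J : Finset Xhat := (f.locallyFinite.finite_nonempty_inter_compact hK).toFinset
  let m : Fin J.card → Xhat := fun j => J.equivFin.symm j
  let e : Fin J.card → atlas C2 Xhat := fun j => ⟨chartAt C2 (m j), chart_mem_atlas C2 (m j)⟩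
  let φ : Fin J.card → (OM).Form 2 := fun j => smulForm (smooth_partition f (m j)) ψ.1
  have hφ : ∀ j, CompactSupportIn (φ j) (e j).1.source := fun j => by
    refine ⟨K ∩ tsupport (f (m j)), fun x hx => hf (m j) hx.2,
      hK.inter_right (isClosed_tsupport _), fun c x hx hxK => ?_⟩
    change f (m j) (c.1.map x) • ψ.1.1 c x = 0
    by_cases h : c.1.map x ∈ K
    · rw [image_eq_zero_of_notMem_tsupport fun h' => hxK ⟨h, h'⟩, zero_smul]
    · rw [hv c x hx h, smul_zero]
  have hsum : ∀ x ∈ K, ∑ j, f (m j) x = 1 := fun x hx => by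
    rw [← f.sum_eq_one (mem_univ x), finsum_eq_sum_of_support_subset (s := J) _ fun l hl =>
      (f.locallyFinite.finite_nonempty_inter_compact hK).mem_toFinset.2 ⟨x, hl, hx⟩,
      ← Finset.sum_coe_sort J fun l => f l x]
    exact Equiv.sum_comp J.equivFin.symm fun l : J => f l x
  have hpull : ∀ {V : Type} [NormedAddCommGroup V] [NormedSpace ℂ V] [NormedSpace ℝ V]
      [IsScalarTower ℝ ℂ V] {g : V → Xhat} {y : V}, (OM).Hol g y →
      ∑ j, pull (φ j) g y = pull ψ.1 g y := fun {V} _ _ _ _ {g y} hg => by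
    simp only [φ, pull_smulForm _ _ hg, ← Finset.sum_smul]
    by_cases h : g y ∈ K
    · rw [hsum _ h, one_smul]
    · rw [hv.pull_eq_zero h, smul_zero]
  refine ⟨J.card, e, φ, hφ, ?_, ?_⟩
  · refine form_ext fun c x hx => ?_
    rw [← pull_chart _ c hx, ← pull_chart _ c hx, pull_sum, hpull ((OM).hol_chart c.2 hx)]
  · have h1 := fun j => hε.integral_wedge_chart i (e j) (hφ j)
    rw [Finset.sum_congr rfl fun j _ => (h1 j).2, ← integral_finsetSum _ fun j _ => (h1 j).1,
      integralE]
    simp only [hε.density_eq i]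
    rw [← (hε.integral_wedge_dual i ψ).2]
    refine setIntegral_congr_fun (isOpen_affNorm_lt _).measurableSet fun y hy => ?_
    have hy' : affNorm y < ε ^ 2 := lt_trans hy (by linarith [pow_pos hε.pos 2])
    rw [← hpull (hε.hol_affMap i false hy')]
    exact map_sum (AddMonoidHom.mk' (wedge (ddc (dualModel ε) y)) (wedge_add_right _)) _ _

end Blowup
namespace Blowup

variable [T2Space X] {ε' : ℝ}

/-- The class of the dual form does not depend on the radius at which the potential is cut off: the
difference of two cut-off potentials is a smooth function, which vanishes near `E i`. -/
lemma Good.cls_dual_eq (hε : B.Good ε) (hε' : B.Good ε') (i : Fin k) :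
    (OM).cls (dualPot hε i).form = (OM).cls (dualPot hε' i).form := by
  let F : Xhat → ℝ := fun x => B.logF i ε (B.q x) - B.logF i ε' (B.q x)
  have near : ∀ (c : (OM).charts), ∀ x ∈ c.1.dom, B.q (c.1.map x) = p i →
      ∃ l : C2 → C2 × ℂ, AnalyticAt ℂ l x ∧ l x ∈ tube (ε / 3) ∧ l x ∈ tube (ε' / 3) ∧
        ∀ᶠ z in 𝓝 x, B.Φ i (l z) = c.1.map z := fun c x hx h => by
    obtain ⟨y, hy, hy0, hyx⟩ := (hε.q_eq_p i).1 h
    obtain ⟨l, hl, rfl, hle⟩ := B.exists_section_Φ i (hε.tube_subset i hy) c.2 hx hyx.symm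
    have ht : ∀ {r : ℝ}, B.Good r → l x ∈ tube (r / 3) := fun hr => ⟨hy.1, by
      rw [hy0, norm_zero, zero_mul]
      exact pow_pos hr.third.pos 2⟩
    exact ⟨l, hl, ht hε, ht hε', hle⟩
  have zero : ∀ (c : (OM).charts), ∀ x ∈ c.1.dom, B.q (c.1.map x) = p i →
      (fun z => F (c.1.map z)) =ᶠ[𝓝 x] fun _ => 0 := fun c x hx h => by
    obtain ⟨l, hl, h1, h2, h3⟩ := near c x hx h
    filter_upwards [hl.continuousAt.preimage_mem_nhds ((isOpen_tube _).mem_nhds h1),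
      hl.continuousAt.preimage_mem_nhds ((isOpen_tube _).mem_nhds h2), h3] with z g1 g2 g3
    simp only [F]
    rw [← g3, hε.logF_q_Φ i g1, hε'.logF_q_Φ i g2, sub_self]
  refine Potentials.cls_eq _ _ (F := F) (fun c hc x hx => ?_) fun c x hx => ?_
  · by_cases h : B.q (c.map x) = p i
    · exact contDiffAt_const.congr_of_eventuallyEq (zero ⟨c, hc⟩ x hx h)
    · have h1 := (dualPot hε i).smooth ⟨c, hc⟩ x hx _ (Or.inl ⟨h, EventuallyEq.rfl⟩)
      have h2 := (dualPot hε' i).smooth ⟨c, hc⟩ x hx _ (Or.inl ⟨h, EventuallyEq.rfl⟩)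
      refine (h2.sub h1).congr_of_eventuallyEq (Eventually.of_forall fun z => ?_)
      simp only [F]
      ring
  · by_cases h : B.q (c.1.map x) = p i
    · obtain ⟨l, hl, h1, h2, h3⟩ := near c x hx h
      refine ⟨_, _, Or.inr ⟨l, hl, h1, h3, EventuallyEq.rfl⟩, Or.inr ⟨l, hl, h2, h3, EventuallyEq.rfl⟩, ?_⟩
      filter_upwards [zero c x hx h] with z hz
      rw [hz, add_zero]
    · refine ⟨_, _, Or.inl ⟨h, EventuallyEq.rfl⟩, Or.inl ⟨h, EventuallyEq.rfl⟩,
        Eventually.of_forall fun z => ?_⟩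
      simp only [F]
      ring

end Blowup

lemma Potentials.isType11 (P : Potentials O) : O.IsType11 (O.cls P.form) :=
  ⟨P.form, rfl, P.form_I⟩

lemma Potentials.isType11_neg (P : Potentials O) : O.IsType11 (-O.cls P.form) := by
  refine ⟨-P.form, rfl, fun c x v w => ?_⟩
  change -P.form.1.1 c x _ = -P.form.1.1 c x _
  rw [P.form_I]

end BlowupEuler

theorem mainTheorem7 {X Xhat : Type u}
    [TopologicalSpace X] [T2Space X] [SecondCountableTopology X]
    [TopologicalSpace Xhat] [T2Space Xhat] [SecondCountableTopology Xhat]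
    [ChartedSpace C2 Xhat] [IsManifold 𝓘(ℂ, C2) ω Xhat]
    (O : ComplexOrbifold X) {k : ℕ} (p : Fin k → X) (hp : O.HasIsolatedZ2Singularities p)
    (B : Blowup O p Xhat) :
    ∃ E : Fin k → (ComplexOrbifold.ofManifold Xhat).H2,
      (∀ i, B.IsPoincareDualE i (E i) ∧ (ComplexOrbifold.ofManifold Xhat).IsType11 (E i)) ∧
      ∀ Lhat : CStarBundle (ComplexOrbifold.ofManifold Xhat),
        ∃ (ehat : (ComplexOrbifold.ofManifold Xhat).H2) (n : Fin k → ℤ),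
          Lhat.IsEulerClass ehat ∧ (∀ i, B.HasIntegralE i ehat (n i)) ∧
          ∃ (L : CStarBundle O) (e : O.H2),
            L.IsEulerClass e ∧ O.IsType11 e ∧
            (∀ a : O.H2, IsPullbackClass (ComplexOrbifold.ofManifold Xhat) O B.q p a
              (ehat + ∑ i, ((1 / 2 : ℝ) * (n i : ℝ)) • E i) ↔ a = e) ∧
            (L.IsComplexManifold ↔ ∀ i, Odd (n i)) := by
  obtain ⟨ε₀, hε₀, -⟩ := B.exists_good hp.1 (fun _ => 1) fun _ => one_pos
  refine ⟨fun i => (ComplexOrbifold.ofManifold Xhat).cls (Blowup.dualPot hε₀ i).form,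
    fun i => ⟨hε₀.isPoincareDualE i, Potentials.isType11 _⟩, fun Lhat => ?_⟩
  choose m δ S hδ hδr hS using exists_equivariant_section B Lhat
  obtain ⟨ε, hε, hεδ⟩ := B.exists_good hp.1 δ hδ
  let T : Blowup.TubeSections B ε Lhat :=
    ⟨m, S, fun i y hy => hS i y (tube_mono hε.pos.le (hεδ i) hy)⟩
  obtain ⟨H, hH⟩ := hε.exists_normalised_metric Lhat m S T.spec
  refine ⟨-(ComplexOrbifold.ofManifold Xhat).cls H.pot.form, m, H.isEulerClass,
    fun i => hε.hasIntegralE i T H hH, hε.descent T, -O.cls (hε.descentMetric hH).pot.form,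
    (hε.descentMetric hH).isEulerClass, Potentials.isType11_neg _, fun a => ?_,
    hε.isComplexManifold_iff T⟩
  have hb : -(ComplexOrbifold.ofManifold Xhat).cls H.pot.form +
      ∑ i, ((1 / 2 : ℝ) * (m i : ℝ)) •
        (ComplexOrbifold.ofManifold Xhat).cls (Blowup.dualPot hε₀ i).form =
      (ComplexOrbifold.ofManifold Xhat).cls (hε.pullbackForm T H) := by
    simp only [hε₀.cls_dual_eq hε]
    refine Eq.symm ((map_add (ComplexOrbifold.ofManifold Xhat).Exact2.mkQ _ _).trans ?_)
    rw [_root_.map_neg, map_sum]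
    simp only [map_smul]
    rfl
  rw [hb]
  exact ⟨fun h => Blowup.isPullbackClass_unique B hp.1 h (hε.isPullbackClass hH),
    fun h => h ▸ hε.isPullbackClass hH⟩
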